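/- **Setting.** Let $d\ge 1$, $m\ge1$, $k\ge 0$ be integers and let $\Omega\subset\mathbb R^d$ be a bounded polytopal domain. Let $\mathcal A^1,\dots,\mathcal A^d\in C^{0,1/2}(\Omega;\mathbb C^{m\times m})$ be Hermitian fields whose distributional divergence $\nabla\cdot\mathcal A=\sum_i\partial_i\mathcal A^i$ lies in $L^\infty(\Omega;\mathbb C^{m\times m})$, and let $\mathcal K\in L^\infty(\Omega;\mathbb C^{m\times m})$ and $\mathfrak r_\flat>0$ satisfy $\mathcal K+\mathcal K^{\mathsf H}-\nabla\cdot\mathcal A\ge 2\mathfrak r_\flat\mathcal I_m$ a.e. in $\Omega$. With $n$ the outward unit normal on $\partial\Omega$ and $\mathcal N=\sum_i n_i\mathcal A^i$, let $\mathcal M\in L^\infty(\partial\Omega;\mathbb C^{m\times m})$ satisfy $\Re(\mathcal M\xi,\xi)\ge0$ for all $\xi\in\mathbb C^m$ and $\operatorname{Ker}(\mathcal M-\mathcal N)+\operatorname{Ker}(\mathcal M+\mathcal N)=\mathbb C^m$ a.e. on $\partial\Omega$. Matrices are measured in the operator norm, and $(a,b)_Y=\int_Y b^{\mathsf H}a$.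 Put $A_1v=\sum_i\mathcal A^i\partial_iv$, $A=\mathcal K+A_1$, $\mathfrak r_\sharp=\|\mathcal K\|_{L^\infty(\Omega)}+\|\nabla\cdot\mathcal A\|_{L^\infty(\Omega)}$ and $\rho=\mathfrak r_\sharp/\mathfrak r_\flat$. Let $(\mathcal T_h,\mathcal F_h)$ be a polytopal mesh of $\Omega$ with regularity parameter $\varrho\in(0,1)$, that is, having a matching simplicial submesh such that $\varrho h_\tau\le r_\tau$ for every simplex $\tau$ (with diameter $h_\tau$ and inradius $r_\tau$) and $\varrho h_T\le h_\tau$ whenever $\tau\subset T\in\mathcal T_h$. Let $\mathcal F_T$ be the set of faces on $\partial T$, $\mathcal F_h^{\rm b}$ the set of boundary faces, $h_T$ the diameter of $T$, $n_F$ a fixed unit normal to $F$ (outward to $\Omega$ if $F\in\mathcal F_h^{\rm b}$), $\omega_{TF}=\pm1$ such that $\omega_{TF}n_F$ points out of $T$, and $\mathcal N_F=\sum_i n_{F,i}\mathcal A^i|_F$. Put $$\mathfrak a_T=\max_i\|\mathcal A^i\|_{L^\infty(T)},\qquad \mathfrak t_T=\max(\mathfrak a_Th_T^{-1},\mathfrak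 r_\flat)^{-1},$$ and let $\pi^0_T$ denote the mean value on $T$. The hybrid space $\underline U_h^k$ consists of all families $\underline v_h=((v_T)_{T\in\mathcal T_h},(v_F)_{F\in\mathcal F_h})$ of $\mathbb C^m$-valued polynomials of total degree $\le k$ on the elements and on the faces. Let $\mathcal S^{\rm i}_{TF}$ ($F\in\mathcal F_T$) and $\mathcal S^{\rm b}_F$ ($F\in\mathcal F_h^{\rm b}$) be Hermitian positive semidefinite fields in $L^\infty(F;\mathbb C^{m\times m})$, and write $\mathcal M_F=\mathcal M|_F$. Let $$\begin{aligned}a_h(\underline w_h,\underline v_h)={}&\sum_T(Aw_T,v_T)_T+\mathfrak r_\flat\sum_Th_T\sum_{F\in\mathcal F_T}(w_F-w_T,v_F-v_T)_F+\sum_T\sum_{F\in\mathcal F_T}\omega_{TF}\Big(\mathcal N_F(w_F-w_T),\frac{v_F+v_T}2\Big)_F\\&+\frac12\sum_{F\in\mathcal F_h^{\rm b}}((\mathcal M_F+\mathcal S^{\rm b}_F-\mathcal N_F)w_F,v_F)_F+j_h(\underline w_h,\underline v_h),\\ j_h(\underline w_h,\underline v_h)={}&\sum_T\sum_{F\in\mathcal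 F_T}(\mathcal S^{\rm i}_{TF}(w_F-w_T),v_F-v_T)_F,\end{aligned}$$ $$\begin{aligned}\|\underline v_h\|_h^2={}&\mathfrak r_\flat\sum_T\Big(\|v_T\|_{L^2(T)}^2+h_T\sum_{F\in\mathcal F_T}\|v_F-v_T\|_{L^2(F)}^2\Big)+\frac12\sum_{F\in\mathcal F_h^{\rm b}}\Re((\mathcal M_F+\mathcal S^{\rm b}_F)v_F,v_F)_F\\&+j_h(\underline v_h,\underline v_h)+\sum_T\mathfrak t_T\|A_1v_T\|_{L^2(T)}^2.\end{aligned}$$ **Stabilization assumption (with constant $C_S$).** For all $T\in\mathcal T_h$ and $F\in\mathcal F_T$, $$(\mathcal S^{\rm i}_{TF}v,v)_F\le C_S\,\mathfrak a_T\|v\|_{L^2(F)}^2\quad\text{for all polynomials } v \text{ of degree}\le k \text{ on } F,$$ $$|(w,\mathcal N_Fv)_F|\le C_S\,\mathfrak a_T^{1/2}\|w\|_{L^2(F)}(\mathcal S^{\rm i}_{TF}v,v)_F^{1/2}\quad\text{for all } w,v\in L^2(F;\mathbb C^m),$$ and, for all $F\in\mathcal F_h^{\rm b}$, with $T$ the element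 such that $F\in\mathcal F_T$, $\operatorname{Ker}(\mathcal M_F-\mathcal N_F)\subset\operatorname{Ker}(\mathcal M_F+\mathcal S^{\rm b}_F-\mathcal N_F)$ a.e. on $F$ and $$|((\mathcal M_F+\mathcal S_F^{\rm b}+\mathcal N_F)w,v)_F|\le C_S\,\mathfrak a_T^{1/2}\|w\|_{L^2(F)}\big(\Re((\mathcal M_F+\mathcal S^{\rm b}_F)v,v)_F\big)^{1/2}\quad\text{for all } w,v\in L^2(F;\mathbb C^m).$$ **Lemma (Inf-sup condition).** Given $d$, $\Omega$, $k$, $\varrho$, $C_{\mathcal A}$ and $C_S$, there is a constant $C>0$ depending only on them (in particular not on $m$, on the mesh otherwise, or on the fields $\mathcal A,\mathcal K,\mathcal M$) such that, whenever the stabilization assumption holds with constant $C_S$ on a mesh with regularity parameter $\varrho$: 1. if $\|\pi_T^0\mathcal A^i-\mathcal A^i\|_{L^\infty(T)}\le C_{\mathcal A}(\mathfrak r_\flat\mathfrak a_Th_T)^{1/2}$ for all $T\in\mathcal T_h$ and all $i$, then, for every $\underline v_h\in\underline U_h^k$, $$\|\underline v_h\|_h\le C\rho^2\sup_{\underline w_h\in\underline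 U_h^k\setminus\{\underline0\}}\frac{|a_h(\underline v_h,\underline w_h)|}{\|\underline w_h\|_h},$$ where the supremum is finite; 2. the discrete problem is well-posed: for every $f\in L^2(\Omega;\mathbb C^m)$ there is a unique $\underline u_h\in\underline U_h^k$ such that $a_h(\underline u_h,\underline v_h)=(f,v_h)_\Omega$ for all $\underline v_h\in\underline U_h^k$, where $v_h|_T=v_T$ for all $T\in\mathcal T_h$, and $\|\underline u_h\|_h\le c\,\|f\|_{L^2(\Omega)}$ with $c$ independent of $f$. -/

import Mathlib

open MeasureTheory Set
open scoped Matrix Matrix.Norms.L2Operator ContDiff NNReal ComplexOrder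

noncomputable section

namespace Friedrichs

/-- `ℝ^d` with its Euclidean structure. -/
abbrev Rd (d : ℕ) : Type := EuclideanSpace ℝ (Fin d)

/-- `ℂ^m` with its Hermitian structure. -/
abbrev Cm (m : ℕ) : Type := EuclideanSpace ℂ (Fin m)

/-- Matrices in `ℂ^{m × m}`; they carry the operator norm induced by the Hermitian norm of `ℂ^m`. -/
abbrev Mat (m : ℕ) : Type := Matrix (Fin m) (Fin m) ℂ

/-- The matrix-vector product, on `ℂ^m` with its Hermitian structure. -/
def act {m : ℕ} (H : Mat m) (ξ : Cm m) : Cm m := Matrix.toEuclideanCLM (n := Fin m) (𝕜 := ℂ) H ξ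

/-- The `(d-1)`-dimensional surface measure of `ℝ^d`: the Hausdorff measure normalized so that it
is the Lebesgue measure on hyperplanes (the counting measure if `d = 1`). -/
def surf (d : ℕ) : Measure (Rd d) := Measure.euclideanHausdorffMeasure (d - 1)

/-! ### Polytopal sets and meshes -/

/-- A polytopal set: the interior of a finite union of closed (nondegenerate) simplices. -/
def IsPolytopal {d : ℕ} (P : Set (Rd d)) : Prop :=
  ∃ S : Set (Affine.Simplex ℝ (Rd d) d), S.Finite ∧
    P = interior (⋃ s ∈ S, convexHull ℝ (Set.range s.points))

/-- A polytopal domain: a nonempty connected polytopal set (it is open and bounded). -/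
def IsPolytopalDomain {d : ℕ} (Ω : Set (Rd d)) : Prop :=
  IsPolytopal Ω ∧ IsConnected Ω

/-- `ν` is the outward unit normal vector to the set `P` at the point `x`: near `x`, the set `P` is
the open half-space through `x` lying opposite to `ν`. -/
def IsOutwardNormal {d : ℕ} (P : Set (Rd d)) (x ν : Rd d) : Prop :=
  ‖ν‖ = 1 ∧ ∃ ε > 0, ∀ y ∈ Metric.ball x ε, y ∈ P ↔ inner ℝ ν (y - x) < 0

/-- `ν` points out of `P` on `F`: it is the outward unit normal at almost every point of `F`. -/
def PointsOut {d : ℕ} (P F : Set (Rd d)) (ν : Rd d) : Prop :=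
  ∀ᵐ x ∂((surf d).restrict F), IsOutwardNormal P x ν

/-- A polytopal mesh of `Ω`, together with the choice of a unit normal vector to every face. -/
structure PolytopalMesh (d : ℕ) (Ω : Set (Rd d)) where
  /-- the mesh elements -/
  cells : Finset (Set (Rd d))
  /-- the mesh faces -/
  faces : Finset (Set (Rd d))
  /-- the selected unit normal `n_F` -/
  normal : faces → Rd d
  cell_polytopal : ∀ T ∈ cells, IsPolytopal T
  cell_nonempty : ∀ T ∈ cells, T.Nonempty
  cells_disjoint : ∀ T₁ ∈ cells, ∀ T₂ ∈ cells, T₁ ≠ T₂ → Disjoint T₁ T₂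
  cells_cover : closure Ω = ⋃ T ∈ cells, closure T
  face_connected : ∀ F ∈ faces, IsConnected F
  faces_disjoint : ∀ F₁ ∈ faces, ∀ F₂ ∈ faces, F₁ ≠ F₂ → Disjoint F₁ F₂
  normal_unit : ∀ F, ‖normal F‖ = 1
  /-- every face is a relatively open subset of a hyperplane orthogonal to `n_F` -/
  face_planar : ∀ F : faces, ∃ (c : ℝ) (U : Set (Rd d)), IsOpen U ∧
    (F : Set (Rd d)) = U ∩ {x | inner ℝ (normal F) x = c}
  /-- the relative boundary of every face has zero surface measure -/
  face_boundary_null : ∀ F ∈ faces, surf d (closure F \ F) = 0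
  /-- every face is either an interface or a boundary face -/
  face_dichotomy : ∀ F ∈ faces,
    (∃ T₁ ∈ cells, ∃ T₂ ∈ cells, T₁ ≠ T₂ ∧ F ⊆ frontier T₁ ∩ frontier T₂) ∨
      (∃ T ∈ cells, F ⊆ frontier T ∩ frontier Ω)
  /-- the faces partition the mesh skeleton -/
  skeleton : (⋃ T ∈ cells, frontier T) = ⋃ F ∈ faces, closure F
  /-- a face of an element has a well-defined orientation relative to it -/
  oriented : ∀ T ∈ cells, ∀ F : faces, (F : Set (Rd d)) ⊆ frontier T →
    PointsOut T F (normal F) ∨ PointsOut T F (-normal F)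
  /-- on the boundary faces, `n_F` is the outward normal of `Ω` -/
  boundary_normal : ∀ F : faces, (F : Set (Rd d)) ⊆ frontier Ω → PointsOut Ω F (normal F)

namespace PolytopalMesh

variable {d : ℕ} {Ω : Set (Rd d)}

open Classical in
/-- The set `F_T` of the faces lying on the boundary of the element `T`. -/
def cellFaces (ℳ : PolytopalMesh d Ω) (T : ℳ.cells) : Finset ℳ.faces :=
  Finset.univ.filter fun F => (F : Set (Rd d)) ⊆ frontier (T : Set (Rd d))

open Classical in
/-- The set of the boundary faces. -/
def bdryFaces (ℳ : PolytopalMesh d Ω) : Finset ℳ.faces :=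
  Finset.univ.filter fun F => (F : Set (Rd d)) ⊆ frontier Ω

open Classical in
/-- The orientation `ω_{TF}` of the face `F` relative to the element `T`. -/
def orient (ℳ : PolytopalMesh d Ω) (T : ℳ.cells) (F : ℳ.faces) : ℝ :=
  if PointsOut (T : Set (Rd d)) F (ℳ.normal F) then 1 else -1

/-- The diameter `h_T`. -/
def diam (ℳ : PolytopalMesh d Ω) (T : ℳ.cells) : ℝ := Metric.diam (T : Set (Rd d))

/-- `𝒦` is a matching simplicial submesh: a conforming simplicial mesh of `Ω`, each simplex of which
is contained in a mesh element and each simplicial face of which is either contained in or disjoint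
from any given mesh face. Simplices are given by their vertices. -/
structure IsMatchingSubmesh (ℳ : PolytopalMesh d Ω)
    (𝒦 : Geometry.SimplicialComplex ℝ (Rd d)) : Prop where
  finite : 𝒦.faces.Finite
  pure : ∀ s ∈ 𝒦.faces, ∃ t ∈ 𝒦.faces, s ⊆ t ∧ t.card = d + 1
  cover : 𝒦.space = closure Ω
  in_cell : ∀ t ∈ 𝒦.faces, t.card = d + 1 →
    ∃ T ∈ ℳ.cells, interior (convexHull ℝ (t : Set (Rd d))) ⊆ T
  in_face : ∀ s ∈ 𝒦.faces, s.card = d → ∀ F ∈ ℳ.faces,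
    Disjoint (intrinsicInterior ℝ (convexHull ℝ (s : Set (Rd d)))) F ∨
      intrinsicInterior ℝ (convexHull ℝ (s : Set (Rd d))) ⊆ F

/-- The mesh has regularity parameter `ϱ`: there is a matching simplicial submesh that is
shape-regular (`ϱ h_τ ≤ r_τ`, with `r_τ` the inradius of `τ`) and contact-regular
(`ϱ h_T ≤ h_τ` for every simplex `τ` contained in the element `T`). -/
def IsRegular (ℳ : PolytopalMesh d Ω) (ϱ : ℝ) : Prop :=
  ∃ 𝒦 : Geometry.SimplicialComplex ℝ (Rd d), ℳ.IsMatchingSubmesh 𝒦 ∧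
    ∀ t ∈ 𝒦.faces, t.card = d + 1 →
      (∃ x, Metric.ball x (ϱ * Metric.diam (convexHull ℝ (t : Set (Rd d)))) ⊆
        convexHull ℝ (t : Set (Rd d))) ∧
      ∀ T : ℳ.cells, interior (convexHull ℝ (t : Set (Rd d))) ⊆ (T : Set (Rd d)) →
        ϱ * ℳ.diam T ≤ Metric.diam (convexHull ℝ (t : Set (Rd d)))

end PolytopalMesh

/-! ### Polynomial and hybrid spaces -/

/-- Polynomial functions `ℝ^d → ℂ^m` of total degree at most `k`. -/
def polySpace (d m k : ℕ) : Submodule ℂ (Rd d → Cm m) where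
  carrier := {v | ∀ j, ∃ p : MvPolynomial (Fin d) ℂ, p.totalDegree ≤ k ∧
    ∀ x, v x j = MvPolynomial.eval (fun i => (x i : ℂ)) p}
  add_mem' := by
    intro v w hv hw j
    obtain ⟨p, hp, hp'⟩ := hv j
    obtain ⟨q, hq, hq'⟩ := hw j
    exact ⟨p + q, (MvPolynomial.totalDegree_add p q).trans (max_le hp hq),
      fun x => by simp [hp', hq']⟩
  zero_mem' := fun j => ⟨0, by simp, fun x => by simp⟩
  smul_mem' := by
    intro c v hv j
    obtain ⟨p, hp, hp'⟩ := hv j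
    exact ⟨c • p, (MvPolynomial.totalDegree_smul_le c p).trans hp,
      fun x => by simp [hp', MvPolynomial.smul_eval]⟩

/-- Restrictions to `F` of the polynomial functions of degree at most `k`. A function on `F` is
represented by its extension by zero, so that the values outside of `F` carry no information. -/
def facePolySpace (d m k : ℕ) (F : Set (Rd d)) : Submodule ℂ (Rd d → Cm m) where
  carrier := {v | ∃ p ∈ polySpace d m k, v = F.indicator p}
  add_mem' := by
    rintro v w ⟨p, hp, rfl⟩ ⟨q, hq, rfl⟩
    exact ⟨p + q, add_mem hp hq, (Set.indicator_add' F p q).symm⟩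
  zero_mem' := ⟨0, zero_mem _, by ext1 x; simp [Set.indicator]⟩
  smul_mem' := by
    rintro c v ⟨p, hp, rfl⟩
    exact ⟨c • p, Submodule.smul_mem _ c hp, (Set.indicator_const_smul F c p).symm⟩

/-- The hybrid space: one polynomial per element and one per face. Elements are nonempty open sets,
so a polynomial on an element (or on its closure) is the same as a polynomial on `ℝ^d`. -/
abbrev HybridSpace {d : ℕ} {Ω : Set (Rd d)} (ℳ : PolytopalMesh d Ω) (m k : ℕ) : Type :=
  (ℳ.cells → polySpace d m k) × ((F : ℳ.faces) → facePolySpace d m k (F : Set (Rd d)))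

section Hybrid

variable {d m k : ℕ} {Ω : Set (Rd d)} {ℳ : PolytopalMesh d Ω}

/-- The element component `v_T`. -/
def cellVal (v : HybridSpace ℳ m k) (T : ℳ.cells) : Rd d → Cm m := (v.1 T : Rd d → Cm m)

/-- The face component `v_F`. -/
def faceVal (v : HybridSpace ℳ m k) (F : ℳ.faces) : Rd d → Cm m := (v.2 F : Rd d → Cm m)

/-- The jump `v_F - v_T`; it is used on `F` only. -/
def jump (v : HybridSpace ℳ m k) (T : ℳ.cells) (F : ℳ.faces) : Rd d → Cm m :=
  fun x => faceVal v F x - cellVal v T x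

/-- The average `(v_F + v_T) / 2`; it is used on `F` only. -/
def avg (v : HybridSpace ℳ m k) (T : ℳ.cells) (F : ℳ.faces) : Rd d → Cm m :=
  fun x => (2⁻¹ : ℂ) • (faceVal v F x + cellVal v T x)

/-- The piecewise polynomial field `v_h`, equal to `v_T` on every element `T`. -/
def brokenField (v : HybridSpace ℳ m k) : Rd d → Cm m :=
  fun x => ∑ T : ℳ.cells, (T : Set (Rd d)).indicator (cellVal v T) x

end Hybrid

/-! ### Inner products and norms -/

/-- The inner product `(a, b) = ∫ b^H a` of `L²(Y; ℂ^m)` with respect to the volume. -/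
def cellInner {d m : ℕ} (Y : Set (Rd d)) (a b : Rd d → Cm m) : ℂ := ∫ x in Y, inner ℂ (b x) (a x)

/-- The inner product `(a, b) = ∫ b^H a` of `L²(F; ℂ^m)` with respect to the surface measure. -/
def faceInner {d m : ℕ} (F : Set (Rd d)) (a b : Rd d → Cm m) : ℂ :=
  ∫ x in F, inner ℂ (b x) (a x) ∂(surf d)

/-- The squared norm of `L²(Y; ℂ^m)` with respect to the volume. -/
def cellNormSq {d m : ℕ} (Y : Set (Rd d)) (a : Rd d → Cm m) : ℝ := ∫ x in Y, ‖a x‖ ^ 2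

/-- The squared norm of `L²(F; ℂ^m)` with respect to the surface measure. -/
def faceNormSq {d m : ℕ} (F : Set (Rd d)) (a : Rd d → Cm m) : ℝ := ∫ x in F, ‖a x‖ ^ 2 ∂(surf d)

/-- The norm of `L^∞(Y; ℂ^{m × m})`. -/
def linfty {d m : ℕ} (Y : Set (Rd d)) (H : Rd d → Mat m) : ℝ :=
  (eLpNorm H ⊤ (volume.restrict Y)).toReal

/-! ### Friedrichs systems -/

/-- The trace `∑ ν_i A^i(x)` of the fields in the direction `ν`. -/
def normalTrace {d m : ℕ} (A : Fin d → Rd d → Mat m) (ν x : Rd d) : Mat m :=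
  ∑ i, (ν i : ℂ) • A i x

/-- The data of a Friedrichs system on `Ω`. The `A^i`, which are Hölder continuous on `Ω`, are given
together with their continuous extension to the closure of `Ω`. -/
structure System (d m : ℕ) (Ω : Set (Rd d)) where
  A : Fin d → Rd d → Mat m
  K : Rd d → Mat m
  /-- the divergence `∑ ∂_i A^i` -/
  divA : Rd d → Mat m
  /-- the lower reference reaction -/
  rlow : ℝ
  /-- the field of the boundary condition -/
  M : Rd d → Mat m
  A_holder : ∀ i, ∃ C : ℝ≥0, HolderOnWith C (1 / 2) (A i) (closure Ω)
  A_hermitian : ∀ i, ∀ x ∈ Ω, (A i x).IsHermitian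
  K_bounded : MemLp K ⊤ (volume.restrict Ω)
  divA_bounded : MemLp divA ⊤ (volume.restrict Ω)
  /-- `divA` is the distributional divergence of the family `A` -/
  divA_weak : ∀ φ : Rd d → ℝ, ContDiff ℝ ∞ φ → HasCompactSupport φ → tsupport φ ⊆ Ω → ∀ a b,
    ∫ x in Ω, ∑ i, (fderiv ℝ φ x (EuclideanSpace.single i 1) : ℂ) * A i x a b =
      - ∫ x in Ω, (φ x : ℂ) * divA x a b
  rlow_pos : 0 < rlow
  lower_bound : ∀ᵐ x ∂(volume.restrict Ω),
    (K x + (K x)ᴴ - divA x - ((2 * rlow : ℝ) : ℂ) • (1 : Mat m)).PosSemidef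
  M_bounded : MemLp M ⊤ ((surf d).restrict (frontier Ω))
  M_nonneg : ∀ᵐ x ∂((surf d).restrict (frontier Ω)),
    ∀ ξ : Cm m, 0 ≤ (inner ℂ ξ (act (M x) ξ)).re
  M_kernels : ∀ᵐ x ∂((surf d).restrict (frontier Ω)), ∀ ν, IsOutwardNormal Ω x ν →
    LinearMap.ker (M x - normalTrace A ν x).mulVecLin ⊔
      LinearMap.ker (M x + normalTrace A ν x).mulVecLin = ⊤

section Scheme

variable {d m : ℕ} {Ω : Set (Rd d)} (𝒮 : System d m Ω) (ℳ : PolytopalMesh d Ω)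

namespace System

/-- The directional derivative `A_1 v = ∑ A^i ∂_i v`. -/
def dirDeriv (v : Rd d → Cm m) : Rd d → Cm m :=
  fun x => ∑ i, act (𝒮.A i x) (fderiv ℝ v x (EuclideanSpace.single i 1))

/-- The operator `A v = K v + A_1 v`. -/
def op (v : Rd d → Cm m) : Rd d → Cm m := fun x => act (𝒮.K x) (v x) + 𝒮.dirDeriv v x

/-- The upper reference reaction. -/
def rhigh : ℝ := linfty Ω 𝒮.K + linfty Ω 𝒮.divA

/-- The ratio `ρ` of the reference reactions. -/
def rho : ℝ := 𝒮.rhigh / 𝒮.rlow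

variable {ℳ}

/-- The local reference value of the fields `A^i` on an element. -/
def aref (T : ℳ.cells) : ℝ := ⨆ i, linfty (T : Set (Rd d)) (𝒮.A i)

/-- The local reference time `t_T`. -/
def tref (T : ℳ.cells) : ℝ := (max (𝒮.aref T * (ℳ.diam T)⁻¹) 𝒮.rlow)⁻¹

/-- The field `N_F`. -/
def NF (F : ℳ.faces) : Rd d → Mat m := normalTrace 𝒮.A (ℳ.normal F)

end System

/-- The mean value of a matrix field on `T`, i.e. its `L²`-projection on the constants. -/
def meanMat (T : Set (Rd d)) (H : Rd d → Mat m) : Mat m :=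
  Matrix.of fun a b => ⨍ x in T, H x a b

/-- `C_A` bounds the oscillation of the fields `A^i` on the elements. -/
def OscillationBound (CA : ℝ) : Prop :=
  ∀ (T : ℳ.cells) (i : Fin d),
    linfty (T : Set (Rd d)) (fun x => meanMat (T : Set (Rd d)) (𝒮.A i) - 𝒮.A i x) ≤
      CA * Real.sqrt (𝒮.rlow * 𝒮.aref T * ℳ.diam T)

/-- The stabilization fields, on the element-face pairs and on the boundary faces. -/
structure Stabilization {d : ℕ} {Ω : Set (Rd d)} (ℳ : PolytopalMesh d Ω) (m : ℕ) where
  Si : ℳ.cells → ℳ.faces → Rd d → Mat m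
  Sb : ℳ.faces → Rd d → Mat m

variable {ℳ}
variable (S : Stabilization ℳ m)

/-- The stabilization assumption, for polynomials of degree `k` and with hidden constant `CS`. -/
structure StabilizationAssumption (k : ℕ) (CS : ℝ) : Prop where
  Si_bounded : ∀ T, ∀ F ∈ ℳ.cellFaces T,
    MemLp (S.Si T F) ⊤ ((surf d).restrict (F : Set (Rd d)))
  Si_positive : ∀ T, ∀ F ∈ ℳ.cellFaces T,
    ∀ᵐ x ∂((surf d).restrict (F : Set (Rd d))), (S.Si T F x).PosSemidef
  Si_upper : ∀ T, ∀ F ∈ ℳ.cellFaces T, ∀ v ∈ facePolySpace d m k (F : Set (Rd d)),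
    (faceInner F (fun x => act (S.Si T F x) (v x)) v).re ≤ CS * 𝒮.aref T * faceNormSq F v
  Si_control : ∀ T, ∀ F ∈ ℳ.cellFaces T, ∀ w v : Rd d → Cm m,
    MemLp w 2 ((surf d).restrict (F : Set (Rd d))) →
    MemLp v 2 ((surf d).restrict (F : Set (Rd d))) →
    ‖faceInner F w (fun x => act (𝒮.NF F x) (v x))‖ ≤
      CS * Real.sqrt (𝒮.aref T) * Real.sqrt (faceNormSq F w) *
        Real.sqrt (faceInner F (fun x => act (S.Si T F x) (v x)) v).re
  Sb_bounded : ∀ F ∈ ℳ.bdryFaces, MemLp (S.Sb F) ⊤ ((surf d).restrict (F : Set (Rd d)))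
  Sb_positive : ∀ F ∈ ℳ.bdryFaces,
    ∀ᵐ x ∂((surf d).restrict (F : Set (Rd d))), (S.Sb F x).PosSemidef
  Sb_kernel : ∀ F ∈ ℳ.bdryFaces, ∀ᵐ x ∂((surf d).restrict (F : Set (Rd d))),
    LinearMap.ker (𝒮.M x - 𝒮.NF F x).mulVecLin ≤
      LinearMap.ker (𝒮.M x + S.Sb F x - 𝒮.NF F x).mulVecLin
  Sb_control : ∀ F ∈ ℳ.bdryFaces, ∀ T, F ∈ ℳ.cellFaces T → ∀ w v : Rd d → Cm m,
    MemLp w 2 ((surf d).restrict (F : Set (Rd d))) →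
    MemLp v 2 ((surf d).restrict (F : Set (Rd d))) →
    ‖faceInner F (fun x => act (𝒮.M x + S.Sb F x + 𝒮.NF F x) (w x)) v‖ ≤
      CS * Real.sqrt (𝒮.aref T) * Real.sqrt (faceNormSq F w) *
        Real.sqrt (faceInner F (fun x => act (𝒮.M x + S.Sb F x) (v x)) v).re

variable {k : ℕ}

/-- The stabilization form `j_h`. -/
def jh (w v : HybridSpace ℳ m k) : ℂ :=
  ∑ T, ∑ F ∈ ℳ.cellFaces T,
    faceInner (F : Set (Rd d)) (fun x => act (S.Si T F x) (jump w T F x)) (jump v T F)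

/-- The discrete sesquilinear form `a_h`. -/
def ah (w v : HybridSpace ℳ m k) : ℂ :=
  ∑ T : ℳ.cells, cellInner (T : Set (Rd d)) (𝒮.op (cellVal w T)) (cellVal v T)
  + (𝒮.rlow : ℂ) * ∑ T, (ℳ.diam T : ℂ) * ∑ F ∈ ℳ.cellFaces T,
      faceInner (F : Set (Rd d)) (jump w T F) (jump v T F)
  + ∑ T, ∑ F ∈ ℳ.cellFaces T, (ℳ.orient T F : ℂ) *
      faceInner (F : Set (Rd d)) (fun x => act (𝒮.NF F x) (jump w T F x)) (avg v T F)
  + 2⁻¹ * ∑ F ∈ ℳ.bdryFaces, faceInner (F : Set (Rd d))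
      (fun x => act (𝒮.M x + S.Sb F x - 𝒮.NF F x) (faceVal w F x)) (faceVal v F)
  + jh S w v

/-- The square of the boundary seminorm. As `M` need not be Hermitian, the real part is taken. -/
def bdrySeminormSq (v : HybridSpace ℳ m k) : ℝ :=
  ∑ F ∈ ℳ.bdryFaces, (faceInner (F : Set (Rd d))
    (fun x => act (𝒮.M x + S.Sb F x) (faceVal v F x)) (faceVal v F)).re

/-- The square of the local norm `‖·‖_{0,T}`. -/
def localNormSq (v : HybridSpace ℳ m k) (T : ℳ.cells) : ℝ :=
  cellNormSq (T : Set (Rd d)) (cellVal v T) +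
    ℳ.diam T * ∑ F ∈ ℳ.cellFaces T, faceNormSq (F : Set (Rd d)) (jump v T F)

/-- The square of the norm `‖·‖_{♭,h}`. -/
def flatNormSq (v : HybridSpace ℳ m k) : ℝ :=
  𝒮.rlow * ∑ T, localNormSq v T + 2⁻¹ * bdrySeminormSq 𝒮 S v + (jh S v v).re

/-- The norm `‖·‖_h`. -/
def tnorm (v : HybridSpace ℳ m k) : ℝ :=
  Real.sqrt (flatNormSq 𝒮 S v +
    ∑ T : ℳ.cells, 𝒮.tref T * cellNormSq (T : Set (Rd d)) (𝒮.dirDeriv (cellVal v T)))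

/-- `u` solves the discrete problem with datum `f`. -/
def IsDiscreteSolution (f : Rd d → Cm m) (u : HybridSpace ℳ m k) : Prop :=
  ∀ v : HybridSpace ℳ m k, ah 𝒮 S u v = cellInner Ω f (brokenField v)

/-- Well-posedness of the discrete problem of degree `k`: existence, uniqueness and continuous
dependence on the datum. -/
def DiscreteWellPosed (k : ℕ) : Prop :=
  (∀ f : Rd d → Cm m, MemLp f 2 (volume.restrict Ω) →
    ∃! u : HybridSpace ℳ m k, IsDiscreteSolution 𝒮 S f u) ∧
  ∃ c : ℝ, ∀ f : Rd d → Cm m, MemLp f 2 (volume.restrict Ω) →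
    ∀ u : HybridSpace ℳ m k, IsDiscreteSolution 𝒮 S f u →
      tnorm 𝒮 S u ≤ c * Real.sqrt (cellNormSq Ω f)

end Scheme

end Friedrichs

end

/-!
The discrete form `a_h` is coercive with respect to the part of `‖·‖_h` without the graph term
(the flat norm, `flatNormSq`), and the graph term `∑ 𝔱_T ‖A_1 v_T‖²` is recovered by testing with a
discrete version of `A_1 v`.

*Integration by parts.* On an element `T`, the vector field with components `Re (v^H A^i v)` is
continuous up to the boundary, but its divergence `Re (v^H (∇·A) v) + 2 Re (v^H A_1 v)` exists only
in the sense of distributions (`System.hasWeakDiv_energyField`). The divergence theorem is therefore proved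
for continuous fields with an integrable weak divergence, on bounded open sets whose boundary is
flat with an outward normal up to a set of vanishing surface measure. Near a regular boundary point
the weak divergence is tested with a cutoff at distance `1 / n` from the boundary
(`half_space_divergence`). The exceptional set is compact and `(d - 1)`-null, so it is avoided by
cutoff functions whose gradients tend to zero in `L¹` (`exists_cutoff`), and the local statements
are glued together (`of_local`, `divergence_theorem`). Elements of a polytopal mesh satisfy the
hypotheses (`surf_singular_part`, `cell_divergence`); the two orientations of an interface are
opposite, and a boundary face has only one element (`sum_orient`).

*Coercivity and well-posedness.* Together with the lower bound on `K + K^H - ∇·A`, integration by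
parts leaves half of the boundary energies of the element components. These are compensated by the
face terms of `a_h`, and `flatNormSq v ≤ Re a_h(v, v)` follows (`flatNormSq_le_re_ah`). The flat
norm is definite (`eq_zero_of_flatNormSq`), so the discrete problem is uniquely solvable in the
finite-dimensional hybrid space (`discreteWellPosed`), and the supremum in the inf-sup condition is
finite (`exists_isLUB_ah`).

*Inverse and trace inequalities.* Each simplex of the submesh lies between two concentric balls of
comparable radii. Equivalence of norms on the polynomials of degree at most `k`, for the unit ball
and a smaller concentric one, and scaling bound a polynomial and its gradient on the simplex
pointwise by its `L²` norm (`exists_ball_bounds`). This gives the inverse inequality. For the trace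
inequality the total area of the faces is needed as well. Almost every point of a face of `T`
belongs to a simplex which is supported by the hyperplane of the face (`ae_mem_simplex`), and the
cones over disjoint parts of the boundary of a convex set are disjoint, so the area is at most a
multiple of the volume divided by the inradius (`sum_surf_le`). No bound on the number of faces
enters, and the constant does not depend on `m` (`exists_trace_inverse_constant`).

*The inf-sup condition.* The test function `w = testField v` has the element components
`𝔱_T ∑ (π⁰_T A^i) ∂_i v_T` and vanishing face components. The mean values make it a polynomial; the
oscillation bound and the inverse inequality make the error of replacing `A^i` by its mean value
comparable to the flat norm (`nsq_meanDefect_le`). Hence `a_h(v, w)` equals the graph term up to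
products of the flat norm of `v` with the norm of `v` (`ah_testField`), the factor `ρ` coming from
the reaction term, while the norm of `w` is controlled by that of `v` (`re_tForm_testField_le`).
With `X` the supremum, `N = ‖v‖_h`, and `F` and `D` the squares of the flat norm and of the graph
part, this reads `F ≤ X N` and `D ≤ K (X + ρ √F) N`; absorbing `√F ≤ √(X N)` into `N` gives
`N ≤ C ρ² X`, because `ρ ≥ 1` (`sqrt_add_le_of_absorb`, `System.one_le_rho`).
-/


open Filter Topology

noncomputable section

namespace Friedrichs

/-! ### Surface measure on hyperplanes -/

section Surface

variable {d : ℕ}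

theorem finrank_orthogonal_unit {ν : Rd d} (hν : ‖ν‖ = 1) :
    Module.finrank ℝ (ℝ ∙ ν)ᗮ = d - 1 := by
  have h1 : Module.finrank ℝ (ℝ ∙ ν) = 1 :=
    finrank_span_singleton (norm_ne_zero_iff.mp (by rw [hν]; exact one_ne_zero))
  have h2 := (ℝ ∙ ν).finrank_add_finrank_orthogonal
  rw [h1, finrank_euclideanSpace, Fintype.card_fin] at h2
  omega

theorem isometry_planeMap (ν x₀ : Rd d) : Isometry (fun y : (ℝ ∙ ν)ᗮ => x₀ + (y : Rd d)) :=
  (IsometryEquiv.addLeft x₀).isometry.comp isometry_subtype_coe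

theorem range_planeMap (ν x₀ : Rd d) :
    Set.range (fun y : (ℝ ∙ ν)ᗮ => x₀ + (y : Rd d)) = {x | inner ℝ ν x = inner ℝ ν x₀} := by
  ext x
  simp only [Set.mem_range, Set.mem_ofPred_eq]
  constructor
  · rintro ⟨y, rfl⟩
    have := Submodule.mem_orthogonal_singleton_iff_inner_right.mp y.2
    simp [inner_add_right, this]
  · intro h
    refine ⟨⟨x - x₀, Submodule.mem_orthogonal_singleton_iff_inner_right.mpr ?_⟩, by simp⟩
    rw [inner_sub_right, h, sub_self]

/-- On a hyperplane the surface measure is the Lebesgue measure. -/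
theorem surf_restrict_plane {ν : Rd d} (hν : ‖ν‖ = 1) (x₀ : Rd d) :
    (surf d).restrict {x | inner ℝ ν x = inner ℝ ν x₀} =
      (volume : Measure (ℝ ∙ ν)ᗮ).map (fun y : (ℝ ∙ ν)ᗮ => x₀ + (y : Rd d)) := by
  rw [← range_planeMap ν x₀, surf, ← (isometry_planeMap ν x₀).map_euclideanHausdorffMeasure,
    ← InnerProductSpace.euclideanHausdorffMeasure_eq_volume, finrank_orthogonal_unit hν]

theorem measurableSet_plane (ν : Rd d) (c : ℝ) : MeasurableSet {x : Rd d | inner ℝ ν x = c} :=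
  (isClosed_eq (by fun_prop) continuous_const).measurableSet

theorem surf_plane_inter {ν : Rd d} (hν : ‖ν‖ = 1) (x₀ : Rd d) {s : Set (Rd d)}
    (hs : MeasurableSet s) :
    surf d (s ∩ {x | inner ℝ ν x = inner ℝ ν x₀}) =
      volume ((fun y : (ℝ ∙ ν)ᗮ => x₀ + (y : Rd d)) ⁻¹' s) := by
  rw [← Measure.restrict_apply hs, surf_restrict_plane hν,
    Measure.map_apply (isometry_planeMap ν x₀).continuous.measurable hs]

theorem exists_inner_eq {ν : Rd d} (hν : ‖ν‖ = 1) (c : ℝ) : ∃ x₀ : Rd d, inner ℝ ν x₀ = c :=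
  ⟨c • ν, by rw [inner_smul_right, real_inner_self_eq_norm_sq, hν]; simp⟩

theorem surf_plane_lt_top {ν : Rd d} (hν : ‖ν‖ = 1) (c : ℝ) {s : Set (Rd d)}
    (hs : Bornology.IsBounded s) : surf d (s ∩ {x | inner ℝ ν x = c}) < ⊤ := by
  obtain ⟨x₀, rfl⟩ := exists_inner_eq hν c
  obtain ⟨R, hR⟩ := hs.subset_closedBall x₀
  refine (measure_mono (inter_subset_inter_left _ hR)).trans_lt ?_
  rw [surf_plane_inter hν x₀ Metric.isClosed_closedBall.measurableSet]
  refine (measure_mono ?_).trans_lt (measure_closedBall_lt_top (x := (0 : (ℝ ∙ ν)ᗮ)) (r := R))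
  intro y hy
  simpa [dist_eq_norm] using hy

theorem surf_plane_pos {ν : Rd d} (hν : ‖ν‖ = 1) {U : Set (Rd d)} (hU : IsOpen U) {x₀ : Rd d}
    (hx : x₀ ∈ U) : 0 < surf d (U ∩ {x | inner ℝ ν x = inner ℝ ν x₀}) := by
  rw [surf_plane_inter hν x₀ hU.measurableSet]
  exact (hU.preimage (isometry_planeMap ν x₀).continuous).measure_pos _ ⟨0, by simpa using hx⟩

/-- Slicing of the volume by the hyperplanes orthogonal to a unit vector. -/
theorem measurePreserving_slice {ν : Rd d} (hν : ‖ν‖ = 1) (x₀ : Rd d) :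
    MeasurePreserving (fun q : ℝ × (ℝ ∙ ν)ᗮ => x₀ + (q.1 • ν + (q.2 : Rd d))) := by
  have h1 := ((ℝ ∙ ν).measurePreserving_measurableEquivProd (P := Rd d) x₀).symm
  rw [InnerProductSpace.euclideanHausdorffMeasure_eq_volume] at h1
  have h2 := (LinearIsometryEquiv.toSpanUnitSingleton (𝕜 := ℝ) ν hν).measurePreserving
  have h3 := h1.comp (h2.prod (MeasurePreserving.id (volume : Measure (ℝ ∙ ν)ᗮ)))
  convert h3 using 1
  · ext1 q
    simp [add_comm]
  · exact Measure.volume_eq_prod _ _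

theorem measurableEmbedding_slice {ν : Rd d} (hν : ‖ν‖ = 1) (x₀ : Rd d) :
    MeasurableEmbedding (fun q : ℝ × (ℝ ∙ ν)ᗮ => x₀ + (q.1 • ν + (q.2 : Rd d))) := by
  have h1 := ((ℝ ∙ ν).measurableEquivProd (P := Rd d) x₀).symm.measurableEmbedding
  have h2 := ((LinearIsometryEquiv.toSpanUnitSingleton (𝕜 := ℝ) ν
    hν).toHomeomorph.toMeasurableEquiv.prodCongr
      (MeasurableEquiv.refl (ℝ ∙ ν)ᗮ)).measurableEmbedding
  have h3 := h1.comp h2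
  convert h3 using 1
  ext1 q
  simp only [Function.comp_apply, Submodule.measurableEquivProd_symm_apply, vadd_eq_add]
  rw [add_comm]
  rfl

end Surface

/-! ### Localization of additive statements about test functions -/

/-- A property of test functions which is stable under sums, and which holds for the test functions
supported near each point of `S`, holds for all test functions supported in `S`. The induction runs
over a finite covering of the support by balls: a bump function splits off the part of the test
function in one of the balls. -/
theorem of_local {E : Type*} [NormedAddCommGroup E] [InnerProductSpace ℝ E]
    [FiniteDimensional ℝ E] (P : (E → ℝ) → Prop) (h0 : P 0)
    (hadd : ∀ φ ψ : E → ℝ, ContDiff ℝ ∞ φ → HasCompactSupport φ → ContDiff ℝ ∞ ψ →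
      HasCompactSupport ψ → P φ → P ψ → P (φ + ψ)) {S : Set E}
    (hloc : ∀ x ∈ S, ∃ r > 0, ∀ φ : E → ℝ, ContDiff ℝ ∞ φ → HasCompactSupport φ →
      tsupport φ ⊆ Metric.ball x r → P φ)
    (φ : E → ℝ) (hφ : ContDiff ℝ ∞ φ) (hc : HasCompactSupport φ) (hs : tsupport φ ⊆ S) : P φ := by
  classical
  choose! r hr hP using hloc
  obtain ⟨t, ht, hcov⟩ := hc.isCompact.elim_nhds_subcover (fun x => Metric.ball x (r x / 2))
    (fun x hx => Metric.ball_mem_nhds x (half_pos (hr x (hs hx))))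
  replace ht : ∀ x ∈ t, x ∈ S := fun x hx => hs (ht x hx)
  clear hs
  induction t using Finset.induction_on generalizing φ with
  | empty =>
    have : tsupport φ = ∅ := by simpa using hcov
    rw [tsupport_eq_empty_iff.mp this]
    exact h0
  | insert a t _ ih =>
    have ha : a ∈ S := ht a (Finset.mem_insert_self _ _)
    let f : ContDiffBump a :=
      { rIn := r a / 2, rOut := r a * (3 / 4), rIn_pos := half_pos (hr a ha),
        rIn_lt_rOut := by linarith [hr a ha] }
    have hf : ContDiff ℝ ∞ (f : E → ℝ) := f.contDiff
    have h1 : P (fun x => f x * φ x) := by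
      refine hP a ha _ (hf.mul hφ) hc.mul_left ?_
      refine (tsupport_mul_subset_left).trans ?_
      rw [f.tsupport_eq]
      exact Metric.closedBall_subset_ball (by change r a * (3 / 4) < _; linarith [hr a ha])
    have h2 : P (fun x => (1 - f x) * φ x) := by
      refine ih _ ((contDiff_const.sub hf).mul hφ) hc.mul_left ?_
        (fun x hx => ht x (Finset.mem_insert_of_mem hx))
      -- the bump function equals one on the ball of half the radius: the remainder vanishes there
      have hcl : tsupport (fun x => (1 - f x) * φ x) ⊆ tsupport φ ∩ (Metric.ball a (r a / 2))ᶜ := by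
        refine closure_minimal ?_ ((isClosed_tsupport φ).inter Metric.isOpen_ball.isClosed_compl)
        intro x hx
        refine ⟨subset_tsupport _ (right_ne_zero_of_mul hx), fun hxa => left_ne_zero_of_mul hx ?_⟩
        rw [f.one_of_mem_closedBall (Metric.ball_subset_closedBall hxa), sub_self]
      intro x hx
      obtain ⟨hx1, hx2⟩ := hcl hx
      have := hcov hx1
      simp only [Finset.mem_insert, iUnion_iUnion_eq_or_left] at this
      exact this.resolve_left hx2
    have := hadd _ _ (hf.mul hφ) hc.mul_left ((contDiff_const.sub hf).mul hφ) hc.mul_left h1 h2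
    convert this using 1
    ext x
    simp only [Pi.add_apply]
    ring

/-! ### The divergence theorem on a flat piece of boundary -/

section HalfSpace

variable {d : ℕ}

/-- `g` is the distributional divergence in `Ω` of the vector field `G`. -/
def HasWeakDiv (Ω : Set (Rd d)) (G : Rd d → Rd d) (g : Rd d → ℝ) : Prop :=
  ∀ φ : Rd d → ℝ, ContDiff ℝ ∞ φ → HasCompactSupport φ → tsupport φ ⊆ Ω →
    ∫ x in Ω, fderiv ℝ φ x (G x) = -∫ x in Ω, φ x * g x

theorem setIntegral_congr_support {X : Type*} [MeasurableSpace X] {μ : Measure X} {s t u : Set X}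
    {f : X → ℝ} (hs : MeasurableSet s) (ht : MeasurableSet t)
    (hf : ∀ x, x ∉ u → f x = 0) (hst : s ∩ u = t ∩ u) :
    ∫ x in s, f x ∂μ = ∫ x in t, f x ∂μ := by
  rw [← integral_indicator hs, ← integral_indicator ht]
  congr 1
  ext x
  by_cases hx : x ∈ u
  · have h1 : x ∈ s ↔ x ∈ t :=
      ⟨fun h => (hst ▸ (⟨h, hx⟩ : x ∈ s ∩ u) : x ∈ t ∩ u).1,
        fun h => (hst ▸ (⟨h, hx⟩ : x ∈ t ∩ u) : x ∈ s ∩ u).1⟩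
    by_cases h2 : x ∈ s
    · rw [indicator_of_mem h2, indicator_of_mem (h1.mp h2)]
    · rw [indicator_of_notMem h2, indicator_of_notMem (fun h => h2 (h1.mpr h))]
  · simp [indicator, hf x hx]

theorem fderiv_eq_zero_of_notMem_tsupport {φ : Rd d → ℝ} {x : Rd d} (hx : x ∉ tsupport φ) :
    fderiv ℝ φ x = 0 := by
  by_contra h
  exact hx (support_fderiv_subset ℝ h)

theorem HasWeakDiv.mono {Ω V : Set (Rd d)} {G : Rd d → Rd d} {g : Rd d → ℝ}
    (h : HasWeakDiv Ω G g) (hV : V ⊆ Ω) (mV : MeasurableSet V) (mΩ : MeasurableSet Ω) :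
    HasWeakDiv V G g := by
  intro φ h1 h2 h3
  have h4 := h φ h1 h2 (h3.trans hV)
  have h5 : V ∩ tsupport φ = Ω ∩ tsupport φ := by
    rw [inter_eq_right.mpr h3, inter_eq_right.mpr (h3.trans hV)]
  rw [setIntegral_congr_support mV mΩ (u := tsupport φ) _ h5, h4,
    setIntegral_congr_support mΩ mV (u := tsupport φ) _ h5.symm]
  · intro x hx
    simp [image_eq_zero_of_notMem_tsupport hx]
  · intro x hx
    simp [fderiv_eq_zero_of_notMem_tsupport hx]

theorem integrableOn_of_bound {X E : Type*} [MeasurableSpace X] [NormedAddCommGroup E]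
    {μ : Measure X} {s : Set X} {f : X → E} (hs : MeasurableSet s) (hfin : μ s ≠ ⊤)
    (hf : AEStronglyMeasurable f (μ.restrict s)) (C : ℝ) (hC : ∀ x ∈ s, ‖f x‖ ≤ C) :
    IntegrableOn f s μ := by
  have : IsFiniteMeasure (μ.restrict s) := ⟨by simpa using hfin.lt_top⟩
  exact Integrable.of_bound hf C ((ae_restrict_iff' hs).mpr (Eventually.of_forall hC))

/-- The product of a compactly supported field of linear forms with a vector field which is
continuous near the support is continuous and bounded. -/
theorem continuousOn_bounded_apply {ψ : Rd d → Rd d →L[ℝ] ℝ} {G : Rd d → Rd d} {U H : Set (Rd d)}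
    (hψ : Continuous ψ) (hc : HasCompactSupport ψ) (hU : IsOpen U) (hs : tsupport ψ ⊆ U)
    (hH : IsClosed H) (hG : ContinuousOn G (U ∩ H)) :
    ContinuousOn (fun x => ψ x (G x)) H ∧ ∃ C, 0 ≤ C ∧ ∀ x ∈ H, |ψ x (G x)| ≤ C := by
  have h1 : ContinuousOn (fun x => ψ x (G x)) H := by
    intro x hx
    by_cases hxs : x ∈ tsupport ψ
    · have h2 : ContinuousWithinAt G H x :=
        (hG x ⟨hs hxs, hx⟩).mono_of_mem_nhdsWithin
          (inter_mem (mem_nhdsWithin_of_mem_nhds (hU.mem_nhds (hs hxs))) self_mem_nhdsWithin)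
      exact hψ.continuousWithinAt.clm_apply h2
    · have h2 : (fun x => ψ x (G x)) =ᶠ[𝓝 x] fun _ => (0 : ℝ) := by
        filter_upwards [(isClosed_tsupport ψ).isOpen_compl.mem_nhds hxs] with y hy
        simp [image_eq_zero_of_notMem_tsupport hy]
      exact (continuousAt_const.congr h2.symm).continuousWithinAt
  refine ⟨h1, ?_⟩
  obtain ⟨C, hC⟩ := (hc.isCompact.inter_right hH).exists_bound_of_continuousOn
    (h1.mono inter_subset_right)
  refine ⟨max C 0, le_max_right _ _, fun x hx => ?_⟩
  by_cases hxs : x ∈ tsupport ψ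
  · exact (hC x ⟨hxs, hx⟩).trans (le_max_left _ _)
  · simp [image_eq_zero_of_notMem_tsupport hxs]

/-- The rescaled derivatives of the smooth transition function form an approximate identity: the
derivative is supported in `[0, 1]` and has integral one. -/
theorem deriv_smoothTransition_props :
    Continuous (deriv Real.smoothTransition) ∧
    (∀ x, x < 0 ∨ 1 < x → deriv Real.smoothTransition x = 0) ∧
    (∀ x, HasDerivAt Real.smoothTransition (deriv Real.smoothTransition x) x) ∧
    ∫ x, deriv Real.smoothTransition x = 1 := by
  have hd : ContDiff ℝ ∞ Real.smoothTransition := Real.smoothTransition.contDiff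
  have h1 : Continuous (deriv Real.smoothTransition) := hd.continuous_deriv (by simp)
  have h2 : ∀ x, x < 0 ∨ 1 < x → deriv Real.smoothTransition x = 0 := by
    rintro x (hx | hx)
    · have : Real.smoothTransition =ᶠ[𝓝 x] fun _ => 0 := by
        filter_upwards [gt_mem_nhds hx] with y hy
        exact Real.smoothTransition.zero_of_nonpos hy.le
      rw [this.deriv_eq]; simp
    · have : Real.smoothTransition =ᶠ[𝓝 x] fun _ => 1 := by
        filter_upwards [lt_mem_nhds hx] with y hy
        exact Real.smoothTransition.one_of_one_le hy.le
      rw [this.deriv_eq]; simp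
  have h3 : ∀ x, HasDerivAt Real.smoothTransition (deriv Real.smoothTransition x) x := fun x =>
    ((hd.differentiable (by simp)) x).hasDerivAt
  refine ⟨h1, h2, h3, ?_⟩
  have h4 := intervalIntegral.integral_eq_sub_of_hasDerivAt (a := -1) (b := 2) (fun x _ => h3 x)
    (h1.intervalIntegrable _ _)
  rw [Real.smoothTransition.one_of_one_le (by norm_num),
    Real.smoothTransition.zero_of_nonpos (by norm_num), sub_zero,
    intervalIntegral.integral_of_le (by norm_num)] at h4
  rw [← h4, setIntegral_eq_integral_of_forall_compl_eq_zero]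
  intro x hx
  apply h2
  by_contra! h
  exact hx ⟨by linarith, by linarith⟩

/-- A cutoff function on the inner side of the hyperplane through `x₀`: it vanishes up to the
distance `1 / n` from the hyperplane and equals one beyond the distance `2 / n`. -/
def halfCut (ν x₀ : Rd d) (n : ℝ) (x : Rd d) : ℝ :=
  Real.smoothTransition (-n * inner ℝ ν (x - x₀) - 1)

theorem contDiff_halfCut (ν x₀ : Rd d) (n : ℝ) : ContDiff ℝ ∞ (halfCut ν x₀ n) := by
  unfold halfCut
  refine Real.smoothTransition.contDiff.comp ?_
  exact (contDiff_const.mul (contDiff_const.inner ℝ (contDiff_id.sub contDiff_const))).sub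
    contDiff_const

theorem fderiv_halfCut (ν x₀ : Rd d) (n : ℝ) (x v : Rd d) :
    fderiv ℝ (halfCut ν x₀ n) x v =
      deriv Real.smoothTransition (-n * inner ℝ ν (x - x₀) - 1) * (-n * inner ℝ ν v) := by
  have h1 : HasFDerivAt (fun x => -n * inner ℝ ν (x - x₀) - 1) (-n • innerSL ℝ ν) x := by
    have h0 : HasFDerivAt (fun x => innerSL ℝ ν (x - x₀)) (innerSL ℝ ν) x :=
      (innerSL ℝ ν).hasFDerivAt.comp x ((hasFDerivAt_id x).sub_const x₀)
    exact (h0.const_mul (-n)).sub_const 1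
  have h2 :=
    (deriv_smoothTransition_props.2.2.1 (-n * inner ℝ ν (x - x₀) - 1)).comp_hasFDerivAt x h1
  rw [HasFDerivAt.fderiv (f := halfCut ν x₀ n) h2]
  simp

theorem norm_le_norm_smul_add {ν : Rd d} (s : ℝ) (y : (ℝ ∙ ν)ᗮ) :
    ‖(y : Rd d)‖ ≤ ‖s • ν + (y : Rd d)‖ := by
  have h0 : inner ℝ (s • ν) (y : Rd d) = 0 := by
    rw [inner_smul_left, Submodule.mem_orthogonal_singleton_iff_inner_right.mp y.2, mul_zero]
  have := norm_add_sq_eq_norm_sq_add_norm_sq_of_inner_eq_zero _ _ h0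
  nlinarith [norm_nonneg (s • ν), norm_nonneg (y : Rd d), norm_nonneg (s • ν + (y : Rd d))]

theorem inner_slice {ν : Rd d} (hν : ‖ν‖ = 1) (x₀ : Rd d) (s : ℝ) (y : (ℝ ∙ ν)ᗮ) :
    inner ℝ ν (x₀ + (s • ν + (y : Rd d)) - x₀) = s := by
  rw [add_sub_cancel_left, inner_add_right, inner_smul_right, real_inner_self_eq_norm_sq, hν,
    Submodule.mem_orthogonal_singleton_iff_inner_right.mp y.2]
  simp

/-- Against an approximate identity which concentrates on a hyperplane from the inner side, the
integral of `h` over the half-space tends to its integral over the hyperplane. -/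
theorem tendsto_slice_integral {ν x₀ : Rd d} (hν : ‖ν‖ = 1) {r : ℝ} {h : Rd d → ℝ}
    (hcont : ContinuousOn h {x | inner ℝ ν (x - x₀) ≤ 0}) {C : ℝ}
    (hC : ∀ x, inner ℝ ν (x - x₀) ≤ 0 → |h x| ≤ C) (hsupp : ∀ x, x ∉ Metric.ball x₀ r → h x = 0) :
    Tendsto (fun n : ℕ => ∫ x in Metric.ball x₀ r ∩ {x | inner ℝ ν (x - x₀) < 0},
      ((n : ℝ) + 1) * (h x *
        deriv Real.smoothTransition (-((n : ℝ) + 1) * inner ℝ ν (x - x₀) - 1))) atTop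
      (𝓝 (∫ x in Metric.ball x₀ r ∩ {x | inner ℝ ν x = inner ℝ ν x₀}, h x ∂(surf d))) := by
  obtain ⟨hst1, hst2, -, hst4⟩ := deriv_smoothTransition_props
  set st := deriv Real.smoothTransition with hst
  set J : ℝ → ℝ := fun s => ∫ y : (ℝ ∙ ν)ᗮ, h (x₀ + (s • ν + (y : Rd d))) with hJ
  set B : Set (ℝ ∙ ν)ᗮ := Metric.closedBall 0 r with hB
  -- the slices of `h` are dominated by a constant multiple of an indicator function
  have hdom : ∀ s ≤ (0 : ℝ), ∀ y : (ℝ ∙ ν)ᗮ,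
      ‖h (x₀ + (s • ν + (y : Rd d)))‖ ≤ B.indicator (fun _ => C) y := by
    intro s hs y
    by_cases hy : y ∈ B
    · rw [indicator_of_mem hy]
      exact hC _ (by rw [inner_slice hν]; exact hs)
    · rw [indicator_of_notMem hy, hsupp, norm_zero]
      intro hb
      apply hy
      rw [mem_ball_iff_norm, add_sub_cancel_left] at hb
      rw [hB, mem_closedBall_zero_iff]
      exact ((norm_le_norm_smul_add s y).trans_lt hb).le
  have hBint : Integrable (B.indicator (fun _ => C)) (volume : Measure (ℝ ∙ ν)ᗮ) :=
    (integrable_indicator_iff Metric.isClosed_closedBall.measurableSet).mpr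
      (integrableOn_const measure_closedBall_lt_top.ne)
  have hcs : ∀ y : (ℝ ∙ ν)ᗮ, ContinuousOn (fun s : ℝ => h (x₀ + (s • ν + (y : Rd d)))) (Iic 0) := by
    intro y
    refine hcont.comp (by fun_prop) ?_
    intro s hs
    show inner ℝ ν _ ≤ 0
    rw [inner_slice hν]
    exact hs
  have hcy : ∀ s ≤ (0 : ℝ), Continuous (fun y : (ℝ ∙ ν)ᗮ => h (x₀ + (s • ν + (y : Rd d)))) := by
    intro s hs
    refine hcont.comp_continuous (by fun_prop) ?_
    intro y
    show inner ℝ ν _ ≤ 0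
    rw [inner_slice hν]
    exact hs
  have hJc : ContinuousOn J (Iic 0) := by
    intro s hs
    refine continuousWithinAt_of_dominated (bound := B.indicator (fun _ => C)) ?_ ?_ hBint ?_
    · filter_upwards [self_mem_nhdsWithin] with t ht
      exact (hcy t ht).aestronglyMeasurable
    · filter_upwards [self_mem_nhdsWithin] with t ht
      exact Eventually.of_forall fun y => hdom t ht y
    · exact Eventually.of_forall fun y => hcs y s hs
  have hJb : ∀ s ≤ 0, |J s| ≤ ∫ y, B.indicator (fun _ => C) y := fun s hs =>
    norm_integral_le_of_norm_le hBint (Eventually.of_forall (hdom s hs))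
  -- the integrals as integrals over the line
  have hline : ∀ n : ℕ, ∫ x in Metric.ball x₀ r ∩ {x | inner ℝ ν (x - x₀) < 0},
      ((n : ℝ) + 1) * (h x * st (-((n : ℝ) + 1) * inner ℝ ν (x - x₀) - 1)) =
      ∫ t, J (-(t / ((n : ℝ) + 1))) * st (t - 1) := by
    intro n
    have hn : (0 : ℝ) < (n : ℝ) + 1 := by positivity
    set f : Rd d → ℝ := fun x => ((n : ℝ) + 1) *
      (h x * st (-((n : ℝ) + 1) * inner ℝ ν (x - x₀) - 1)) with hf
    have hf0 : ∀ x, -1 < ((n : ℝ) + 1) * inner ℝ ν (x - x₀) → f x = 0 := by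
      intro x hx
      rw [hf]
      simp only
      rw [hst2 _ (Or.inl (by linarith))]
      simp
    -- `h` may jump across the hyperplane, but the cutoff vanishes near it
    have hfc : Continuous f := by
      rw [continuous_iff_continuousAt]
      intro x
      rcases lt_or_ge (inner ℝ ν (x - x₀)) 0 with hx | hx
      · have h1 : ContinuousAt h x := by
          refine hcont.continuousAt ?_
          have : {x | inner ℝ ν (x - x₀) < 0} ∈ 𝓝 x :=
            (isOpen_lt (by fun_prop) continuous_const).mem_nhds hx
          exact mem_of_superset this fun y (hy : inner ℝ ν (y - x₀) < 0) =>
            (hy.le : inner ℝ ν (y - x₀) ≤ 0)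
        have h2 : Continuous fun x : Rd d => st (-((n : ℝ) + 1) * inner ℝ ν (x - x₀) - 1) :=
          hst1.comp (by fun_prop)
        exact continuousAt_const.mul (h1.mul h2.continuousAt)
      · have : f =ᶠ[𝓝 x] fun _ => 0 := by
          have : {x | -1 < ((n : ℝ) + 1) * inner ℝ ν (x - x₀)} ∈ 𝓝 x :=
            (isOpen_lt continuous_const (by fun_prop)).mem_nhds
              (by show (-1 : ℝ) < _; nlinarith)
          filter_upwards [this] with y hy using hf0 y hy
        exact continuousAt_const.congr this.symm
    have hfs : HasCompactSupport f := by
      refine HasCompactSupport.of_support_subset_isCompact (isCompact_closedBall x₀ r) ?_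
      intro x hx
      by_contra hxb
      refine hx ?_
      rw [hf]
      simp only
      rw [hsupp x (fun h => hxb (Metric.ball_subset_closedBall h))]
      simp
    have hfi : Integrable f := hfc.integrable_of_hasCompactSupport hfs
    rw [setIntegral_eq_integral_of_forall_compl_eq_zero]
    swap
    · intro x hx
      by_cases hxb : x ∈ Metric.ball x₀ r
      · have : ¬ inner ℝ ν (x - x₀) < 0 := fun h => hx ⟨hxb, h⟩
        exact hf0 x (by nlinarith)
      · simp [hsupp x hxb]
    have hmp := measurePreserving_slice hν x₀
    have hme := measurableEmbedding_slice hν x₀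
    rw [← hmp.integral_comp hme f, Measure.volume_eq_prod, integral_prod]
    swap
    · rw [← Measure.volume_eq_prod]
      exact (hmp.integrable_comp_emb hme).mpr hfi
    -- Fubini in the direction of `ν` gives an integral over `s`; substitute `t = -(n + 1) s`
    have hsub := Measure.integral_comp_mul_left
      (fun t => J (-(t / ((n : ℝ) + 1))) * st (t - 1)) (-((n : ℝ) + 1))
    have h3 : ∫ t, J (-(t / ((n : ℝ) + 1))) * st (t - 1) =
        ((n : ℝ) + 1) * ∫ s, J (-((-((n : ℝ) + 1) * s) / ((n : ℝ) + 1))) *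
          st ((-((n : ℝ) + 1) * s) - 1) := by
      rw [hsub, abs_inv, abs_neg, abs_of_pos hn, smul_eq_mul, ← mul_assoc, mul_inv_cancel₀ hn.ne',
        one_mul]
    rw [h3, ← integral_const_mul]
    congr 1
    ext s
    have h4 : -((-((n : ℝ) + 1) * s) / ((n : ℝ) + 1)) = s := by field_simp
    rw [h4, hf, hJ]
    simp only
    rw [← integral_mul_const, ← integral_const_mul]
    congr 1
    ext y
    rw [inner_slice hν]
  simp_rw [hline]
  -- the limit is the slice `J 0`, as the approximate identity has integral one
  have hlim : ∫ x in Metric.ball x₀ r ∩ {x | inner ℝ ν x = inner ℝ ν x₀}, h x ∂(surf d) =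
      ∫ t, J 0 * st (t - 1) := by
    rw [integral_const_mul, integral_sub_right_eq_self (fun t => st t), hst4, mul_one]
    have h5 : ∫ x in Metric.ball x₀ r ∩ {x | inner ℝ ν x = inner ℝ ν x₀}, h x ∂(surf d) =
        ∫ x in {x | inner ℝ ν x = inner ℝ ν x₀}, h x ∂(surf d) := by
      refine setIntegral_congr_support (u := Metric.ball x₀ r)
        (Metric.isOpen_ball.measurableSet.inter (measurableSet_plane _ _))
        (measurableSet_plane _ _) hsupp ?_
      ext x; simp; tauto
    have hemb : MeasurableEmbedding (fun y : (ℝ ∙ ν)ᗮ => x₀ + (y : Rd d)) :=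
      (isometry_planeMap ν x₀).isClosedEmbedding.measurableEmbedding
    rw [h5, surf_restrict_plane hν x₀, hemb.integral_map, hJ]
    simp
  rw [hlim]
  -- dominated convergence, by the continuity of the slices up to the hyperplane
  refine tendsto_integral_of_dominated_convergence
    (fun t => (∫ y, B.indicator (fun _ => C) y) * |st (t - 1)|) ?_ ?_ ?_ ?_
  · intro n
    have : (fun t : ℝ => J (-(t / ((n : ℝ) + 1))) * st (t - 1)) =
        (Ici (0 : ℝ)).indicator (fun t : ℝ => J (-(t / ((n : ℝ) + 1))) * st (t - 1)) := by
      ext t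
      by_cases ht : t ∈ Ici (0 : ℝ)
      · rw [indicator_of_mem ht]
      · rw [indicator_of_notMem ht, hst2 _ (Or.inl (by simp at ht; linarith)), mul_zero]
    rw [this]
    refine (aestronglyMeasurable_indicator_iff measurableSet_Ici).mpr ?_
    refine ContinuousOn.aestronglyMeasurable ?_ measurableSet_Ici
    refine (hJc.comp (by fun_prop) ?_).mul (hst1.comp (by fun_prop)).continuousOn
    intro t ht
    simp only [mem_Iic, Left.neg_nonpos_iff]
    exact div_nonneg ht (by positivity)
  · refine Integrable.const_mul ?_ _
    have hi : Integrable st := by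
      refine hst1.integrable_of_hasCompactSupport
        (HasCompactSupport.of_support_subset_isCompact (isCompact_Icc (a := 0) (b := 1)) ?_)
      intro x hx
      by_contra hxn
      refine hx (hst2 x ?_)
      by_contra! hcon
      exact hxn ⟨hcon.1, hcon.2⟩
    exact (hi.comp_sub_right 1).abs
  · intro n
    refine Eventually.of_forall fun t => ?_
    rw [norm_mul]
    rcases lt_or_ge t 0 with ht | ht
    · rw [hst2 _ (Or.inl (by linarith))]; simp
    · exact mul_le_mul_of_nonneg_right (hJb _ (neg_nonpos.mpr (div_nonneg ht (by positivity))))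
        (abs_nonneg _)
  · refine Eventually.of_forall fun t => ?_
    rcases lt_or_ge t 0 with ht | ht
    · simp only [hst2 (t - 1) (Or.inl (by linarith)), mul_zero]
      exact tendsto_const_nhds
    · refine Tendsto.mul_const _ ?_
      have h0 : Tendsto (fun n : ℕ => -(t / ((n : ℝ) + 1))) atTop (𝓝[Iic 0] 0) := by
        refine tendsto_nhdsWithin_iff.mpr ⟨?_, Eventually.of_forall fun n => ?_⟩
        · have := (tendsto_const_div_atTop_nhds_zero_nat t).comp (tendsto_add_atTop_nat 1)
          simpa [Function.comp_def] using this.neg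
        · exact neg_nonpos.mpr (div_nonneg ht (by positivity))
      exact (hJc 0 (by simp)).tendsto.comp h0

/-- The divergence theorem in a half-ball, for test functions supported in the ball: only the flat
part of the boundary contributes. -/
theorem half_space_divergence {ν x₀ : Rd d} (hν : ‖ν‖ = 1) {r : ℝ} {G : Rd d → Rd d}
    {g : Rd d → ℝ}
    (hG : ContinuousOn G (Metric.ball x₀ r ∩ {x | inner ℝ ν (x - x₀) ≤ 0}))
    (hg : IntegrableOn g (Metric.ball x₀ r ∩ {x | inner ℝ ν (x - x₀) < 0}))
    (hw : HasWeakDiv (Metric.ball x₀ r ∩ {x | inner ℝ ν (x - x₀) < 0}) G g)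
    {φ : Rd d → ℝ} (hφ : ContDiff ℝ ∞ φ) (hc : HasCompactSupport φ)
    (hs : tsupport φ ⊆ Metric.ball x₀ r) :
    ∫ x in Metric.ball x₀ r ∩ {x | inner ℝ ν (x - x₀) < 0}, (fderiv ℝ φ x (G x) + φ x * g x) =
      ∫ x in Metric.ball x₀ r ∩ {x | inner ℝ ν x = inner ℝ ν x₀},
        φ x * inner ℝ ν (G x) ∂(surf d) := by
  set D := Metric.ball x₀ r ∩ {x : Rd d | inner ℝ ν (x - x₀) < 0} with hD
  have hDo : IsOpen D := Metric.isOpen_ball.inter (isOpen_lt (by fun_prop) continuous_const)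
  have hDm : MeasurableSet D := hDo.measurableSet
  have hDfin : volume D ≠ ⊤ := ((measure_mono inter_subset_left).trans_lt measure_ball_lt_top).ne
  have hH : IsClosed {x : Rd d | inner ℝ ν (x - x₀) ≤ 0} :=
    isClosed_le (by fun_prop) continuous_const
  have hDH : D ⊆ {x : Rd d | inner ℝ ν (x - x₀) ≤ 0} := fun x hx =>
    (le_of_lt hx.2 : inner ℝ ν (x - x₀) ≤ 0)
  obtain ⟨hc1, C1, -, hb1⟩ := continuousOn_bounded_apply (ψ := fun x => φ x • innerSL ℝ ν) (G := G)
    (by have := hφ.continuous; fun_prop) hc.smul_right Metric.isOpen_ball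
    ((closure_mono (fun x hx => left_ne_zero_of_smul hx)).trans hs) hH hG
  obtain ⟨hc2, C2, -, hb2⟩ := continuousOn_bounded_apply (ψ := fderiv ℝ φ) (G := G)
    (hφ.continuous_fderiv (by simp)) (hc.fderiv ℝ) Metric.isOpen_ball
    ((tsupport_fderiv_subset ℝ).trans hs) hH hG
  simp only [smul_apply, innerSL_apply_apply, smul_eq_mul] at hc1 hb1
  have hlim := tendsto_slice_integral hν hc1 hb1 (r := r) (fun x hx => by
    rw [image_eq_zero_of_notMem_tsupport (fun h => hx (hs h)), zero_mul])
  refine tendsto_nhds_unique ?_ hlim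
  have hi1 : IntegrableOn (fun x => fderiv ℝ φ x (G x)) D :=
    integrableOn_of_bound hDm hDfin ((hc2.mono hDH).aestronglyMeasurable hDm) C2
      (fun x hx => hb2 x (hDH hx))
  obtain ⟨Cφ, hCφ⟩ := hc.exists_bound_of_continuous hφ.continuous
  have hi2 : IntegrableOn (fun x => φ x * g x) D :=
    Integrable.bdd_mul hg (c := Cφ) hφ.continuous.aestronglyMeasurable (Eventually.of_forall hCφ)
  -- test the weak divergence with `halfCut * φ`, which is supported in the open half-ball; the
  -- derivative of the cutoff produces the concentrating integrals
  have hkey : ∀ n : ℕ, ∫ x in D, ((n : ℝ) + 1) * (φ x * inner ℝ ν (G x) *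
        deriv Real.smoothTransition (-((n : ℝ) + 1) * inner ℝ ν (x - x₀) - 1)) =
      ∫ x in D, halfCut ν x₀ ((n : ℝ) + 1) x * (fderiv ℝ φ x (G x) + φ x * g x) := by
    intro n
    set c := halfCut ν x₀ ((n : ℝ) + 1) with hcdef
    have hcd : ContDiff ℝ ∞ c := contDiff_halfCut _ _ _
    have hcb : ∀ x, ‖c x‖ ≤ 1 := by
      intro x
      rw [hcdef, halfCut, Real.norm_eq_abs, abs_of_nonneg (Real.smoothTransition.nonneg _)]
      exact Real.smoothTransition.le_one _
    have h1 := hw (fun x => c x * φ x) (hcd.mul hφ) hc.mul_left (by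
      have : tsupport (fun x => c x * φ x) ⊆
          tsupport φ ∩ {x | inner ℝ ν (x - x₀) ≤ -(1 / ((n : ℝ) + 1))} := by
        refine closure_minimal ?_ ((isClosed_tsupport φ).inter
          (isClosed_le (by fun_prop) continuous_const))
        intro x hx
        refine ⟨subset_tsupport _ (right_ne_zero_of_mul hx), ?_⟩
        have h3 := left_ne_zero_of_mul hx
        by_contra! h4
        refine h3 (Real.smoothTransition.zero_of_nonpos ?_)
        have h5 : -(1 / ((n : ℝ) + 1)) < inner ℝ ν (x - x₀) := by simpa using h4
        have h6 : (0 : ℝ) < (n : ℝ) + 1 := by positivity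
        have h7 : ((n : ℝ) + 1) * (1 / ((n : ℝ) + 1)) = 1 := by field_simp
        nlinarith
      refine this.trans fun x hx => ⟨hs hx.1, ?_⟩
      have h3 : (0 : ℝ) < 1 / ((n : ℝ) + 1) := by positivity
      have h4 : inner ℝ ν (x - x₀) ≤ -(1 / ((n : ℝ) + 1)) := hx.2
      show inner ℝ ν (x - x₀) < 0
      linarith)
    have h2 : ∀ x, fderiv ℝ (fun x => c x * φ x) x (G x) =
        c x * fderiv ℝ φ x (G x) - ((n : ℝ) + 1) * (φ x * inner ℝ ν (G x) *
        deriv Real.smoothTransition (-((n : ℝ) + 1) * inner ℝ ν (x - x₀) - 1)) := by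
      intro x
      rw [fderiv_fun_mul (hcd.differentiable (by simp) x) (hφ.differentiable (by simp) x)]
      simp only [add_apply, smul_apply, smul_eq_mul]
      rw [hcdef, fderiv_halfCut]
      ring
    have hia : IntegrableOn (fun x => c x * fderiv ℝ φ x (G x)) D :=
      Integrable.bdd_mul hi1 (c := 1) hcd.continuous.aestronglyMeasurable (Eventually.of_forall hcb)
    have hib : IntegrableOn (fun x => c x * (φ x * g x)) D :=
      Integrable.bdd_mul hi2 (c := 1) hcd.continuous.aestronglyMeasurable (Eventually.of_forall hcb)
    have hi3 : IntegrableOn (fun x => φ x * inner ℝ ν (G x)) D :=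
      integrableOn_of_bound hDm hDfin ((hc1.mono hDH).aestronglyMeasurable hDm) C1
        (fun x hx => hb1 x (hDH hx))
    have hic : IntegrableOn (fun x => ((n : ℝ) + 1) * (φ x * inner ℝ ν (G x) *
        deriv Real.smoothTransition (-((n : ℝ) + 1) * inner ℝ ν (x - x₀) - 1))) D := by
      have hcont : Continuous fun x : Rd d =>
          deriv Real.smoothTransition (-((n : ℝ) + 1) * inner ℝ ν (x - x₀) - 1) :=
        deriv_smoothTransition_props.1.comp (by fun_prop)
      obtain ⟨M, hM⟩ := (isCompact_closedBall x₀ r).exists_bound_of_continuousOn hcont.continuousOn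
      refine Integrable.const_mul ?_ _
      refine Integrable.mul_bdd hi3 (c := M) hcont.aestronglyMeasurable ?_
      exact (ae_restrict_iff' hDm).mpr (Eventually.of_forall fun x hx =>
        hM x (Metric.ball_subset_closedBall hx.1))
    simp_rw [h2] at h1
    rw [integral_sub hia hic] at h1
    have h3 : ∫ x in D, c x * (fderiv ℝ φ x (G x) + φ x * g x) =
        (∫ x in D, c x * fderiv ℝ φ x (G x)) + ∫ x in D, c x * (φ x * g x) := by
      rw [← integral_add hia hib]
      congr 1
      ext x
      ring
    rw [h3]
    have h4 : ∫ x in D, c x * φ x * g x = ∫ x in D, c x * (φ x * g x) := by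
      congr 1
      ext x
      ring
    rw [h4] at h1
    linarith
  refine (tendsto_congr hkey).mpr ?_
  -- the cutoffs tend to one inside the half-ball
  refine tendsto_integral_of_dominated_convergence
    (fun x => |fderiv ℝ φ x (G x) + φ x * g x|) ?_ ?_ ?_ ?_
  · intro n
    exact (contDiff_halfCut _ _ _).continuous.aestronglyMeasurable.mul
      (hi1.add hi2).aestronglyMeasurable
  · exact (hi1.add hi2).abs
  · intro n
    refine Eventually.of_forall fun x => ?_
    rw [norm_mul, halfCut, Real.norm_eq_abs, abs_of_nonneg (Real.smoothTransition.nonneg _)]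
    exact mul_le_of_le_one_left (abs_nonneg _) (Real.smoothTransition.le_one _)
  · refine (ae_restrict_iff' hDm).mpr (Eventually.of_forall fun x hx => ?_)
    refine tendsto_const_nhds.congr' ?_
    have hx2 : 0 < -inner ℝ ν (x - x₀) := neg_pos.mpr hx.2
    obtain ⟨N, hN⟩ := exists_nat_gt (2 / -inner ℝ ν (x - x₀))
    filter_upwards [eventually_ge_atTop N] with n hn
    rw [halfCut, Real.smoothTransition.one_of_one_le, one_mul]
    rw [div_lt_iff₀ hx2] at hN
    have : (N : ℝ) ≤ n := by exact_mod_cast hn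
    nlinarith

end HalfSpace

/-! ### Cutoff functions near a set of vanishing surface measure -/

section Cutoff

variable {d : ℕ}

/-- A cutoff function vanishing on finitely many balls; its gradient is controlled in `L¹` by the
sum of the `(d - 1)`-st powers of the radii. -/
theorem exists_cutoff_balls (d : ℕ) (hd : 0 < d) : ∃ K : ℝ, 0 ≤ K ∧
    ∀ {ι : Type} (J : Finset ι) (x : ι → Rd d) (ρ : ι → ℝ), (∀ i ∈ J, 0 < ρ i) →
      ∃ χ : Rd d → ℝ, ContDiff ℝ ∞ χ ∧ (∀ y, 0 ≤ χ y ∧ χ y ≤ 1) ∧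
        (∀ i ∈ J, ∀ y ∈ Metric.ball (x i) (ρ i), χ y = 0) ∧
        (∀ y, (∀ i ∈ J, 3 * ρ i ≤ dist y (x i)) → χ y = 1) ∧
        Integrable (fderiv ℝ χ) ∧ ∫ y, ‖fderiv ℝ χ y‖ ≤ K * ∑ i ∈ J, ρ i ^ (d - 1) := by
  classical
  let f : ContDiffBump (0 : Rd d) := ⟨1, 2, one_pos, by norm_num⟩
  have hf : ContDiff ℝ ∞ (f : Rd d → ℝ) := f.contDiff
  have hfc : Continuous (fderiv ℝ (f : Rd d → ℝ)) := hf.continuous_fderiv (by simp)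
  have hfs : HasCompactSupport (fderiv ℝ (f : Rd d → ℝ)) := f.hasCompactSupport.fderiv ℝ
  set K := ∫ y, ‖fderiv ℝ (f : Rd d → ℝ) y‖ with hK
  refine ⟨K, integral_nonneg fun _ => norm_nonneg _, ?_⟩
  intro ι J x ρ hρ
  induction J using Finset.induction_on with
  | empty =>
    refine ⟨fun _ => 1, contDiff_const, fun _ => ⟨zero_le_one, le_rfl⟩, by simp, by simp, ?_, ?_⟩
    · rw [fderiv_fun_const]
      exact integrable_zero (Rd d) (Rd d →L[ℝ] ℝ) volume
    · simp
  | insert a J ha ih =>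
    obtain ⟨χ, h1, h2, h3, h4, h5, h6⟩ := ih fun i hi => hρ i (Finset.mem_insert_of_mem hi)
    have hra := hρ a (Finset.mem_insert_self _ _)
    -- multiply the cutoff function of the remaining balls by one minus a rescaled bump function
    set b : Rd d → ℝ := fun y => f ((ρ a)⁻¹ • (y - x a)) with hb
    have hbd : ContDiff ℝ ∞ b := hf.comp (by fun_prop)
    have hb01 : ∀ y, 0 ≤ b y ∧ b y ≤ 1 := fun y => ⟨f.nonneg, f.le_one⟩
    have hbf : ∀ y, ‖fderiv ℝ b y‖ = (ρ a)⁻¹ *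
        ‖fderiv ℝ (f : Rd d → ℝ) ((ρ a)⁻¹ • (y - x a))‖ := by
      intro y
      have e1 : HasFDerivAt (fun y => (ρ a)⁻¹ • (y - x a))
          ((ρ a)⁻¹ • ContinuousLinearMap.id ℝ (Rd d)) y :=
        ((hasFDerivAt_id y).sub_const (x a)).const_smul (ρ a)⁻¹
      have e2 := ((hf.differentiable (by simp)) ((ρ a)⁻¹ • (y - x a))).hasFDerivAt.comp y e1
      rw [HasFDerivAt.fderiv (f := b) e2, ContinuousLinearMap.comp_smul, norm_smul,
        ContinuousLinearMap.comp_id, norm_inv, Real.norm_eq_abs, abs_of_pos hra]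
    have hbi : Integrable (fderiv ℝ b) := by
      refine (hbd.continuous_fderiv (by simp)).integrable_of_hasCompactSupport ?_
      refine HasCompactSupport.fderiv ℝ ?_
      refine HasCompactSupport.of_support_subset_isCompact
        (isCompact_closedBall (x a) (2 * ρ a)) ?_
      intro y hy
      by_contra hn
      refine hy (f.zero_of_le_dist ?_)
      rw [mem_closedBall_iff_norm, not_le] at hn
      rw [dist_zero_right, norm_smul, norm_inv, Real.norm_eq_abs, abs_of_pos hra]
      change 2 ≤ _
      rw [inv_mul_eq_div, le_div_iff₀ hra]
      exact hn.le
    -- the volume scales with `ρ ^ d` and the gradient with `ρ⁻¹`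
    have hbint : ∫ y, ‖fderiv ℝ b y‖ = K * ρ a ^ (d - 1) := by
      simp_rw [hbf]
      rw [integral_const_mul,
        integral_sub_right_eq_self (fun y => ‖fderiv ℝ (f : Rd d → ℝ) ((ρ a)⁻¹ • y)‖),
        Measure.integral_comp_inv_smul_of_nonneg volume
          (fun y => ‖fderiv ℝ (f : Rd d → ℝ) y‖) hra.le, finrank_euclideanSpace,
        Fintype.card_fin, smul_eq_mul]
      obtain ⟨e, rfl⟩ : ∃ e, d = e + 1 := ⟨d - 1, by omega⟩
      rw [Nat.add_sub_cancel, pow_succ]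
      field_simp
      rw [hK]
    have hprod : ∀ y, ‖fderiv ℝ (fun y => χ y * (1 - b y)) y‖ ≤
        ‖fderiv ℝ χ y‖ + ‖fderiv ℝ b y‖ := by
      intro y
      rw [fderiv_fun_mul (h1.differentiable (by simp) y)
        ((contDiff_const.sub hbd).differentiable (by simp) y), fderiv_const_sub]
      refine (norm_add_le _ _).trans ?_
      rw [norm_smul, norm_smul, norm_neg, Real.norm_eq_abs, Real.norm_eq_abs,
        abs_of_nonneg (h2 y).1, abs_of_nonneg (by linarith [(hb01 y).2]), add_comm]
      exact add_le_add (mul_le_of_le_one_left (norm_nonneg _) (by linarith [(hb01 y).1]))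
        (mul_le_of_le_one_left (norm_nonneg _) (h2 y).2)
    have hc : ContDiff ℝ ∞ fun y => χ y * (1 - b y) := h1.mul (contDiff_const.sub hbd)
    have hint : Integrable (fderiv ℝ fun y => χ y * (1 - b y)) :=
      (h5.norm.add hbi.norm).mono' (hc.continuous_fderiv (by simp)).aestronglyMeasurable
        (Eventually.of_forall hprod)
    refine ⟨fun y => χ y * (1 - b y), hc, ?_, ?_, ?_, hint, ?_⟩
    · intro y
      have := h2 y
      have := hb01 y
      exact ⟨mul_nonneg (by linarith) (by linarith), mul_le_one₀ (by linarith) (by linarith)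
        (by linarith)⟩
    · intro i hi y hy
      rcases Finset.mem_insert.mp hi with rfl | hi
      · have : b y = 1 := by
          refine f.one_of_mem_closedBall ?_
          rw [mem_closedBall_zero_iff, norm_smul, norm_inv, Real.norm_eq_abs, abs_of_pos hra]
          change _ ≤ (1 : ℝ)
          rw [inv_mul_eq_div, div_le_one₀ hra]
          exact (mem_ball_iff_norm.mp hy).le
        simp [this]
      · simp [h3 i hi y hy]
    · intro y hy
      have e1 : b y = 0 := by
        refine f.zero_of_le_dist ?_
        have := hy a (Finset.mem_insert_self _ _)
        rw [dist_eq_norm] at this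
        rw [dist_zero_right, norm_smul, norm_inv, Real.norm_eq_abs, abs_of_pos hra]
        change 2 ≤ _
        rw [inv_mul_eq_div, le_div_iff₀ hra]
        linarith
      simp [e1, h4 y fun i hi => hy i (Finset.mem_insert_of_mem hi)]
    · rw [Finset.sum_insert ha, mul_add, ← hbint]
      refine (integral_mono hint.norm (h5.norm.add hbi.norm) hprod).trans ?_
      rw [integral_add' h5.norm hbi.norm]
      linarith

theorem hausdorff_eq_zero_of_surf {Z : Set (Rd d)} (h : surf d Z = 0) :
    μH[((d - 1 : ℕ) : ℝ)] Z = 0 := by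
  rw [surf, Measure.euclideanHausdorffMeasure_def, Measure.smul_apply] at h
  have := Measure.addHaarScalarFactor_volume_hausdorffMeasure_ne_zero (d - 1)
  rw [ENNReal.smul_def, smul_eq_mul, mul_eq_zero] at h
  exact h.resolve_left (by simpa using this)

/-- A compact set of vanishing surface measure has finite coverings by balls centred in it with
small radii, the sum of the `(d - 1)`-st powers of which is small. -/
theorem exists_ball_cover {Z : Set (Rd d)} (hZ : IsCompact Z) (h0 : surf d Z = 0) {ε : ℝ}
    (hε : 0 < ε) : ∃ (J : Finset ℕ) (x : ℕ → Rd d) (ρ : ℕ → ℝ),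
      (∀ i ∈ J, x i ∈ Z ∧ 0 < ρ i ∧ ρ i ≤ ε) ∧ (Z ⊆ ⋃ i ∈ J, Metric.ball (x i) (ρ i)) ∧
      ∑ i ∈ J, ρ i ^ (d - 1) ≤ ε := by
  classical
  -- the definition of the Hausdorff measure provides a countable covering by sets of small diameter
  have h1 := hausdorff_eq_zero_of_surf h0
  rw [Measure.hausdorffMeasure_apply] at h1
  have h2 := (ENNReal.iSup_eq_zero.mp h1) (ENNReal.ofReal (ε / 2))
  have h3 := (ENNReal.iSup_eq_zero.mp h2) (by simpa using hε)
  have h4 : (0 : ENNReal) < ENNReal.ofReal (ε / 2) := by simpa using hε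
  rw [← h3] at h4
  simp only [iInf_lt_iff] at h4
  obtain ⟨t, ht1, ht2, ht3⟩ := h4
  have hD : ∀ n, Metric.diam (t n) ≤ ε / 2 := fun n =>
    ENNReal.toReal_le_of_le_ofReal (by positivity) (ht2 n)
  have hbdd : ∀ n, Bornology.IsBounded (t n) := fun n =>
    Metric.isBounded_iff_ediam_ne_top.mpr ((ht2 n).trans_lt ENNReal.ofReal_lt_top).ne
  -- radii slightly larger than the diameters, which may vanish, at the cost of a geometric series
  have hρ : ∀ n : ℕ, ∃ ρ : ℝ, Metric.diam (t n) < ρ ∧ ρ ≤ ε ∧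
      ρ ^ (d - 1) ≤ Metric.diam (t n) ^ (d - 1) + (ε / 2) / 2 / 2 ^ n := by
    intro n
    have hc : ContinuousAt (fun r : ℝ => r ^ (d - 1)) (Metric.diam (t n)) := by fun_prop
    have e1 : ∀ᶠ r in 𝓝 (Metric.diam (t n)), r ^ (d - 1) <
        Metric.diam (t n) ^ (d - 1) + (ε / 2) / 2 / 2 ^ n :=
      hc.eventually_lt continuousAt_const (by
        have : 0 < (ε / 2) / 2 / 2 ^ n := by positivity
        linarith)
    have e2 : ∀ᶠ r in 𝓝 (Metric.diam (t n)), r < ε := gt_mem_nhds (by linarith [hD n])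
    have e3 : ∀ᶠ r in 𝓝[>] (Metric.diam (t n)), Metric.diam (t n) < r := self_mem_nhdsWithin
    obtain ⟨r, ⟨hr1, hr2⟩, hr3⟩ := (((e1.and e2).filter_mono nhdsWithin_le_nhds).and e3).exists
    exact ⟨r, hr3, hr2.le, hr1.le⟩
  choose ρ hρ1 hρ2 hρ3 using hρ
  have hne : Z.Nonempty ∨ Z = ∅ := Z.eq_empty_or_nonempty.symm
  rcases hne with ⟨z₀, hz₀⟩ | rfl
  swap
  · exact ⟨∅, fun _ => 0, fun _ => 0, by simp, by simp, by simpa using hε.le⟩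
  have hx : ∀ n, ∃ x : Rd d, (t n ∩ Z).Nonempty → x ∈ t n ∩ Z := by
    intro n
    by_cases h : (t n ∩ Z).Nonempty
    · exact ⟨h.some, fun _ => h.some_mem⟩
    · exact ⟨z₀, fun h' => absurd h' h⟩
  choose x hx using hx
  have hcov : Z ⊆ ⋃ n : {n // (t n ∩ Z).Nonempty}, Metric.ball (x n) (ρ n) := by
    intro z hz
    obtain ⟨n, hn⟩ := mem_iUnion.mp (ht1 hz)
    have hne : (t n ∩ Z).Nonempty := ⟨z, hn, hz⟩
    refine mem_iUnion.mpr ⟨⟨n, hne⟩, ?_⟩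
    exact (Metric.dist_le_diam_of_mem (hbdd n) hn (hx n hne).1).trans_lt (hρ1 n)
  obtain ⟨J, hJ⟩ := hZ.elim_finite_subcover _ (fun _ => Metric.isOpen_ball) hcov
  refine ⟨J.map (Function.Embedding.subtype _), x, ρ, ?_, ?_, ?_⟩
  · intro i hi
    simp only [Finset.mem_map, Function.Embedding.subtype_apply, Subtype.exists] at hi
    obtain ⟨n, hn, -, rfl⟩ := hi
    exact ⟨(hx n hn).2, Metric.diam_nonneg.trans_lt (hρ1 n), hρ2 n⟩
  · intro z hz
    have := hJ hz
    simp only [mem_iUnion] at this ⊢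
    obtain ⟨n, hn, h⟩ := this
    exact ⟨n, Finset.mem_map.mpr ⟨n, hn, rfl⟩, h⟩
  · set J' := J.map (Function.Embedding.subtype _) with hJ'
    have hs1 : ∑ i ∈ J', Metric.diam (t i) ^ (d - 1) ≤ ε / 2 := by
      have e1 : ∑ i ∈ J', (⨆ _ : (t i).Nonempty, Metric.ediam (t i) ^ ((d - 1 : ℕ) : ℝ)) ≤
          ENNReal.ofReal (ε / 2) := (ENNReal.sum_le_tsum _).trans ht3.le
      have e2 : ∀ i ∈ J', (⨆ _ : (t i).Nonempty, Metric.ediam (t i) ^ ((d - 1 : ℕ) : ℝ)) =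
          ENNReal.ofReal (Metric.diam (t i) ^ (d - 1)) := by
        intro i hi
        simp only [hJ', Finset.mem_map, Function.Embedding.subtype_apply, Subtype.exists] at hi
        obtain ⟨n, hn, -, rfl⟩ := hi
        have hn' : (t n).Nonempty := hn.mono inter_subset_left
        rw [iSup_pos hn', ENNReal.rpow_natCast, ENNReal.ofReal_pow Metric.diam_nonneg,
          Metric.diam, ENNReal.ofReal_toReal ((ht2 n).trans_lt ENNReal.ofReal_lt_top).ne]
      rw [Finset.sum_congr rfl e2, ← ENNReal.ofReal_sum_of_nonneg
        (fun i _ => pow_nonneg Metric.diam_nonneg _)] at e1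
      exact (ENNReal.ofReal_le_ofReal_iff (by positivity)).mp e1
    have hs2 : ∑ i ∈ J', (ε / 2) / 2 / 2 ^ i ≤ ε / 2 := by
      have := (summable_geometric_two' (ε / 2)).sum_le_tsum J' (fun i _ => by positivity)
      rwa [tsum_geometric_two'] at this
    calc ∑ i ∈ J', ρ i ^ (d - 1)
        ≤ ∑ i ∈ J', (Metric.diam (t i) ^ (d - 1) + (ε / 2) / 2 / 2 ^ i) :=
          Finset.sum_le_sum fun i _ => hρ3 i
      _ ≤ ε := by rw [Finset.sum_add_distrib]; linarith

/-- A compact set of vanishing surface measure has vanishing `W^{1,1}` capacity. -/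
theorem exists_cutoff (hd : 0 < d) {Z : Set (Rd d)} (hZ : IsCompact Z) (h0 : surf d Z = 0) {ε : ℝ}
    (hε : 0 < ε) : ∃ χ : Rd d → ℝ, ContDiff ℝ ∞ χ ∧ (∀ y, 0 ≤ χ y ∧ χ y ≤ 1) ∧
      (∃ W, IsOpen W ∧ Z ⊆ W ∧ ∀ y ∈ W, χ y = 0) ∧
      (∀ y, (∀ z ∈ Z, ε ≤ dist y z) → χ y = 1) ∧
      Integrable (fderiv ℝ χ) ∧ ∫ y, ‖fderiv ℝ χ y‖ ≤ ε := by
  obtain ⟨K, hK0, hK⟩ := exists_cutoff_balls d hd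
  -- the cutoff differs from one up to the distance `3 * ρ i` from the centres, which lie in `Z`
  set δ := min (ε / 3) (ε / (K + 1)) with hδ
  have hδ0 : 0 < δ := lt_min (by positivity) (by positivity)
  obtain ⟨J, x, ρ, h1, h2, h3⟩ := exists_ball_cover hZ h0 hδ0
  obtain ⟨χ, c1, c2, c3, c4, c5, c6⟩ := hK J x ρ fun i hi => (h1 i hi).2.1
  refine ⟨χ, c1, c2, ⟨_, isOpen_biUnion fun _ _ => Metric.isOpen_ball, h2, ?_⟩, ?_, c5, ?_⟩
  · intro y hy
    obtain ⟨i, hi, hy⟩ := mem_iUnion₂.mp hy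
    exact c3 i hi y hy
  · intro y hy
    refine c4 y fun i hi => ?_
    have := hy _ (h1 i hi).1
    have := (h1 i hi).2.2.trans (min_le_left _ _)
    linarith
  · refine c6.trans ?_
    have e1 : K * ∑ i ∈ J, ρ i ^ (d - 1) ≤ K * (ε / (K + 1)) :=
      mul_le_mul_of_nonneg_left (h3.trans (min_le_right _ _)) hK0
    have e2 : K * (ε / (K + 1)) ≤ ε := by
      rw [mul_div_assoc', div_le_iff₀ (by positivity)]
      nlinarith
    exact e1.trans e2

end Cutoff

/-! ### The divergence theorem -/

section Divergence

variable {d : ℕ}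

/-- Near a point with an outward normal, the boundary is flat and the normal is constant. -/
theorem IsOutwardNormal.local_structure {P : Set (Rd d)} {x ν : Rd d}
    (h : IsOutwardNormal P x ν) : ∃ ε > 0, ∀ δ ≤ ε,
      (∀ y ∈ Metric.ball x δ, y ∈ P ↔ inner ℝ ν (y - x) < 0) ∧
      (∀ y ∈ Metric.ball x δ, y ∈ closure P ↔ inner ℝ ν (y - x) ≤ 0) ∧
      (∀ y ∈ Metric.ball x δ, y ∈ frontier P ↔ inner ℝ ν (y - x) = 0) ∧
      (∀ y ∈ Metric.ball x δ, y ∈ frontier P → IsOutwardNormal P y ν) := by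
  obtain ⟨hν, ε, hε, hP⟩ := h
  refine ⟨ε, hε, fun δ hδ => ?_⟩
  have hsub : Metric.ball x δ ⊆ Metric.ball x ε := Metric.ball_subset_ball hδ
  have hP' : ∀ y ∈ Metric.ball x δ, y ∈ P ↔ inner ℝ ν (y - x) < 0 := fun y hy => hP y (hsub hy)
  -- a point of the half-space is approached from inside `P` along `-ν`
  have hcl : ∀ y ∈ Metric.ball x δ, y ∈ closure P ↔ inner ℝ ν (y - x) ≤ 0 := by
    intro y hy
    constructor
    · intro hyc
      by_contra! hlt
      have ho : IsOpen (Metric.ball x δ ∩ {z | 0 < inner ℝ ν (z - x)}) :=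
        Metric.isOpen_ball.inter (isOpen_lt continuous_const (by fun_prop))
      obtain ⟨z, ⟨hz1, hz2⟩, hz3⟩ := mem_closure_iff.mp hyc _ ho ⟨hy, hlt⟩
      have := (hP' z hz1).mp hz3
      exact absurd this (not_lt.mpr (le_of_lt hz2))
    · intro hle
      have ht : Tendsto (fun s : ℝ => y - s • ν) (𝓝[>] 0) (𝓝 y) := by
        have : Tendsto (fun s : ℝ => y - s • ν) (𝓝 0) (𝓝 (y - (0 : ℝ) • ν)) :=
          Continuous.tendsto (by fun_prop) 0
        rw [zero_smul, sub_zero] at this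
        exact this.mono_left nhdsWithin_le_nhds
      refine mem_closure_of_tendsto ht ?_
      filter_upwards [ht (Metric.isOpen_ball.mem_nhds hy), self_mem_nhdsWithin] with s hs1 hs2
      refine (hP' _ hs1).mpr ?_
      have e : inner ℝ ν (y - s • ν - x) = inner ℝ ν (y - x) - s := by
        rw [sub_right_comm, inner_sub_right, inner_smul_right, real_inner_self_eq_norm_sq, hν]
        ring
      have hs3 : (0 : ℝ) < s := hs2
      linarith
  have hint : ∀ y ∈ Metric.ball x δ, inner ℝ ν (y - x) < 0 → y ∈ interior P := by
    intro y hy hlt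
    refine mem_interior.mpr ⟨Metric.ball x δ ∩ {z | inner ℝ ν (z - x) < 0}, ?_,
      Metric.isOpen_ball.inter (isOpen_lt (by fun_prop) continuous_const), hy, hlt⟩
    rintro z ⟨hz1, hz2⟩
    exact (hP' z hz1).mpr hz2
  have hfr : ∀ y ∈ Metric.ball x δ, y ∈ frontier P ↔ inner ℝ ν (y - x) = 0 := by
    intro y hy
    constructor
    · rintro ⟨h1, h2⟩
      refine le_antisymm ((hcl y hy).mp h1) ?_
      by_contra! hlt
      exact h2 (hint y hy hlt)
    · intro h0
      refine ⟨(hcl y hy).mpr h0.le, fun hi => ?_⟩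
      have := (hP' y hy).mp (interior_subset hi)
      linarith
  refine ⟨hP', hcl, hfr, fun y hy hyf => ⟨hν, δ - dist y x, by
    simpa using hy, fun z hz => ?_⟩⟩
  have hz' : z ∈ Metric.ball x δ := by
    have h1 := dist_triangle z y x
    rw [Metric.mem_ball] at hz ⊢
    linarith
  rw [hP' z hz']
  have h2 := (hfr y hy).mp hyf
  have h3 : inner ℝ ν (z - x) = inner ℝ ν (z - y) + inner ℝ ν (y - x) := by
    rw [← inner_add_right, sub_add_sub_cancel]
  rw [h3, h2, add_zero]

/-- A bounded relatively open piece `F` of a hyperplane orthogonal to the unit vector `ν`. -/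
def IsFlatPiece (F : Set (Rd d)) (ν : Rd d) : Prop :=
  ‖ν‖ = 1 ∧ Bornology.IsBounded F ∧
    ∃ (c : ℝ) (U : Set (Rd d)), IsOpen U ∧ F = U ∩ {x | inner ℝ ν x = c}

theorem IsFlatPiece.measurableSet {F : Set (Rd d)} {ν : Rd d} (h : IsFlatPiece F ν) :
    MeasurableSet F := by
  obtain ⟨-, -, c, U, hU, rfl⟩ := h
  exact hU.measurableSet.inter (measurableSet_plane _ _)

theorem IsFlatPiece.surf_lt_top {F : Set (Rd d)} {ν : Rd d} (h : IsFlatPiece F ν) :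
    surf d F < ⊤ := by
  obtain ⟨hν, hb, c, U, hU, rfl⟩ := h
  have := surf_plane_lt_top hν c hb
  rwa [inter_assoc, inter_self] at this

/-- The regular part of the boundary: the points of the faces with the prescribed normal. -/
def regPart {ι : Type*} (T : Set (Rd d)) (s : Finset ι) (F : ι → Set (Rd d)) (ν : ι → Rd d) :
    Set (Rd d) :=
  ⋃ i ∈ s, {x | x ∈ F i ∧ IsOutwardNormal T x (ν i)}

variable {ι : Type*} {T : Set (Rd d)} {s : Finset ι} {F : ι → Set (Rd d)} {ν : ι → Rd d}

/-- Around a regular boundary point, the boundary consists of regular points of one face. -/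
theorem regular_local (hF : ∀ i ∈ s, IsFlatPiece (F i) (ν i)) {x : Rd d} {i : ι} (hi : i ∈ s)
    (hx : x ∈ F i) (hn : IsOutwardNormal T x (ν i)) : ∃ ε > 0,
      (∀ y ∈ Metric.ball x ε, y ∈ T ↔ inner ℝ (ν i) (y - x) < 0) ∧
      (∀ y ∈ Metric.ball x ε, y ∈ closure T ↔ inner ℝ (ν i) (y - x) ≤ 0) ∧
      (∀ y ∈ Metric.ball x ε, y ∈ F i ↔ inner ℝ (ν i) (y - x) = 0) ∧
      (∀ y ∈ Metric.ball x ε, y ∈ frontier T → y ∈ F i ∧ IsOutwardNormal T y (ν i)) := by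
  obtain ⟨ε, hε, h⟩ := hn.local_structure
  obtain ⟨-, -, c, U, hU, hFU⟩ := hF i hi
  have hx' := hx
  rw [hFU] at hx'
  obtain ⟨hxU, hxc⟩ := hx'
  replace hxc : inner ℝ (ν i) x = c := hxc
  obtain ⟨ε', hε', hball⟩ := Metric.isOpen_iff.mp hU x hxU
  obtain ⟨h1, h2, h3, h4⟩ := h (min ε ε') (min_le_left _ _)
  have hFi : ∀ y ∈ Metric.ball x (min ε ε'), y ∈ F i ↔ inner ℝ (ν i) (y - x) = 0 := by
    intro y hy
    have hyU : y ∈ U := hball (Metric.ball_subset_ball (min_le_right _ _) hy)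
    rw [hFU, inner_sub_right, hxc, sub_eq_zero]
    exact ⟨fun h => h.2, fun h => ⟨hyU, h⟩⟩
  refine ⟨min ε ε', lt_min hε hε', h1, h2, hFi, fun y hy hyf => ⟨?_, h4 y hy hyf⟩⟩
  exact (hFi y hy).mpr ((h3 y hy).mp hyf)

/-- The divergence theorem for a bounded open set whose boundary consists, up to a set of
vanishing surface measure, of flat pieces with an outward normal. The field is continuous up to the
boundary, and its divergence is taken in the sense of distributions. -/
theorem divergence_theorem (hd : 0 < d) (hT : IsOpen T) (hTb : Bornology.IsBounded T)
    (hF : ∀ i ∈ s, IsFlatPiece (F i) (ν i)) (hFT : ∀ i ∈ s, F i ⊆ frontier T)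
    (hdisj : ∀ i ∈ s, ∀ j ∈ s, i ≠ j → Disjoint (F i) (F j))
    (hnull : surf d (frontier T \ regPart T s F ν) = 0) {G : Rd d → Rd d} {g : Rd d → ℝ}
    (hG : ContinuousOn G (closure T)) (hg : IntegrableOn g T) (hw : HasWeakDiv T G g) :
    ∫ x in T, g x = ∑ i ∈ s, ∫ x in F i, inner ℝ (ν i) (G x) ∂(surf d) := by
  classical
  set Z := frontier T \ regPart T s F ν with hZdef
  have hTc : IsCompact (closure T) := hTb.isCompact_closure
  obtain ⟨C, hC⟩ := hTc.exists_bound_of_continuousOn hG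
  have hC0 : 0 ≤ max C 0 := le_max_right _ _
  have hTfin : volume T ≠ ⊤ := ((measure_mono subset_closure).trans_lt hTc.measure_lt_top).ne
  have hFcl : ∀ i ∈ s, F i ⊆ closure T := fun i hi => (hFT i hi).trans frontier_subset_closure
  -- the exceptional set is compact
  have hZ : IsCompact Z := by
    have hcl : IsClosed Z := by
      rw [← isOpen_compl_iff, Metric.isOpen_iff]
      intro x hx
      by_cases hxf : x ∈ frontier T
      · have hxR : x ∈ regPart T s F ν := by
          by_contra hn
          exact hx ⟨hxf, hn⟩
        obtain ⟨i, hi, hxi, hn⟩ := mem_iUnion₂.mp hxR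
        obtain ⟨ε, hε, -, -, -, h4⟩ := regular_local hF hi hxi hn
        refine ⟨ε, hε, fun y hy hyZ => hyZ.2 ?_⟩
        exact mem_iUnion₂.mpr ⟨i, hi, h4 y hy hyZ.1⟩
      · obtain ⟨ε, hε, hb⟩ := Metric.isOpen_iff.mp isClosed_frontier.isOpen_compl x hxf
        exact ⟨ε, hε, fun y hy hyZ => hb hy hyZ.1⟩
    exact hTc.of_isClosed_subset hcl (sdiff_subset.trans frontier_subset_closure)
  have hi1 : ∀ ψ : Rd d → ℝ, ContDiff ℝ ∞ ψ → IntegrableOn (fun x => fderiv ℝ ψ x (G x)) T := by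
    intro ψ hψ
    have hc := hψ.continuous_fderiv (by simp)
    obtain ⟨M, hM⟩ := hTc.exists_bound_of_continuousOn (hc.continuousOn.clm_apply hG)
    refine integrableOn_of_bound hT.measurableSet hTfin ?_ M (fun x hx => hM x (subset_closure hx))
    exact ((hc.continuousOn.clm_apply hG).mono subset_closure).aestronglyMeasurable hT.measurableSet
  have hi2 : ∀ ψ : Rd d → ℝ, ContDiff ℝ ∞ ψ → IntegrableOn (fun x => ψ x * g x) T := by
    intro ψ hψ
    obtain ⟨M, hM⟩ := hTc.exists_bound_of_continuousOn hψ.continuous.continuousOn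
    refine Integrable.bdd_mul hg (c := M) hψ.continuous.aestronglyMeasurable ?_
    exact (ae_restrict_iff' hT.measurableSet).mpr
      (Eventually.of_forall fun x hx => hM x (subset_closure hx))
  have hi3 : ∀ i ∈ s, ∀ ψ : Rd d → ℝ, ContDiff ℝ ∞ ψ →
      IntegrableOn (fun x => ψ x * inner ℝ (ν i) (G x)) (F i) (surf d) := by
    intro i hi ψ hψ
    have hc : ContinuousOn (fun x => ψ x * inner ℝ (ν i) (G x)) (closure T) :=
      hψ.continuous.continuousOn.mul (continuousOn_const.inner hG)
    obtain ⟨M, hM⟩ := hTc.exists_bound_of_continuousOn hc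
    exact integrableOn_of_bound (hF i hi).measurableSet (hF i hi).surf_lt_top.ne
      ((hc.mono (hFcl i hi)).aestronglyMeasurable (hF i hi).measurableSet) M
      (fun x hx => hM x (hFcl i hi hx))
  -- the identity tested against functions supported away from the exceptional set
  have hP : ∀ φ : Rd d → ℝ, ContDiff ℝ ∞ φ → HasCompactSupport φ → tsupport φ ⊆ Zᶜ →
      ∫ x in T, (fderiv ℝ φ x (G x) + φ x * g x) =
        ∑ i ∈ s, ∫ x in F i, φ x * inner ℝ (ν i) (G x) ∂(surf d) := by
    refine of_local (fun φ => ∫ x in T, (fderiv ℝ φ x (G x) + φ x * g x) =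
        ∑ i ∈ s, ∫ x in F i, φ x * inner ℝ (ν i) (G x) ∂(surf d)) ?_ ?_ ?_
    · simp
    · intro φ ψ hφ _ hψ _ h1 h2
      have e1 : ∫ x in T, (fderiv ℝ (φ + ψ) x (G x) + (φ + ψ) x * g x) =
          (∫ x in T, (fderiv ℝ φ x (G x) + φ x * g x)) +
            ∫ x in T, (fderiv ℝ ψ x (G x) + ψ x * g x) := by
        have i1 : IntegrableOn (fun x => fderiv ℝ φ x (G x) + φ x * g x) T :=
          (hi1 φ hφ).add (hi2 φ hφ)
        have i2 : IntegrableOn (fun x => fderiv ℝ ψ x (G x) + ψ x * g x) T :=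
          (hi1 ψ hψ).add (hi2 ψ hψ)
        rw [← integral_add i1 i2]
        congr 1
        ext x
        rw [fderiv_add (hφ.differentiable (by simp) x) (hψ.differentiable (by simp) x)]
        simp only [add_apply, Pi.add_apply]
        ring
      rw [e1, h1, h2, ← Finset.sum_add_distrib]
      refine Finset.sum_congr rfl fun i hi => ?_
      rw [← integral_add (hi3 i hi φ hφ) (hi3 i hi ψ hψ)]
      congr 1
      ext x
      simp only [Pi.add_apply]
      ring
    · intro x hx
      by_cases hxT : x ∈ closure T
      swap
      -- away from the closure both sides vanish
      · obtain ⟨ε, hε, hb⟩ := Metric.isOpen_iff.mp isClosed_closure.isOpen_compl x hxT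
        refine ⟨ε, hε, fun φ hφ hc hs => ?_⟩
        have h0 : ∀ y ∈ closure T, y ∉ tsupport φ := fun y hy hyt => hb (hs hyt) hy
        rw [setIntegral_eq_zero_of_forall_eq_zero, Finset.sum_eq_zero]
        · intro i hi
          refine setIntegral_eq_zero_of_forall_eq_zero fun y hy => ?_
          rw [image_eq_zero_of_notMem_tsupport (h0 y (hFcl i hi hy)), zero_mul]
        · intro y hy
          rw [image_eq_zero_of_notMem_tsupport (h0 y (subset_closure hy)),
            fderiv_eq_zero_of_notMem_tsupport (h0 y (subset_closure hy))]
          simp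
      by_cases hxi : x ∈ T
      -- in the interior the identity is the definition of the weak divergence
      · obtain ⟨ε, hε, hb⟩ := Metric.isOpen_iff.mp hT x hxi
        refine ⟨ε, hε, fun φ hφ hc hs => ?_⟩
        rw [integral_add (hi1 φ hφ) (hi2 φ hφ), hw φ hφ hc (hs.trans hb), neg_add_cancel,
          Finset.sum_eq_zero]
        intro i hi
        refine setIntegral_eq_zero_of_forall_eq_zero fun y hy => ?_
        have : y ∉ tsupport φ := by
          intro hyt
          have := (hFT i hi hy).2
          rw [hT.interior_eq] at this
          exact this (hb (hs hyt))
        rw [image_eq_zero_of_notMem_tsupport this, zero_mul]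
      -- near a regular point of the boundary `T` is a half-ball, and meets a single face
      · have hxf : x ∈ frontier T := ⟨hxT, by rwa [hT.interior_eq]⟩
        have hxR : x ∈ regPart T s F ν := by
          by_contra hn
          exact hx ⟨hxf, hn⟩
        obtain ⟨i, hi, hxi, hn⟩ := mem_iUnion₂.mp hxR
        obtain ⟨ε, hε, h1, h2, h3, h4⟩ := regular_local hF hi hxi hn
        refine ⟨ε, hε, fun φ hφ hc hs => ?_⟩
        have hD : T ∩ Metric.ball x ε = Metric.ball x ε ∩ {y | inner ℝ (ν i) (y - x) < 0} := by
          ext y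
          constructor
          · rintro ⟨ha, hb⟩
            exact ⟨hb, (h1 y hb).mp ha⟩
          · rintro ⟨hb, ha⟩
            exact ⟨(h1 y hb).mpr ha, hb⟩
        have hDo : IsOpen (Metric.ball x ε ∩ {y | inner ℝ (ν i) (y - x) < 0}) :=
          Metric.isOpen_ball.inter (isOpen_lt (by fun_prop) continuous_const)
        have hDT : Metric.ball x ε ∩ {y | inner ℝ (ν i) (y - x) < 0} ⊆ T := by
          rw [← hD]; exact inter_subset_left
        have key := half_space_divergence (hF i hi).1 (x₀ := x) (r := ε) (G := G) (g := g)
          (hG.mono (fun y hy => (h2 y hy.1).mpr hy.2)) (hg.mono_set hDT)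
          (hw.mono hDT hDo.measurableSet hT.measurableSet) hφ hc hs
        have hφ0 : ∀ y, y ∉ Metric.ball x ε → φ y = 0 := fun y hy =>
          image_eq_zero_of_notMem_tsupport fun h => hy (hs h)
        rw [setIntegral_congr_support (u := Metric.ball x ε) hT.measurableSet hDo.measurableSet,
          key, Finset.sum_eq_single_of_mem i hi]
        · refine setIntegral_congr_support (u := Metric.ball x ε)
            (Metric.isOpen_ball.measurableSet.inter (measurableSet_plane _ _))
            (hF i hi).measurableSet (fun y hy => by rw [hφ0 y hy, zero_mul]) ?_
          ext y
          constructor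
          · rintro ⟨⟨ha, hb⟩, -⟩
            refine ⟨(h3 y ha).mpr ?_, ha⟩
            rw [inner_sub_right, sub_eq_zero]
            exact hb
          · rintro ⟨hb, ha⟩
            refine ⟨⟨ha, ?_⟩, ha⟩
            have := (h3 y ha).mp hb
            rwa [inner_sub_right, sub_eq_zero] at this
        · intro j hj hji
          refine setIntegral_eq_zero_of_forall_eq_zero fun y hy => ?_
          rw [hφ0 y, zero_mul]
          intro hyb
          exact disjoint_left.mp (hdisj j hj i hi hji) hy (h4 y hyb (hFT j hj hy)).1
        · intro y hy
          rw [hφ0 y hy, fderiv_eq_zero_of_notMem_tsupport fun h => hy (hs h)]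
          simp
        · rw [hD]
          ext y
          simp; tauto
  -- passage to the limit along cutoff functions concentrating on the exceptional set
  have hcut : ∀ n : ℕ, ∃ χ : Rd d → ℝ, ContDiff ℝ ∞ χ ∧ (∀ y, 0 ≤ χ y ∧ χ y ≤ 1) ∧
      (∀ y, (∀ z ∈ Z, 1 / ((n : ℝ) + 1) ≤ dist y z) → χ y = 1) ∧
      Integrable (fderiv ℝ χ) ∧ ∫ y, ‖fderiv ℝ χ y‖ ≤ 1 / ((n : ℝ) + 1) ∧
      ∫ x in T, (fderiv ℝ χ x (G x) + χ x * g x) =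
        ∑ i ∈ s, ∫ x in F i, χ x * inner ℝ (ν i) (G x) ∂(surf d) := by
    intro n
    obtain ⟨χ, c1, c2, ⟨W, hW, hZW, hχW⟩, c4, c5, c6⟩ := exists_cutoff hd hZ hnull
      (ε := 1 / ((n : ℝ) + 1)) (by positivity)
    refine ⟨χ, c1, c2, c4, c5, c6, ?_⟩
    obtain ⟨R, hR⟩ := hTc.isBounded.subset_ball 0
    -- a bump function equal to one on the closure of `T` makes the cutoff compactly supported
    let f : ContDiffBump (0 : Rd d) :=
      ⟨max R 1, max R 1 + 1, lt_max_of_lt_right one_pos, lt_add_one _⟩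
    have hf1 : ∀ x ∈ closure T, f =ᶠ[𝓝 x] fun _ => 1 := fun x hx =>
      (f.eventuallyEq_one_of_mem_ball (Metric.ball_subset_ball (le_max_left _ _) (hR hx)))
    have h1 := hP (fun x => f x * χ x) (f.contDiff.mul c1) f.hasCompactSupport.mul_right (by
      have : tsupport (fun x => f x * χ x) ⊆ Wᶜ := by
        refine closure_minimal (fun x hx hxW => ?_) hW.isClosed_compl
        exact right_ne_zero_of_mul hx (hχW x hxW)
      exact this.trans (compl_subset_compl.mpr hZW))
    have h2 : ∀ x ∈ closure T, (fun x => f x * χ x) =ᶠ[𝓝 x] χ := by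
      intro x hx
      filter_upwards [hf1 x hx] with y hy
      rw [hy, one_mul]
    have h3 : ∫ x in T, (fderiv ℝ (fun x => f x * χ x) x (G x) + f x * χ x * g x) =
        ∫ x in T, (fderiv ℝ χ x (G x) + χ x * g x) := by
      refine setIntegral_congr_fun hT.measurableSet fun x hx => ?_
      have := h2 x (subset_closure hx)
      simp only [this.fderiv_eq]
      rw [this.eq_of_nhds]
    rw [← h3, h1]
    refine Finset.sum_congr rfl fun i hi => ?_
    refine setIntegral_congr_fun (hF i hi).measurableSet fun x hx => ?_
    rw [(h2 x (hFcl i hi hx)).eq_of_nhds]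
  choose χ c1 c2 c3 c4 c5 c6 using hcut
  have hχlim : ∀ y, y ∉ Z → Tendsto (fun n => χ n y) atTop (𝓝 1) := by
    intro y hy
    refine tendsto_const_nhds.congr' ?_
    obtain ⟨ε, hε, hb⟩ := Metric.isOpen_iff.mp hZ.isClosed.isOpen_compl y hy
    obtain ⟨N, hN⟩ := exists_nat_one_div_lt hε
    filter_upwards [eventually_ge_atTop N] with n hn
    refine (c3 n y fun z hz => ?_).symm
    have h1 : (1 : ℝ) / (n + 1) ≤ 1 / (N + 1) := by
      have : (N : ℝ) ≤ n := by exact_mod_cast hn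
      gcongr
    have h2 : ¬ dist z y < ε := fun h => hb h hz
    rw [dist_comm] at h2
    linarith
  -- the gradients of the cutoff functions tend to zero in `L¹`
  have l1 : Tendsto (fun n => ∫ x in T, fderiv ℝ (χ n) x (G x)) atTop (𝓝 0) := by
    refine squeeze_zero_norm (a := fun n : ℕ => max C 0 * (1 / ((n : ℝ) + 1))) (fun n => ?_) ?_
    · have e1 : ‖∫ x in T, fderiv ℝ (χ n) x (G x)‖ ≤ ∫ x in T, max C 0 * ‖fderiv ℝ (χ n) x‖ := by
        refine norm_integral_le_of_norm_le ((c4 n).norm.const_mul _).integrableOn ?_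
        refine (ae_restrict_iff' hT.measurableSet).mpr (Eventually.of_forall fun x hx => ?_)
        rw [mul_comm]
        exact (ContinuousLinearMap.le_opNorm _ _).trans (mul_le_mul_of_nonneg_left
          ((hC x (subset_closure hx)).trans (le_max_left _ _)) (norm_nonneg _))
      refine e1.trans ?_
      rw [integral_const_mul]
      refine mul_le_mul_of_nonneg_left ((setIntegral_le_integral (c4 n).norm
        (Eventually.of_forall fun _ => norm_nonneg _)).trans (c5 n)) hC0
    · have := (tendsto_one_div_add_atTop_nhds_zero_nat (𝕜 := ℝ)).const_mul (max C 0)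
      simpa using this
  have l2 : Tendsto (fun n => ∫ x in T, χ n x * g x) atTop (𝓝 (∫ x in T, g x)) := by
    refine tendsto_integral_of_dominated_convergence (fun x => |g x|) ?_ hg.abs ?_ ?_
    · exact fun n => (hi2 (χ n) (c1 n)).aestronglyMeasurable
    · intro n
      refine Eventually.of_forall fun x => ?_
      rw [norm_mul, Real.norm_eq_abs, abs_of_nonneg (c2 n x).1]
      exact mul_le_of_le_one_left (abs_nonneg _) (c2 n x).2
    · refine (ae_restrict_iff' hT.measurableSet).mpr (Eventually.of_forall fun x hx => ?_)
      have hxZ : x ∉ Z := fun h => by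
        have := h.1.2
        rw [hT.interior_eq] at this
        exact this hx
      simpa using (hχlim x hxZ).mul_const (g x)
  -- the exceptional set is negligible in the faces
  have l3 : Tendsto (fun n => ∑ i ∈ s, ∫ x in F i, χ n x * inner ℝ (ν i) (G x) ∂(surf d)) atTop
      (𝓝 (∑ i ∈ s, ∫ x in F i, inner ℝ (ν i) (G x) ∂(surf d))) := by
    refine tendsto_finsetSum s fun i hi => ?_
    have hi0 : IntegrableOn (fun x => inner ℝ (ν i) (G x)) (F i) (surf d) := by
      simpa using hi3 i hi (fun _ => 1) contDiff_const
    refine tendsto_integral_of_dominated_convergence (fun x => |inner ℝ (ν i) (G x)|) ?_ hi0.abs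
      ?_ ?_
    · exact fun n => (hi3 i hi (χ n) (c1 n)).aestronglyMeasurable
    · intro n
      refine Eventually.of_forall fun x => ?_
      rw [norm_mul, Real.norm_eq_abs, abs_of_nonneg (c2 n x).1]
      exact mul_le_of_le_one_left (abs_nonneg _) (c2 n x).2
    · have hZ0 : ∀ᵐ x ∂((surf d).restrict (F i)), x ∉ Z :=
        ae_restrict_of_ae (measure_eq_zero_iff_ae_notMem.mp hnull)
      filter_upwards [hZ0] with x hxZ
      simpa using (hχlim x hxZ).mul_const (inner ℝ (ν i) (G x))
  have l4 : Tendsto (fun n => ∫ x in T, (fderiv ℝ (χ n) x (G x) + χ n x * g x)) atTop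
      (𝓝 (∫ x in T, g x)) := by
    have e : (fun n => ∫ x in T, (fderiv ℝ (χ n) x (G x) + χ n x * g x)) =
        fun n => (∫ x in T, fderiv ℝ (χ n) x (G x)) + ∫ x in T, χ n x * g x := by
      ext n
      exact integral_add (hi1 _ (c1 n)) (hi2 _ (c1 n))
    rw [e]
    simpa using l1.add l2
  simp_rw [c6] at l4
  exact tendsto_nhds_unique l4 l3

end Divergence

/-! ### Polynomial functions -/

section Poly

variable {d m k : ℕ}

/-- The complex-valued function on `ℝ^d` defined by a polynomial. -/
def polyEval (d : ℕ) : MvPolynomial (Fin d) ℂ →ₗ[ℂ] (Rd d → ℂ) where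
  toFun p x := MvPolynomial.eval (fun i => (x i : ℂ)) p
  map_add' p q := by ext x; simp
  map_smul' c p := by ext x; simp [MvPolynomial.smul_eval]

theorem polyEval_apply (p : MvPolynomial (Fin d) ℂ) (x : Rd d) :
    polyEval d p x = MvPolynomial.eval (fun i => (x i : ℂ)) p := rfl

/-- The scalar polynomial functions of degree at most `k`. -/
def polyFun (d k : ℕ) : Submodule ℂ (Rd d → ℂ) :=
  (MvPolynomial.restrictTotalDegree (Fin d) ℂ k).map (polyEval d)

instance : Module.Finite ℂ (polyFun d k) := by
  unfold polyFun; infer_instance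

theorem mem_polyFun {f : Rd d → ℂ} :
    f ∈ polyFun d k ↔ ∃ p : MvPolynomial (Fin d) ℂ, p.totalDegree ≤ k ∧ polyEval d p = f := by
  simp [polyFun, Submodule.mem_map, MvPolynomial.mem_restrictTotalDegree]

theorem mem_polySpace {v : Rd d → Cm m} :
    v ∈ polySpace d m k ↔ ∀ j, (fun x => v x j) ∈ polyFun d k := by
  simp only [mem_polyFun]
  constructor
  · intro h j
    obtain ⟨p, hp, h⟩ := h j
    exact ⟨p, hp, by ext x; rw [polyEval_apply, h]⟩
  · intro h j
    obtain ⟨p, hp, h⟩ := h j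
    exact ⟨p, hp, fun x => by rw [← polyEval_apply, h]⟩

theorem contDiff_polyEval (p : MvPolynomial (Fin d) ℂ) : ContDiff ℝ ∞ (polyEval d p) := by
  have hcoord : ∀ i : Fin d, ContDiff ℝ ∞ (fun x : Rd d => ((x i : ℝ) : ℂ)) := fun i =>
    Complex.ofRealCLM.contDiff.comp (EuclideanSpace.proj (𝕜 := ℝ) i).contDiff
  induction p using MvPolynomial.induction_on with
  | C a =>
    have : polyEval d (MvPolynomial.C a) = fun _ => a := by ext x; simp [polyEval_apply]
    rw [this]; exact contDiff_const
  | add p q hp hq => rw [map_add]; exact hp.add hq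
  | mul_X p i hp =>
    have : polyEval d (p * MvPolynomial.X i) = fun x => polyEval d p x * ((x i : ℝ) : ℂ) := by
      ext x; simp [polyEval_apply]
    rw [this]; exact hp.mul (hcoord i)

theorem fderiv_polyEval (p : MvPolynomial (Fin d) ℂ) (x : Rd d) (i : Fin d) :
    fderiv ℝ (polyEval d p) x (EuclideanSpace.single i 1) =
      polyEval d (MvPolynomial.pderiv i p) x := by
  induction p using MvPolynomial.induction_on with
  | C a =>
    have : polyEval d (MvPolynomial.C a) = fun _ => a := by ext x; simp [polyEval_apply]
    rw [this]; simp [polyEval_apply]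
  | add p q hp hq =>
    rw [map_add, fderiv_add ((contDiff_polyEval p).differentiable (by simp) x)
      ((contDiff_polyEval q).differentiable (by simp) x), add_apply, hp, hq]
    simp
  | mul_X p j hp =>
    have h1 : polyEval d (p * MvPolynomial.X j) = fun x => polyEval d p x * ((x j : ℝ) : ℂ) := by
      ext x; simp [polyEval_apply]
    have h2 : HasFDerivAt (fun x : Rd d => ((x j : ℝ) : ℂ))
        (Complex.ofRealCLM.comp (EuclideanSpace.proj (𝕜 := ℝ) j)) x :=
      (Complex.ofRealCLM.comp (EuclideanSpace.proj (𝕜 := ℝ) j)).hasFDerivAt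
    rw [h1, fderiv_fun_mul ((contDiff_polyEval p).differentiable (by simp) x) h2.differentiableAt,
      h2.fderiv]
    simp only [add_apply, smul_apply, hp, smul_eq_mul, ContinuousLinearMap.comp_apply,
      Derivation.leibniz, MvPolynomial.pderiv_X, map_add, polyEval_apply, map_mul,
      MvPolynomial.eval_X, PiLp.proj_apply, Complex.ofRealCLM_apply]
    by_cases hij : i = j
    · subst hij; simp
    · have h3 : j ≠ i := fun h => hij h.symm
      simp [h3]

theorem totalDegree_pderiv_le (p : MvPolynomial (Fin d) ℂ) (i : Fin d) :
    (MvPolynomial.pderiv i p).totalDegree ≤ p.totalDegree := by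
  conv_lhs => rw [p.as_sum, map_sum]
  refine MvPolynomial.totalDegree_finsetSum_le fun s hs => ?_
  rw [MvPolynomial.pderiv_monomial]
  refine (MvPolynomial.totalDegree_monomial_le _ _).trans ?_
  refine le_trans ?_ (MvPolynomial.le_totalDegree hs)
  rw [Finsupp.sum_fintype _ _ (fun _ => rfl), Finsupp.sum_fintype _ _ (fun _ => rfl)]
  exact Finset.sum_le_sum fun j _ => by simp

theorem contDiff_of_mem_polyFun {f : Rd d → ℂ} (hf : f ∈ polyFun d k) : ContDiff ℝ ∞ f := by
  obtain ⟨p, -, rfl⟩ := mem_polyFun.mp hf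
  exact contDiff_polyEval p

theorem fderiv_mem_polyFun {f : Rd d → ℂ} (hf : f ∈ polyFun d k) (i : Fin d) :
    (fun x => fderiv ℝ f x (EuclideanSpace.single i 1)) ∈ polyFun d k := by
  obtain ⟨p, hp, rfl⟩ := mem_polyFun.mp hf
  exact mem_polyFun.mpr ⟨_, (totalDegree_pderiv_le p i).trans hp,
    by ext x; exact (fderiv_polyEval p x i).symm⟩

theorem comp_affine_mem_polyFun {f : Rd d → ℂ} (hf : f ∈ polyFun d k) (x₀ : Rd d) (h : ℝ) :
    (fun x => f (x₀ + h • x)) ∈ polyFun d k := by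
  obtain ⟨p, hp, rfl⟩ := mem_polyFun.mp hf
  set L : Fin d → MvPolynomial (Fin d) ℂ := fun i =>
    MvPolynomial.C (x₀ i : ℂ) + MvPolynomial.C (h : ℂ) * MvPolynomial.X i with hL
  have hLd : ∀ i, (L i).totalDegree ≤ 1 := by
    intro i
    refine (MvPolynomial.totalDegree_add _ _).trans (max_le (by simp) ?_)
    refine (MvPolynomial.totalDegree_mul _ _).trans ?_
    simp
  refine mem_polyFun.mpr ⟨MvPolynomial.bind₁ L p, ?_, ?_⟩
  · conv_lhs => rw [p.as_sum, map_sum]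
    refine MvPolynomial.totalDegree_finsetSum_le fun s hs => ?_
    rw [MvPolynomial.bind₁_monomial]
    refine (MvPolynomial.totalDegree_mul _ _).trans ?_
    rw [MvPolynomial.totalDegree_C, zero_add]
    refine (MvPolynomial.totalDegree_finsetProd _ _).trans ?_
    refine le_trans ?_ ((MvPolynomial.le_totalDegree hs).trans hp)
    rw [Finsupp.sum]
    refine Finset.sum_le_sum fun i _ => (MvPolynomial.totalDegree_pow _ _).trans ?_
    exact (Nat.mul_le_mul_left _ (hLd i)).trans (by simp)
  · ext x
    simp only [polyEval_apply]
    rw [← MvPolynomial.aeval_eq_eval, ← MvPolynomial.aeval_eq_eval, MvPolynomial.aeval_bind₁]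
    congr 1
    congr 1
    ext i
    simp [hL]

/-- A polynomial vanishing on a nonempty open set vanishes. -/
theorem eq_zero_of_mem_polyFun {f : Rd d → ℂ} (hf : f ∈ polyFun d k) {U : Set (Rd d)}
    (hU : IsOpen U) {x₀ : Rd d} (hx : x₀ ∈ U) (h0 : ∀ x ∈ U, f x = 0) : f = 0 := by
  obtain ⟨p, -, rfl⟩ := mem_polyFun.mp hf
  have hU' : (WithLp.toLp 2 : (Fin d → ℝ) → Rd d) ⁻¹' U ∈ 𝓝 (WithLp.ofLp x₀) :=
    (hU.preimage (PiLp.continuous_toLp 2 _)).mem_nhds hx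
  obtain ⟨δ, hδ, hball⟩ := Metric.mem_nhds_iff.mp hU'
  have hp : p = 0 := by
    refine MvPolynomial.funext_set (fun i => Complex.ofReal '' Metric.ball (x₀ i) δ) ?_ ?_
    · intro i
      refine Set.Infinite.image Complex.ofReal_injective.injOn ?_
      rw [Real.ball_eq_Ioo]
      exact Ioo_infinite (by linarith)
    · intro y hy
      have hy' : ∀ i, ∃ t ∈ Metric.ball (x₀ i) δ, (t : ℂ) = y i := fun i => hy i (mem_univ i)
      choose t ht hty using hy'
      have h1 : t ∈ Metric.ball (WithLp.ofLp x₀) δ := by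
        rw [Metric.mem_ball, dist_pi_lt_iff hδ]
        exact ht
      have h2 := h0 _ (hball h1)
      rw [polyEval_apply] at h2
      have h3 : (fun i => ((WithLp.toLp 2 t : Rd d) i : ℂ)) = y := by
        ext i; exact hty i
      rw [h3] at h2
      simpa using h2
  rw [hp, map_zero]

/-- On polynomials of bounded degree, the maximum norm on the unit ball of a linear expression in
the polynomial is controlled by the `L²` norm on a smaller ball: all norms on a finite-dimensional
space are equivalent. -/
theorem exists_reference_bound {r : ℝ} (hr : 0 < r) (D : polyFun d k →ₗ[ℂ] (Rd d → ℂ))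
    (hD : ∀ f, Continuous (D f)) : ∃ C : ℝ, 0 < C ∧
    ∀ f : polyFun d k, ∀ y ∈ Metric.closedBall (0 : Rd d) 1,
      ‖D f y‖ ^ 2 ≤ C * ∫ x in Metric.closedBall (0 : Rd d) r, ‖(f : Rd d → ℂ) x‖ ^ 2 := by
  let b := Module.finBasis ℂ (polyFun d k)
  set n := Module.finrank ℂ (polyFun d k) with hn
  -- the polynomial with coordinates `c`, and its squared norm `Q c` on the small ball
  set Φ : (Fin n → ℂ) → Rd d → ℂ := fun c x => ∑ j, c j * (b j : Rd d → ℂ) x with hΦ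
  have hbc : ∀ j, Continuous (b j : Rd d → ℂ) := fun j =>
    (contDiff_of_mem_polyFun (b j).2).continuous
  have hΦc : Continuous fun q : (Fin n → ℂ) × Rd d => Φ q.1 q.2 := by
    refine continuous_finsetSum _ fun j _ => ?_
    exact ((continuous_apply j).comp continuous_fst).mul ((hbc j).comp continuous_snd)
  have hΦb : ∀ c : Fin n → ℂ, Φ c = ((∑ j, c j • b j : polyFun d k) : Rd d → ℂ) := by
    intro c
    ext x
    simp [hΦ]
  set Q : (Fin n → ℂ) → ℝ := fun c => ∫ x in Metric.closedBall (0 : Rd d) r, ‖Φ c x‖ ^ 2 with hQ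
  have hQc : Continuous Q :=
    continuous_parametric_integral_of_continuous (by fun_prop) (isCompact_closedBall _ _)
  have hΦcc : ∀ c, Continuous (Φ c) := fun c => hΦc.comp (Continuous.prodMk_right c)
  -- `Q` is definite: a polynomial vanishing on a ball vanishes
  have hQpos : ∀ c, c ≠ 0 → 0 < Q c := by
    intro c hc
    refine lt_of_le_of_ne (integral_nonneg fun _ => by positivity) fun h => hc ?_
    have hint : IntegrableOn (fun x => ‖Φ c x‖ ^ 2) (Metric.closedBall (0 : Rd d) r) :=
      (((hΦcc c).norm.pow 2).continuousOn).integrableOn_compact (isCompact_closedBall _ _)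
    have h0 := (integral_eq_zero_iff_of_nonneg (fun x => by positivity) hint).mp h.symm
    have h1 := Measure.eqOn_open_of_ae_eq (μ := volume) (U := Metric.ball (0 : Rd d) r)
      (f := fun x => ‖Φ c x‖ ^ 2) (g := fun _ => (0 : ℝ))
      (ae_restrict_of_ae_restrict_of_subset Metric.ball_subset_closedBall h0) Metric.isOpen_ball
      ((hΦcc c).norm.pow 2).continuousOn continuousOn_const
    have h2 : Φ c = 0 := by
      refine eq_zero_of_mem_polyFun (k := k) (U := Metric.ball (0 : Rd d) r) (x₀ := 0)
        (by rw [hΦb]; exact Submodule.coe_mem _) Metric.isOpen_ball (Metric.mem_ball_self hr)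
        fun x hx => ?_
      have := h1 hx
      simpa using this
    rw [hΦb] at h2
    have h3 : ∑ j, c j • b j = 0 := Subtype.ext h2
    ext j
    exact Fintype.linearIndependent_iff.mp b.linearIndependent c h3 j
  have hB : ∀ j, ∃ B, ∀ y ∈ Metric.closedBall (0 : Rd d) 1, ‖D (b j) y‖ ≤ B := fun j =>
    (isCompact_closedBall (0 : Rd d) 1).exists_bound_of_continuousOn (hD (b j)).continuousOn
  choose B hB using hB
  have hB0 : ∀ j, 0 ≤ B j := fun j =>
    (norm_nonneg _).trans (hB j 0 (Metric.mem_closedBall_self zero_le_one))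
  -- by compactness of the unit sphere and homogeneity, `Q` controls the squared norm of `c`
  have hQm : ∃ μ > 0, ∀ c, μ * ‖c‖ ^ 2 ≤ Q c := by
    by_cases hne : (Metric.sphere (0 : Fin n → ℂ) 1).Nonempty
    · obtain ⟨c₀, hc₀, hmin⟩ := (isCompact_sphere (0 : Fin n → ℂ) 1).exists_isMinOn hne
        hQc.continuousOn
      have hc₀' : c₀ ≠ 0 := by
        rintro rfl
        simp at hc₀
      refine ⟨Q c₀, hQpos c₀ hc₀', fun c => ?_⟩
      by_cases hc : c = 0
      · subst hc
        simp only [norm_zero, ne_eq, OfNat.ofNat_ne_zero, not_false_eq_true, zero_pow, mul_zero]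
        exact integral_nonneg fun _ => by positivity
      have hcn : 0 < ‖c‖ := norm_pos_iff.mpr hc
      have h1 : Q c₀ ≤ Q (((‖c‖⁻¹ : ℝ) : ℂ) • c) := by
        refine hmin ?_
        rw [mem_sphere_zero_iff_norm, norm_smul, Complex.norm_real, norm_inv, norm_norm,
          inv_mul_cancel₀ hcn.ne']
      have h2 : Q (((‖c‖⁻¹ : ℝ) : ℂ) • c) = (‖c‖⁻¹) ^ 2 * Q c := by
        rw [hQ]
        simp only
        rw [← integral_const_mul]
        congr 1
        ext x
        have : Φ (((‖c‖⁻¹ : ℝ) : ℂ) • c) x = ((‖c‖⁻¹ : ℝ) : ℂ) * Φ c x := by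
          simp [hΦ, Finset.mul_sum, mul_assoc]
        rw [this, norm_mul, Complex.norm_real, norm_inv, norm_norm, mul_pow]
      rw [h2] at h1
      calc Q c₀ * ‖c‖ ^ 2 ≤ (‖c‖⁻¹) ^ 2 * Q c * ‖c‖ ^ 2 := by gcongr
        _ = Q c := by field_simp
    · refine ⟨1, one_pos, fun c => ?_⟩
      have : c = 0 := by
        by_contra hc
        have hcn : 0 < ‖c‖ := norm_pos_iff.mpr hc
        refine hne ⟨((‖c‖⁻¹ : ℝ) : ℂ) • c, ?_⟩
        rw [mem_sphere_zero_iff_norm, norm_smul, Complex.norm_real, norm_inv, norm_norm,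
          inv_mul_cancel₀ hcn.ne']
      subst this
      simp only [norm_zero, ne_eq, OfNat.ofNat_ne_zero, not_false_eq_true, zero_pow, mul_zero]
      exact integral_nonneg fun _ => by positivity
  obtain ⟨μ, hμ, hQμ⟩ := hQm
  refine ⟨((∑ j, B j) ^ 2 + 1) / μ, by positivity, fun f y hy => ?_⟩
  -- `D f` depends linearly on the coordinates of `f`
  set c : Fin n → ℂ := fun j => b.repr f j with hc
  have hfb : ∑ j, c j • b j = f := b.sum_repr f
  have h1 : ‖D f y‖ ≤ ‖c‖ * ∑ j, B j := by
    rw [← hfb, map_sum, Finset.sum_apply, Finset.mul_sum]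
    refine (norm_sum_le _ _).trans (Finset.sum_le_sum fun j _ => ?_)
    rw [map_smul, Pi.smul_apply, norm_smul]
    exact mul_le_mul (norm_le_pi_norm c j) (hB j y hy) (norm_nonneg _) (norm_nonneg _)
  have h2 := hQμ c
  have h3 : Q c = ∫ x in Metric.closedBall (0 : Rd d) r, ‖(f : Rd d → ℂ) x‖ ^ 2 := by
    rw [hQ, ← hfb, ← hΦb]
  rw [← h3]
  calc ‖D f y‖ ^ 2 ≤ (‖c‖ * ∑ j, B j) ^ 2 := by gcongr
    _ ≤ ((∑ j, B j) ^ 2 + 1) * ‖c‖ ^ 2 := by nlinarith [sq_nonneg ‖c‖]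
    _ ≤ ((∑ j, B j) ^ 2 + 1) * (Q c / μ) := by
        have : ‖c‖ ^ 2 ≤ Q c / μ := by rw [le_div_iff₀ hμ]; linarith
        gcongr
    _ = ((∑ j, B j) ^ 2 + 1) / μ * Q c := by ring

/-- The partial derivative of a polynomial function. -/
def polyPartial (d k : ℕ) (i : Fin d) : polyFun d k →ₗ[ℂ] (Rd d → ℂ) where
  toFun f x := fderiv ℝ (f : Rd d → ℂ) x (EuclideanSpace.single i 1)
  map_add' f g := by
    ext x
    simp only [Submodule.coe_add, Pi.add_apply]
    rw [fderiv_add ((contDiff_of_mem_polyFun f.2).differentiable (by simp) x)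
      ((contDiff_of_mem_polyFun g.2).differentiable (by simp) x), add_apply]
  map_smul' c f := by
    ext x
    simp only [Submodule.coe_smul, RingHom.id_apply, Pi.smul_apply]
    rw [fderiv_const_smul ((contDiff_of_mem_polyFun f.2).differentiable (by simp) x), smul_apply]

theorem continuous_fderiv_apply_single {f : Rd d → ℂ} (hf : f ∈ polyFun d k) (i : Fin d) :
    Continuous fun x => fderiv ℝ f x (EuclideanSpace.single i 1) :=
  (contDiff_of_mem_polyFun (fderiv_mem_polyFun hf i)).continuous

theorem integral_closedBall_scale (f : Rd d → ℝ) (x₀ : Rd d) {h : ℝ} (hh : 0 < h) (r : ℝ) :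
    h ^ d * ∫ x in Metric.closedBall (0 : Rd d) r, f (x₀ + h • x) =
      ∫ x in Metric.closedBall x₀ (r * h), f x := by
  rw [← integral_indicator Metric.isClosed_closedBall.measurableSet,
    ← integral_indicator Metric.isClosed_closedBall.measurableSet]
  have h1 : ∀ x, (Metric.closedBall (0 : Rd d) r).indicator (fun x => f (x₀ + h • x)) x =
      (fun z => (Metric.closedBall x₀ (r * h)).indicator f (x₀ + z)) (h • x) := by
    intro x
    have : x ∈ Metric.closedBall (0 : Rd d) r ↔ x₀ + h • x ∈ Metric.closedBall x₀ (r * h) := by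
      rw [mem_closedBall_zero_iff, mem_closedBall_iff_norm, add_sub_cancel_left, norm_smul,
        Real.norm_eq_abs, abs_of_pos hh, mul_comm r, mul_le_mul_iff_right₀ hh]
    by_cases hx : x ∈ Metric.closedBall (0 : Rd d) r
    · simp only
      rw [indicator_of_mem hx, indicator_of_mem (this.mp hx)]
    · simp only
      rw [indicator_of_notMem hx, indicator_of_notMem (fun h' => hx (this.mpr h'))]
  simp_rw [h1]
  rw [Measure.integral_comp_smul_of_nonneg volume
      (fun z => (Metric.closedBall x₀ (r * h)).indicator f (x₀ + z)) h (hR := hh.le),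
    integral_add_left_eq_self (fun z => (Metric.closedBall x₀ (r * h)).indicator f z),
    finrank_euclideanSpace, Fintype.card_fin, smul_eq_mul, ← mul_assoc,
    mul_inv_cancel₀ (by positivity), one_mul]

theorem contDiff_of_mem_polySpace {v : Rd d → Cm m} (hv : v ∈ polySpace d m k) :
    ContDiff ℝ ∞ v :=
  (contDiff_piLp 2).mpr fun j => contDiff_of_mem_polyFun (mem_polySpace.mp hv j)

theorem fderiv_coord {v : Rd d → Cm m} (hv : ContDiff ℝ ∞ v) (x e : Rd d) (j : Fin m) :
    (fderiv ℝ v x e) j = fderiv ℝ (fun x => v x j) x e := by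
  have h1 := (hv.differentiable (by simp) x).hasFDerivAt
  have h2 :=
    ((EuclideanSpace.proj (𝕜 := ℂ) j : Cm m →L[ℂ] ℂ).restrictScalars ℝ).hasFDerivAt.comp x h1
  have h3 : HasFDerivAt (fun x => v x j) _ x := h2
  rw [h3.fderiv]
  rfl

theorem fderiv_mem_polySpace {v : Rd d → Cm m} (hv : v ∈ polySpace d m k) (i : Fin d) :
    (fun x => fderiv ℝ v x (EuclideanSpace.single i 1)) ∈ polySpace d m k := by
  refine mem_polySpace.mpr fun j => ?_
  have := fderiv_mem_polyFun (mem_polySpace.mp hv j) i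
  simpa only [fderiv_coord (contDiff_of_mem_polySpace hv)] using this

/-- Inverse inequalities on balls, uniform in the centre, in the radius and in the number of
components. -/
theorem exists_ball_bounds (d k : ℕ) {ϱ : ℝ} (hϱ : 0 < ϱ) : ∃ C : ℝ, 0 < C ∧
    ∀ (m : ℕ), ∀ v ∈ polySpace d m k, ∀ (x₀ : Rd d) (h : ℝ), 0 < h →
      ∀ y ∈ Metric.closedBall x₀ h,
        h ^ d * ‖v y‖ ^ 2 ≤ C * ∫ x in Metric.closedBall x₀ (ϱ * h), ‖v x‖ ^ 2 ∧
        ∀ i, h ^ d * (h ^ 2 * ‖fderiv ℝ v y (EuclideanSpace.single i 1)‖ ^ 2) ≤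
          C * ∫ x in Metric.closedBall x₀ (ϱ * h), ‖v x‖ ^ 2 := by
  obtain ⟨C₀, hC₀, h₀⟩ := exists_reference_bound hϱ (polyFun d k).subtype
    (fun f => (contDiff_of_mem_polyFun f.2).continuous)
  choose C₁ hC₁ h₁ using fun i => exists_reference_bound hϱ (polyPartial d k i)
    (fun f => continuous_fderiv_apply_single f.2 i)
  have hCs : ∀ i, C₁ i ≤ C₀ + ∑ i, C₁ i := fun i =>
    (Finset.single_le_sum (fun i _ => (hC₁ i).le) (Finset.mem_univ i)).trans (by linarith)
  have hC0 : C₀ ≤ C₀ + ∑ i, C₁ i :=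
    le_add_of_nonneg_right (Finset.sum_nonneg fun i _ => (hC₁ i).le)
  refine ⟨C₀ + ∑ i, C₁ i, by linarith, ?_⟩
  intro m v hv x₀ h hh y hy
  -- the pulled back components
  set g : Fin m → polyFun d k := fun j =>
    ⟨fun x => v (x₀ + h • x) j, comp_affine_mem_polyFun (mem_polySpace.mp hv j) x₀ h⟩ with hg
  set z : Rd d := h⁻¹ • (y - x₀) with hz
  have hyz : y = x₀ + h • z := by
    rw [hz, smul_smul, mul_inv_cancel₀ hh.ne', one_smul, add_sub_cancel]
  have hzB : z ∈ Metric.closedBall (0 : Rd d) 1 := by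
    rw [mem_closedBall_zero_iff, hz, norm_smul, norm_inv, Real.norm_eq_abs, abs_of_pos hh,
      inv_mul_eq_div, div_le_one₀ hh]
    exact mem_closedBall_iff_norm.mp hy
  have hvc : Continuous v := (contDiff_of_mem_polySpace hv).continuous
  -- the reference bound is applied to each component, so that the constant does not depend on `m`
  have hI : ∑ j, h ^ d * ∫ x in Metric.closedBall (0 : Rd d) ϱ, ‖(g j : Rd d → ℂ) x‖ ^ 2 =
      ∫ x in Metric.closedBall x₀ (ϱ * h), ‖v x‖ ^ 2 := by
    have e1 : ∀ j, h ^ d * ∫ x in Metric.closedBall (0 : Rd d) ϱ, ‖(g j : Rd d → ℂ) x‖ ^ 2 =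
        ∫ x in Metric.closedBall x₀ (ϱ * h), ‖v x j‖ ^ 2 := fun j =>
      integral_closedBall_scale (fun x => ‖v x j‖ ^ 2) x₀ hh ϱ
    rw [Finset.sum_congr rfl fun j _ => e1 j, ← integral_finsetSum]
    · congr 1
      ext x
      rw [EuclideanSpace.norm_sq_eq]
    · intro j _
      have : Continuous fun x => ‖v x j‖ ^ 2 := by fun_prop
      exact this.continuousOn.integrableOn_compact (isCompact_closedBall _ _)
  rw [← hI]
  constructor
  · rw [EuclideanSpace.norm_sq_eq, Finset.mul_sum, Finset.mul_sum]
    refine Finset.sum_le_sum fun j _ => ?_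
    have e2 := h₀ (g j) z hzB
    have e3 : (polyFun d k).subtype (g j) z = v y j := by rw [hyz]; rfl
    rw [e3] at e2
    have e4 : 0 ≤ ∫ x in Metric.closedBall (0 : Rd d) ϱ, ‖(g j : Rd d → ℂ) x‖ ^ 2 :=
      integral_nonneg fun _ => by positivity
    calc h ^ d * ‖v y j‖ ^ 2 ≤ h ^ d * ((C₀ + ∑ i, C₁ i) *
          ∫ x in Metric.closedBall (0 : Rd d) ϱ, ‖(g j : Rd d → ℂ) x‖ ^ 2) := by
          gcongr
          exact e2.trans (by gcongr)
      _ = _ := by ring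
  · intro i
    rw [EuclideanSpace.norm_sq_eq, Finset.mul_sum, Finset.mul_sum, Finset.mul_sum]
    refine Finset.sum_le_sum fun j _ => ?_
    have e2 := h₁ i (g j) z hzB
    have e3 : polyPartial d k i (g j) z =
        (h : ℂ) * (fderiv ℝ v y (EuclideanSpace.single i 1)) j := by
      rw [fderiv_coord (contDiff_of_mem_polySpace hv)]
      change fderiv ℝ (fun x => v (x₀ + h • x) j) z (EuclideanSpace.single i 1) = _
      have f1 : HasFDerivAt (fun x : Rd d => x₀ + h • x) (h • ContinuousLinearMap.id ℝ (Rd d)) z :=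
        ((hasFDerivAt_id z).const_smul h).const_add x₀
      have f2 : HasFDerivAt (fun x => v x j) (fderiv ℝ (fun x => v x j) y) (x₀ + h • z) := by
        rw [← hyz]
        exact ((contDiff_of_mem_polyFun (mem_polySpace.mp hv j)).differentiable
          (by simp) y).hasFDerivAt
      have f3 := f2.comp z f1
      rw [HasFDerivAt.fderiv (f := fun x => v (x₀ + h • x) j) f3]
      simp
    rw [e3, norm_mul, Complex.norm_real, Real.norm_eq_abs, abs_of_pos hh, mul_pow] at e2
    have e4 : 0 ≤ ∫ x in Metric.closedBall (0 : Rd d) ϱ, ‖(g j : Rd d → ℂ) x‖ ^ 2 :=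
      integral_nonneg fun _ => by positivity
    calc h ^ d * (h ^ 2 * ‖(fderiv ℝ v y (EuclideanSpace.single i 1)) j‖ ^ 2)
        ≤ h ^ d * ((C₀ + ∑ i, C₁ i) *
          ∫ x in Metric.closedBall (0 : Rd d) ϱ, ‖(g j : Rd d → ℂ) x‖ ^ 2) := by
          refine mul_le_mul_of_nonneg_left ?_ (by positivity)
          exact e2.trans (mul_le_mul_of_nonneg_right (hCs i) e4)
      _ = _ := by ring

end Poly

/-! ### Geometry of polytopal meshes -/

section Mesh

variable {d : ℕ} {Ω : Set (Rd d)}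

theorem IsPolytopal.exists_compact {P : Set (Rd d)} (h : IsPolytopal P) :
    ∃ K, IsCompact K ∧ P = interior K := by
  obtain ⟨S, hS, rfl⟩ := h
  exact ⟨_, hS.isCompact_biUnion fun s _ => (Set.finite_range s.points).isCompact_convexHull ℝ, rfl⟩

theorem IsPolytopal.isOpen {P : Set (Rd d)} (h : IsPolytopal P) : IsOpen P := by
  obtain ⟨K, -, rfl⟩ := h.exists_compact
  exact isOpen_interior

theorem IsPolytopal.isBounded {P : Set (Rd d)} (h : IsPolytopal P) : Bornology.IsBounded P := by
  obtain ⟨K, hK, rfl⟩ := h.exists_compact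
  exact hK.isBounded.subset interior_subset

theorem IsPolytopal.interior_closure {P : Set (Rd d)} (h : IsPolytopal P) :
    interior (closure P) = P := by
  obtain ⟨K, hK, rfl⟩ := h.exists_compact
  refine subset_antisymm (interior_mono (closure_minimal interior_subset hK.isClosed)) ?_
  exact interior_maximal subset_closure isOpen_interior

theorem IsPolytopalDomain.volume_pos (h : IsPolytopalDomain Ω) : 0 < volume Ω :=
  h.1.isOpen.measure_pos _ h.2.nonempty

theorem IsPolytopalDomain.volume_lt_top (h : IsPolytopalDomain Ω) : volume Ω < ⊤ :=
  h.1.isBounded.measure_lt_top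

namespace PolytopalMesh

variable (ℳ : PolytopalMesh d Ω)

theorem cell_isOpen (T : ℳ.cells) : IsOpen (T : Set (Rd d)) := (ℳ.cell_polytopal T T.2).isOpen

theorem cell_isBounded (T : ℳ.cells) : Bornology.IsBounded (T : Set (Rd d)) :=
  (ℳ.cell_polytopal T T.2).isBounded

theorem cell_volume_lt_top (T : ℳ.cells) : volume (T : Set (Rd d)) < ⊤ :=
  (ℳ.cell_isBounded T).measure_lt_top

theorem closure_cell_subset (T : ℳ.cells) : closure (T : Set (Rd d)) ⊆ closure Ω := by
  rw [ℳ.cells_cover]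
  exact subset_biUnion_of_mem (u := fun T : Set (Rd d) => closure T) T.2

theorem cell_subset (hΩ : IsPolytopal Ω) (T : ℳ.cells) : (T : Set (Rd d)) ⊆ Ω := by
  have h := interior_maximal (subset_closure.trans (ℳ.closure_cell_subset T)) (ℳ.cell_isOpen T)
  exact h.trans hΩ.interior_closure.subset

theorem cells_disj {T₁ T₂ : ℳ.cells} (h : T₁ ≠ T₂) :
    Disjoint (T₁ : Set (Rd d)) (T₂ : Set (Rd d)) :=
  ℳ.cells_disjoint _ T₁.2 _ T₂.2 fun h' => h (Subtype.ext h')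

theorem mem_cellFaces {T : ℳ.cells} {F : ℳ.faces} :
    F ∈ ℳ.cellFaces T ↔ (F : Set (Rd d)) ⊆ frontier (T : Set (Rd d)) := by
  simp [cellFaces]

theorem mem_bdryFaces {F : ℳ.faces} : F ∈ ℳ.bdryFaces ↔ (F : Set (Rd d)) ⊆ frontier Ω := by
  simp [bdryFaces]

theorem exists_cell_of_face (F : ℳ.faces) : ∃ T, F ∈ ℳ.cellFaces T := by
  rcases ℳ.face_dichotomy F F.2 with ⟨T₁, h₁, T₂, -, -, h⟩ | ⟨T, h₁, h⟩
  · exact ⟨⟨T₁, h₁⟩, ℳ.mem_cellFaces.mpr (h.trans inter_subset_left)⟩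
  · exact ⟨⟨T, h₁⟩, ℳ.mem_cellFaces.mpr (h.trans inter_subset_left)⟩

theorem face_isFlatPiece (F : ℳ.faces) : IsFlatPiece (F : Set (Rd d)) (ℳ.normal F) := by
  refine ⟨ℳ.normal_unit F, ?_, ℳ.face_planar F⟩
  obtain ⟨T, hT⟩ := ℳ.exists_cell_of_face F
  exact (ℳ.cell_isBounded T).closure.subset
    ((ℳ.mem_cellFaces.mp hT).trans frontier_subset_closure)

theorem face_measurableSet (F : ℳ.faces) : MeasurableSet (F : Set (Rd d)) :=
  (ℳ.face_isFlatPiece F).measurableSet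

theorem surf_face_lt_top (F : ℳ.faces) : surf d (F : Set (Rd d)) < ⊤ :=
  (ℳ.face_isFlatPiece F).surf_lt_top

/-- A nonempty relatively open subset of a face has positive surface measure. -/
theorem surf_face_inter_pos (F : ℳ.faces) {V : Set (Rd d)} (hV : IsOpen V)
    {x : Rd d} (hxF : x ∈ (F : Set (Rd d))) (hxV : x ∈ V) :
    0 < surf d ((F : Set (Rd d)) ∩ V) := by
  obtain ⟨c, U, hU, hF⟩ := ℳ.face_planar F
  rw [hF] at hxF ⊢
  have h1 := surf_plane_pos (ℳ.normal_unit F) (hU.inter hV) ⟨hxF.1, hxV⟩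
  have h2 : inner ℝ (ℳ.normal F) x = c := hxF.2
  rw [h2] at h1
  rwa [inter_right_comm]

theorem surf_face_pos (F : ℳ.faces) : 0 < surf d (F : Set (Rd d)) := by
  obtain ⟨x, hx⟩ := (ℳ.face_connected F F.2).nonempty
  simpa using ℳ.surf_face_inter_pos F isOpen_univ hx (mem_univ x)

theorem exists_mem_face_of_ae (F : ℳ.faces) {p : Rd d → Prop}
    (h : ∀ᵐ x ∂((surf d).restrict (F : Set (Rd d))), p x) : ∃ x ∈ (F : Set (Rd d)), p x := by
  have h1 := (ae_restrict_iff' (ℳ.face_measurableSet F)).mp h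
  by_contra! hcon
  have h2 : ∀ᵐ x ∂(surf d), x ∉ (F : Set (Rd d)) := by
    filter_upwards [h1] with x hx hxF using hcon x hxF (hx hxF)
  exact (ℳ.surf_face_pos F).ne' (measure_eq_zero_iff_ae_notMem.mpr h2)

theorem orient_eq_or (T : ℳ.cells) (F : ℳ.faces) : ℳ.orient T F = 1 ∨ ℳ.orient T F = -1 := by
  unfold orient
  split_ifs
  · exact Or.inl rfl
  · exact Or.inr rfl

theorem pointsOut_orient {T : ℳ.cells} {F : ℳ.faces} (h : F ∈ ℳ.cellFaces T) :
    PointsOut (T : Set (Rd d)) F (ℳ.orient T F • ℳ.normal F) := by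
  unfold orient
  split_ifs with h1
  · rwa [one_smul]
  · rw [neg_one_smul]
    exact (ℳ.oriented T T.2 F (ℳ.mem_cellFaces.mp h)).resolve_left h1

end PolytopalMesh

/-- Two disjoint sets cannot have the same outward normal at a point. -/
theorem IsOutwardNormal.not_disjoint {P Q : Set (Rd d)} {x ν : Rd d} (hP : IsOutwardNormal P x ν)
    (hQ : IsOutwardNormal Q x ν) : ¬ Disjoint P Q := by
  obtain ⟨hν, ε₁, h₁, hP⟩ := hP
  obtain ⟨-, ε₂, h₂, hQ⟩ := hQ
  have hε : 0 < min ε₁ ε₂ := lt_min h₁ h₂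
  set y := x - (min ε₁ ε₂ / 2) • ν with hy
  have hyx : y - x = -((min ε₁ ε₂ / 2) • ν) := by rw [hy]; abel
  have hin : inner ℝ ν (y - x) < 0 := by
    rw [hyx, inner_neg_right, inner_smul_right, real_inner_self_eq_norm_sq, hν]
    linarith
  have hd : dist y x < min ε₁ ε₂ := by
    rw [dist_eq_norm, hyx, norm_neg, norm_smul, hν, Real.norm_eq_abs, abs_of_pos (half_pos hε)]
    linarith
  exact fun hdis => disjoint_left.mp hdis
    ((hP y (hd.trans_le (min_le_left _ _))).mpr hin)
    ((hQ y (hd.trans_le (min_le_right _ _))).mpr hin)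

/-- If `P` and `Q` have the same outward normal at `x`, then a subset of `Q` disjoint from `P` stays
away from `x`. -/
theorem notMem_closure_of_same_normal {P Q T : Set (Rd d)} {x ν : Rd d}
    (hP : IsOutwardNormal P x ν) (hQ : IsOutwardNormal Q x ν) (hTQ : T ⊆ Q)
    (hTP : Disjoint T P) : x ∉ closure T := by
  obtain ⟨-, ε₁, h₁, hP⟩ := hP
  obtain ⟨-, ε₂, h₂, hQ⟩ := hQ
  intro hx
  obtain ⟨y, hy, hyT⟩ := mem_closure_iff.mp hx _
    (Metric.isOpen_ball (x := x) (ε := min ε₁ ε₂)) (Metric.mem_ball_self (lt_min h₁ h₂))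
  exact disjoint_left.mp hTP hyT ((hP y (Metric.ball_subset_ball (min_le_left _ _) hy)).mpr
    ((hQ y (Metric.ball_subset_ball (min_le_right _ _) hy)).mp (hTQ hyT)))

/-- An open set disjoint from two sets with opposite outward normals at `x` stays away from `x`. -/
theorem notMem_closure_of_opposite_normal {P Q T : Set (Rd d)} {x ν : Rd d}
    (hP : IsOutwardNormal P x ν) (hQ : IsOutwardNormal Q x (-ν)) (hT : IsOpen T)
    (hTP : Disjoint T P) (hTQ : Disjoint T Q) : x ∉ closure T := by
  obtain ⟨hν, ε₁, h₁, hP⟩ := hP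
  obtain ⟨-, ε₂, h₂, hQ⟩ := hQ
  intro hx
  obtain ⟨y, hy, hyT⟩ := mem_closure_iff.mp hx _
    (Metric.isOpen_ball (x := x) (ε := min ε₁ ε₂)) (Metric.mem_ball_self (lt_min h₁ h₂))
  -- a generic point of the open set near `y` lies off the common hyperplane
  have hW : IsOpen (T ∩ Metric.ball x (min ε₁ ε₂)) := hT.inter Metric.isOpen_ball
  have ht : Tendsto (fun s : ℝ => y + s • ν) (𝓝[>] 0) (𝓝 y) := by
    have : Tendsto (fun s : ℝ => y + s • ν) (𝓝 0) (𝓝 (y + (0 : ℝ) • ν)) :=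
      Continuous.tendsto (by fun_prop) 0
    rw [zero_smul, add_zero] at this
    exact this.mono_left nhdsWithin_le_nhds
  have hoff : ∃ z ∈ T ∩ Metric.ball x (min ε₁ ε₂), inner ℝ ν (z - x) ≠ 0 := by
    by_cases h0 : inner ℝ ν (y - x) = 0
    · have e1 : ∀ᶠ s in 𝓝[>] (0 : ℝ), y + s • ν ∈ T ∩ Metric.ball x (min ε₁ ε₂) :=
        ht (hW.mem_nhds ⟨hyT, hy⟩)
      have e2 : ∀ᶠ s in 𝓝[>] (0 : ℝ), (0 : ℝ) < s := self_mem_nhdsWithin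
      obtain ⟨s, hs, hs0⟩ := (e1.and e2).exists
      refine ⟨_, hs, ?_⟩
      rw [add_sub_right_comm, inner_add_right, h0, inner_smul_right, real_inner_self_eq_norm_sq, hν]
      simpa using hs0.ne'
    · exact ⟨y, ⟨hyT, hy⟩, h0⟩
  obtain ⟨z, ⟨hzT, hz⟩, h0⟩ := hoff
  rcases lt_or_gt_of_ne h0 with h | h
  · exact disjoint_left.mp hTP hzT ((hP z (Metric.ball_subset_ball (min_le_left _ _) hz)).mpr h)
  · refine disjoint_left.mp hTQ hzT ((hQ z (Metric.ball_subset_ball (min_le_right _ _) hz)).mpr ?_)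
    rw [inner_neg_left]
    linarith

namespace PolytopalMesh

variable (ℳ : PolytopalMesh d Ω)

/-- A face is seen with opposite orientations by two distinct elements. -/
theorem orient_neg {T₁ T₂ : ℳ.cells} {F : ℳ.faces} (h₁ : F ∈ ℳ.cellFaces T₁)
    (h₂ : F ∈ ℳ.cellFaces T₂) (hne : T₁ ≠ T₂) : ℳ.orient T₂ F = -ℳ.orient T₁ F := by
  have hne' : ℳ.orient T₁ F ≠ ℳ.orient T₂ F := by
    intro h
    obtain ⟨x, -, h3, h4⟩ := ℳ.exists_mem_face_of_ae F
      ((ℳ.pointsOut_orient h₁).and (ℳ.pointsOut_orient h₂))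
    rw [← h] at h4
    exact h3.not_disjoint h4 (ℳ.cells_disj hne)
  rcases ℳ.orient_eq_or T₁ F with h | h <;> rcases ℳ.orient_eq_or T₂ F with h' | h' <;>
    simp_all

theorem orient_bdry (hΩ : IsPolytopal Ω) {T : ℳ.cells} {F : ℳ.faces} (h : F ∈ ℳ.cellFaces T)
    (hb : F ∈ ℳ.bdryFaces) : ℳ.orient T F = 1 := by
  refine (ℳ.orient_eq_or T F).resolve_right fun h1 => ?_
  obtain ⟨x, -, h3, h4⟩ := ℳ.exists_mem_face_of_ae F
    ((ℳ.pointsOut_orient h).and (ℳ.boundary_normal F (ℳ.mem_bdryFaces.mp hb)))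
  rw [h1, neg_one_smul] at h3
  obtain ⟨hν, ε₁, h₁, hP⟩ := h3
  obtain ⟨-, ε₂, h₂, hQ⟩ := h4
  have hε : 0 < min ε₁ ε₂ := lt_min h₁ h₂
  rw [norm_neg] at hν
  set ν := ℳ.normal F
  set y := x + (min ε₁ ε₂ / 2) • ν with hy
  have hyx : y - x = (min ε₁ ε₂ / 2) • ν := by rw [hy]; abel
  have hin : 0 < inner ℝ ν (y - x) := by
    rw [hyx, inner_smul_right, real_inner_self_eq_norm_sq, hν]
    linarith
  have hd : dist y x < min ε₁ ε₂ := by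
    rw [dist_eq_norm, hyx, norm_smul, hν, Real.norm_eq_abs, abs_of_pos (half_pos hε)]
    linarith
  have h5 : y ∈ (T : Set (Rd d)) := (hP y (hd.trans_le (min_le_left _ _))).mpr (by
    rw [inner_neg_left]; linarith)
  have h6 := (hQ y (hd.trans_le (min_le_right _ _))).mp (ℳ.cell_subset hΩ T h5)
  linarith

/-- The orientations of a face cancel, except on the boundary. -/
theorem sum_orient (hΩ : IsPolytopal Ω) (F : ℳ.faces) [DecidablePred fun T => F ∈ ℳ.cellFaces T]
    [Decidable (F ∈ ℳ.bdryFaces)] :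
    ∑ T with F ∈ ℳ.cellFaces T, ℳ.orient T F = if F ∈ ℳ.bdryFaces then 1 else 0 := by
  split_ifs with hb
  · obtain ⟨T, hT⟩ := ℳ.exists_cell_of_face F
    rw [Finset.sum_eq_single_of_mem T (by simpa using hT), ℳ.orient_bdry hΩ hT hb]
    intro T' hT' hne
    have hT'' : F ∈ ℳ.cellFaces T' := by simpa using hT'
    have h1 := ℳ.orient_neg hT'' hT hne
    rw [ℳ.orient_bdry hΩ hT hb, ℳ.orient_bdry hΩ hT'' hb] at h1
    norm_num at h1
  · rcases ℳ.face_dichotomy F F.2 with ⟨T₁, h₁, T₂, h₂, hne, h⟩ | ⟨T, -, h⟩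
    swap
    · exact absurd (ℳ.mem_bdryFaces.mpr (h.trans inter_subset_right)) hb
    have hF1 : F ∈ ℳ.cellFaces ⟨T₁, h₁⟩ := ℳ.mem_cellFaces.mpr (h.trans inter_subset_left)
    have hF2 : F ∈ ℳ.cellFaces ⟨T₂, h₂⟩ := ℳ.mem_cellFaces.mpr (h.trans inter_subset_right)
    have hne' : (⟨T₁, h₁⟩ : ℳ.cells) ≠ ⟨T₂, h₂⟩ := fun h => hne (congrArg Subtype.val h)
    have hset : (Finset.univ.filter fun T => F ∈ ℳ.cellFaces T) = {⟨T₁, h₁⟩, ⟨T₂, h₂⟩} := by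
      ext T
      simp only [Finset.mem_filter, Finset.mem_univ, true_and, Finset.mem_insert,
        Finset.mem_singleton]
      constructor
      · intro hT
        by_contra! hcon
        have e1 := ℳ.orient_neg hT hF1 hcon.1
        have e2 := ℳ.orient_neg hT hF2 hcon.2
        have e3 := ℳ.orient_neg hF1 hF2 hne'
        rcases ℳ.orient_eq_or T F with h | h <;> rw [h] at e1 e2 <;> rw [e1, e2] at e3 <;>
          norm_num at e3
      · rintro (rfl | rfl)
        · exact hF1
        · exact hF2
    rw [hset, Finset.sum_pair hne', ℳ.orient_neg hF1 hF2 hne', add_neg_cancel]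

/-- Almost every point of a face that is not a face of `T` is away from `T`. -/
theorem ae_notMem_closure (hΩ : IsPolytopal Ω) {T : ℳ.cells} {F : ℳ.faces}
    (h : F ∉ ℳ.cellFaces T) :
    ∀ᵐ x ∂((surf d).restrict (F : Set (Rd d))), x ∉ closure (T : Set (Rd d)) := by
  rcases ℳ.face_dichotomy F F.2 with ⟨T₁, h₁, T₂, h₂, hne, hsub⟩ | ⟨T₁, h₁, hsub⟩
  · have hF1 : F ∈ ℳ.cellFaces ⟨T₁, h₁⟩ := ℳ.mem_cellFaces.mpr (hsub.trans inter_subset_left)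
    have hF2 : F ∈ ℳ.cellFaces ⟨T₂, h₂⟩ := ℳ.mem_cellFaces.mpr (hsub.trans inter_subset_right)
    have hne' : (⟨T₁, h₁⟩ : ℳ.cells) ≠ ⟨T₂, h₂⟩ := fun h => hne (congrArg Subtype.val h)
    filter_upwards [ℳ.pointsOut_orient hF1, ℳ.pointsOut_orient hF2] with x hx1 hx2
    rw [ℳ.orient_neg hF1 hF2 hne', neg_smul] at hx2
    refine notMem_closure_of_opposite_normal hx1 hx2 (ℳ.cell_isOpen T)
      (ℳ.cells_disj (T₁ := T) (T₂ := ⟨T₁, h₁⟩) ?_) (ℳ.cells_disj (T₁ := T) (T₂ := ⟨T₂, h₂⟩) ?_)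
    · rintro rfl; exact h hF1
    · rintro rfl; exact h hF2
  · have hF1 : F ∈ ℳ.cellFaces ⟨T₁, h₁⟩ := ℳ.mem_cellFaces.mpr (hsub.trans inter_subset_left)
    have hb : F ∈ ℳ.bdryFaces := ℳ.mem_bdryFaces.mpr (hsub.trans inter_subset_right)
    filter_upwards [ℳ.pointsOut_orient hF1, ℳ.boundary_normal F (ℳ.mem_bdryFaces.mp hb)]
      with x hx1 hx2
    rw [ℳ.orient_bdry hΩ hF1 hb, one_smul] at hx1
    refine notMem_closure_of_same_normal hx1 hx2 (ℳ.cell_subset hΩ T)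
      (ℳ.cells_disj (T₁ := T) (T₂ := ⟨T₁, h₁⟩) ?_)
    rintro rfl; exact h hF1

/-- Up to a set of vanishing surface measure, the boundary of an element consists of points of its
faces with an outward normal. -/
theorem surf_singular_part (hΩ : IsPolytopal Ω) (T : ℳ.cells) :
    surf d (frontier (T : Set (Rd d)) \ regPart (T : Set (Rd d)) (ℳ.cellFaces T)
      (fun F : ℳ.faces => (F : Set (Rd d))) fun F => ℳ.orient T F • ℳ.normal F) = 0 := by
  have hcov : frontier (T : Set (Rd d)) ⊆ ⋃ F ∈ ℳ.faces, closure F := by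
    rw [← ℳ.skeleton]
    exact subset_biUnion_of_mem (u := fun T : Set (Rd d) => frontier T) T.2
  set R := regPart (T : Set (Rd d)) (ℳ.cellFaces T)
      (fun F : ℳ.faces => (F : Set (Rd d))) fun F => ℳ.orient T F • ℳ.normal F with hR
  have hsub : frontier (T : Set (Rd d)) \ R ⊆
      ⋃ F : ℳ.faces, ((closure (F : Set (Rd d)) \ F) ∪
        ((F : Set (Rd d)) ∩ (frontier (T : Set (Rd d)) \ R))) := by
    rintro x ⟨hx, hxR⟩
    obtain ⟨F, hF, hxF⟩ := mem_iUnion₂.mp (hcov hx)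
    refine mem_iUnion.mpr ⟨⟨F, hF⟩, ?_⟩
    by_cases h : x ∈ F
    · exact Or.inr ⟨h, hx, hxR⟩
    · exact Or.inl ⟨hxF, h⟩
  refine measure_mono_null hsub ((measure_iUnion_null_iff).mpr fun F => ?_)
  refine measure_union_null (ℳ.face_boundary_null F F.2) ?_
  by_cases h : F ∈ ℳ.cellFaces T
  · have h1 := (ae_restrict_iff' (ℳ.face_measurableSet F)).mp (ℳ.pointsOut_orient h)
    refine measure_mono_null (fun x hx => ?_) h1
    obtain ⟨hxF, -, hxR⟩ := hx
    exact fun hcon => hxR (mem_iUnion₂.mpr ⟨F, h, hxF, hcon hxF⟩)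
  · have h1 := (ae_restrict_iff' (ℳ.face_measurableSet F)).mp (ℳ.ae_notMem_closure hΩ h)
    refine measure_mono_null (fun x hx => ?_) h1
    obtain ⟨hxF, hxf, -⟩ := hx
    exact fun hcon => hcon hxF (frontier_subset_closure hxf)

/-- The divergence theorem on a mesh element. -/
theorem cell_divergence (hd : 0 < d) (hΩ : IsPolytopal Ω) (T : ℳ.cells) {G : Rd d → Rd d}
    {g : Rd d → ℝ} (hG : ContinuousOn G (closure Ω)) (hg : IntegrableOn g Ω)
    (hw : HasWeakDiv Ω G g) :
    ∫ x in (T : Set (Rd d)), g x = ∑ F ∈ ℳ.cellFaces T,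
      ℳ.orient T F * ∫ x in (F : Set (Rd d)), inner ℝ (ℳ.normal F) (G x) ∂(surf d) := by
  rw [divergence_theorem (s := ℳ.cellFaces T) (F := fun F : ℳ.faces => (F : Set (Rd d)))
    (ν := fun F => ℳ.orient T F • ℳ.normal F) hd (ℳ.cell_isOpen T) (ℳ.cell_isBounded T)
    ?_ (fun F hF => ℳ.mem_cellFaces.mp hF) ?_ (ℳ.surf_singular_part hΩ T)
    (hG.mono (ℳ.closure_cell_subset T)) (hg.mono_set (ℳ.cell_subset hΩ T))
    (hw.mono (ℳ.cell_subset hΩ T) (ℳ.cell_isOpen T).measurableSet hΩ.isOpen.measurableSet)]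
  · refine Finset.sum_congr rfl fun F _ => ?_
    rw [← integral_const_mul]
    simp only [real_inner_smul_left]
  · intro F _
    obtain ⟨h1, h2, c, U, hU, hF⟩ := ℳ.face_isFlatPiece F
    refine ⟨?_, h2, ℳ.orient T F * c, U, hU, ?_⟩
    · rcases ℳ.orient_eq_or T F with h | h <;> simp [h, h1]
    · rw [hF]
      ext x
      rcases ℳ.orient_eq_or T F with h | h <;> simp [h, inner_neg_left]
  · intro F₁ _ F₂ _ hne
    exact ℳ.faces_disjoint _ F₁.2 _ F₂.2 fun h => hne (Subtype.ext h)

end PolytopalMesh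

end Mesh

/-! ### The area of the boundary of a convex set -/

section Cone

variable {d : ℕ}

/-- The truncated cone with apex `x₀` over a set lying in the hyperplane at distance `h` of `x₀` in
the direction `ν`. -/
def truncCone (x₀ ν : Rd d) (h : ℝ) (S : Set (Rd d)) : Set (Rd d) :=
  {z | inner ℝ ν (z - x₀) ∈ Ioo (h / 2) h ∧ x₀ + (h / inner ℝ ν (z - x₀)) • (z - x₀) ∈ S}

theorem measurableSet_truncCone (x₀ ν : Rd d) (h : ℝ) {S : Set (Rd d)} (hS : MeasurableSet S) :
    MeasurableSet (truncCone x₀ ν h S) := by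
  have h1 : Continuous fun z : Rd d => inner ℝ ν (z - x₀) := by fun_prop
  have h2 : Measurable fun z : Rd d => x₀ + (h / inner ℝ ν (z - x₀)) • (z - x₀) := by
    have h3 : Measurable fun z : Rd d => h / inner ℝ ν (z - x₀) :=
      measurable_const.div h1.measurable
    exact measurable_const.add (h3.smul (measurable_id.sub measurable_const))
  exact (h1.measurable measurableSet_Ioo).inter (h2 hS)

/-- The volume of a cone controls the area of its base. -/
theorem surf_le_volume_truncCone (hd : 0 < d) {x₀ ν : Rd d} (hν : ‖ν‖ = 1) {h : ℝ} (hh : 0 < h)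
    {S : Set (Rd d)} (hS : MeasurableSet S) (hSh : ∀ y ∈ S, inner ℝ ν (y - x₀) = h) :
    ENNReal.ofReal (h / 2 ^ d) * surf d S ≤ volume (truncCone x₀ ν h S) := by
  have hν0 : ν ≠ 0 := norm_ne_zero_iff.mp (by rw [hν]; exact one_ne_zero)
  -- slice the cone by the hyperplanes orthogonal to `ν`, with `σ` the distance to the apex
  have key := EuclideanGeometry.euclideanHausdorffMeasure_eq_lintegral (V := Rd d) (P := Rd d) x₀
    hν0 (measurableSet_truncCone x₀ ν h hS)
  rw [InnerProductSpace.euclideanHausdorffMeasure_eq_volume, finrank_euclideanSpace,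
    Fintype.card_fin, ← ofReal_norm, hν, ENNReal.ofReal_one, one_mul] at key
  rw [key]
  -- the slice at `σ > h / 2` contains the base scaled by `σ / h ≥ 1 / 2`
  have hslice : ∀ σ ∈ Ioo (h / 2) h, ENNReal.ofReal ((1 / 2) ^ (d - 1)) * surf d S ≤
      μHE[d - 1] (truncCone x₀ ν h S ∩ AffineSubspace.mk' (σ • ν +ᵥ x₀) (ℝ ∙ ν)ᗮ) := by
    intro σ hσ
    have hσ0 : 0 < σ := by linarith [hσ.1]
    have hsub : AffineMap.homothety x₀ (h / σ) ⁻¹' S ⊆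
        truncCone x₀ ν h S ∩ AffineSubspace.mk' (σ • ν +ᵥ x₀) (ℝ ∙ ν)ᗮ := by
      intro z hz
      have hz' : (h / σ) • (z - x₀) + x₀ ∈ S := by
        simpa [AffineMap.homothety_apply] using hz
      have h1 := hSh _ hz'
      rw [add_sub_cancel_right, inner_smul_right] at h1
      have h2 : inner ℝ ν (z - x₀) = σ := by
        field_simp at h1
        nlinarith
      refine ⟨⟨by rw [h2]; exact hσ, by rw [h2, add_comm]; exact hz'⟩, ?_⟩
      rw [SetLike.mem_coe, AffineSubspace.mem_mk',
        Submodule.mem_orthogonal_singleton_iff_inner_right]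
      rw [vsub_eq_sub, vadd_eq_add, sub_add_eq_sub_sub_swap, inner_sub_right, h2, inner_smul_right,
        real_inner_self_eq_norm_sq, hν]
      simp
    refine le_trans ?_ (measure_mono hsub)
    have hc : h / σ ≠ 0 := by positivity
    rw [euclideanHausdorffMeasure_homothety_preimage _ _ hc, ENNReal.smul_def, smul_eq_mul]
    refine mul_le_mul_left ?_ _
    rw [← ENNReal.ofReal_coe_nnreal]
    refine ENNReal.ofReal_le_ofReal ?_
    push_cast
    rw [Real.norm_eq_abs, abs_of_pos (by positivity), inv_div]
    have : 1 / 2 ≤ σ / h := by rw [div_le_div_iff₀ two_pos hh]; linarith [hσ.1]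
    gcongr
  calc ENNReal.ofReal (h / 2 ^ d) * surf d S
      = ∫⁻ _ in Ioo (h / 2) h, ENNReal.ofReal ((1 / 2) ^ (d - 1)) * surf d S := by
        rw [setLIntegral_const, Real.volume_Ioo, mul_right_comm,
          ← ENNReal.ofReal_mul (by positivity)]
        congr 2
        obtain ⟨e, rfl⟩ : ∃ e, d = e + 1 := ⟨d - 1, by omega⟩
        rw [Nat.add_sub_cancel, pow_succ, one_div, inv_pow]
        field_simp
        ring
    _ ≤ ∫⁻ σ in Ioo (h / 2) h,
        μHE[d - 1] (truncCone x₀ ν h S ∩ AffineSubspace.mk' (σ • ν +ᵥ x₀) (ℝ ∙ ν)ᗮ) :=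
        setLIntegral_mono' measurableSet_Ioo hslice
    _ ≤ _ := setLIntegral_le_lintegral _ _

/-- Disjoint subsets of the boundary of a convex set, each of them in a supporting hyperplane, have
a total area controlled by the volume and by the radius of an inscribed ball: the cones over them
are disjoint. -/
theorem sum_surf_le (hd : 0 < d) {K : Set (Rd d)} (hK : Convex ℝ K) {x₀ : Rd d} {r : ℝ}
    (hr : 0 < r) (hball : Metric.ball x₀ r ⊆ K) (hKv : volume K ≠ ⊤) {ι : Type*} (s : Finset ι)
    {S : ι → Set (Rd d)} {ν : ι → Rd d} {c : ι → ℝ} (hν : ∀ i ∈ s, ‖ν i‖ = 1)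
    (hS : ∀ i ∈ s, MeasurableSet (S i)) (hSK : ∀ i ∈ s, S i ⊆ K)
    (hSc : ∀ i ∈ s, ∀ y ∈ S i, inner ℝ (ν i) y = c i)
    (hKc : ∀ i ∈ s, ∀ y ∈ K, inner ℝ (ν i) y ≤ c i)
    (hdisj : ∀ i ∈ s, ∀ j ∈ s, i ≠ j → Disjoint (S i) (S j)) :
    ∑ i ∈ s, (surf d (S i)).toReal ≤ 2 ^ d / r * (volume K).toReal := by
  classical
  set h : ι → ℝ := fun i => c i - inner ℝ (ν i) x₀ with hh
  have hx₀ : x₀ ∈ K := hball (Metric.mem_ball_self hr)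
  -- the supporting hyperplanes are at least at the distance `r` from the centre of the ball
  have hhr : ∀ i ∈ s, r ≤ h i := by
    intro i hi
    refine le_of_forall_lt fun a ha => ?_
    obtain ⟨b, hab, hbr⟩ := exists_between (max_lt ha hr)
    have hb0 : 0 < b := (le_max_right _ _).trans_lt hab
    have h1 := hKc i hi (x₀ + b • ν i) (hball (by
      rw [mem_ball_iff_norm, add_sub_cancel_left, norm_smul, hν i hi, Real.norm_eq_abs,
        abs_of_pos hb0, mul_one]
      exact hbr))
    rw [inner_add_right, inner_smul_right, real_inner_self_eq_norm_sq, hν i hi] at h1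
    have h2 : a < b := (le_max_left _ _).trans_lt hab
    rw [hh]
    simp only
    linarith
  have hh0 : ∀ i ∈ s, 0 < h i := fun i hi => hr.trans_le (hhr i hi)
  have hSh : ∀ i ∈ s, ∀ y ∈ S i, inner ℝ (ν i) (y - x₀) = h i := by
    intro i hi y hy
    rw [inner_sub_right, hSc i hi y hy]
  have hKh : ∀ i ∈ s, ∀ y ∈ K, inner ℝ (ν i) (y - x₀) ≤ h i := by
    intro i hi y hy
    rw [inner_sub_right]
    linarith [hKc i hi y hy]
  set A : ι → Set (Rd d) := fun i => truncCone x₀ (ν i) (h i) (S i) with hA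
  -- the cones lie in `K` by convexity
  have hAK : ∀ i ∈ s, A i ⊆ K := by
    rintro i hi z ⟨hz1, hz2⟩
    set σ := inner ℝ (ν i) (z - x₀) with hσ
    have hσ0 : 0 < σ := by linarith [hz1.1, hh0 i hi]
    have := hK hx₀ (hSK i hi hz2) (a := 1 - σ / h i) (b := σ / h i)
      (by rw [sub_nonneg, div_le_one₀ (hh0 i hi)]; exact hz1.2.le)
      (div_nonneg hσ0.le (hh0 i hi).le) (by ring)
    convert this using 1
    rw [smul_add, smul_smul, div_mul_div_comm, mul_comm (h i) σ,
      div_self (mul_pos hσ0 (hh0 i hi)).ne', one_smul, ← add_assoc, ← add_smul]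
    simp
  have hAd : ∀ i ∈ s, ∀ j ∈ s, i ≠ j → Disjoint (A i) (A j) := by
    -- on each ray from the centre, the base points of both cones coincide
    have aux : ∀ i ∈ s, ∀ j ∈ s, ∀ z ∈ A i ∩ A j,
        h j / inner ℝ (ν j) (z - x₀) ≤ h i / inner ℝ (ν i) (z - x₀) := by
      rintro i hi j hj z ⟨⟨hi1, hi2⟩, ⟨hj1, hj2⟩⟩
      have h1 := hKh i hi _ (hSK j hj hj2)
      rw [add_sub_cancel_left, inner_smul_right] at h1
      have : 0 < inner ℝ (ν i) (z - x₀) := by linarith [hi1.1, hh0 i hi]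
      rwa [le_div_iff₀ this]
    intro i hi j hj hij
    refine disjoint_left.mpr fun z hzi hzj => ?_
    have heq := le_antisymm (aux i hi j hj z ⟨hzi, hzj⟩) (aux j hj i hi z ⟨hzj, hzi⟩)
    have h1 := hzi.2
    rw [← heq] at h1
    exact disjoint_left.mp (hdisj i hi j hj hij) h1 hzj.2
  have hAm : ∀ i ∈ s, MeasurableSet (A i) := fun i hi =>
    measurableSet_truncCone _ _ _ (hS i hi)
  have hsum : ∑ i ∈ s, volume (A i) ≤ volume K := by
    rw [← measure_biUnion_finset (fun i hi j hj hij => hAd i hi j hj hij) hAm]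
    exact measure_mono (iUnion₂_subset hAK)
  have hone : ∀ i ∈ s, (surf d (S i)).toReal ≤ 2 ^ d / r * (volume (A i)).toReal := by
    intro i hi
    have h1 := surf_le_volume_truncCone hd (hν i hi) (hh0 i hi) (hS i hi) (hSh i hi)
    have hfin : volume (A i) ≠ ⊤ := ((measure_mono (hAK i hi)).trans_lt hKv.lt_top).ne
    have h2 := ENNReal.toReal_mono hfin h1
    rw [ENNReal.toReal_mul, ENNReal.toReal_ofReal (by have := hh0 i hi; positivity)] at h2
    have h3 : r / 2 ^ d * (surf d (S i)).toReal ≤ h i / 2 ^ d * (surf d (S i)).toReal := by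
      gcongr
      exact hhr i hi
    have h4 := h3.trans h2
    rw [div_mul_eq_mul_div, div_le_iff₀ (by positivity)] at h4
    rw [div_mul_eq_mul_div, le_div_iff₀ hr]
    linarith
  calc ∑ i ∈ s, (surf d (S i)).toReal ≤ ∑ i ∈ s, 2 ^ d / r * (volume (A i)).toReal :=
        Finset.sum_le_sum hone
    _ = 2 ^ d / r * (∑ i ∈ s, volume (A i)).toReal := by
        rw [← Finset.mul_sum, ENNReal.toReal_sum]
        exact fun i hi => ((measure_mono (hAK i hi)).trans_lt hKv.lt_top).ne
    _ ≤ _ := by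
        gcongr

end Cone

/-! ### The simplicial submesh of an element -/

section Submesh

variable {d : ℕ} {Ω : Set (Rd d)} {ℳ : PolytopalMesh d Ω}
  {𝒦 : Geometry.SimplicialComplex ℝ (Rd d)}

open Classical in
/-- The simplices of the submesh contained in an element. -/
def PolytopalMesh.IsMatchingSubmesh.simplices (h : ℳ.IsMatchingSubmesh 𝒦) (T : ℳ.cells) :
    Finset (Finset (Rd d)) :=
  h.finite.toFinset.filter fun t => t.card = d + 1 ∧
    interior (convexHull ℝ (t : Set (Rd d))) ⊆ (T : Set (Rd d))

theorem interior_simplex_nonempty {t : Finset (Rd d)} (ht : t ∈ 𝒦.faces) (hc : t.card = d + 1) :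
    (interior (convexHull ℝ (t : Set (Rd d)))).Nonempty := by
  rw [interior_convexHull_nonempty_iff_affineSpan_eq_top]
  have h1 := (𝒦.indep ht).affineSpan_eq_top_iff_card_eq_finrank_add_one
  rw [Subtype.range_coe] at h1
  exact h1.mpr (by simp [hc])

theorem closure_interior_simplex {t : Finset (Rd d)} (ht : t ∈ 𝒦.faces) (hc : t.card = d + 1) :
    closure (interior (convexHull ℝ (t : Set (Rd d)))) = convexHull ℝ (t : Set (Rd d)) := by
  rw [(convex_convexHull ℝ _).closure_interior_eq_closure_of_nonempty_interior
    (interior_simplex_nonempty ht hc)]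
  exact (t.finite_toSet.isCompact_convexHull ℝ).isClosed.closure_eq

theorem disjoint_interior_simplices {s t : Finset (Rd d)} (hs : s ∈ 𝒦.faces) (ht : t ∈ 𝒦.faces)
    (hsc : s.card = d + 1) (htc : t.card = d + 1) (hne : s ≠ t) :
    Disjoint (interior (convexHull ℝ (s : Set (Rd d))))
      (interior (convexHull ℝ (t : Set (Rd d)))) := by
  classical
  rw [disjoint_iff_inter_eq_empty]
  by_contra hcon
  have hne' := nonempty_iff_ne_empty.mpr hcon
  have hsub : interior (convexHull ℝ (s : Set (Rd d))) ∩ interior (convexHull ℝ (t : Set (Rd d))) ⊆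
      convexHull ℝ ((s ∩ t : Finset (Rd d)) : Set (Rd d)) := by
    rw [Finset.coe_inter]
    exact (inter_subset_inter interior_subset interior_subset).trans
      (𝒦.inter_subset_convexHull hs ht)
  have hint : (interior (convexHull ℝ ((s ∩ t : Finset (Rd d)) : Set (Rd d)))).Nonempty :=
    hne'.mono (interior_maximal hsub (isOpen_interior.inter isOpen_interior))
  rw [interior_convexHull_nonempty_iff_affineSpan_eq_top] at hint
  have hstne : (s ∩ t).Nonempty := by
    rw [← Finset.coe_nonempty, ← convexHull_nonempty_iff (𝕜 := ℝ)]
    exact hne'.mono hsub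
  have hst := 𝒦.down_closed hs Finset.inter_subset_left hstne
  have h1 := (𝒦.indep hst).affineSpan_eq_top_iff_card_eq_finrank_add_one
  rw [Subtype.range_coe] at h1
  have h2 := h1.mp hint
  simp only [Fintype.card_coe, finrank_euclideanSpace, Fintype.card_fin] at h2
  have h3 : s ∩ t = s := Finset.eq_of_subset_of_card_le Finset.inter_subset_left (by omega)
  have h4 : s ∩ t = t := Finset.eq_of_subset_of_card_le Finset.inter_subset_right (by omega)
  exact hne (h3.symm.trans h4)

namespace PolytopalMesh.IsMatchingSubmesh

variable (h : ℳ.IsMatchingSubmesh 𝒦)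

theorem mem_simplices {T : ℳ.cells} {t : Finset (Rd d)} :
    t ∈ h.simplices T ↔ t ∈ 𝒦.faces ∧ t.card = d + 1 ∧
      interior (convexHull ℝ (t : Set (Rd d))) ⊆ (T : Set (Rd d)) := by
  simp [simplices]

theorem simplex_subset_closure {T : ℳ.cells} {t : Finset (Rd d)} (ht : t ∈ h.simplices T) :
    convexHull ℝ (t : Set (Rd d)) ⊆ closure (T : Set (Rd d)) := by
  obtain ⟨h1, h2, h3⟩ := h.mem_simplices.mp ht
  rw [← closure_interior_simplex h1 h2]
  exact closure_mono h3

theorem closure_cell_subset (T : ℳ.cells) :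
    closure (T : Set (Rd d)) ⊆ ⋃ t ∈ h.simplices T, convexHull ℝ (t : Set (Rd d)) := by
  refine closure_minimal ?_ ((h.simplices T).finite_toSet.isClosed_biUnion fun t _ =>
    (t.finite_toSet.isCompact_convexHull ℝ).isClosed)
  intro y hy
  have hyΩ : y ∈ 𝒦.space := by
    rw [h.cover]
    exact ℳ.closure_cell_subset T (subset_closure hy)
  obtain ⟨s, hs, hys⟩ := Geometry.SimplicialComplex.mem_space_iff.mp hyΩ
  obtain ⟨t, ht, hst, htc⟩ := h.pure s hs
  have hyt : y ∈ convexHull ℝ (t : Set (Rd d)) := convexHull_mono (by exact_mod_cast hst) hys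
  refine mem_iUnion₂.mpr ⟨t, h.mem_simplices.mpr ⟨ht, htc, ?_⟩, hyt⟩
  obtain ⟨T', hT', hsub⟩ := h.in_cell t ht htc
  rw [← closure_interior_simplex ht htc] at hyt
  obtain ⟨z, hzT, hz⟩ := mem_closure_iff.mp hyt _ (ℳ.cell_isOpen T) hy
  have : T = ⟨T', hT'⟩ := by
    by_contra hne
    exact disjoint_left.mp (ℳ.cells_disj hne) hzT (hsub hz)
  rw [this]
  exact hsub

/-- Integrals over an element are sums over its simplices. -/
theorem integral_cell (T : ℳ.cells) {f : Rd d → ℝ} (hf : Continuous f) :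
    ∫ x in (T : Set (Rd d)), f x =
      ∑ t ∈ h.simplices T, ∫ x in convexHull ℝ (t : Set (Rd d)), f x := by
  have hfr : ∀ t : Finset (Rd d), volume (frontier (convexHull ℝ (t : Set (Rd d)))) = 0 := fun t =>
    (convex_convexHull ℝ _).addHaar_frontier volume
  have h1 : ∀ t ∈ h.simplices T, ∫ x in convexHull ℝ (t : Set (Rd d)), f x =
      ∫ x in interior (convexHull ℝ (t : Set (Rd d))), f x := fun t _ =>
    (setIntegral_congr_set (interior_ae_eq_of_null_frontier (hfr t))).symm
  rw [Finset.sum_congr rfl h1, ← integral_biUnion_finset]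
  · refine setIntegral_congr_set ?_
    refine Filter.EventuallyLE.antisymm ?_ ?_
    · rw [ae_le_set]
      refine measure_mono_null (t := ⋃ t ∈ h.simplices T,
        frontier (convexHull ℝ (t : Set (Rd d)))) ?_ ?_
      · rintro x ⟨hx, hxn⟩
        obtain ⟨t, ht, hxt⟩ := mem_iUnion₂.mp (h.closure_cell_subset T (subset_closure hx))
        refine mem_iUnion₂.mpr ⟨t, ht, subset_closure hxt, fun hxi => hxn ?_⟩
        exact mem_iUnion₂.mpr ⟨t, ht, hxi⟩
      · exact (measure_biUnion_null_iff (h.simplices T).countable_toSet).mpr fun t _ => hfr t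
    · exact LE.le.eventuallyLE (iUnion₂_subset fun t ht => (h.mem_simplices.mp ht).2.2)
  · exact fun t _ => isOpen_interior.measurableSet
  · intro s hs t ht hne
    obtain ⟨hs1, hs2, -⟩ := h.mem_simplices.mp hs
    obtain ⟨ht1, ht2, -⟩ := h.mem_simplices.mp ht
    exact disjoint_interior_simplices hs1 ht1 hs2 ht2 hne
  · intro t _
    exact (hf.continuousOn.integrableOn_compact (t.finite_toSet.isCompact_convexHull ℝ)).mono_set
      interior_subset

/-- Almost every point of a face of `T` belongs to a simplex of `T` for which the hyperplane of the
face is a supporting hyperplane. -/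
theorem ae_mem_simplex {T : ℳ.cells} {F : ℳ.faces} (hF : F ∈ ℳ.cellFaces T) :
    ∀ᵐ x ∂((surf d).restrict (F : Set (Rd d))), ∃ t ∈ h.simplices T,
      x ∈ convexHull ℝ (t : Set (Rd d)) ∧ ∀ y ∈ convexHull ℝ (t : Set (Rd d)),
        inner ℝ (ℳ.orient T F • ℳ.normal F) y ≤ inner ℝ (ℳ.orient T F • ℳ.normal F) x := by
  have hmem := ae_restrict_mem (μ := surf d) (ℳ.face_measurableSet F)
  filter_upwards [ℳ.pointsOut_orient hF, hmem] with x hx hxF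
  obtain ⟨ε, hε, hloc⟩ := hx.local_structure
  obtain ⟨-, hcl, -, -⟩ := hloc ε le_rfl
  have hxc : x ∈ closure (T : Set (Rd d)) :=
    frontier_subset_closure (ℳ.mem_cellFaces.mp hF hxF)
  obtain ⟨t, ht, hxt⟩ := mem_iUnion₂.mp (h.closure_cell_subset T hxc)
  refine ⟨t, ht, hxt, fun y hy => ?_⟩
  set ν := ℳ.orient T F • ℳ.normal F
  -- a point of the segment from `x` to `y` close to `x`
  have hs : ∃ s : ℝ, 0 < s ∧ s ≤ 1 ∧ x + s • (y - x) ∈ Metric.ball x ε := by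
    have ht : Tendsto (fun s : ℝ => x + s • (y - x)) (𝓝[>] 0) (𝓝 x) := by
      have : Tendsto (fun s : ℝ => x + s • (y - x)) (𝓝 0) (𝓝 (x + (0 : ℝ) • (y - x))) :=
        Continuous.tendsto (by fun_prop) 0
      rw [zero_smul, add_zero] at this
      exact this.mono_left nhdsWithin_le_nhds
    have e1 := ht (Metric.ball_mem_nhds x hε)
    have e2 : ∀ᶠ s in 𝓝[>] (0 : ℝ), s ∈ Ioc (0 : ℝ) 1 := Ioc_mem_nhdsGT one_pos
    obtain ⟨s, hs1, hs2⟩ := (e2.and e1).exists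
    exact ⟨s, hs1.1, hs1.2, hs2⟩
  obtain ⟨s, hs0, hs1, hsb⟩ := hs
  have hmem : x + s • (y - x) ∈ convexHull ℝ (t : Set (Rd d)) :=
    (convex_convexHull ℝ _).add_smul_sub_mem hxt hy ⟨hs0.le, hs1⟩
  have := (hcl _ hsb).mp (h.simplex_subset_closure ht hmem)
  rw [add_sub_cancel_left, inner_smul_right, inner_sub_right] at this
  nlinarith

end PolytopalMesh.IsMatchingSubmesh

end Submesh

/-! ### Discrete trace and inverse inequalities -/

section Trace

variable {d m k : ℕ} {Ω : Set (Rd d)}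

theorem PolytopalMesh.diam_pos (hd : 0 < d) (ℳ : PolytopalMesh d Ω) (T : ℳ.cells) :
    0 < ℳ.diam T := by
  have : Nonempty (Fin d) := ⟨⟨0, hd⟩⟩
  obtain ⟨x, hx⟩ := ℳ.cell_nonempty T T.2
  have h1 : (T : Set (Rd d)).Infinite :=
    infinite_of_mem_nhds x ((ℳ.cell_isOpen T).mem_nhds hx)
  exact Metric.diam_pos h1.nontrivial (ℳ.cell_isBounded T)

/-- The simplices of a regular submesh contain balls of a radius comparable to the diameter of the
element. -/
theorem exists_simplex_balls (hd : 0 < d) {ℳ : PolytopalMesh d Ω} {ϱ : ℝ} (hϱ : 0 < ϱ)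
    (hreg : ℳ.IsRegular ϱ) :
    ∃ (𝒦 : Geometry.SimplicialComplex ℝ (Rd d)) (h𝒦 : ℳ.IsMatchingSubmesh 𝒦)
      (x₀ : Finset (Rd d) → Rd d) (h : Finset (Rd d) → ℝ), ∀ T, ∀ t ∈ h𝒦.simplices T,
        0 < h t ∧ ϱ * ℳ.diam T ≤ h t ∧
        Metric.ball (x₀ t) (ϱ * h t) ⊆ convexHull ℝ (t : Set (Rd d)) ∧
        convexHull ℝ (t : Set (Rd d)) ⊆ Metric.closedBall (x₀ t) (h t) := by
  obtain ⟨𝒦, h𝒦, hball⟩ := hreg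
  have hex : ∀ t : Finset (Rd d), ∃ x, t ∈ 𝒦.faces → t.card = d + 1 →
      Metric.ball x (ϱ * Metric.diam (convexHull ℝ (t : Set (Rd d)))) ⊆
        convexHull ℝ (t : Set (Rd d)) := by
    intro t
    by_cases ht : t ∈ 𝒦.faces ∧ t.card = d + 1
    · obtain ⟨x, hx⟩ := (hball t ht.1 ht.2).1
      exact ⟨x, fun _ _ => hx⟩
    · exact ⟨0, fun h1 h2 => absurd ⟨h1, h2⟩ ht⟩
  choose x₀ hx₀ using hex
  refine ⟨𝒦, h𝒦, x₀, fun t => Metric.diam (convexHull ℝ (t : Set (Rd d))), fun T t ht => ?_⟩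
  obtain ⟨h1, h2, h3⟩ := h𝒦.mem_simplices.mp ht
  have h4 := (hball t h1 h2).2 T h3
  have h5 : 0 < Metric.diam (convexHull ℝ (t : Set (Rd d))) :=
    lt_of_lt_of_le (mul_pos hϱ (ℳ.diam_pos hd T)) h4
  refine ⟨h5, h4, hx₀ t h1 h2, fun y hy => ?_⟩
  exact Metric.dist_le_diam_of_mem (t.finite_toSet.isCompact_convexHull ℝ).isBounded hy
    (hx₀ t h1 h2 (Metric.mem_ball_self (mul_pos hϱ h5)))

theorem volume_toReal_le_of_subset_closedBall {K : Set (Rd d)} {x₀ : Rd d} {h : ℝ} (hh : 0 < h)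
    (hK : K ⊆ Metric.closedBall x₀ h) : (volume K).toReal ≤
      h ^ d * (volume (Metric.closedBall (0 : Rd d) 1)).toReal := by
  have h1 := ENNReal.toReal_mono measure_closedBall_lt_top.ne (measure_mono (μ := volume) hK)
  rw [Measure.addHaar_closedBall' volume x₀ hh.le,
    finrank_euclideanSpace, Fintype.card_fin, ENNReal.toReal_mul,
    ENNReal.toReal_ofReal (by positivity)] at h1
  exact h1

/-- The discrete trace inequality and the inverse inequality for polynomials on the elements of
regular meshes. The constant depends only on the dimension, on the degree and on the regularity
parameter. -/
theorem exists_trace_inverse_constant (d k : ℕ) (hd : 0 < d) {ϱ : ℝ} (hϱ : 0 < ϱ) :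
    ∃ C : ℝ, 0 < C ∧ ∀ (m : ℕ) (Ω : Set (Rd d)) (ℳ : PolytopalMesh d Ω), ℳ.IsRegular ϱ →
      ∀ T : ℳ.cells, ∀ v ∈ polySpace d m k,
        ℳ.diam T * ∑ F ∈ ℳ.cellFaces T, faceNormSq (F : Set (Rd d)) v ≤
          C * cellNormSq (T : Set (Rd d)) v ∧
        ∀ i, ℳ.diam T ^ 2 * cellNormSq (T : Set (Rd d))
          (fun x => fderiv ℝ v x (EuclideanSpace.single i 1)) ≤
            C * cellNormSq (T : Set (Rd d)) v := by
  classical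
  -- half of the regularity parameter makes the closed balls fit into the open inscribed balls
  obtain ⟨C₀, hC₀, hC⟩ := exists_ball_bounds d k (half_pos hϱ)
  set θ := (volume (Metric.closedBall (0 : Rd d) 1)).toReal with hθ
  have hθ0 : 0 ≤ θ := ENNReal.toReal_nonneg
  refine ⟨C₀ * (2 ^ d * θ + θ + 1) / ϱ ^ 2, by positivity, ?_⟩
  intro m Ω ℳ hreg T v hv
  obtain ⟨𝒦, h𝒦, x₀, h, hgeo⟩ := exists_simplex_balls hd hϱ hreg
  have hvc : Continuous v := (contDiff_of_mem_polySpace hv).continuous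
  have hv2 : Continuous fun x => ‖v x‖ ^ 2 := by fun_prop
  have hT := ℳ.diam_pos hd T
  set K : Finset (Rd d) → Set (Rd d) := fun t => convexHull ℝ (t : Set (Rd d)) with hK
  have hKc : ∀ t, IsCompact (K t) := fun t => t.finite_toSet.isCompact_convexHull ℝ
  set I : Finset (Rd d) → ℝ := fun t => ∫ x in K t, ‖v x‖ ^ 2 with hI
  have hI0 : ∀ t, 0 ≤ I t := fun t => integral_nonneg fun _ => by positivity
  have hcell : cellNormSq (T : Set (Rd d)) v = ∑ t ∈ h𝒦.simplices T, I t :=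
    h𝒦.integral_cell T hv2
  -- pointwise bounds on a simplex
  have hpt : ∀ t ∈ h𝒦.simplices T, ∀ y ∈ K t, ‖v y‖ ^ 2 ≤ C₀ * I t / h t ^ d ∧
      ∀ i, ‖fderiv ℝ v y (EuclideanSpace.single i 1)‖ ^ 2 ≤ C₀ * I t / h t ^ d / h t ^ 2 := by
    intro t ht y hy
    obtain ⟨h1, h2, h3, h4⟩ := hgeo T t ht
    have hsub : Metric.closedBall (x₀ t) (ϱ / 2 * h t) ⊆ K t := by
      refine (Metric.closedBall_subset_ball ?_).trans h3
      have := mul_pos hϱ h1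
      linarith
    have hle : ∫ x in Metric.closedBall (x₀ t) (ϱ / 2 * h t), ‖v x‖ ^ 2 ≤ I t :=
      setIntegral_mono_set (hv2.continuousOn.integrableOn_compact (hKc t))
        (Eventually.of_forall fun _ => by positivity) hsub.eventuallyLE
    obtain ⟨h5, h6⟩ := hC m v hv (x₀ t) (h t) h1 y (h4 hy)
    have hle' := mul_le_mul_of_nonneg_left hle hC₀.le
    constructor
    · rw [le_div_iff₀ (by positivity), mul_comm]
      exact h5.trans hle'
    · intro i
      rw [le_div_iff₀ (by positivity), le_div_iff₀ (by positivity)]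
      refine le_trans (le_of_eq ?_) ((h6 i).trans hle')
      ring
  have hvol : ∀ t ∈ h𝒦.simplices T, (volume (K t)).toReal ≤ h t ^ d * θ := fun t ht =>
    volume_toReal_le_of_subset_closedBall (hgeo T t ht).1 (hgeo T t ht).2.2.2
  constructor
  · -- the hyperplane of a face, oriented by the outward normal of the element
    set ν : ℳ.faces → Rd d := fun F => ℳ.orient T F • ℳ.normal F with hν
    have hν1 : ∀ F, ‖ν F‖ = 1 := by
      intro F
      rcases ℳ.orient_eq_or T F with h | h <;> simp [hν, h, ℳ.normal_unit F]
    have hcex : ∀ F : ℳ.faces, ∃ c : ℝ, ∀ x ∈ (F : Set (Rd d)), inner ℝ (ν F) x = c := by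
      intro F
      obtain ⟨c, U, -, hFU⟩ := ℳ.face_planar F
      refine ⟨ℳ.orient T F * c, fun x hx => ?_⟩
      rw [hFU] at hx
      have hx2 : inner ℝ (ℳ.normal F) x = c := hx.2
      rw [hν, real_inner_smul_left, hx2]
    choose c hc using hcex
    -- the part of the face lying in the simplex, if the hyperplane of the face supports the simplex
    set S : ℳ.faces → Finset (Rd d) → Set (Rd d) := fun F t =>
      if ∀ y ∈ K t, inner ℝ (ν F) y ≤ c F then (F : Set (Rd d)) ∩ K t else ∅ with hS
    have hSm : ∀ F t, MeasurableSet (S F t) := by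
      intro F t
      rw [hS]
      simp only
      split_ifs
      · exact (ℳ.face_measurableSet F).inter (hKc t).isClosed.measurableSet
      · exact MeasurableSet.empty
    have hSF : ∀ F t, S F t ⊆ F := by
      intro F t
      rw [hS]
      simp only
      split_ifs
      · exact inter_subset_left
      · exact empty_subset _
    have hSfin : ∀ F t, surf d (S F t) ≠ ⊤ := fun F t =>
      ((measure_mono (hSF F t)).trans_lt (ℳ.surf_face_lt_top F)).ne
    -- almost all of the face is covered by such parts, on which the pointwise bound applies
    have hface : ∀ F ∈ ℳ.cellFaces T, faceNormSq (F : Set (Rd d)) v ≤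
        ∑ t ∈ h𝒦.simplices T, C₀ * I t / h t ^ d * (surf d (S F t)).toReal := by
      intro F hF
      have hbd : ∀ᵐ x ∂((surf d).restrict (F : Set (Rd d))), ‖v x‖ ^ 2 ≤
          ∑ t ∈ h𝒦.simplices T, (S F t).indicator (fun _ => C₀ * I t / h t ^ d) x := by
        filter_upwards [h𝒦.ae_mem_simplex hF, ae_restrict_mem (ℳ.face_measurableSet F)]
          with x ⟨t, ht, hxt, hsup⟩ hxF
        have hxS : x ∈ S F t := by
          rw [hS]
          simp only
          rw [if_pos]
          · exact ⟨hxF, hxt⟩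
          · intro y hy
            rw [← hc F x hxF]
            exact hsup y hy
        refine (hpt t ht x hxt).1.trans ?_
        have hval : (S F t).indicator (fun _ => C₀ * I t / h t ^ d) x = C₀ * I t / h t ^ d :=
          indicator_of_mem hxS _
        rw [← hval]
        refine Finset.single_le_sum (f := fun t =>
          (S F t).indicator (fun _ => C₀ * I t / h t ^ d) x) (fun s hs => ?_) ht
        exact indicator_nonneg (fun _ _ => by
          have := (hgeo T s hs).1
          have := hI0 s
          positivity) _
      have hint : ∀ t ∈ h𝒦.simplices T, Integrable
          ((S F t).indicator fun _ => C₀ * I t / h t ^ d)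
          ((surf d).restrict (F : Set (Rd d))) := by
        intro t _
        have : IsFiniteMeasure ((surf d).restrict (F : Set (Rd d))) :=
          ⟨by simpa using ℳ.surf_face_lt_top F⟩
        exact (integrable_const _).indicator (hSm F t)
      calc faceNormSq (F : Set (Rd d)) v
          ≤ ∫ x in (F : Set (Rd d)), ∑ t ∈ h𝒦.simplices T,
              (S F t).indicator (fun _ => C₀ * I t / h t ^ d) x ∂(surf d) :=
            integral_mono_of_nonneg (Eventually.of_forall fun _ => by positivity)
              (integrable_finsetSum _ hint) hbd
        _ = _ := by
            rw [integral_finsetSum _ hint]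
            refine Finset.sum_congr rfl fun t _ => ?_
            rw [integral_indicator (hSm F t), Measure.restrict_restrict (hSm F t),
              inter_eq_left.mpr (hSF F t), setIntegral_const, smul_eq_mul, mul_comm]
            rfl
    -- the parts lying in one simplex have a total area comparable to volume over inradius
    have harea : ∀ t ∈ h𝒦.simplices T, ∑ F ∈ ℳ.cellFaces T, (surf d (S F t)).toReal ≤
        2 ^ d / (ϱ * h t) * (h t ^ d * θ) := by
      intro t ht
      obtain ⟨h1, h2, h3, h4⟩ := hgeo T t ht
      have e1 : ∑ F ∈ ℳ.cellFaces T, (surf d (S F t)).toReal =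
          ∑ F ∈ ℳ.cellFaces T with ∀ y ∈ K t, inner ℝ (ν F) y ≤ c F,
            (surf d ((F : Set (Rd d)) ∩ K t)).toReal := by
        rw [Finset.sum_filter]
        refine Finset.sum_congr rfl fun F _ => ?_
        rw [hS]
        simp only
        split_ifs <;> simp
      rw [e1]
      refine (sum_surf_le hd (convex_convexHull ℝ _) (mul_pos hϱ h1) h3 (hKc t).measure_lt_top.ne
        _ (ν := ν) (c := c) (fun F _ => hν1 F)
        (fun F _ => (ℳ.face_measurableSet F).inter (hKc t).isClosed.measurableSet)
        (fun F _ => inter_subset_right) (fun F _ y hy => hc F y hy.1)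
        (fun F hF => (Finset.mem_filter.mp hF).2) ?_).trans ?_
      · intro F₁ _ F₂ _ hne
        exact (ℳ.faces_disjoint _ F₁.2 _ F₂.2 fun h => hne (Subtype.ext h)).mono
          inter_subset_left inter_subset_left
      · exact mul_le_mul_of_nonneg_left (hvol t ht) (by positivity)
    have hsum : ∑ F ∈ ℳ.cellFaces T, faceNormSq (F : Set (Rd d)) v ≤
        ∑ t ∈ h𝒦.simplices T, C₀ * (2 ^ d * θ) / (ϱ ^ 2 * ℳ.diam T) * I t := by
      refine (Finset.sum_le_sum hface).trans ?_
      rw [Finset.sum_comm]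
      refine Finset.sum_le_sum fun t ht => ?_
      obtain ⟨h1, h2, -, -⟩ := hgeo T t ht
      rw [← Finset.mul_sum]
      have := hI0 t
      calc C₀ * I t / h t ^ d * ∑ F ∈ ℳ.cellFaces T, (surf d (S F t)).toReal
          ≤ C₀ * I t / h t ^ d * (2 ^ d / (ϱ * h t) * (h t ^ d * θ)) :=
            mul_le_mul_of_nonneg_left (harea t ht) (by positivity)
        _ = C₀ * (2 ^ d * θ) / (ϱ * h t) * I t := by field_simp
        _ ≤ C₀ * (2 ^ d * θ) / (ϱ * (ϱ * ℳ.diam T)) * I t := by gcongr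
        _ = _ := by ring
    rw [hcell]
    calc ℳ.diam T * ∑ F ∈ ℳ.cellFaces T, faceNormSq (F : Set (Rd d)) v
        ≤ ℳ.diam T * ∑ t ∈ h𝒦.simplices T,
            C₀ * (2 ^ d * θ) / (ϱ ^ 2 * ℳ.diam T) * I t := by gcongr
      _ = C₀ * (2 ^ d * θ) / ϱ ^ 2 * ∑ t ∈ h𝒦.simplices T, I t := by
          rw [← Finset.mul_sum]
          field_simp
      _ ≤ _ := by
          have : 0 ≤ ∑ t ∈ h𝒦.simplices T, I t := Finset.sum_nonneg fun t _ => hI0 t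
          gcongr
          linarith
  · intro i
    have hdc : Continuous fun x => ‖fderiv ℝ v x (EuclideanSpace.single i 1)‖ ^ 2 :=
      (contDiff_of_mem_polySpace (fderiv_mem_polySpace hv i)).continuous.norm.pow 2
    have e1 : cellNormSq (T : Set (Rd d)) (fun x => fderiv ℝ v x (EuclideanSpace.single i 1)) ≤
        ∑ t ∈ h𝒦.simplices T, C₀ * θ / (ϱ ^ 2 * ℳ.diam T ^ 2) * I t := by
      rw [cellNormSq, h𝒦.integral_cell T hdc]
      refine Finset.sum_le_sum fun t ht => ?_
      obtain ⟨h1, h2, -, -⟩ := hgeo T t ht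
      have := hI0 t
      calc ∫ x in K t, ‖fderiv ℝ v x (EuclideanSpace.single i 1)‖ ^ 2
          ≤ ∫ x in K t, C₀ * I t / h t ^ d / h t ^ 2 :=
            setIntegral_mono_on (hdc.continuousOn.integrableOn_compact (hKc t))
              (integrableOn_const (hKc t).measure_lt_top.ne) (hKc t).isClosed.measurableSet
              fun y hy => (hpt t ht y hy).2 i
        _ = (volume (K t)).toReal * (C₀ * I t / h t ^ d / h t ^ 2) := by
            rw [setIntegral_const, smul_eq_mul]; rfl
        _ ≤ h t ^ d * θ * (C₀ * I t / h t ^ d / h t ^ 2) :=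
            mul_le_mul_of_nonneg_right (hvol t ht) (by positivity)
        _ = C₀ * θ / h t ^ 2 * I t := by field_simp
        _ ≤ C₀ * θ / (ϱ * ℳ.diam T) ^ 2 * I t := by gcongr
        _ = _ := by rw [mul_pow]
    rw [hcell]
    calc ℳ.diam T ^ 2 * cellNormSq (T : Set (Rd d))
          (fun x => fderiv ℝ v x (EuclideanSpace.single i 1))
        ≤ ℳ.diam T ^ 2 * ∑ t ∈ h𝒦.simplices T,
            C₀ * θ / (ϱ ^ 2 * ℳ.diam T ^ 2) * I t := by gcongr
      _ = C₀ * θ / ϱ ^ 2 * ∑ t ∈ h𝒦.simplices T, I t := by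
          rw [← Finset.mul_sum]
          field_simp
      _ ≤ _ := by
          have : 0 ≤ ∑ t ∈ h𝒦.simplices T, I t := Finset.sum_nonneg fun t _ => hI0 t
          have : (0 : ℝ) ≤ 2 ^ d * θ := by positivity
          gcongr
          linarith

end Trace

/-! ### Matrix fields and square-integrable fields -/

section Act

variable {m : ℕ}

theorem act_apply (H : Mat m) (ξ : Cm m) (i : Fin m) : act H ξ i = ∑ j, H i j * ξ j := by
  simp [act, Matrix.mulVec, dotProduct]

theorem act_add (H : Mat m) (ξ η : Cm m) : act H (ξ + η) = act H ξ + act H η := by simp [act]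

theorem act_sub (H : Mat m) (ξ η : Cm m) : act H (ξ - η) = act H ξ - act H η := by simp [act]

theorem act_smul (H : Mat m) (c : ℂ) (ξ : Cm m) : act H (c • ξ) = c • act H ξ := by simp [act]

theorem act_add_left (H J : Mat m) (ξ : Cm m) : act (H + J) ξ = act H ξ + act J ξ := by simp [act]

theorem act_sub_left (H J : Mat m) (ξ : Cm m) : act (H - J) ξ = act H ξ - act J ξ := by simp [act]

theorem act_smul_left (c : ℂ) (H : Mat m) (ξ : Cm m) : act (c • H) ξ = c • act H ξ := by simp [act]

theorem act_one (ξ : Cm m) : act (1 : Mat m) ξ = ξ := by simp [act]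

theorem act_sum_left {ι : Type*} (s : Finset ι) (H : ι → Mat m) (ξ : Cm m) :
    act (∑ i ∈ s, H i) ξ = ∑ i ∈ s, act (H i) ξ := by
  simp [act, map_sum]

theorem norm_act_le (H : Mat m) (ξ : Cm m) : ‖act H ξ‖ ≤ ‖H‖ * ‖ξ‖ := by
  have := (Matrix.toEuclideanCLM (n := Fin m) (𝕜 := ℂ) H).le_opNorm ξ
  rwa [Matrix.l2_opNorm_toEuclideanCLM] at this

theorem inner_act_conjTranspose (H : Mat m) (ξ η : Cm m) :
    inner ℂ ξ (act Hᴴ η) = inner ℂ (act H ξ) η := by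
  unfold act
  have : Matrix.toEuclideanCLM (n := Fin m) (𝕜 := ℂ) Hᴴ =
      ContinuousLinearMap.adjoint (Matrix.toEuclideanCLM (n := Fin m) (𝕜 := ℂ) H) := by
    rw [← ContinuousLinearMap.star_eq_adjoint, ← map_star]; rfl
  rw [this, ContinuousLinearMap.adjoint_inner_right]

theorem inner_act_comm {H : Mat m} (hH : H.IsHermitian) (ξ η : Cm m) :
    inner ℂ ξ (act H η) = inner ℂ (act H ξ) η := by
  rw [← inner_act_conjTranspose, hH.eq]

theorem re_inner_act_nonneg {H : Mat m} (hH : H.PosSemidef) (ξ : Cm m) :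
    0 ≤ (inner ℂ ξ (act H ξ)).re := by
  have := hH.re_dotProduct_nonneg (WithLp.ofLp ξ)
  rw [EuclideanSpace.inner_eq_star_dotProduct]
  rw [dotProduct_comm]
  simpa [act, Matrix.ofLp_toEuclideanCLM] using this

theorem norm_entry_le (H : Mat m) (i j : Fin m) : ‖H i j‖ ≤ ‖H‖ := by
  have h1 := norm_act_le H (EuclideanSpace.single j 1)
  have h2 := PiLp.norm_apply_le (act H (EuclideanSpace.single j 1)) i
  have h3 : act H (EuclideanSpace.single j 1) i = H i j := by
    rw [act_apply]; simp
  rw [h3] at h2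
  simp at h1
  exact h2.trans h1

theorem continuous_entry (i j : Fin m) : Continuous fun H : Mat m => H i j :=
  continuous_id.matrix_elem i j

theorem continuous_act : Continuous fun p : Mat m × Cm m => act p.1 p.2 := by
  have : (fun p : Mat m × Cm m => act p.1 p.2) =
      fun p => WithLp.toLp 2 (fun i => ∑ j, p.1 i j * p.2 j) := by
    ext p i; simp [act_apply]
  rw [this]
  refine (PiLp.continuous_toLp 2 _).comp
    (continuous_pi fun i => continuous_finsetSum _ fun j _ => ?_)
  exact ((continuous_entry i j).comp continuous_fst).mul
    ((PiLp.continuous_apply 2 _ j).comp continuous_snd)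

theorem continuousOn_act {X : Type*} [TopologicalSpace X] {s : Set X} {H : X → Mat m} {v : X → Cm m}
    (hH : ContinuousOn H s) (hv : ContinuousOn v s) :
    ContinuousOn (fun x => act (H x) (v x)) s := by
  have h := hH.prodMk hv
  have h' := Continuous.comp_continuousOn (g := fun p : Mat m × Cm m => act p.1 p.2)
    continuous_act h
  exact h'

end Act

section SquareIntegrable

variable {X : Type*} [MeasurableSpace X] {m : ℕ} {μ : Measure X}

/-- The inner product `∫ bᴴ a` of `L²(μ; ℂ^m)`. -/
def ip (μ : Measure X) (a b : X → Cm m) : ℂ := ∫ x, inner ℂ (b x) (a x) ∂μ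

/-- The squared norm of `L²(μ; ℂ^m)`. -/
def nsq (μ : Measure X) (a : X → Cm m) : ℝ := ∫ x, ‖a x‖ ^ 2 ∂μ

theorem nsq_nonneg (μ : Measure X) (a : X → Cm m) : 0 ≤ nsq μ a :=
  integral_nonneg fun _ => by positivity

theorem integrable_ip {a b : X → Cm m} (ha : MemLp a 2 μ) (hb : MemLp b 2 μ) :
    Integrable (fun x => inner ℂ (b x) (a x)) μ := by
  have := L2.integrable_inner (𝕜 := ℂ) (hb.toLp b) (ha.toLp a)
  refine this.congr ?_
  filter_upwards [ha.coeFn_toLp, hb.coeFn_toLp] with x h1 h2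
  rw [h1, h2]

theorem ip_eq_inner {a b : X → Cm m} (ha : MemLp a 2 μ) (hb : MemLp b 2 μ) :
    ip μ a b = inner ℂ (hb.toLp b) (ha.toLp a) := by
  rw [L2.inner_def]
  refine integral_congr_ae ?_
  filter_upwards [ha.coeFn_toLp, hb.coeFn_toLp] with x h1 h2
  rw [h1, h2]

theorem ip_self (a : X → Cm m) : ip μ a a = nsq μ a := by
  unfold ip nsq
  rw [← integral_complex_ofReal]
  congr 1; ext x
  rw [inner_self_eq_norm_sq_to_K]; simp

theorem nsq_eq_norm {a : X → Cm m} (ha : MemLp a 2 μ) : nsq μ a = ‖ha.toLp a‖ ^ 2 := by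
  have h := ip_self (μ := μ) a
  rw [ip_eq_inner ha ha, inner_self_eq_norm_sq_to_K] at h
  exact (Complex.ofReal_injective (by rw [← h]; simp)).symm

theorem norm_ip_le {a b : X → Cm m} (ha : MemLp a 2 μ) (hb : MemLp b 2 μ) :
    ‖ip μ a b‖ ≤ √(nsq μ a) * √(nsq μ b) := by
  rw [ip_eq_inner ha hb, nsq_eq_norm ha, nsq_eq_norm hb, Real.sqrt_sq (norm_nonneg _),
    Real.sqrt_sq (norm_nonneg _), mul_comm]
  exact norm_inner_le_norm _ _

theorem nsq_add_le {a b : X → Cm m} (ha : MemLp a 2 μ) (hb : MemLp b 2 μ) :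
    nsq μ (fun x => a x + b x) ≤ 2 * (nsq μ a + nsq μ b) := by
  have h : MemLp (fun x => a x + b x) 2 μ := ha.add hb
  have h1 : ‖h.toLp _‖ ≤ ‖ha.toLp a‖ + ‖hb.toLp b‖ := norm_add_le (ha.toLp a) (hb.toLp b)
  rw [nsq_eq_norm h, nsq_eq_norm ha, nsq_eq_norm hb]
  nlinarith [norm_nonneg (h.toLp _), sq_nonneg (‖ha.toLp a‖ - ‖hb.toLp b‖)]

theorem nsq_smul (c : ℂ) (a : X → Cm m) : nsq μ (fun x => c • a x) = ‖c‖ ^ 2 * nsq μ a := by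
  unfold nsq
  rw [← integral_const_mul]
  congr 1; ext x; rw [norm_smul, mul_pow]

theorem nsq_neg (a : X → Cm m) : nsq μ (fun x => -a x) = nsq μ a := by
  simp [nsq]

theorem nsq_congr {a b : X → Cm m} (h : ∀ᵐ x ∂μ, a x = b x) : nsq μ a = nsq μ b :=
  integral_congr_ae (h.mono fun x hx => by simp only [hx])

theorem ip_congr {a b a' b' : X → Cm m} (h : ∀ᵐ x ∂μ, a x = a' x) (h' : ∀ᵐ x ∂μ, b x = b' x) :
    ip μ a b = ip μ a' b' :=
  integral_congr_ae (by filter_upwards [h, h'] with x hx hx'; simp only [hx, hx'])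

theorem nsq_le_of_bound {a b : X → Cm m} {C : ℝ} (hb : MemLp b 2 μ)
    (h : ∀ᵐ x ∂μ, ‖a x‖ ≤ C * ‖b x‖) : nsq μ a ≤ C ^ 2 * nsq μ b := by
  unfold nsq
  rw [← integral_const_mul]
  refine integral_mono_of_nonneg (Eventually.of_forall fun x => by positivity)
    (hb.integrable_norm_pow (by norm_num) |>.const_mul _) (h.mono fun x hx => ?_)
  simp only
  rw [← mul_pow]
  exact pow_le_pow_left₀ (norm_nonneg _) hx 2

theorem ip_add_left {a a' b : X → Cm m} (ha : MemLp a 2 μ) (ha' : MemLp a' 2 μ) (hb : MemLp b 2 μ) :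
    ip μ (fun x => a x + a' x) b = ip μ a b + ip μ a' b := by
  unfold ip
  rw [← integral_add (integrable_ip ha hb) (integrable_ip ha' hb)]
  simp only [inner_add_right]

theorem ip_add_right {a b b' : X → Cm m} (ha : MemLp a 2 μ) (hb : MemLp b 2 μ)
    (hb' : MemLp b' 2 μ) :
    ip μ a (fun x => b x + b' x) = ip μ a b + ip μ a b' := by
  unfold ip
  rw [← integral_add (integrable_ip ha hb) (integrable_ip ha hb')]
  simp only [inner_add_left]

theorem ip_sub_left {a a' b : X → Cm m} (ha : MemLp a 2 μ) (ha' : MemLp a' 2 μ) (hb : MemLp b 2 μ) :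
    ip μ (fun x => a x - a' x) b = ip μ a b - ip μ a' b := by
  unfold ip
  rw [← integral_sub (integrable_ip ha hb) (integrable_ip ha' hb)]
  simp only [inner_sub_right]

theorem ip_smul_left (c : ℂ) (a b : X → Cm m) : ip μ (fun x => c • a x) b = c * ip μ a b := by
  unfold ip
  rw [← integral_const_mul]
  simp only [inner_smul_right]

theorem ip_smul_right (c : ℂ) (a b : X → Cm m) :
    ip μ a (fun x => c • b x) = starRingEnd ℂ c * ip μ a b := by
  unfold ip
  rw [← integral_const_mul]
  simp only [inner_smul_left]

theorem ip_conj (a b : X → Cm m) : starRingEnd ℂ (ip μ a b) = ip μ b a := by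
  unfold ip
  rw [← integral_conj]
  simp only [inner_conj_symm]

theorem ip_zero_right (a : X → Cm m) : ip μ a (fun _ => 0) = 0 := by simp [ip]

theorem ae_norm_le_toReal {H : X → Mat m} (hH : MemLp H ⊤ μ) :
    ∀ᵐ x ∂μ, ‖H x‖ ≤ (eLpNorm H ⊤ μ).toReal := by
  filter_upwards [ae_le_eLpNormEssSup (f := H) (μ := μ)] with x hx
  rw [eLpNorm_exponent_top, ← toReal_enorm]
  exact ENNReal.toReal_mono (by rw [← eLpNorm_exponent_top]; exact hH.2.ne) hx

/-- A bounded matrix field acts on square-integrable fields. -/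
theorem memLp_act {H : X → Mat m} {v : X → Cm m} (hH : MemLp H ⊤ μ) (hv : MemLp v 2 μ) :
    MemLp (fun x => act (H x) (v x)) 2 μ := by
  have h := hH.1.prodMk hv.1
  have h' := Continuous.comp_aestronglyMeasurable (g := fun p : Mat m × Cm m => act p.1 p.2)
    continuous_act h
  refine hv.of_le_mul (c := (eLpNorm H ⊤ μ).toReal) h' ?_
  filter_upwards [ae_norm_le_toReal hH] with x hx
  exact (norm_act_le _ _).trans (mul_le_mul_of_nonneg_right hx (norm_nonneg _))

theorem ip_act_conj {H : X → Mat m} (hH : ∀ᵐ x ∂μ, (H x).IsHermitian) (a b : X → Cm m) :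
    starRingEnd ℂ (ip μ (fun x => act (H x) (a x)) b) = ip μ (fun x => act (H x) (b x)) a := by
  rw [ip_conj]
  refine integral_congr_ae (hH.mono fun x hx => ?_)
  simp only
  rw [inner_act_comm hx]

theorem re_ip_act_nonneg {H : X → Mat m} (hH : ∀ᵐ x ∂μ, ∀ ξ, 0 ≤ (inner ℂ ξ (act (H x) ξ)).re)
    {a : X → Cm m} (hi : Integrable (fun x => inner ℂ (a x) (act (H x) (a x))) μ) :
    0 ≤ (ip μ (fun x => act (H x) (a x)) a).re := by
  unfold ip
  have : (∫ x, inner ℂ (a x) (act (H x) (a x)) ∂μ).re =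
      ∫ x, (inner ℂ (a x) (act (H x) (a x))).re ∂μ := (integral_re hi).symm
  rw [this]
  exact integral_nonneg_of_ae (hH.mono fun x hx => hx _)

end SquareIntegrable

/-- The Cauchy–Schwarz inequality for a positive semidefinite Hermitian form. -/
theorem norm_form_le {V : Type*} [AddCommGroup V] [Module ℂ V] (B : V → V → ℂ)
    (hadd : ∀ x y z, B (x + y) z = B x z + B y z) (hsmul : ∀ (c : ℂ) x y, B (c • x) y = c * B x y)
    (hconj : ∀ x y, starRingEnd ℂ (B x y) = B y x) (hpos : ∀ x, 0 ≤ (B x x).re) (x y : V) :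
    ‖B x y‖ ≤ √(B x x).re * √(B y y).re := by
  let c : PreInnerProductSpace.Core ℂ V :=
    { inner := fun x y => B y x
      conj_inner_symm := fun x y => hconj _ _
      re_inner_nonneg := fun x => hpos x
      add_left := fun x y z => by
        rw [← hconj, hadd, map_add, hconj, hconj]
      smul_left := fun x y r => by
        rw [← hconj, hsmul, map_mul, hconj] }
  have := @InnerProductSpace.Core.norm_inner_le_norm ℂ V _ _ _ c y x
  rw [mul_comm]
  exact this

/-! ### Integration by parts for the fields of a Friedrichs system -/

theorem memLp_of_continuousOn {d : ℕ} {E : Type*} [NormedAddCommGroup E] {p : ENNReal}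
    {μ : Measure (Rd d)} {K Y : Set (Rd d)} {f : Rd d → E} (hK : IsCompact K) (hYK : Y ⊆ K)
    (hY : MeasurableSet Y) (hfin : μ Y < ⊤) (hf : ContinuousOn f K) : MemLp f p (μ.restrict Y) := by
  have : IsFiniteMeasure (μ.restrict Y) := ⟨by simpa using hfin⟩
  obtain ⟨C, hC⟩ := hK.exists_bound_of_continuousOn hf
  exact MemLp.of_bound ((hf.mono hYK).aestronglyMeasurable hY) C
    ((ae_restrict_iff' hY).mpr (Eventually.of_forall fun x hx => hC x (hYK hx)))

theorem inner_act_eq_sum {m : ℕ} (H : Mat m) (ξ η : Cm m) :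
    inner ℂ ξ (act H η) = ∑ a, ∑ b, starRingEnd ℂ (ξ a) * η b * H a b := by
  simp only [PiLp.inner_apply, RCLike.inner_apply, act_apply, Finset.sum_mul]
  refine Finset.sum_congr rfl fun a _ => Finset.sum_congr rfl fun b _ => ?_
  ring

section Fields

variable {d m : ℕ} {Ω : Set (Rd d)}

theorem IsPolytopalDomain.isCompact_closure (hΩ : IsPolytopalDomain Ω) : IsCompact (closure Ω) :=
  hΩ.1.isBounded.isCompact_closure

namespace System

variable (𝒮 : System d m Ω)

theorem continuousOn_A (i : Fin d) : ContinuousOn (𝒮.A i) (closure Ω) := by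
  obtain ⟨C, hC⟩ := 𝒮.A_holder i
  exact hC.continuousOn (by norm_num)

theorem continuousOn_A_entry (i : Fin d) (a b : Fin m) :
    ContinuousOn (fun x => 𝒮.A i x a b) (closure Ω) :=
  Continuous.comp_continuousOn (g := fun H : Mat m => H a b) (continuous_entry a b)
    (𝒮.continuousOn_A i)

theorem isHermitian_A (i : Fin d) {x : Rd d} (hx : x ∈ closure Ω) : (𝒮.A i x).IsHermitian := by
  ext a b
  have h : EqOn (fun x => star (𝒮.A i x b a)) (fun x => 𝒮.A i x a b) Ω := by
    intro x hx
    exact (𝒮.A_hermitian i x hx).apply a b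
  exact h.of_subset_closure (𝒮.continuousOn_A_entry i b a).star (𝒮.continuousOn_A_entry i a b)
    subset_closure subset_rfl hx

theorem continuousOn_normalTrace (ν : Rd d) :
    ContinuousOn (normalTrace 𝒮.A ν) (closure Ω) := by
  refine continuousOn_finsetSum _ fun i _ => ?_
  have h := (𝒮.continuousOn_A i).const_smul (ν i : ℂ)
  exact h

theorem isHermitian_normalTrace (ν : Rd d) {x : Rd d} (hx : x ∈ closure Ω) :
    (normalTrace 𝒮.A ν x).IsHermitian := by
  unfold normalTrace Matrix.IsHermitian
  rw [Matrix.conjTranspose_sum]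
  refine Finset.sum_congr rfl fun i _ => ?_
  rw [Matrix.conjTranspose_smul, (𝒮.isHermitian_A i hx).eq]
  simp

theorem continuousOn_dirDeriv {v : Rd d → Cm m} (hv : ContDiff ℝ ∞ v) :
    ContinuousOn (𝒮.dirDeriv v) (closure Ω) :=
  continuousOn_finsetSum _ fun i _ => continuousOn_act (𝒮.continuousOn_A i)
    ((hv.continuous_fderiv (by simp)).clm_apply continuous_const).continuousOn

theorem continuousOn_re_inner_act (i : Fin d) {v w : Rd d → Cm m} (hv : Continuous v)
    (hw : Continuous w) :
    ContinuousOn (fun x => (inner ℂ (v x) (act (𝒮.A i x) (w x))).re) (closure Ω) := by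
  refine Complex.continuous_re.comp_continuousOn ?_
  exact hv.continuousOn.inner (continuousOn_act (𝒮.continuousOn_A i) hw.continuousOn)

/-- The definition of the distributional divergence, tested with complex-valued functions. -/
theorem divA_weak_complex (hΩ : IsPolytopalDomain Ω) {ψ : Rd d → ℂ} (hψ : ContDiff ℝ ∞ ψ)
    (hc : HasCompactSupport ψ) (hs : tsupport ψ ⊆ Ω) (a b : Fin m) :
    ∫ x in Ω, ∑ i, fderiv ℝ ψ x (EuclideanSpace.single i 1) * 𝒮.A i x a b =
      - ∫ x in Ω, ψ x * 𝒮.divA x a b := by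
  have hfin : volume Ω < ⊤ := hΩ.volume_lt_top
  have hΩm : MeasurableSet Ω := hΩ.1.isOpen.measurableSet
  have : IsFiniteMeasure (volume.restrict Ω) := ⟨by simpa using hfin⟩
  have hdiv : Integrable (fun x => 𝒮.divA x a b) (volume.restrict Ω) := by
    have h1 := 𝒮.divA_bounded
    refine Integrable.of_bound
      (Continuous.comp_aestronglyMeasurable (g := fun H : Mat m => H a b) (continuous_entry a b)
        h1.1)
      (eLpNorm 𝒮.divA ⊤ (volume.restrict Ω)).toReal ?_
    filter_upwards [ae_norm_le_toReal h1] with x hx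
    exact (norm_entry_le _ _ _).trans hx
  -- the real and the imaginary part of `ψ` are real test functions
  have key : ∀ L : ℂ →L[ℝ] ℝ, ContDiff ℝ ∞ (fun x => L (ψ x)) ∧
      HasCompactSupport (fun x => L (ψ x)) ∧ tsupport (fun x => L (ψ x)) ⊆ Ω ∧
      (∀ x e, fderiv ℝ (fun x => L (ψ x)) x e = L (fderiv ℝ ψ x e)) ∧
      Integrable (fun x => ∑ i, (L (fderiv ℝ ψ x (EuclideanSpace.single i 1)) : ℂ) * 𝒮.A i x a b)
        (volume.restrict Ω) ∧
      Integrable (fun x => (L (ψ x) : ℂ) * 𝒮.divA x a b) (volume.restrict Ω) := by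
    intro L
    refine ⟨L.contDiff.comp hψ, hc.comp_left (map_zero L),
      (tsupport_comp_subset (map_zero L) ψ).trans hs, fun x e => ?_, ?_, ?_⟩
    · have h1 := L.hasFDerivAt.comp x (hψ.differentiable (by simp) x).hasFDerivAt
      have h2 : HasFDerivAt (fun x => L (ψ x)) _ x := h1
      rw [h2.fderiv]; rfl
    · refine memLp_one_iff_integrable.mp (memLp_of_continuousOn hΩ.isCompact_closure subset_closure
        hΩm hfin (continuousOn_finsetSum _ fun i _ => ?_))
      refine ContinuousOn.mul ?_ (𝒮.continuousOn_A_entry i a b)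
      refine (Complex.continuous_ofReal.comp (L.continuous.comp ?_)).continuousOn
      exact (hψ.continuous_fderiv (by simp)).clm_apply continuous_const
    · have hcont : Continuous fun x => (L (ψ x) : ℂ) :=
        Complex.continuous_ofReal.comp (L.continuous.comp hψ.continuous)
      obtain ⟨C, hC⟩ :=
        (hc.comp_left (g := fun z : ℂ => (L z : ℂ)) (by simp)).exists_bound_of_continuous hcont
      exact hdiv.bdd_mul (c := C) hcont.aestronglyMeasurable (Eventually.of_forall hC)
  obtain ⟨r1, r2, r3, r4, r5, r6⟩ := key Complex.reCLM
  obtain ⟨s1, s2, s3, s4, s5, s6⟩ := key Complex.imCLM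
  have hr := 𝒮.divA_weak _ r1 r2 r3 a b
  have hi := 𝒮.divA_weak _ s1 s2 s3 a b
  simp only [r4, s4] at hr hi
  have e1 : ∀ x, ∑ i, fderiv ℝ ψ x (EuclideanSpace.single i 1) * 𝒮.A i x a b =
      (∑ i, (Complex.reCLM (fderiv ℝ ψ x (EuclideanSpace.single i 1)) : ℂ) * 𝒮.A i x a b) +
      (∑ i, (Complex.imCLM (fderiv ℝ ψ x (EuclideanSpace.single i 1)) : ℂ) * 𝒮.A i x a b) *
        Complex.I := by
    intro x
    rw [Finset.sum_mul, ← Finset.sum_add_distrib]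
    refine Finset.sum_congr rfl fun i _ => ?_
    conv_lhs => rw [← Complex.re_add_im (fderiv ℝ ψ x (EuclideanSpace.single i 1))]
    simp only [Complex.reCLM_apply, Complex.imCLM_apply]
    ring
  have e2 : ∀ x, ψ x * 𝒮.divA x a b = (Complex.reCLM (ψ x) : ℂ) * 𝒮.divA x a b +
      (Complex.imCLM (ψ x) : ℂ) * 𝒮.divA x a b * Complex.I := by
    intro x
    conv_lhs => rw [← Complex.re_add_im (ψ x)]
    simp only [Complex.reCLM_apply, Complex.imCLM_apply]
    ring
  simp only [e1, e2]
  rw [integral_add r5 (s5.mul_const _), integral_add r6 (s6.mul_const _), integral_mul_const,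
    integral_mul_const, hr, hi]
  ring

/-- The vector field with components `Re (v^H A^i v)`. -/
def energyField (v : Rd d → Cm m) (x : Rd d) : Rd d :=
  WithLp.toLp 2 fun i => (inner ℂ (v x) (act (𝒮.A i x) (v x))).re

/-- The divergence of the energy field: `Re (v^H (∇·A) v) + 2 Re (v^H A_1 v)`. -/
def energyDiv (v : Rd d → Cm m) (x : Rd d) : ℝ :=
  (inner ℂ (v x) (act (𝒮.divA x) (v x))).re + 2 * (inner ℂ (v x) (𝒮.dirDeriv v x)).re

theorem continuousOn_energyField {v : Rd d → Cm m} (hv : Continuous v) :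
    ContinuousOn (𝒮.energyField v) (closure Ω) :=
  (PiLp.continuous_toLp 2 _).comp_continuousOn
    (continuousOn_pi.mpr fun i => 𝒮.continuousOn_re_inner_act i hv hv)

theorem integrable_inner_divA (hΩ : IsPolytopalDomain Ω) {v : Rd d → Cm m} (hv : Continuous v) :
    Integrable (fun x => inner ℂ (v x) (act (𝒮.divA x) (v x))) (volume.restrict Ω) := by
  have h2 : MemLp v 2 (volume.restrict Ω) := memLp_of_continuousOn hΩ.isCompact_closure
    subset_closure hΩ.1.isOpen.measurableSet hΩ.volume_lt_top hv.continuousOn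
  exact integrable_ip (memLp_act 𝒮.divA_bounded h2) h2

theorem integrable_inner_dirDeriv (hΩ : IsPolytopalDomain Ω) {v : Rd d → Cm m}
    (hv : ContDiff ℝ ∞ v) :
    Integrable (fun x => inner ℂ (v x) (𝒮.dirDeriv v x)) (volume.restrict Ω) :=
  memLp_one_iff_integrable.mp (memLp_of_continuousOn hΩ.isCompact_closure subset_closure
    hΩ.1.isOpen.measurableSet hΩ.volume_lt_top
    (hv.continuous.continuousOn.inner (𝒮.continuousOn_dirDeriv hv)))

/-- The weak divergence of the energy field is obtained by testing the divergence of the `A^i` with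
`φ conj(v_a) v_b`; the two terms in which the derivative falls on `v` or on `conj(v)` have the same
real part, since the `A^i` are Hermitian. -/
theorem hasWeakDiv_energyField (hΩ : IsPolytopalDomain Ω) {v : Rd d → Cm m} (hv : ContDiff ℝ ∞ v) :
    HasWeakDiv Ω (𝒮.energyField v) (𝒮.energyDiv v) := by
  intro φ hφ hc hs
  have hfin : volume Ω < ⊤ := hΩ.volume_lt_top
  have hΩm : MeasurableSet Ω := hΩ.1.isOpen.measurableSet
  have hva : ∀ a, ContDiff ℝ ∞ fun x => v x a := fun a => (contDiff_piLp 2).mp hv a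
  let w : Fin d → Rd d → Cm m := fun i x => fderiv ℝ v x (EuclideanSpace.single i 1)
  have hw : ∀ i, Continuous (w i) := fun i =>
    (hv.continuous_fderiv (by simp)).clm_apply continuous_const
  let ψ : Fin m → Fin m → Rd d → ℂ := fun a b x =>
    (φ x : ℂ) * (starRingEnd ℂ (v x a) * v x b)
  have hψ : ∀ a b, ContDiff ℝ ∞ (ψ a b) := fun a b =>
    (Complex.ofRealCLM.contDiff.comp hφ).mul
      ((Complex.conjCLE.contDiff.comp (hva a)).mul (hva b))
  have hψc : ∀ a b, HasCompactSupport (ψ a b) := fun a b =>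
    (hc.comp_left (g := fun r : ℝ => (r : ℂ)) (by simp)).mul_right
  have hψs : ∀ a b, tsupport (ψ a b) ⊆ Ω := fun a b =>
    (closure_mono (s := Function.support (ψ a b)) (t := Function.support φ)
      fun x hx h0 => hx (by simp [ψ, h0])).trans hs
  have hdψ : ∀ a b x i, fderiv ℝ (ψ a b) x (EuclideanSpace.single i 1) =
      (fderiv ℝ φ x (EuclideanSpace.single i 1) : ℂ) * (starRingEnd ℂ (v x a) * v x b) +
      (φ x : ℂ) * (starRingEnd ℂ (w i x a) * v x b + starRingEnd ℂ (v x a) * w i x b) := by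
    intro a b x i
    have h1 : HasFDerivAt (fun x => (φ x : ℂ)) _ x :=
      Complex.ofRealCLM.hasFDerivAt.comp x (hφ.differentiable (by simp) x).hasFDerivAt
    have h2 : HasFDerivAt (fun x => starRingEnd ℂ (v x a)) _ x :=
      Complex.conjCLE.hasFDerivAt.comp x ((hva a).differentiable (by simp) x).hasFDerivAt
    have h3 := ((hva b).differentiable (by simp) x).hasFDerivAt
    have h4 : HasFDerivAt (ψ a b) _ x := h1.mul (h2.mul h3)
    rw [h4.fderiv]
    simp only [w, fderiv_coord hv]
    simp [smul_eq_mul]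
    ring
  -- the sum over all entries of the tested identities
  have hsum := Finset.sum_congr (rfl : (Finset.univ : Finset (Fin m × Fin m)) = _) fun p _ =>
    𝒮.divA_weak_complex hΩ (hψ p.1 p.2) (hψc p.1 p.2) (hψs p.1 p.2) p.1 p.2
  have hint1 : ∀ p ∈ (Finset.univ : Finset (Fin m × Fin m)), Integrable (fun x =>
      ∑ i, fderiv ℝ (ψ p.1 p.2) x (EuclideanSpace.single i 1) * 𝒮.A i x p.1 p.2)
      (volume.restrict Ω) := fun p _ =>
    memLp_one_iff_integrable.mp (memLp_of_continuousOn hΩ.isCompact_closure subset_closure hΩm hfin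
      (continuousOn_finsetSum _ fun i _ => ContinuousOn.mul
        (((hψ p.1 p.2).continuous_fderiv (by simp)).clm_apply continuous_const).continuousOn
        (𝒮.continuousOn_A_entry i _ _)))
  have hint2 : ∀ p ∈ (Finset.univ : Finset (Fin m × Fin m)), Integrable (fun x =>
      ψ p.1 p.2 x * 𝒮.divA x p.1 p.2) (volume.restrict Ω) := by
    intro p _
    have : IsFiniteMeasure (volume.restrict Ω) := ⟨by simpa using hfin⟩
    obtain ⟨C, hC⟩ := (hψc p.1 p.2).exists_bound_of_continuous (hψ p.1 p.2).continuous
    refine Integrable.bdd_mul (c := C) ?_ (hψ p.1 p.2).continuous.aestronglyMeasurable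
      (Eventually.of_forall hC)
    have h1 := 𝒮.divA_bounded
    refine Integrable.of_bound
      (Continuous.comp_aestronglyMeasurable (g := fun H : Mat m => H p.1 p.2)
        (continuous_entry p.1 p.2) h1.1) (eLpNorm 𝒮.divA ⊤ (volume.restrict Ω)).toReal ?_
    filter_upwards [ae_norm_le_toReal h1] with x hx
    exact (norm_entry_le _ _ _).trans hx
  rw [Finset.sum_neg_distrib, ← integral_finsetSum _ hint1, ← integral_finsetSum _ hint2] at hsum
  have e1 : ∀ x, ∑ p : Fin m × Fin m, ψ p.1 p.2 x * 𝒮.divA x p.1 p.2 =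
      (φ x : ℂ) * inner ℂ (v x) (act (𝒮.divA x) (v x)) := by
    intro x
    rw [inner_act_eq_sum, Fintype.sum_prod_type, Finset.mul_sum]
    refine Finset.sum_congr rfl fun a _ => ?_
    rw [Finset.mul_sum]
    refine Finset.sum_congr rfl fun b _ => ?_
    simp only [ψ]; ring
  have e2 : ∀ x, ∑ p : Fin m × Fin m,
      ∑ i, fderiv ℝ (ψ p.1 p.2) x (EuclideanSpace.single i 1) * 𝒮.A i x p.1 p.2 =
      ∑ i, ((fderiv ℝ φ x (EuclideanSpace.single i 1) : ℂ) * inner ℂ (v x) (act (𝒮.A i x) (v x)) +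
        (φ x : ℂ) * (inner ℂ (w i x) (act (𝒮.A i x) (v x)) +
          inner ℂ (v x) (act (𝒮.A i x) (w i x)))) := by
    intro x
    rw [Finset.sum_comm]
    refine Finset.sum_congr rfl fun i _ => ?_
    simp only [inner_act_eq_sum, Fintype.sum_prod_type, ← Finset.sum_add_distrib, Finset.mul_sum]
    refine Finset.sum_congr rfl fun a _ => Finset.sum_congr rfl fun b _ => ?_
    rw [hdψ]; ring
  simp only [e1, e2] at hsum hint1 hint2
  have hint1' : Integrable (fun x =>
      ∑ i, ((fderiv ℝ φ x (EuclideanSpace.single i 1) : ℂ) * inner ℂ (v x) (act (𝒮.A i x) (v x)) +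
        (φ x : ℂ) * (inner ℂ (w i x) (act (𝒮.A i x) (v x)) +
          inner ℂ (v x) (act (𝒮.A i x) (w i x))))) (volume.restrict Ω) :=
    (integrable_finsetSum _ hint1).congr (Eventually.of_forall e2)
  have hint2' : Integrable (fun x => (φ x : ℂ) * inner ℂ (v x) (act (𝒮.divA x) (v x)))
      (volume.restrict Ω) := (integrable_finsetSum _ hint2).congr (Eventually.of_forall e1)
  -- take real parts; the terms with a derivative of `v` combine to `2 Re (v^H A_1 v)`
  have hre := congrArg Complex.re hsum
  rw [Complex.neg_re] at hre
  rw [show (∫ x in Ω, (φ x : ℂ) * inner ℂ (v x) (act (𝒮.divA x) (v x))).re = _ from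
    (integral_re hint2').symm] at hre
  rw [show (∫ x in Ω, ∑ i, ((fderiv ℝ φ x (EuclideanSpace.single i 1) : ℂ) *
      inner ℂ (v x) (act (𝒮.A i x) (v x)) + (φ x : ℂ) * (inner ℂ (w i x) (act (𝒮.A i x) (v x)) +
          inner ℂ (v x) (act (𝒮.A i x) (w i x))))).re = _ from
    (integral_re hint1').symm] at hre
  have e3 : ∀ x ∈ Ω, RCLike.re (∑ i, ((fderiv ℝ φ x (EuclideanSpace.single i 1) : ℂ) *
      inner ℂ (v x) (act (𝒮.A i x) (v x)) + (φ x : ℂ) * (inner ℂ (w i x) (act (𝒮.A i x) (v x)) +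
          inner ℂ (v x) (act (𝒮.A i x) (w i x))))) =
      fderiv ℝ φ x (𝒮.energyField v x) + φ x * (2 * (inner ℂ (v x) (𝒮.dirDeriv v x)).re) := by
    intro x hx
    have h1 : 𝒮.energyField v x = ∑ i, (inner ℂ (v x) (act (𝒮.A i x) (v x))).re •
        EuclideanSpace.single i (1 : ℝ) := by
      ext j
      simp [energyField, Finset.sum_apply, Pi.single_apply]
    rw [h1, map_sum, map_sum]
    unfold dirDeriv
    rw [inner_sum, Complex.re_sum, Finset.mul_sum, Finset.mul_sum, ← Finset.sum_add_distrib]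
    refine Finset.sum_congr rfl fun i _ => ?_
    have h2 : (inner ℂ (w i x) (act (𝒮.A i x) (v x))).re =
        (inner ℂ (v x) (act (𝒮.A i x) (w i x))).re := by
      rw [inner_act_comm (𝒮.A_hermitian i x hx), ← inner_conj_symm, Complex.conj_re]
    simp only [map_smul, smul_eq_mul, Complex.add_re, RCLike.re_to_complex, Complex.re_ofReal_mul,
      h2, w]
    ring
  rw [setIntegral_congr_fun hΩm e3] at hre
  have hφc : ContinuousOn (fun x => fderiv ℝ φ x (𝒮.energyField v x)) (closure Ω) :=
    (hφ.continuous_fderiv (by simp)).continuousOn.clm_apply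
      (𝒮.continuousOn_energyField hv.continuous)
  have i1 : Integrable (fun x => fderiv ℝ φ x (𝒮.energyField v x)) (volume.restrict Ω) :=
    memLp_one_iff_integrable.mp
      (memLp_of_continuousOn hΩ.isCompact_closure subset_closure hΩm hfin hφc)
  have i2 : Integrable (fun x => φ x * (2 * (inner ℂ (v x) (𝒮.dirDeriv v x)).re))
      (volume.restrict Ω) :=
    memLp_one_iff_integrable.mp
      (memLp_of_continuousOn hΩ.isCompact_closure subset_closure hΩm hfin
        (hφ.continuous.continuousOn.mul (continuousOn_const.mul
          (Complex.continuous_re.comp_continuousOn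
            (hv.continuous.continuousOn.inner (𝒮.continuousOn_dirDeriv hv))))))
  have i3 : Integrable (fun x => RCLike.re ((φ x : ℂ) * inner ℂ (v x) (act (𝒮.divA x) (v x))))
      (volume.restrict Ω) := hint2'.re
  rw [integral_add i1 i2] at hre
  have e4 : ∀ x, φ x * 𝒮.energyDiv v x =
      RCLike.re ((φ x : ℂ) * inner ℂ (v x) (act (𝒮.divA x) (v x))) +
      φ x * (2 * (inner ℂ (v x) (𝒮.dirDeriv v x)).re) := by
    intro x
    simp only [energyDiv, RCLike.re_to_complex, Complex.re_ofReal_mul]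
    ring
  simp only [e4]
  rw [integral_add i3 i2]
  linarith

/-- The real part of the integration by parts formula on a mesh element: the divergence theorem for
the energy field. -/
theorem integration_by_parts (hd : 0 < d) (hΩ : IsPolytopalDomain Ω) (ℳ : PolytopalMesh d Ω)
    (T : ℳ.cells) {v : Rd d → Cm m} (hv : ContDiff ℝ ∞ v) :
    (cellInner (T : Set (Rd d)) (fun x => act (𝒮.divA x) (v x)) v).re +
      2 * (cellInner (T : Set (Rd d)) (𝒮.dirDeriv v) v).re =
    ∑ F ∈ ℳ.cellFaces T, ℳ.orient T F *
      (faceInner (F : Set (Rd d)) (fun x => act (𝒮.NF F x) (v x)) v).re := by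
  have j1 := 𝒮.integrable_inner_divA hΩ hv.continuous
  have j2 := 𝒮.integrable_inner_dirDeriv hΩ hv
  have hT := ℳ.cell_subset hΩ.1 T
  have k1 : Integrable (fun x => inner ℂ (v x) (act (𝒮.divA x) (v x)))
    (volume.restrict (T : Set (Rd d))) := IntegrableOn.mono_set j1 hT
  have k2 : Integrable (fun x => inner ℂ (v x) (𝒮.dirDeriv v x))
    (volume.restrict (T : Set (Rd d))) := IntegrableOn.mono_set j2 hT
  have h := ℳ.cell_divergence hd hΩ.1 T (𝒮.continuousOn_energyField hv.continuous)
    (g := 𝒮.energyDiv v) (j1.re.add (j2.re.const_mul 2)) (𝒮.hasWeakDiv_energyField hΩ hv)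
  have e1 : ∫ x in (T : Set (Rd d)), 𝒮.energyDiv v x =
      (cellInner (T : Set (Rd d)) (fun x => act (𝒮.divA x) (v x)) v).re +
      2 * (cellInner (T : Set (Rd d)) (𝒮.dirDeriv v) v).re := by
    unfold cellInner
    rw [show (∫ x in (T : Set (Rd d)), inner ℂ (v x) (act (𝒮.divA x) (v x))).re = _ from
      (integral_re k1).symm,
      show (∫ x in (T : Set (Rd d)), inner ℂ (v x) (𝒮.dirDeriv v x)).re = _ from
        (integral_re k2).symm, ← integral_const_mul, ← integral_add k1.re (k2.re.const_mul 2)]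
    rfl
  rw [← e1, h]
  refine Finset.sum_congr rfl fun F hF => ?_
  congr 1
  have hFc : (F : Set (Rd d)) ⊆ closure Ω :=
    (ℳ.mem_cellFaces.mp hF).trans (frontier_subset_closure.trans (ℳ.closure_cell_subset T))
  have k3 : Integrable (fun x => inner ℂ (v x) (act (𝒮.NF F x) (v x)))
      ((surf d).restrict (F : Set (Rd d))) :=
    memLp_one_iff_integrable.mp (memLp_of_continuousOn hΩ.isCompact_closure hFc
      (ℳ.face_measurableSet F) (ℳ.surf_face_lt_top F) (hv.continuous.continuousOn.inner
        (continuousOn_act (𝒮.continuousOn_normalTrace (ℳ.normal F)) hv.continuous.continuousOn)))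
  unfold faceInner
  rw [show (∫ x in (F : Set (Rd d)), inner ℂ (v x) (act (𝒮.NF F x) (v x)) ∂(surf d)).re = _ from
    (integral_re k3).symm]
  congr 1
  ext x
  unfold NF normalTrace
  rw [act_sum_left, inner_sum]
  simp only [energyField, PiLp.inner_apply, RCLike.inner_apply, conj_trivial, act_smul_left,
    inner_smul_right, RCLike.re_to_complex, Complex.re_sum, Complex.re_ofReal_mul]
  refine Finset.sum_congr rfl fun i _ => mul_comm _ _

end System

end Fields

/-! ### The discrete forms -/

/-- `B` is linear in its first argument and conjugate-linear in the second one. -/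
structure IsSesquilinear {V : Type*} [AddCommGroup V] [Module ℂ V] (B : V → V → ℂ) : Prop where
  add_left : ∀ x y z, B (x + y) z = B x z + B y z
  smul_left : ∀ (c : ℂ) x y, B (c • x) y = c * B x y
  add_right : ∀ x y z, B x (y + z) = B x y + B x z
  smul_right : ∀ (c : ℂ) x y, B x (c • y) = starRingEnd ℂ c * B x y

namespace IsSesquilinear

variable {V : Type*} [AddCommGroup V] [Module ℂ V] {B B' : V → V → ℂ}

theorem add (h : IsSesquilinear B) (h' : IsSesquilinear B') :
    IsSesquilinear fun x y => B x y + B' x y where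
  add_left x y z := by rw [h.add_left, h'.add_left]; ring
  smul_left c x y := by rw [h.smul_left, h'.smul_left]; ring
  add_right x y z := by rw [h.add_right, h'.add_right]; ring
  smul_right c x y := by rw [h.smul_right, h'.smul_right]; ring

theorem const_mul (h : IsSesquilinear B) (a : ℂ) : IsSesquilinear fun x y => a * B x y where
  add_left x y z := by rw [h.add_left]; ring
  smul_left c x y := by rw [h.smul_left]; ring
  add_right x y z := by rw [h.add_right]; ring
  smul_right c x y := by rw [h.smul_right]; ring

theorem conj_swap (h : IsSesquilinear B) : IsSesquilinear fun x y => starRingEnd ℂ (B y x) where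
  add_left x y z := by rw [h.add_right, map_add]
  smul_left c x y := by rw [h.smul_right, map_mul, Complex.conj_conj]
  add_right x y z := by rw [h.add_left, map_add]
  smul_right c x y := by rw [h.smul_left, map_mul]

theorem sum {ι : Type*} (s : Finset ι) {B : ι → V → V → ℂ} (h : ∀ i ∈ s, IsSesquilinear (B i)) :
    IsSesquilinear fun x y => ∑ i ∈ s, B i x y where
  add_left x y z := by
    rw [← Finset.sum_add_distrib]
    exact Finset.sum_congr rfl fun i hi => (h i hi).add_left x y z
  smul_left c x y := by
    rw [Finset.mul_sum]
    exact Finset.sum_congr rfl fun i hi => (h i hi).smul_left c x y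
  add_right x y z := by
    rw [← Finset.sum_add_distrib]
    exact Finset.sum_congr rfl fun i hi => (h i hi).add_right x y z
  smul_right c x y := by
    rw [Finset.mul_sum]
    exact Finset.sum_congr rfl fun i hi => (h i hi).smul_right c x y

theorem of_ip {X : Type*} [MeasurableSpace X] {m : ℕ} {μ : Measure X} {L L' : V → X → Cm m}
    (hL : IsLinearMap ℂ L) (hL' : IsLinearMap ℂ L') (h : ∀ v, MemLp (L v) 2 μ)
    (h' : ∀ v, MemLp (L' v) 2 μ) : IsSesquilinear fun x y => ip μ (L x) (L' y) where
  add_left x y z := by rw [hL.map_add]; exact ip_add_left (h x) (h y) (h' z)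
  smul_left c x y := by rw [hL.map_smul]; exact ip_smul_left c _ _
  add_right x y z := by rw [hL'.map_add]; exact ip_add_right (h x) (h' y) (h' z)
  smul_right c x y := by rw [hL'.map_smul]; exact ip_smul_right c _ _

/-- On a finite-dimensional space, a linear functional is bounded with respect to the norm given by
a positive definite Hermitian form. -/
theorem exists_bound [FiniteDimensional ℂ V] (h : IsSesquilinear B)
    (hconj : ∀ x y, starRingEnd ℂ (B x y) = B y x) (hpos : ∀ x, 0 ≤ (B x x).re)
    (hdef : ∀ x, (B x x).re = 0 → x = 0) (ℓ : V →ₗ[ℂ] ℂ) :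
    ∃ C : ℝ, ∀ x, ‖ℓ x‖ ≤ C * √(B x x).re := by
  let c : InnerProductSpace.Core ℂ V :=
    { inner := fun x y => B y x
      conj_inner_symm := fun x y => hconj _ _
      re_inner_nonneg := fun x => hpos x
      add_left := fun x y z => h.add_right _ _ _
      smul_left := fun x y r => h.smul_right _ _ _
      definite := fun x hx => hdef x (by
        have : B x x = 0 := hx
        rw [this]; rfl) }
  let _ : NormedAddCommGroup V := c.toNormedAddCommGroup
  let _ : InnerProductSpace ℂ V := InnerProductSpace.ofCore c.toCore
  refine ⟨‖LinearMap.toContinuousLinearMap ℓ‖, fun x => ?_⟩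
  exact (LinearMap.toContinuousLinearMap ℓ).le_opNorm x

end IsSesquilinear

section Linear

variable {d m k : ℕ} {Ω : Set (Rd d)} {ℳ : PolytopalMesh d Ω}

theorem isLinearMap_act {V X : Type*} [AddCommGroup V] [Module ℂ V] {L : V → X → Cm m}
    (hL : IsLinearMap ℂ L) (H : X → Mat m) : IsLinearMap ℂ fun v x => act (H x) (L v x) where
  map_add v w := by ext1 x; rw [hL.map_add]; exact act_add _ _ _
  map_smul c v := by ext1 x; rw [hL.map_smul]; exact act_smul _ _ _

theorem isLinearMap_cellVal (T : ℳ.cells) :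
    IsLinearMap ℂ fun v : HybridSpace ℳ m k => cellVal v T := ⟨fun _ _ => rfl, fun _ _ => rfl⟩

theorem isLinearMap_faceVal (F : ℳ.faces) :
    IsLinearMap ℂ fun v : HybridSpace ℳ m k => faceVal v F := ⟨fun _ _ => rfl, fun _ _ => rfl⟩

theorem isLinearMap_jump (T : ℳ.cells) (F : ℳ.faces) :
    IsLinearMap ℂ fun v : HybridSpace ℳ m k => jump v T F where
  map_add v w := by
    ext1 x
    change (faceVal v F x + faceVal w F x) - (cellVal v T x + cellVal w T x) =
      (faceVal v F x - cellVal v T x) + (faceVal w F x - cellVal w T x)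
    abel
  map_smul c v := by
    ext1 x
    exact (smul_sub c (faceVal v F x) (cellVal v T x)).symm

theorem isLinearMap_avg (T : ℳ.cells) (F : ℳ.faces) :
    IsLinearMap ℂ fun v : HybridSpace ℳ m k => avg v T F where
  map_add v w := by
    ext1 x
    change (2⁻¹ : ℂ) • ((faceVal v F x + faceVal w F x) + (cellVal v T x + cellVal w T x)) =
      (2⁻¹ : ℂ) • (faceVal v F x + cellVal v T x) + (2⁻¹ : ℂ) • (faceVal w F x + cellVal w T x)
    module
  map_smul c v := by
    ext1 x
    change (2⁻¹ : ℂ) • (c • faceVal v F x + c • cellVal v T x) =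
      c • ((2⁻¹ : ℂ) • (faceVal v F x + cellVal v T x))
    module

theorem contDiff_cellVal (v : HybridSpace ℳ m k) (T : ℳ.cells) : ContDiff ℝ ∞ (cellVal v T) :=
  contDiff_of_mem_polySpace (v.1 T).2

theorem System.dirDeriv_add (𝒮 : System d m Ω) {v w : Rd d → Cm m} (hv : ContDiff ℝ ∞ v)
    (hw : ContDiff ℝ ∞ w) (x : Rd d) :
    𝒮.dirDeriv (v + w) x = 𝒮.dirDeriv v x + 𝒮.dirDeriv w x := by
  unfold dirDeriv
  rw [fderiv_add (hv.differentiable (by simp) x) (hw.differentiable (by simp) x),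
    ← Finset.sum_add_distrib]
  exact Finset.sum_congr rfl fun i _ => act_add _ _ _

theorem System.dirDeriv_smul (𝒮 : System d m Ω) (c : ℂ) {v : Rd d → Cm m} (hv : ContDiff ℝ ∞ v)
    (x : Rd d) : 𝒮.dirDeriv (c • v) x = c • 𝒮.dirDeriv v x := by
  unfold dirDeriv
  rw [fderiv_const_smul (hv.differentiable (by simp) x), Finset.smul_sum]
  exact Finset.sum_congr rfl fun i _ => act_smul _ _ _

theorem isLinearMap_dirDeriv (𝒮 : System d m Ω) (T : ℳ.cells) :
    IsLinearMap ℂ fun v : HybridSpace ℳ m k => 𝒮.dirDeriv (cellVal v T) where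
  map_add v w := by
    ext1 x; exact 𝒮.dirDeriv_add (contDiff_cellVal v T) (contDiff_cellVal w T) x
  map_smul c v := by ext1 x; exact 𝒮.dirDeriv_smul c (contDiff_cellVal v T) x

theorem isLinearMap_op (𝒮 : System d m Ω) (T : ℳ.cells) :
    IsLinearMap ℂ fun v : HybridSpace ℳ m k => 𝒮.op (cellVal v T) where
  map_add v w := by
    ext1 x
    have h := congrFun ((isLinearMap_dirDeriv (k := k) 𝒮 T).map_add v w) x
    change act (𝒮.K x) (cellVal v T x + cellVal w T x) + _ =
      (act (𝒮.K x) (cellVal v T x) + 𝒮.dirDeriv (cellVal v T) x) +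
        (act (𝒮.K x) (cellVal w T x) + 𝒮.dirDeriv (cellVal w T) x)
    rw [h, act_add]
    simp only [Pi.add_apply]
    abel
  map_smul c v := by
    ext1 x
    have h := congrFun ((isLinearMap_dirDeriv (k := k) 𝒮 T).map_smul c v) x
    change act (𝒮.K x) (c • cellVal v T x) + _ =
      c • (act (𝒮.K x) (cellVal v T x) + 𝒮.dirDeriv (cellVal v T) x)
    rw [h, act_smul, smul_add]
    rfl

end Linear

section Membership

variable {d m k : ℕ} {Ω : Set (Rd d)}

theorem PolytopalMesh.face_subset_closure (ℳ : PolytopalMesh d Ω) (F : ℳ.faces) :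
    (F : Set (Rd d)) ⊆ closure Ω := by
  obtain ⟨T, hT⟩ := ℳ.exists_cell_of_face F
  exact (ℳ.mem_cellFaces.mp hT).trans (frontier_subset_closure.trans (ℳ.closure_cell_subset T))

variable {ℳ : PolytopalMesh d Ω}

section

variable {E : Type*} [NormedAddCommGroup E] {p : ENNReal}

theorem memLp_cell (hΩ : IsPolytopalDomain Ω) (T : ℳ.cells) {f : Rd d → E}
    (hf : ContinuousOn f (closure Ω)) :
    MemLp f p (volume.restrict (T : Set (Rd d))) :=
  memLp_of_continuousOn hΩ.isCompact_closure ((ℳ.cell_subset hΩ.1 T).trans subset_closure)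
    (ℳ.cell_isOpen T).measurableSet (ℳ.cell_volume_lt_top T) hf

theorem memLp_face (hΩ : IsPolytopalDomain Ω) (F : ℳ.faces) {f : Rd d → E}
    (hf : ContinuousOn f (closure Ω)) :
    MemLp f p ((surf d).restrict (F : Set (Rd d))) :=
  memLp_of_continuousOn hΩ.isCompact_closure (ℳ.face_subset_closure F)
    (ℳ.face_measurableSet F) (ℳ.surf_face_lt_top F) hf

end

theorem memLp_cellVal (hΩ : IsPolytopalDomain Ω) (v : HybridSpace ℳ m k) (T : ℳ.cells) :
    MemLp (cellVal v T) 2 (volume.restrict (T : Set (Rd d))) :=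
  memLp_cell hΩ T (contDiff_cellVal v T).continuous.continuousOn

theorem memLp_cellVal_face (hΩ : IsPolytopalDomain Ω) (v : HybridSpace ℳ m k) (T : ℳ.cells)
    (F : ℳ.faces) : MemLp (cellVal v T) 2 ((surf d).restrict (F : Set (Rd d))) :=
  memLp_face hΩ F (contDiff_cellVal v T).continuous.continuousOn

theorem memLp_of_mem_facePolySpace (hΩ : IsPolytopalDomain Ω) (F : ℳ.faces) {v : Rd d → Cm m}
    (hv : v ∈ facePolySpace d m k (F : Set (Rd d))) :
    MemLp v 2 ((surf d).restrict (F : Set (Rd d))) := by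
  obtain ⟨p, hp, rfl⟩ := hv
  refine (memLp_face hΩ F (contDiff_of_mem_polySpace hp).continuous.continuousOn).ae_eq ?_
  filter_upwards [ae_restrict_mem (ℳ.face_measurableSet F)] with x hx
  rw [indicator_of_mem hx]

theorem memLp_faceVal (hΩ : IsPolytopalDomain Ω) (v : HybridSpace ℳ m k) (F : ℳ.faces) :
    MemLp (faceVal v F) 2 ((surf d).restrict (F : Set (Rd d))) :=
  memLp_of_mem_facePolySpace hΩ F (v.2 F).2

theorem memLp_jump (hΩ : IsPolytopalDomain Ω) (v : HybridSpace ℳ m k) (T : ℳ.cells) (F : ℳ.faces) :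
    MemLp (jump v T F) 2 ((surf d).restrict (F : Set (Rd d))) :=
  (memLp_faceVal hΩ v F).sub (memLp_cellVal_face hΩ v T F)

theorem memLp_avg (hΩ : IsPolytopalDomain Ω) (v : HybridSpace ℳ m k) (T : ℳ.cells) (F : ℳ.faces) :
    MemLp (avg v T F) 2 ((surf d).restrict (F : Set (Rd d))) :=
  ((memLp_faceVal hΩ v F).add (memLp_cellVal_face hΩ v T F)).const_smul (2⁻¹ : ℂ)

variable (𝒮 : System d m Ω)

theorem System.memLp_A (hΩ : IsPolytopalDomain Ω) (T : ℳ.cells) (i : Fin d) :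
    MemLp (𝒮.A i) ⊤ (volume.restrict (T : Set (Rd d))) :=
  memLp_cell hΩ T (𝒮.continuousOn_A i)

theorem System.memLp_NF (hΩ : IsPolytopalDomain Ω) (F : ℳ.faces) :
    MemLp (𝒮.NF F) ⊤ ((surf d).restrict (F : Set (Rd d))) :=
  memLp_face hΩ F (𝒮.continuousOn_normalTrace _)

theorem System.memLp_K (hΩ : IsPolytopalDomain Ω) (T : ℳ.cells) :
    MemLp 𝒮.K ⊤ (volume.restrict (T : Set (Rd d))) :=
  𝒮.K_bounded.mono_measure (Measure.restrict_mono_set _ (ℳ.cell_subset hΩ.1 T))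

theorem System.memLp_divA (hΩ : IsPolytopalDomain Ω) (T : ℳ.cells) :
    MemLp 𝒮.divA ⊤ (volume.restrict (T : Set (Rd d))) :=
  𝒮.divA_bounded.mono_measure (Measure.restrict_mono_set _ (ℳ.cell_subset hΩ.1 T))

theorem System.memLp_M {F : ℳ.faces} (hF : F ∈ ℳ.bdryFaces) :
    MemLp 𝒮.M ⊤ ((surf d).restrict (F : Set (Rd d))) :=
  𝒮.M_bounded.mono_measure (Measure.restrict_mono_set _ (ℳ.mem_bdryFaces.mp hF))

theorem System.memLp_dirDeriv (hΩ : IsPolytopalDomain Ω) (v : HybridSpace ℳ m k) (T : ℳ.cells) :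
    MemLp (𝒮.dirDeriv (cellVal v T)) 2 (volume.restrict (T : Set (Rd d))) :=
  memLp_cell hΩ T (𝒮.continuousOn_dirDeriv (contDiff_cellVal v T))

theorem System.memLp_op (hΩ : IsPolytopalDomain Ω) (v : HybridSpace ℳ m k) (T : ℳ.cells) :
    MemLp (𝒮.op (cellVal v T)) 2 (volume.restrict (T : Set (Rd d))) :=
  (memLp_act (𝒮.memLp_K hΩ T) (memLp_cellVal hΩ v T)).add (𝒮.memLp_dirDeriv hΩ v T)

theorem System.ae_isHermitian_NF (F : ℳ.faces) :
    ∀ᵐ x ∂((surf d).restrict (F : Set (Rd d))), (𝒮.NF F x).IsHermitian := by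
  filter_upwards [ae_restrict_mem (ℳ.face_measurableSet F)] with x hx
  exact 𝒮.isHermitian_normalTrace _ (ℳ.face_subset_closure F hx)

end Membership

section Forms

variable {d m k : ℕ} {Ω : Set (Rd d)} {ℳ : PolytopalMesh d Ω} {𝒮 : System d m Ω}
  {S : Stabilization ℳ m} {CS : ℝ}

theorem isSesquilinear_jh (hΩ : IsPolytopalDomain Ω) (hS : StabilizationAssumption 𝒮 S k CS) :
    IsSesquilinear (jh (k := k) S) :=
  IsSesquilinear.sum _ fun T _ => IsSesquilinear.sum _ fun F hF =>
    IsSesquilinear.of_ip (isLinearMap_act (isLinearMap_jump T F) _) (isLinearMap_jump T F)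
      (fun v => memLp_act (hS.Si_bounded T F hF) (memLp_jump hΩ v T F))
      (fun v => memLp_jump hΩ v T F)

theorem isSesquilinear_ah (hΩ : IsPolytopalDomain Ω) (hS : StabilizationAssumption 𝒮 S k CS) :
    IsSesquilinear (ah (k := k) 𝒮 S) := by
  refine ((((IsSesquilinear.sum _ fun T _ => ?_).add (IsSesquilinear.const_mul
    (IsSesquilinear.sum _ fun T _ => IsSesquilinear.const_mul
      (IsSesquilinear.sum _ fun F _ => ?_) _) _)).add
    (IsSesquilinear.sum _ fun T _ => IsSesquilinear.sum _ fun F _ =>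
      IsSesquilinear.const_mul ?_ _)).add
    (IsSesquilinear.const_mul (IsSesquilinear.sum _ fun F hF => ?_) _)).add
    (isSesquilinear_jh hΩ hS)
  · exact IsSesquilinear.of_ip (isLinearMap_op 𝒮 T) (isLinearMap_cellVal T)
      (fun v => 𝒮.memLp_op hΩ v T) (fun v => memLp_cellVal hΩ v T)
  · exact IsSesquilinear.of_ip (isLinearMap_jump T F) (isLinearMap_jump T F)
      (fun v => memLp_jump hΩ v T F) (fun v => memLp_jump hΩ v T F)
  · exact IsSesquilinear.of_ip (isLinearMap_act (isLinearMap_jump T F) _) (isLinearMap_avg T F)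
      (fun v => memLp_act (𝒮.memLp_NF hΩ F) (memLp_jump hΩ v T F))
      (fun v => memLp_avg hΩ v T F)
  · exact IsSesquilinear.of_ip (isLinearMap_act (isLinearMap_faceVal F) _) (isLinearMap_faceVal F)
      (fun v => memLp_act (((𝒮.memLp_M hF).add (hS.Sb_bounded F hF)).sub (𝒮.memLp_NF hΩ F))
        (memLp_faceVal hΩ v F))
      (fun v => memLp_faceVal hΩ v F)

variable (𝒮 S)

/-- The contribution of the boundary faces to the norms; `M` need not be Hermitian. -/
def bdryForm (w v : HybridSpace ℳ m k) : ℂ :=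
  ∑ F ∈ ℳ.bdryFaces, faceInner (F : Set (Rd d))
    (fun x => act (𝒮.M x + S.Sb F x) (faceVal w F x)) (faceVal v F)

/-- The Hermitian form associated with the norm `‖·‖_h`. -/
def tForm (w v : HybridSpace ℳ m k) : ℂ :=
  (𝒮.rlow : ℂ) * ∑ T : ℳ.cells, (cellInner (T : Set (Rd d)) (cellVal w T) (cellVal v T) +
      (ℳ.diam T : ℂ) * ∑ F ∈ ℳ.cellFaces T, faceInner (F : Set (Rd d)) (jump w T F) (jump v T F))
    + (4⁻¹ : ℝ) * (bdryForm 𝒮 S w v + starRingEnd ℂ (bdryForm 𝒮 S v w)) + jh S w v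
    + ∑ T : ℳ.cells, (𝒮.tref T : ℂ) * cellInner (T : Set (Rd d))
        (𝒮.dirDeriv (cellVal w T)) (𝒮.dirDeriv (cellVal v T))

variable {𝒮 S}

theorem isSesquilinear_tForm (hΩ : IsPolytopalDomain Ω) (hS : StabilizationAssumption 𝒮 S k CS) :
    IsSesquilinear (tForm (k := k) 𝒮 S) := by
  have hb : IsSesquilinear (bdryForm (k := k) 𝒮 S) := IsSesquilinear.sum _ fun F hF =>
    IsSesquilinear.of_ip (isLinearMap_act (isLinearMap_faceVal F) _) (isLinearMap_faceVal F)
      (fun v => memLp_act ((𝒮.memLp_M hF).add (hS.Sb_bounded F hF)) (memLp_faceVal hΩ v F))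
      (fun v => memLp_faceVal hΩ v F)
  refine (((IsSesquilinear.const_mul (IsSesquilinear.sum _ fun T _ => IsSesquilinear.add ?_
    (IsSesquilinear.const_mul (IsSesquilinear.sum _ fun F _ => ?_) _)) _).add
    (IsSesquilinear.const_mul (hb.add hb.conj_swap) _)).add (isSesquilinear_jh hΩ hS)).add
    (IsSesquilinear.sum _ fun T _ => IsSesquilinear.const_mul ?_ _)
  · exact IsSesquilinear.of_ip (isLinearMap_cellVal T) (isLinearMap_cellVal T)
      (fun v => memLp_cellVal hΩ v T) (fun v => memLp_cellVal hΩ v T)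
  · exact IsSesquilinear.of_ip (isLinearMap_jump T F) (isLinearMap_jump T F)
      (fun v => memLp_jump hΩ v T F) (fun v => memLp_jump hΩ v T F)
  · exact IsSesquilinear.of_ip (isLinearMap_dirDeriv 𝒮 T) (isLinearMap_dirDeriv 𝒮 T)
      (fun v => 𝒮.memLp_dirDeriv hΩ v T) (fun v => 𝒮.memLp_dirDeriv hΩ v T)

theorem jh_conj (hS : StabilizationAssumption 𝒮 S k CS) (w v : HybridSpace ℳ m k) :
    starRingEnd ℂ (jh S w v) = jh S v w := by
  unfold jh
  rw [map_sum]
  refine Finset.sum_congr rfl fun T _ => ?_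
  rw [map_sum]
  refine Finset.sum_congr rfl fun F hF => ?_
  exact ip_act_conj ((hS.Si_positive T F hF).mono fun x hx => hx.1) _ _

theorem tForm_conj (hS : StabilizationAssumption 𝒮 S k CS) (w v : HybridSpace ℳ m k) :
    starRingEnd ℂ (tForm 𝒮 S w v) = tForm 𝒮 S v w := by
  have h1 : ∀ (Y : Set (Rd d)) (a b : Rd d → Cm m),
      starRingEnd ℂ (cellInner Y a b) = cellInner Y b a := fun Y a b => ip_conj a b
  have h2 : ∀ (Y : Set (Rd d)) (a b : Rd d → Cm m),
      starRingEnd ℂ (faceInner Y a b) = faceInner Y b a := fun Y a b => ip_conj a b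
  unfold tForm
  simp only [map_add, map_mul, map_sum, Complex.conj_ofReal, Complex.conj_conj, jh_conj hS, h1, h2]
  rw [add_comm (starRingEnd ℂ (bdryForm 𝒮 S w v))]

theorem re_tForm_self (v : HybridSpace ℳ m k) :
    (tForm 𝒮 S v v).re = flatNormSq 𝒮 S v +
      ∑ T : ℳ.cells, 𝒮.tref T * cellNormSq (T : Set (Rd d)) (𝒮.dirDeriv (cellVal v T)) := by
  have h1 : ∀ (Y : Set (Rd d)) (a : Rd d → Cm m), cellInner Y a a = (cellNormSq Y a : ℂ) :=
    fun Y a => ip_self a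
  have h2 : ∀ (Y : Set (Rd d)) (a : Rd d → Cm m), faceInner Y a a = (faceNormSq Y a : ℂ) :=
    fun Y a => ip_self a
  have h3 : (bdryForm 𝒮 S v v).re = bdrySeminormSq 𝒮 S v := Complex.re_sum _ _
  unfold tForm flatNormSq localNormSq
  simp only [h1, h2, Complex.add_re, Complex.re_ofReal_mul, Complex.re_sum, Complex.ofReal_re,
    Complex.conj_re, h3]
  ring

theorem tnorm_eq (v : HybridSpace ℳ m k) : tnorm 𝒮 S v = √(tForm 𝒮 S v v).re := by
  rw [re_tForm_self]; rfl

end Forms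

/-! ### Coercivity -/

/-- The pairing of the jump with the average under a Hermitian field telescopes. -/
theorem re_ip_act_sub_avg {X : Type*} [MeasurableSpace X] {m : ℕ} {μ : Measure X} {H : X → Mat m}
    (hH : ∀ᵐ x ∂μ, (H x).IsHermitian) (hHb : MemLp H ⊤ μ) {a b : X → Cm m} (ha : MemLp a 2 μ)
    (hb : MemLp b 2 μ) :
    (ip μ (fun x => act (H x) (a x - b x)) (fun x => (2⁻¹ : ℂ) • (a x + b x))).re =
      2⁻¹ * ((ip μ (fun x => act (H x) (a x)) a).re - (ip μ (fun x => act (H x) (b x)) b).re) := by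
  have h1 := memLp_act hHb ha
  have h2 := memLp_act hHb hb
  have h3 : MemLp (fun x => act (H x) (a x) - act (H x) (b x)) 2 μ := h1.sub h2
  simp only [act_sub]
  rw [ip_smul_right, ip_add_right h3 ha hb, ip_sub_left h1 h2 ha, ip_sub_left h1 h2 hb,
    ← ip_act_conj hH b a]
  have : starRingEnd ℂ (2⁻¹ : ℂ) = ((2⁻¹ : ℝ) : ℂ) := by
    rw [map_inv₀, Complex.conj_ofNat]; simp
  rw [this, Complex.re_ofReal_mul]
  simp only [Complex.add_re, Complex.sub_re, Complex.conj_re]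
  ring

section Coercivity

variable {d m k : ℕ} {Ω : Set (Rd d)} {ℳ : PolytopalMesh d Ω} {𝒮 : System d m Ω}
  {S : Stabilization ℳ m} {CS : ℝ}

/-- Local coercivity: integration by parts turns `A_1` into half of `-∇·A` plus boundary terms, and
the lower bound on `K + K^H - ∇·A` applies. -/
theorem System.re_inner_op_ge (hd : 0 < d) (hΩ : IsPolytopalDomain Ω) (v : HybridSpace ℳ m k)
    (T : ℳ.cells) :
    𝒮.rlow * cellNormSq (T : Set (Rd d)) (cellVal v T) + 2⁻¹ * ∑ F ∈ ℳ.cellFaces T,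
      ℳ.orient T F * (faceInner (F : Set (Rd d))
        (fun x => act (𝒮.NF F x) (cellVal v T x)) (cellVal v T)).re ≤
    (cellInner (T : Set (Rd d)) (𝒮.op (cellVal v T)) (cellVal v T)).re := by
  rw [← 𝒮.integration_by_parts hd hΩ ℳ T (contDiff_cellVal v T)]
  have hv := memLp_cellVal hΩ v T
  have i1 := integrable_ip (memLp_act (𝒮.memLp_divA hΩ T) hv) hv
  have i2 := integrable_ip (𝒮.memLp_dirDeriv hΩ v T) hv
  have i3 := integrable_ip (𝒮.memLp_op hΩ v T) hv
  have i4 : Integrable (fun x => ‖cellVal v T x‖ ^ 2) (volume.restrict (T : Set (Rd d))) :=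
    hv.integrable_norm_pow (by norm_num)
  have i5 : Integrable (fun x =>
      RCLike.re (inner ℂ (cellVal v T x) (act (𝒮.divA x) (cellVal v T x))) +
        2 * RCLike.re (inner ℂ (cellVal v T x) (𝒮.dirDeriv (cellVal v T) x)))
      (volume.restrict (T : Set (Rd d))) := i1.re.add (i2.re.const_mul 2)
  unfold cellInner cellNormSq
  rw [show (∫ x in (T : Set (Rd d)), inner ℂ (cellVal v T x) (act (𝒮.divA x) (cellVal v T x))).re =
      _ from (integral_re i1).symm,
    show (∫ x in (T : Set (Rd d)), inner ℂ (cellVal v T x) (𝒮.dirDeriv (cellVal v T) x)).re = _ from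
      (integral_re i2).symm,
    show (∫ x in (T : Set (Rd d)), inner ℂ (cellVal v T x) (𝒮.op (cellVal v T) x)).re = _ from
      (integral_re i3).symm, ← integral_const_mul, ← integral_const_mul,
    ← integral_add i1.re (i2.re.const_mul 2), ← integral_const_mul,
    ← integral_add (i4.const_mul _) (i5.const_mul _)]
  refine integral_mono_ae ((i4.const_mul _).add (i5.const_mul _)) i3.re ?_
  have hlb := ae_mono (Measure.restrict_mono_set volume (ℳ.cell_subset hΩ.1 T)) 𝒮.lower_bound
  filter_upwards [hlb] with x hx
  have h := re_inner_act_nonneg hx (cellVal v T x)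
  rw [act_sub_left, act_sub_left, act_add_left, act_smul_left, act_one, inner_sub_right,
    inner_sub_right, inner_add_right, inner_act_conjTranspose, inner_smul_right,
    inner_self_eq_norm_sq_to_K, ← inner_conj_symm (act (𝒮.K x) (cellVal v T x))] at h
  simp only [Complex.sub_re, Complex.add_re, Complex.conj_re, Complex.re_ofReal_mul] at h
  have h2 : (((‖cellVal v T x‖ : ℝ) : ℂ) ^ 2).re = ‖cellVal v T x‖ ^ 2 := by
    rw [← Complex.ofReal_pow, Complex.ofReal_re]
  rw [show ((RCLike.ofReal ‖cellVal v T x‖ : ℂ) ^ 2).re = ‖cellVal v T x‖ ^ 2 from h2] at h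
  simp only [System.op, inner_add_right, RCLike.re_to_complex, Complex.add_re]
  linarith

theorem re_Si_nonneg (hS : StabilizationAssumption 𝒮 S k CS)
    {T : ℳ.cells} {F : ℳ.faces} (hF : F ∈ ℳ.cellFaces T) {a : Rd d → Cm m}
    (ha : MemLp a 2 ((surf d).restrict (F : Set (Rd d)))) :
    0 ≤ (faceInner (F : Set (Rd d)) (fun x => act (S.Si T F x) (a x)) a).re :=
  re_ip_act_nonneg ((hS.Si_positive T F hF).mono fun _ hx => re_inner_act_nonneg hx)
    (integrable_ip (memLp_act (hS.Si_bounded T F hF) ha) ha)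

theorem re_jh_nonneg (hΩ : IsPolytopalDomain Ω) (hS : StabilizationAssumption 𝒮 S k CS)
    (v : HybridSpace ℳ m k) : 0 ≤ (jh S v v).re := by
  unfold jh
  rw [Complex.re_sum]
  refine Finset.sum_nonneg fun T _ => ?_
  rw [Complex.re_sum]
  exact Finset.sum_nonneg fun F hF => re_Si_nonneg hS hF (memLp_jump hΩ v T F)

theorem bdrySeminormSq_nonneg (hΩ : IsPolytopalDomain Ω) (hS : StabilizationAssumption 𝒮 S k CS)
    (v : HybridSpace ℳ m k) : 0 ≤ bdrySeminormSq 𝒮 S v := by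
  refine Finset.sum_nonneg fun F hF => ?_
  have hM := ae_mono (Measure.restrict_mono_set (surf d) (ℳ.mem_bdryFaces.mp hF)) 𝒮.M_nonneg
  refine re_ip_act_nonneg (H := fun x => 𝒮.M x + S.Sb F x) ?_
    (integrable_ip (memLp_act ((𝒮.memLp_M hF).add (hS.Sb_bounded F hF)) (memLp_faceVal hΩ v F))
      (memLp_faceVal hΩ v F))
  filter_upwards [hM, hS.Sb_positive F hF] with x h1 h2 ξ
  rw [act_add_left, inner_add_right, Complex.add_re]
  exact add_nonneg (h1 ξ) (re_inner_act_nonneg h2 ξ)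

theorem cellNormSq_nonneg (Y : Set (Rd d)) (a : Rd d → Cm m) : 0 ≤ cellNormSq Y a := nsq_nonneg _ a

theorem faceNormSq_nonneg (Y : Set (Rd d)) (a : Rd d → Cm m) : 0 ≤ faceNormSq Y a := nsq_nonneg _ a

theorem diam_mul_sum_nonneg (v : HybridSpace ℳ m k) (T : ℳ.cells) :
    0 ≤ ℳ.diam T * ∑ F ∈ ℳ.cellFaces T, faceNormSq (F : Set (Rd d)) (jump v T F) :=
  mul_nonneg Metric.diam_nonneg (Finset.sum_nonneg fun _ _ => faceNormSq_nonneg _ _)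

theorem localNormSq_nonneg (v : HybridSpace ℳ m k) (T : ℳ.cells) : 0 ≤ localNormSq v T :=
  add_nonneg (cellNormSq_nonneg _ _) (diam_mul_sum_nonneg v T)

theorem rlow_mul_sum_localNormSq_le (hΩ : IsPolytopalDomain Ω)
    (hS : StabilizationAssumption 𝒮 S k CS) (v : HybridSpace ℳ m k) :
    𝒮.rlow * ∑ T, localNormSq v T ≤ flatNormSq 𝒮 S v := by
  have h1 := bdrySeminormSq_nonneg hΩ hS v
  have h2 := re_jh_nonneg hΩ hS v
  unfold flatNormSq
  linarith

theorem flatNormSq_nonneg (hΩ : IsPolytopalDomain Ω)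
    (hS : StabilizationAssumption 𝒮 S k CS) (v : HybridSpace ℳ m k) : 0 ≤ flatNormSq 𝒮 S v :=
  (mul_nonneg 𝒮.rlow_pos.le (Finset.sum_nonneg fun T _ => localNormSq_nonneg v T)).trans
    (rlow_mul_sum_localNormSq_le hΩ hS v)

theorem rlow_mul_sum_cellNormSq_le (hΩ : IsPolytopalDomain Ω)
    (hS : StabilizationAssumption 𝒮 S k CS) (v : HybridSpace ℳ m k) :
    𝒮.rlow * ∑ T : ℳ.cells, cellNormSq (T : Set (Rd d)) (cellVal v T) ≤ flatNormSq 𝒮 S v :=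
  (mul_le_mul_of_nonneg_left (Finset.sum_le_sum fun T _ =>
    le_add_of_nonneg_right (diam_mul_sum_nonneg v T)) 𝒮.rlow_pos.le).trans
    (rlow_mul_sum_localNormSq_le hΩ hS v)

theorem sum_cellFaces_orient (hΩ : IsPolytopalDomain Ω) (c : ℳ.faces → ℝ) :
    ∑ T, ∑ F ∈ ℳ.cellFaces T, ℳ.orient T F * c F = ∑ F ∈ ℳ.bdryFaces, c F := by
  classical
  rw [Finset.sum_comm' (t' := Finset.univ) (s' := fun F => Finset.univ.filter fun T =>
    F ∈ ℳ.cellFaces T) (by simp)]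
  simp only [← Finset.sum_mul, ℳ.sum_orient hΩ.1, ite_mul, one_mul, zero_mul]
  rw [Finset.sum_ite_mem, Finset.univ_inter]

/-- The face terms of `a_h` compensate the boundary terms of the integration by parts on the
elements, because the two orientations of an interface cancel. -/
theorem flatNormSq_le_re_ah (hd : 0 < d) (hΩ : IsPolytopalDomain Ω)
    (hS : StabilizationAssumption 𝒮 S k CS) (v : HybridSpace ℳ m k) :
    flatNormSq 𝒮 S v ≤ (ah 𝒮 S v v).re := by
  have h2 : ∀ (Y : Set (Rd d)) (a : Rd d → Cm m), faceInner Y a a = (faceNormSq Y a : ℂ) :=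
    fun Y a => ip_self a
  -- the energies through a face of the face component and of the element components
  let n (F : ℳ.faces) : ℝ :=
    (faceInner (F : Set (Rd d)) (fun x => act (𝒮.NF F x) (faceVal v F x)) (faceVal v F)).re
  let e (T : ℳ.cells) (F : ℳ.faces) : ℝ :=
    (faceInner (F : Set (Rd d)) (fun x => act (𝒮.NF F x) (cellVal v T x)) (cellVal v T)).re
  have hface : ∀ (T : ℳ.cells) (F : ℳ.faces), (faceInner (F : Set (Rd d))
      (fun x => act (𝒮.NF F x) (jump v T F x)) (avg v T F)).re = 2⁻¹ * (n F - e T F) := fun T F =>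
    re_ip_act_sub_avg (𝒮.ae_isHermitian_NF F) (𝒮.memLp_NF hΩ F) (memLp_faceVal hΩ v F)
      (memLp_cellVal_face hΩ v T F)
  have hbdry : ∀ F ∈ ℳ.bdryFaces, (faceInner (F : Set (Rd d))
      (fun x => act (𝒮.M x + S.Sb F x - 𝒮.NF F x) (faceVal v F x)) (faceVal v F)).re =
      (faceInner (F : Set (Rd d)) (fun x => act (𝒮.M x + S.Sb F x) (faceVal v F x))
        (faceVal v F)).re - n F := by
    intro F hF
    have hv := memLp_faceVal hΩ v F
    have h := ip_sub_left (memLp_act ((𝒮.memLp_M hF).add (hS.Sb_bounded F hF)) hv)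
      (memLp_act (𝒮.memLp_NF hΩ F) hv) hv
    simp only [Pi.add_apply, ← act_sub_left] at h
    exact (congrArg Complex.re h).trans (Complex.sub_re _ _)
  have hop := Finset.sum_le_sum fun T (_ : T ∈ Finset.univ) => 𝒮.re_inner_op_ge hd hΩ v T
  have hor := sum_cellFaces_orient hΩ n
  have hhalf : (2⁻¹ : ℂ) = ((2⁻¹ : ℝ) : ℂ) := by simp
  unfold ah flatNormSq localNormSq bdrySeminormSq
  rw [hhalf]
  simp only [h2, Complex.add_re, Complex.re_ofReal_mul, Complex.re_sum, Complex.ofReal_re, hface]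
  rw [Finset.sum_congr rfl hbdry, Finset.sum_sub_distrib, ← hor]
  rw [Finset.sum_add_distrib, ← Finset.mul_sum, ← Finset.mul_sum] at hop
  have e1 : ∑ T, ∑ F ∈ ℳ.cellFaces T, ℳ.orient T F * (2⁻¹ * (n F - e T F)) =
      2⁻¹ * (∑ T, ∑ F ∈ ℳ.cellFaces T, ℳ.orient T F * n F) -
      2⁻¹ * (∑ T, ∑ F ∈ ℳ.cellFaces T, ℳ.orient T F * e T F) := by
    simp only [Finset.mul_sum, ← Finset.sum_sub_distrib]
    refine Finset.sum_congr rfl fun T _ => Finset.sum_congr rfl fun F _ => ?_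
    ring
  rw [e1, Finset.sum_add_distrib]
  simp only [e] at hop ⊢
  linarith

theorem ae_eq_zero_of_nsq {X : Type*} [MeasurableSpace X] {μ : Measure X} {a : X → Cm m}
    (ha : MemLp a 2 μ) (h : nsq μ a = 0) : ∀ᵐ x ∂μ, a x = 0 := by
  have h1 := (integral_eq_zero_iff_of_nonneg (fun x => by positivity)
    (ha.integrable_norm_pow (by norm_num))).mp h
  filter_upwards [h1] with x hx
  simpa using hx

/-- The flat norm is definite: the element components vanish as polynomials, the jumps then carry
this over to the face components, since every face belongs to an element. -/
theorem eq_zero_of_flatNormSq (hd : 0 < d) (hΩ : IsPolytopalDomain Ω)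
    (hS : StabilizationAssumption 𝒮 S k CS) {v : HybridSpace ℳ m k}
    (h : flatNormSq 𝒮 S v = 0) : v = 0 := by
  have h1 : ∑ T, localNormSq v T = 0 := by
    have h2 := rlow_mul_sum_localNormSq_le hΩ hS v
    have h3 := Finset.sum_nonneg fun T (_ : T ∈ Finset.univ) => localNormSq_nonneg v T
    rw [h] at h2
    nlinarith [𝒮.rlow_pos]
  have h2 : ∀ T, localNormSq v T = 0 := fun T =>
    (Finset.sum_eq_zero_iff_of_nonneg fun T _ => localNormSq_nonneg v T).mp h1 T (Finset.mem_univ T)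
  have h3 : ∀ T : ℳ.cells, cellVal v T = 0 := by
    intro T
    have h4 : cellNormSq (T : Set (Rd d)) (cellVal v T) = 0 := by
      have := h2 T
      unfold localNormSq at this
      linarith [diam_mul_sum_nonneg v T, cellNormSq_nonneg (T : Set (Rd d)) (cellVal v T)]
    have h5 := ae_eq_zero_of_nsq (memLp_cellVal hΩ v T) h4
    have h6 := Measure.eqOn_open_of_ae_eq (f := cellVal v T) (g := fun _ => 0) h5 (ℳ.cell_isOpen T)
      (contDiff_cellVal v T).continuous.continuousOn continuousOn_const
    obtain ⟨x₀, hx₀⟩ := ℳ.cell_nonempty T T.2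
    ext x j
    have h7 := eq_zero_of_mem_polyFun (mem_polySpace.mp (v.1 T).2 j) (ℳ.cell_isOpen T) hx₀
      (fun x hx => by
        have := h6 hx
        exact congrArg (fun ξ : Cm m => ξ j) this)
    exact congrFun h7 x
  have h4 : ∀ F : ℳ.faces, faceVal v F = 0 := by
    intro F
    obtain ⟨T, hT⟩ := ℳ.exists_cell_of_face F
    have h5 : faceNormSq (F : Set (Rd d)) (jump v T F) = 0 := by
      have h6 := h2 T
      unfold localNormSq at h6
      have h7 := ℳ.diam_pos hd T
      have h8 : ∑ F ∈ ℳ.cellFaces T, faceNormSq (F : Set (Rd d)) (jump v T F) = 0 := by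
        have h9 := diam_mul_sum_nonneg v T
        have h10 := cellNormSq_nonneg (T : Set (Rd d)) (cellVal v T)
        have h11 : ℳ.diam T *
            ∑ F ∈ ℳ.cellFaces T, faceNormSq (F : Set (Rd d)) (jump v T F) = 0 := by
          linarith
        exact (mul_eq_zero.mp h11).resolve_left h7.ne'
      exact (Finset.sum_eq_zero_iff_of_nonneg fun F _ => faceNormSq_nonneg _ _).mp h8 F hT
    have h6 := ae_eq_zero_of_nsq (memLp_jump hΩ v T F) h5
    obtain ⟨p, hp, hpv⟩ := (v.2 F).2
    have hpv' : faceVal v F = (F : Set (Rd d)).indicator p := hpv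
    have hpc : Continuous p := (contDiff_of_mem_polySpace hp).continuous
    rw [hpv']
    refine indicator_eq_zero.mpr (disjoint_left.mpr fun x hx hxF => ?_)
    -- a polynomial which does not vanish at a point of the face is nonzero on a relatively open
    -- subset, which has positive measure
    have hpos := ℳ.surf_face_inter_pos F (hpc.isOpen_support) hxF hx
    refine hpos.ne' ?_
    have h7 := (ae_restrict_iff' (ℳ.face_measurableSet F)).mp h6
    refine measure_mono_null (fun y hy => ?_) h7
    intro hcon
    have h8 := hcon hy.1
    unfold jump at h8
    rw [h3 T, hpv', indicator_of_mem hy.1] at h8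
    exact hy.2 (by simpa using h8)
  refine Prod.ext (funext fun T => Subtype.ext (h3 T)) (funext fun F => Subtype.ext (h4 F))

instance finite_polySpace (d m k : ℕ) : Module.Finite ℂ (polySpace d m k) := by
  let f : polySpace d m k →ₗ[ℂ] (Fin m → polyFun d k) :=
    { toFun := fun v j => ⟨fun x => v.1 x j, mem_polySpace.mp v.2 j⟩
      map_add' := fun v w => rfl
      map_smul' := fun c v => rfl }
  refine Module.Finite.of_injective f fun v w h => ?_
  ext x j
  exact congrFun (congrArg Subtype.val (congrFun h j)) x

instance finite_facePolySpace (d m k : ℕ) (F : Set (Rd d)) :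
    Module.Finite ℂ (facePolySpace d m k F) := by
  let f : polySpace d m k →ₗ[ℂ] facePolySpace d m k F :=
    { toFun := fun v => ⟨F.indicator v.1, v.1, v.2, rfl⟩
      map_add' := fun v w => Subtype.ext (indicator_add' F v.1 w.1)
      map_smul' := fun c v => Subtype.ext (indicator_const_smul F c v.1) }
  refine Module.Finite.of_surjective f ?_
  rintro ⟨_, p, hp, rfl⟩
  exact ⟨⟨p, hp⟩, rfl⟩

theorem sum_tref_nonneg (v : HybridSpace ℳ m k) : 0 ≤ ∑ T : ℳ.cells, 𝒮.tref T *
    cellNormSq (T : Set (Rd d)) (𝒮.dirDeriv (cellVal v T)) :=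
  Finset.sum_nonneg fun _ _ => mul_nonneg
    (inv_nonneg.mpr (le_max_of_le_right 𝒮.rlow_pos.le)) (cellNormSq_nonneg _ _)

theorem flatNormSq_le_tForm (v : HybridSpace ℳ m k) :
    flatNormSq 𝒮 S v ≤ (tForm 𝒮 S v v).re := by
  rw [re_tForm_self]
  exact le_add_of_nonneg_right (sum_tref_nonneg v)

theorem tnorm_pos (hd : 0 < d) (hΩ : IsPolytopalDomain Ω)
    (hS : StabilizationAssumption 𝒮 S k CS) {v : HybridSpace ℳ m k} (hv : v ≠ 0) :
    0 < tnorm 𝒮 S v := by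
  rw [tnorm_eq]
  refine Real.sqrt_pos.mpr (lt_of_lt_of_le ?_ (flatNormSq_le_tForm v))
  exact (flatNormSq_nonneg hΩ hS v).lt_of_ne fun h => hv (eq_zero_of_flatNormSq hd hΩ hS h.symm)

theorem exists_ah_bound (hd : 0 < d) (hΩ : IsPolytopalDomain Ω)
    (hS : StabilizationAssumption 𝒮 S k CS) (v : HybridSpace ℳ m k) :
    ∃ C : ℝ, ∀ w, ‖ah 𝒮 S v w‖ ≤ C * tnorm 𝒮 S w := by
  have hs := isSesquilinear_ah (k := k) hΩ hS
  let ℓ : HybridSpace ℳ m k →ₗ[ℂ] ℂ :=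
    { toFun := fun w => starRingEnd ℂ (ah 𝒮 S v w)
      map_add' := fun w w' => by rw [hs.add_right, map_add]
      map_smul' := fun c w => by
        rw [hs.smul_right, map_mul, Complex.conj_conj, smul_eq_mul, RingHom.id_apply] }
  obtain ⟨C, hC⟩ := (isSesquilinear_tForm (k := k) hΩ hS).exists_bound (tForm_conj hS)
    (fun x => (flatNormSq_nonneg hΩ hS x).trans (flatNormSq_le_tForm x))
    (fun x hx => eq_zero_of_flatNormSq hd hΩ hS (le_antisymm
      ((flatNormSq_le_tForm x).trans hx.le) (flatNormSq_nonneg hΩ hS x))) ℓ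
  refine ⟨C, fun w => ?_⟩
  rw [tnorm_eq]
  have := hC w
  simpa only [ℓ, LinearMap.coe_mk, AddHom.coe_mk, RCLike.norm_conj] using this

theorem exists_ne_zero (hΩ : IsPolytopalDomain Ω) (hm : 0 < m) (ℳ : PolytopalMesh d Ω) (k : ℕ) :
    ∃ w : HybridSpace ℳ m k, w ≠ 0 := by
  obtain ⟨x, hx⟩ := hΩ.2.nonempty
  have hx' := subset_closure hx
  rw [ℳ.cells_cover] at hx'
  obtain ⟨T, hT, -⟩ := mem_iUnion₂.mp hx'
  let e : Cm m := EuclideanSpace.single ⟨0, hm⟩ 1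
  have he : (fun _ : Rd d => e) ∈ polySpace d m k := fun j =>
    ⟨MvPolynomial.C (e j), by simp, fun x => by simp⟩
  refine ⟨(fun _ => ⟨_, he⟩, 0), fun h => ?_⟩
  have h1 := congrFun (congrArg Prod.fst h) ⟨T, hT⟩
  have h2 := congrFun (congrArg Subtype.val h1) 0
  have h3 := congrArg (fun ξ : Cm m => ξ ⟨0, hm⟩) h2
  simp [e] at h3

/-- The supremum of the inf-sup condition is finite, and bounds `a_h(v, ·)` as a dual norm. -/
theorem exists_isLUB_ah (hd : 0 < d) (hΩ : IsPolytopalDomain Ω) (hm : 0 < m)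
    (hS : StabilizationAssumption 𝒮 S k CS) (v : HybridSpace ℳ m k) :
    ∃ s : ℝ, IsLUB {r : ℝ | ∃ w : HybridSpace ℳ m k, w ≠ 0 ∧
        r = ‖ah 𝒮 S v w‖ / tnorm 𝒮 S w} s ∧ 0 ≤ s ∧ ∀ w, ‖ah 𝒮 S v w‖ ≤ s * tnorm 𝒮 S w := by
  obtain ⟨C, hC⟩ := exists_ah_bound hd hΩ hS v
  obtain ⟨w₀, hw₀⟩ := exists_ne_zero hΩ hm ℳ k
  obtain ⟨s, hs⟩ := Real.exists_isLUB (s := {r : ℝ | ∃ w : HybridSpace ℳ m k, w ≠ 0 ∧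
        r = ‖ah 𝒮 S v w‖ / tnorm 𝒮 S w}) ⟨_, w₀, hw₀, rfl⟩ ⟨C, by
      rintro _ ⟨w, hw, rfl⟩
      exact (div_le_iff₀ (tnorm_pos hd hΩ hS hw)).mpr (hC w)⟩
  refine ⟨s, hs, le_trans (div_nonneg (norm_nonneg _) (Real.sqrt_nonneg _))
    (hs.1 ⟨w₀, hw₀, rfl⟩), fun w => ?_⟩
  -- the supremum only runs over `w ≠ 0`
  by_cases hw : w = 0
  · have h0 := (isSesquilinear_ah (k := k) hΩ hS).smul_right 0 v 0
    rw [zero_smul, map_zero, zero_mul] at h0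
    have h1 := (isSesquilinear_tForm (k := k) hΩ hS).smul_right 0 0 0
    rw [zero_smul, map_zero, zero_mul] at h1
    rw [hw, h0, tnorm_eq, h1]; simp
  · exact (div_le_iff₀ (tnorm_pos hd hΩ hS hw)).mp (hs.1 ⟨w, hw, rfl⟩)

end Coercivity

/-! ### Well-posedness -/

/-- A definite sesquilinear form on a finite-dimensional space represents every conjugate-linear
functional. -/
theorem IsSesquilinear.existsUnique_represent {V : Type*} [AddCommGroup V] [Module ℂ V]
    [FiniteDimensional ℂ V] {B : V → V → ℂ} (h : IsSesquilinear B)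
    (hdef : ∀ x, B x x = 0 → x = 0) (G : V → ℂ) (hadd : ∀ x y, G (x + y) = G x + G y)
    (hsmul : ∀ (c : ℂ) x, G (c • x) = starRingEnd ℂ c * G x) :
    ∃! u, ∀ w, B u w = G w := by
  let b := Module.finBasis ℂ V
  -- conjugate-linear functionals which agree on a basis are equal
  have ext_basis : ∀ u, (∀ j, B u (b j) = G (b j)) → ∀ w, B u w = G w := by
    intro u hu w
    let f : V →ₗ[ℂ] ℂ :=
      { toFun := fun w => starRingEnd ℂ (B u w - G w)
        map_add' := fun x y => by rw [h.add_right, hadd, ← map_add]; congr 1; ring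
        map_smul' := fun c x => by
          rw [h.smul_right, hsmul, ← mul_sub, map_mul, Complex.conj_conj]; rfl }
    have hf : f = 0 := b.ext fun j => by simp [f, hu j]
    have := LinearMap.congr_fun hf w
    simpa [f, ← map_sub, sub_eq_zero] using this
  let Ψ : V →ₗ[ℂ] (Fin (Module.finrank ℂ V) → ℂ) :=
    { toFun := fun u j => B u (b j)
      map_add' := fun x y => funext fun j => h.add_left _ _ _
      map_smul' := fun c x => funext fun j => h.smul_left _ _ _ }
  have hinj : Function.Injective Ψ := by
    refine (injective_iff_map_eq_zero Ψ).mpr fun u hu => hdef u ?_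
    let f : V →ₗ[ℂ] ℂ :=
      { toFun := fun w => starRingEnd ℂ (B u w)
        map_add' := fun x y => by rw [h.add_right, map_add]
        map_smul' := fun c x => by rw [h.smul_right, map_mul, Complex.conj_conj]; rfl }
    have hf : f = 0 := b.ext fun j => by
      have : B u (b j) = 0 := congrFun hu j
      simp [f, this]
    have := LinearMap.congr_fun hf u
    simpa [f] using this
  have hsurj : Function.Surjective Ψ :=
    (LinearMap.injective_iff_surjective_of_finrank_eq_finrank (by simp)).mp hinj
  obtain ⟨u, hu⟩ := hsurj fun j => G (b j)
  refine ⟨u, ext_basis u fun j => congrFun hu j, fun u' hu' => hinj ?_⟩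
  rw [hu]
  exact funext fun j => hu' _

theorem nsq_sum_act_le {X ι : Type*} [MeasurableSpace X] {m : ℕ} {μ : Measure X} [Fintype ι]
    {H : ι → X → Mat m} {u : ι → X → Cm m} {α : ℝ} (hH : ∀ i, MemLp (H i) ⊤ μ)
    (hα : ∀ i, (eLpNorm (H i) ⊤ μ).toReal ≤ α) (hu : ∀ i, MemLp (u i) 2 μ) :
    nsq μ (fun x => ∑ i, act (H i x) (u i x)) ≤ Fintype.card ι * α ^ 2 * ∑ i, nsq μ (u i) := by
  have hi : ∀ i, Integrable (fun x => ‖u i x‖ ^ 2) μ := fun i =>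
    (hu i).integrable_norm_pow (by norm_num)
  unfold nsq
  rw [← integral_finsetSum _ fun i _ => hi i, ← integral_const_mul]
  refine integral_mono_of_nonneg (Eventually.of_forall fun x => by positivity)
    ((integrable_finsetSum _ fun i _ => hi i).const_mul _) ?_
  filter_upwards [ae_all_iff.mpr fun i => ae_norm_le_toReal (hH i)] with x hx
  have h1 : ∀ i, ‖act (H i x) (u i x)‖ ≤ α * ‖u i x‖ := fun i =>
    (norm_act_le _ _).trans (mul_le_mul_of_nonneg_right ((hx i).trans (hα i)) (norm_nonneg _))
  have h2 : ‖∑ i, act (H i x) (u i x)‖ ≤ ∑ i, α * ‖u i x‖ :=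
    (norm_sum_le _ _).trans (Finset.sum_le_sum fun i _ => h1 i)
  have h3 : (∑ i, α * ‖u i x‖) ^ 2 ≤ Fintype.card ι * ∑ i, (α * ‖u i x‖) ^ 2 :=
    sq_sum_le_card_mul_sum_sq
  calc ‖∑ i, act (H i x) (u i x)‖ ^ 2 ≤ (∑ i, α * ‖u i x‖) ^ 2 :=
        pow_le_pow_left₀ (norm_nonneg _) h2 2
    _ ≤ Fintype.card ι * ∑ i, (α * ‖u i x‖) ^ 2 := h3
    _ = Fintype.card ι * α ^ 2 * ∑ i, ‖u i x‖ ^ 2 := by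
        simp only [mul_pow, ← Finset.mul_sum, mul_assoc]

/-- The discrete trace and inverse inequalities hold with constant `C`. -/
def TraceInverseBound {d : ℕ} {Ω : Set (Rd d)} (ℳ : PolytopalMesh d Ω) (m k : ℕ) (C : ℝ) : Prop :=
  ∀ T : ℳ.cells, ∀ v ∈ polySpace d m k,
    ℳ.diam T * ∑ F ∈ ℳ.cellFaces T, faceNormSq (F : Set (Rd d)) v ≤
      C * cellNormSq (T : Set (Rd d)) v ∧
    ∀ i, ℳ.diam T ^ 2 * cellNormSq (T : Set (Rd d))
      (fun x => fderiv ℝ v x (EuclideanSpace.single i 1)) ≤ C * cellNormSq (T : Set (Rd d)) v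

section WellPosed

variable {d m k : ℕ} {Ω : Set (Rd d)} {ℳ : PolytopalMesh d Ω} {𝒮 : System d m Ω}
  {S : Stabilization ℳ m} {CS : ℝ}

theorem memLp_fderiv (hΩ : IsPolytopalDomain Ω) (v : HybridSpace ℳ m k) (T : ℳ.cells) (i : Fin d) :
    MemLp (fun x => fderiv ℝ (cellVal v T) x (EuclideanSpace.single i 1)) 2
      (volume.restrict (T : Set (Rd d))) :=
  memLp_cell hΩ T (((contDiff_cellVal v T).continuous_fderiv (by simp)).clm_apply
    continuous_const).continuousOn

/-- The inverse inequality for a first-order operator with bounded coefficients. -/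
theorem TraceInverseBound.firstOrder {C : ℝ} (hC : TraceInverseBound ℳ m k C)
    (hΩ : IsPolytopalDomain Ω) (v : HybridSpace ℳ m k) (T : ℳ.cells) {H : Fin d → Rd d → Mat m}
    {α : ℝ} (hH : ∀ i, MemLp (H i) ⊤ (volume.restrict (T : Set (Rd d))))
    (hα : ∀ i, linfty (T : Set (Rd d)) (H i) ≤ α) :
    ℳ.diam T ^ 2 * cellNormSq (T : Set (Rd d))
      (fun x => ∑ i, act (H i x) (fderiv ℝ (cellVal v T) x (EuclideanSpace.single i 1))) ≤
    d ^ 2 * C * α ^ 2 * cellNormSq (T : Set (Rd d)) (cellVal v T) := by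
  have h1 := nsq_sum_act_le hH hα (fun i => memLp_fderiv hΩ v T i)
  have h2 : ∑ i, ℳ.diam T ^ 2 * nsq (volume.restrict (T : Set (Rd d)))
      (fun x => fderiv ℝ (cellVal v T) x (EuclideanSpace.single i 1)) ≤
      ∑ _i : Fin d, C * cellNormSq (T : Set (Rd d)) (cellVal v T) :=
    Finset.sum_le_sum fun i _ => (hC T _ (v.1 T).2).2 i
  rw [← Finset.mul_sum, Finset.sum_const, Finset.card_univ, Fintype.card_fin, nsmul_eq_mul] at h2
  rw [Fintype.card_fin] at h1
  calc _ ≤ ℳ.diam T ^ 2 * _ := mul_le_mul_of_nonneg_left h1 (by positivity)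
    _ = d * α ^ 2 * (ℳ.diam T ^ 2 * ∑ i, nsq (volume.restrict (T : Set (Rd d)))
      (fun x => fderiv ℝ (cellVal v T) x (EuclideanSpace.single i 1))) := by ring
    _ ≤ d * α ^ 2 * (d * (C * cellNormSq (T : Set (Rd d)) (cellVal v T))) :=
        mul_le_mul_of_nonneg_left h2 (by positivity)
    _ = _ := by ring

theorem System.linfty_le_aref (T : ℳ.cells) (i : Fin d) :
    linfty (T : Set (Rd d)) (𝒮.A i) ≤ 𝒮.aref T :=
  le_ciSup (f := fun i => linfty (T : Set (Rd d)) (𝒮.A i)) (Set.finite_range _).bddAbove i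

theorem System.aref_nonneg (𝒮 : System d m Ω) (T : ℳ.cells) : 0 ≤ 𝒮.aref T :=
  Real.iSup_nonneg fun _ => ENNReal.toReal_nonneg

theorem System.tref_pos (𝒮 : System d m Ω) (T : ℳ.cells) : 0 < 𝒮.tref T :=
  inv_pos.mpr (lt_max_of_lt_right 𝒮.rlow_pos)

theorem System.tref_mul_rlow_le (𝒮 : System d m Ω) (T : ℳ.cells) : 𝒮.tref T * 𝒮.rlow ≤ 1 := by
  unfold tref
  rw [inv_mul_le_one₀ (lt_max_of_lt_right 𝒮.rlow_pos)]
  exact le_max_right _ _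

theorem System.tref_mul_aref_le (𝒮 : System d m Ω) (hd : 0 < d) (T : ℳ.cells) :
    𝒮.tref T * 𝒮.aref T ≤ ℳ.diam T := by
  have h : 𝒮.tref T * (𝒮.aref T * (ℳ.diam T)⁻¹) ≤ 1 := by
    unfold tref
    rw [inv_mul_le_one₀ (lt_max_of_lt_right 𝒮.rlow_pos)]
    exact le_max_left _ _
  rwa [← mul_assoc, ← div_eq_mul_inv, div_le_one₀ (ℳ.diam_pos hd T)] at h

theorem sq_diam_mul_dirDeriv_le {C : ℝ} (hC : TraceInverseBound ℳ m k C)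
    (hΩ : IsPolytopalDomain Ω) (v : HybridSpace ℳ m k) (T : ℳ.cells) :
    ℳ.diam T ^ 2 * cellNormSq (T : Set (Rd d)) (𝒮.dirDeriv (cellVal v T)) ≤
      d ^ 2 * C * 𝒮.aref T ^ 2 * cellNormSq (T : Set (Rd d)) (cellVal v T) :=
  hC.firstOrder hΩ v T (fun i => 𝒮.memLp_A hΩ T i) (fun i => 𝒮.linfty_le_aref T i)

theorem cellInner_brokenField (hΩ : IsPolytopalDomain Ω) {f : Rd d → Cm m}
    (hf : MemLp f 2 (volume.restrict Ω)) (v : HybridSpace ℳ m k) :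
    cellInner Ω f (brokenField v) =
      ∑ T : ℳ.cells, cellInner (T : Set (Rd d)) f (cellVal v T) := by
  have hΩm := hΩ.1.isOpen.measurableSet
  have e1 : ∀ x, inner ℂ (brokenField v x) (f x) = ∑ T : ℳ.cells,
      (T : Set (Rd d)).indicator (fun x => inner ℂ (cellVal v T x) (f x)) x := by
    intro x
    unfold brokenField
    rw [sum_inner]
    refine Finset.sum_congr rfl fun T _ => ?_
    by_cases hx : x ∈ (T : Set (Rd d)) <;> simp [hx]
  have hi : ∀ T : ℳ.cells, IntegrableOn (fun x => inner ℂ (cellVal v T x) (f x)) T := fun T =>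
    integrable_ip (hf.mono_measure (Measure.restrict_mono_set _ (ℳ.cell_subset hΩ.1 T)))
      (memLp_cellVal hΩ v T)
  unfold cellInner
  simp only [e1]
  rw [integral_finsetSum]
  · refine Finset.sum_congr rfl fun T _ => ?_
    rw [setIntegral_indicator (ℳ.cell_isOpen T).measurableSet,
      inter_eq_self_of_subset_right (ℳ.cell_subset hΩ.1 T)]
  · intro T _
    exact ((integrable_indicator_iff (ℳ.cell_isOpen T).measurableSet).mpr (hi T)).integrableOn

theorem cellNormSq_mono (hΩ : IsPolytopalDomain Ω) {f : Rd d → Cm m}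
    (hf : MemLp f 2 (volume.restrict Ω)) (T : ℳ.cells) :
    cellNormSq (T : Set (Rd d)) f ≤ cellNormSq Ω f :=
  setIntegral_mono_set (hf.integrable_norm_pow (by norm_num))
    (Eventually.of_forall fun x => by positivity) (LE.le.eventuallyLE (ℳ.cell_subset hΩ.1 T))

/-- The load functional is bounded in the flat norm. The factor `Fintype.card ℳ.cells` comes from
bounding the norm of `f` on each element by its norm on `Ω`. -/
theorem norm_cellInner_brokenField_le (hΩ : IsPolytopalDomain Ω)
    (hS : StabilizationAssumption 𝒮 S k CS) {f : Rd d → Cm m}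
    (hf : MemLp f 2 (volume.restrict Ω)) (v : HybridSpace ℳ m k) :
    √𝒮.rlow * ‖cellInner Ω f (brokenField v)‖ ≤
      Fintype.card ℳ.cells * (√(cellNormSq Ω f) * √(flatNormSq 𝒮 S v)) := by
  rw [cellInner_brokenField hΩ hf]
  calc √𝒮.rlow * ‖∑ T : ℳ.cells, cellInner (T : Set (Rd d)) f (cellVal v T)‖
      ≤ √𝒮.rlow * ∑ T : ℳ.cells, ‖cellInner (T : Set (Rd d)) f (cellVal v T)‖ :=
        mul_le_mul_of_nonneg_left (norm_sum_le _ _) (Real.sqrt_nonneg _)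
    _ = ∑ T : ℳ.cells, √𝒮.rlow * ‖cellInner (T : Set (Rd d)) f (cellVal v T)‖ :=
        Finset.mul_sum _ _ _
    _ ≤ ∑ _T : ℳ.cells, √(cellNormSq Ω f) * √(flatNormSq 𝒮 S v) := by
        refine Finset.sum_le_sum fun T _ => ?_
        have h1 : ‖cellInner (T : Set (Rd d)) f (cellVal v T)‖ ≤
            √(cellNormSq (T : Set (Rd d)) f) * √(cellNormSq (T : Set (Rd d)) (cellVal v T)) :=
          norm_ip_le (hf.mono_measure (Measure.restrict_mono_set _ (ℳ.cell_subset hΩ.1 T)))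
            (memLp_cellVal hΩ v T)
        have h2 : 𝒮.rlow * cellNormSq (T : Set (Rd d)) (cellVal v T) ≤ flatNormSq 𝒮 S v :=
          le_trans (mul_le_mul_of_nonneg_left (Finset.single_le_sum (f := fun T : ℳ.cells =>
            cellNormSq (T : Set (Rd d)) (cellVal v T)) (fun _ _ => cellNormSq_nonneg _ _)
              (Finset.mem_univ T)) 𝒮.rlow_pos.le) (rlow_mul_sum_cellNormSq_le hΩ hS v)
        calc √𝒮.rlow * ‖cellInner (T : Set (Rd d)) f (cellVal v T)‖
            ≤ √𝒮.rlow * (√(cellNormSq (T : Set (Rd d)) f) *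
              √(cellNormSq (T : Set (Rd d)) (cellVal v T))) :=
              mul_le_mul_of_nonneg_left h1 (Real.sqrt_nonneg _)
          _ = √(cellNormSq (T : Set (Rd d)) f) *
              √(𝒮.rlow * cellNormSq (T : Set (Rd d)) (cellVal v T)) := by
              rw [Real.sqrt_mul 𝒮.rlow_pos.le]; ring
          _ ≤ _ := mul_le_mul (Real.sqrt_le_sqrt (cellNormSq_mono hΩ hf T)) (Real.sqrt_le_sqrt h2)
              (Real.sqrt_nonneg _) (Real.sqrt_nonneg _)
    _ = _ := by rw [Finset.sum_const, Finset.card_univ, nsmul_eq_mul]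

/-- Coercivity gives uniqueness, and existence follows in finite dimension. The stability constant
may depend on the mesh and on the data. -/
theorem discreteWellPosed (hd : 0 < d) (hΩ : IsPolytopalDomain Ω)
    (hS : StabilizationAssumption 𝒮 S k CS) {C : ℝ} (hC0 : 0 ≤ C)
    (hC : TraceInverseBound ℳ m k C) : DiscreteWellPosed 𝒮 S k := by
  have hdef : ∀ u : HybridSpace ℳ m k, ah 𝒮 S u u = 0 → u = 0 := by
    intro u hu
    have h1 := flatNormSq_le_re_ah hd hΩ hS u
    rw [hu, Complex.zero_re] at h1
    exact eq_zero_of_flatNormSq hd hΩ hS (le_antisymm h1 (flatNormSq_nonneg hΩ hS u))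
  refine ⟨fun f hf => ?_, ?_⟩
  · have hfT : ∀ T : ℳ.cells, MemLp f 2 (volume.restrict (T : Set (Rd d))) := fun T =>
      hf.mono_measure (Measure.restrict_mono_set _ (ℳ.cell_subset hΩ.1 T))
    refine (isSesquilinear_ah hΩ hS).existsUnique_represent hdef _ (fun x y => ?_) (fun c x => ?_)
    · simp only [cellInner_brokenField hΩ hf, ← Finset.sum_add_distrib]
      exact Finset.sum_congr rfl fun T _ =>
        ip_add_right (hfT T) (memLp_cellVal hΩ x T) (memLp_cellVal hΩ y T)
    · simp only [cellInner_brokenField hΩ hf, Finset.mul_sum]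
      exact Finset.sum_congr rfl fun T _ => ip_smul_right c _ _
  · -- the flat norm of the solution is bounded by coercivity, the graph part by the inverse
    -- inequality
    set N : ℝ := (Fintype.card ℳ.cells : ℝ) / √𝒮.rlow with hN
    set E : ℝ := 1 + (∑ T : ℳ.cells, 𝒮.tref T * (d ^ 2 * C * 𝒮.aref T ^ 2 / ℳ.diam T ^ 2)) / 𝒮.rlow
      with hE
    have hr := 𝒮.rlow_pos
    have hN0 : 0 ≤ N := by positivity
    have hsum0 : ∀ T : ℳ.cells,
        0 ≤ 𝒮.tref T * (d ^ 2 * C * 𝒮.aref T ^ 2 / ℳ.diam T ^ 2) := fun T =>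
      mul_nonneg (𝒮.tref_pos T).le (by positivity)
    have hE0 : 0 ≤ E := add_nonneg zero_le_one
      (div_nonneg (Finset.sum_nonneg fun T _ => hsum0 T) hr.le)
    refine ⟨√E * N, fun f hf u hu => ?_⟩
    have hflat0 := flatNormSq_nonneg hΩ hS u
    have h1 : √(flatNormSq 𝒮 S u) ≤ N * √(cellNormSq Ω f) := by
      have h2 := (flatNormSq_le_re_ah hd hΩ hS u).trans (Complex.re_le_norm _)
      rw [hu u] at h2
      have h3 := norm_cellInner_brokenField_le hΩ hS hf u
      by_cases h0 : √(flatNormSq 𝒮 S u) = 0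
      · rw [h0]; positivity
      have h4 : 0 < √(flatNormSq 𝒮 S u) := lt_of_le_of_ne (Real.sqrt_nonneg _) (Ne.symm h0)
      have h5 : √𝒮.rlow * (√(flatNormSq 𝒮 S u) * √(flatNormSq 𝒮 S u)) ≤
          Fintype.card ℳ.cells * (√(cellNormSq Ω f) * √(flatNormSq 𝒮 S u)) := by
        rw [Real.mul_self_sqrt hflat0]
        exact (mul_le_mul_of_nonneg_left h2 (Real.sqrt_nonneg _)).trans h3
      rw [hN, div_mul_eq_mul_div, le_div_iff₀ (Real.sqrt_pos.mpr hr)]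
      refine le_of_mul_le_mul_right ?_ h4
      linarith
    have h2 : (tForm 𝒮 S u u).re ≤ E * flatNormSq 𝒮 S u := by
      rw [re_tForm_self, hE, add_mul, one_mul]
      refine add_le_add_right ?_ _
      rw [div_mul_eq_mul_div, Finset.sum_mul, Finset.sum_div]
      refine Finset.sum_le_sum fun T _ => ?_
      have h3 := sq_diam_mul_dirDeriv_le (𝒮 := 𝒮) hC hΩ u T
      have hh := ℳ.diam_pos hd T
      have h4 : 𝒮.rlow * cellNormSq (T : Set (Rd d)) (cellVal u T) ≤ flatNormSq 𝒮 S u :=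
        le_trans (mul_le_mul_of_nonneg_left (Finset.single_le_sum (f := fun T : ℳ.cells =>
          cellNormSq (T : Set (Rd d)) (cellVal u T)) (fun _ _ => cellNormSq_nonneg _ _)
            (Finset.mem_univ T)) hr.le) (rlow_mul_sum_cellNormSq_le hΩ hS u)
      have h5 : cellNormSq (T : Set (Rd d)) (𝒮.dirDeriv (cellVal u T)) ≤
          d ^ 2 * C * 𝒮.aref T ^ 2 / ℳ.diam T ^ 2 *
            cellNormSq (T : Set (Rd d)) (cellVal u T) := by
        rw [div_mul_eq_mul_div, le_div_iff₀ (by positivity)]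
        linarith
      have h6 : cellNormSq (T : Set (Rd d)) (cellVal u T) ≤ flatNormSq 𝒮 S u / 𝒮.rlow := by
        rw [le_div_iff₀ hr]; linarith
      calc _ ≤ 𝒮.tref T * (d ^ 2 * C * 𝒮.aref T ^ 2 / ℳ.diam T ^ 2 *
            cellNormSq (T : Set (Rd d)) (cellVal u T)) :=
            mul_le_mul_of_nonneg_left h5 (𝒮.tref_pos T).le
        _ = 𝒮.tref T * (d ^ 2 * C * 𝒮.aref T ^ 2 / ℳ.diam T ^ 2) *
            cellNormSq (T : Set (Rd d)) (cellVal u T) := by ring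
        _ ≤ 𝒮.tref T * (d ^ 2 * C * 𝒮.aref T ^ 2 / ℳ.diam T ^ 2) *
            (flatNormSq 𝒮 S u / 𝒮.rlow) := mul_le_mul_of_nonneg_left h6 (hsum0 T)
        _ = _ := by ring
    rw [tnorm_eq]
    calc √(tForm 𝒮 S u u).re ≤ √(E * flatNormSq 𝒮 S u) := Real.sqrt_le_sqrt h2
      _ = √E * √(flatNormSq 𝒮 S u) := Real.sqrt_mul hE0 _
      _ ≤ √E * (N * √(cellNormSq Ω f)) := mul_le_mul_of_nonneg_left h1 (Real.sqrt_nonneg _)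
      _ = _ := by ring

end WellPosed

/-! ### The inf-sup condition -/

/-- The Cauchy–Schwarz inequality for sums of products bounded termwise. -/
theorem sum_le_sqrt_mul_sqrt {ι : Type*} (s : Finset ι) {x y z : ι → ℝ} (hx : ∀ i ∈ s, 0 ≤ x i)
    (hy : ∀ i ∈ s, 0 ≤ y i) (hz : ∀ i ∈ s, z i ≤ √(x i) * √(y i)) :
    ∑ i ∈ s, z i ≤ √(∑ i ∈ s, x i) * √(∑ i ∈ s, y i) := by
  refine (Finset.sum_le_sum hz).trans ?_
  have h := Real.sum_mul_le_sqrt_mul_sqrt s (fun i => √(x i)) (fun i => √(y i))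
  rwa [Finset.sum_congr rfl fun i hi => Real.sq_sqrt (hx i hi),
    Finset.sum_congr rfl fun i hi => Real.sq_sqrt (hy i hi)] at h

/-- Absorption: `F` stands for the square of the flat norm, `D` for that of the graph part, `X` for
the supremum. -/
theorem sqrt_add_le_of_absorb {F D X K ρ : ℝ} (hF : 0 ≤ F) (hD : 0 ≤ D) (hX : 0 ≤ X) (hK : 0 ≤ K)
    (hρ : 1 ≤ ρ) (h1 : F ≤ X * √(F + D)) (h2 : D ≤ K * (X + ρ * √F) * √(F + D)) :
    √(F + D) ≤ (2 + 2 * K + K ^ 2) * ρ ^ 2 * X := by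
  set N := √(F + D) with hN
  set f := √F with hf
  have hN2 : N ^ 2 = F + D := Real.sq_sqrt (by positivity)
  have hf2 : f ^ 2 = F := Real.sq_sqrt hF
  have hN0 : 0 ≤ N := Real.sqrt_nonneg _
  have hf0 : 0 ≤ f := Real.sqrt_nonneg _
  rcases hN0.eq_or_lt with h0 | h0
  · rw [← h0]; positivity
  have h3 : N ≤ X + K * (X + ρ * f) := by
    refine le_of_mul_le_mul_right ?_ h0
    nlinarith
  -- `K ρ f ≤ N / 2 + (K ρ)² X / 2`, as `f² ≤ X N`
  have h4 : K * ρ * f ≤ N / 2 + (K * ρ) ^ 2 * X / 2 := by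
    have h5 : (K * ρ * f) ^ 2 ≤ (N / 2 + (K * ρ) ^ 2 * X / 2) ^ 2 := by
      have h6 : f ^ 2 ≤ X * N := hf2.trans_le h1
      have h7 : (K * ρ) ^ 2 * f ^ 2 ≤ (K * ρ) ^ 2 * (X * N) :=
        mul_le_mul_of_nonneg_left h6 (sq_nonneg _)
      nlinarith [sq_nonneg (N / 2 - (K * ρ) ^ 2 * X / 2)]
    exact (sq_le_sq₀ (by positivity) (by positivity)).mp h5
  have h8 : N ≤ (2 + 2 * K) * X + (K * ρ) ^ 2 * X := by nlinarith
  have h9 : 1 ≤ ρ ^ 2 := one_le_pow₀ hρ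
  have h10 : (2 + 2 * K) * X ≤ (2 + 2 * K) * ρ ^ 2 * X := by
    nlinarith [mul_nonneg (by positivity : 0 ≤ 2 + 2 * K) hX]
  nlinarith

theorem act_const_mem_polySpace {d m k : ℕ} (H : Mat m) {p : Rd d → Cm m}
    (hp : p ∈ polySpace d m k) : (fun x => act H (p x)) ∈ polySpace d m k := by
  refine mem_polySpace.mpr fun j => ?_
  have h : (fun x => act H (p x) j) = ∑ l, H j l • fun x => p x l := by
    ext x
    simp [act_apply, Finset.sum_apply]
  rw [h]
  exact Submodule.sum_mem _ fun l _ => Submodule.smul_mem _ _ (mem_polySpace.mp hp l)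

section InfSup

variable {d m k : ℕ} {Ω : Set (Rd d)} {ℳ : PolytopalMesh d Ω} {𝒮 : System d m Ω}
  {S : Stabilization ℳ m} {CS CA C : ℝ}

/-- Testing the lower bound on `K + K^H - ∇·A` with a unit vector shows `r_♭ ≤ r_♯`; this needs
`m ≥ 1`. -/
theorem System.one_le_rho (hΩ : IsPolytopalDomain Ω) (hm : 0 < m) (𝒮 : System d m Ω) :
    1 ≤ 𝒮.rho := by
  have hpos : volume.restrict Ω ≠ 0 := by
    rw [Ne, Measure.restrict_eq_zero]; exact hΩ.volume_pos.ne'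
  have : (ae (volume.restrict Ω)).NeBot := ae_neBot.mpr hpos
  obtain ⟨x, hx, hK, hdiv⟩ := (𝒮.lower_bound.and ((ae_norm_le_toReal 𝒮.K_bounded).and
    (ae_norm_le_toReal 𝒮.divA_bounded))).exists
  let ξ : Cm m := EuclideanSpace.single ⟨0, hm⟩ 1
  have hξ : ‖ξ‖ = 1 := by simp [ξ]
  have hb : ∀ H : Mat m, ‖inner ℂ ξ (act H ξ)‖ ≤ ‖H‖ := by
    intro H
    have h1 := norm_inner_le_norm (𝕜 := ℂ) ξ (act H ξ)
    have h2 := norm_act_le H ξ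
    rw [hξ] at h1 h2
    linarith
  have h := re_inner_act_nonneg hx ξ
  rw [act_sub_left, act_sub_left, act_add_left, act_smul_left, act_one, inner_sub_right,
    inner_sub_right, inner_add_right, inner_act_conjTranspose, inner_smul_right,
    inner_self_eq_norm_sq_to_K, ← inner_conj_symm (act (𝒮.K x) ξ), hξ] at h
  simp only [Complex.sub_re, Complex.add_re, Complex.conj_re, Complex.re_ofReal_mul] at h
  norm_num at h
  have h1 := (Complex.re_le_norm _).trans (hb (𝒮.K x))
  have h2 := (neg_le_abs _).trans ((Complex.abs_re_le_norm _).trans (hb (𝒮.divA x)))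
  unfold rho rhigh linfty
  rw [le_div_iff₀ 𝒮.rlow_pos]
  have h3 : 0 ≤ (eLpNorm 𝒮.divA ⊤ (volume.restrict Ω)).toReal := ENNReal.toReal_nonneg
  linarith

/-- The operator `A_1` with its coefficients replaced by their mean values on `T`. -/
def System.meanDeriv (𝒮 : System d m Ω) (T : ℳ.cells) (v : Rd d → Cm m) : Rd d → Cm m :=
  fun x => ∑ i, act (meanMat (T : Set (Rd d)) (𝒮.A i)) (fderiv ℝ v x (EuclideanSpace.single i 1))

/-- The difference between the operators `meanDeriv` and `A_1`. -/
def System.meanDefect (𝒮 : System d m Ω) (T : ℳ.cells) (v : Rd d → Cm m) : Rd d → Cm m :=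
  fun x => ∑ i, act (meanMat (T : Set (Rd d)) (𝒮.A i) - 𝒮.A i x)
    (fderiv ℝ v x (EuclideanSpace.single i 1))

theorem System.meanDeriv_eq (𝒮 : System d m Ω) (T : ℳ.cells) (v : Rd d → Cm m) (x : Rd d) :
    𝒮.meanDeriv T v x = 𝒮.dirDeriv v x + 𝒮.meanDefect T v x := by
  unfold meanDeriv meanDefect dirDeriv
  rw [← Finset.sum_add_distrib]
  refine Finset.sum_congr rfl fun i _ => ?_
  rw [← act_add_left]
  congr 1
  abel

theorem meanDeriv_mem_polySpace (𝒮 : System d m Ω) (T : ℳ.cells) {v : Rd d → Cm m}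
    (hv : v ∈ polySpace d m k) : 𝒮.meanDeriv T v ∈ polySpace d m k := by
  have h : 𝒮.meanDeriv T v = ∑ i, fun x => act (meanMat (T : Set (Rd d)) (𝒮.A i))
      (fderiv ℝ v x (EuclideanSpace.single i 1)) := by
    ext x; simp [System.meanDeriv, Finset.sum_apply]
  rw [h]
  exact Submodule.sum_mem _ fun i _ => act_const_mem_polySpace _ (fderiv_mem_polySpace hv i)

theorem memLp_meanMat_sub (hΩ : IsPolytopalDomain Ω) (T : ℳ.cells) (i : Fin d) :
    MemLp (fun x => meanMat (T : Set (Rd d)) (𝒮.A i) - 𝒮.A i x) ⊤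
      (volume.restrict (T : Set (Rd d))) := by
  have h : ContinuousOn (fun x => meanMat (T : Set (Rd d)) (𝒮.A i) - 𝒮.A i x) (closure Ω) :=
    continuousOn_const.sub (𝒮.continuousOn_A i)
  exact memLp_cell hΩ T h

theorem memLp_meanDefect (hΩ : IsPolytopalDomain Ω) (v : HybridSpace ℳ m k) (T : ℳ.cells) :
    MemLp (𝒮.meanDefect T (cellVal v T)) 2 (volume.restrict (T : Set (Rd d))) :=
  memLp_finsetSum _ fun i _ => memLp_act (memLp_meanMat_sub hΩ T i) (memLp_fderiv hΩ v T i)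

/-- The test function of the inf-sup condition: a discrete version of `A_1 v`, scaled by `𝔱_T` on
each element, with vanishing face components. The coefficients of `A_1` are replaced by their mean values
in order to stay in the polynomial space. -/
def testField (𝒮 : System d m Ω) (v : HybridSpace ℳ m k) : HybridSpace ℳ m k :=
  (fun T => ⟨(𝒮.tref T : ℂ) • 𝒮.meanDeriv T (cellVal v T),
    Submodule.smul_mem _ _ (meanDeriv_mem_polySpace 𝒮 T (v.1 T).2)⟩, 0)

theorem cellVal_testField (v : HybridSpace ℳ m k) (T : ℳ.cells) :
    cellVal (testField 𝒮 v) T = fun x => (𝒮.tref T : ℂ) •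
      (𝒮.dirDeriv (cellVal v T) x + 𝒮.meanDefect T (cellVal v T) x) := by
  ext1 x
  rw [← 𝒮.meanDeriv_eq]
  rfl

theorem jump_testField (v : HybridSpace ℳ m k) (T : ℳ.cells) (F : ℳ.faces) :
    jump (testField 𝒮 v) T F = fun x => -cellVal (testField 𝒮 v) T x := by
  ext1 x
  exact zero_sub _

theorem avg_testField (v : HybridSpace ℳ m k) (T : ℳ.cells) (F : ℳ.faces) :
    avg (testField 𝒮 v) T F = fun x => (2⁻¹ : ℂ) • cellVal (testField 𝒮 v) T x := by
  ext1 x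
  exact congrArg _ (zero_add _)

/-- By the inverse inequality and the bound on the oscillation of the `A^i`, replacing them by their
mean values costs no more than the flat norm: `𝔱_T 𝔞_T ≤ h_T` absorbs the powers of `h_T`. -/
theorem nsq_meanDefect_le (hd : 0 < d) (hΩ : IsPolytopalDomain Ω) (hC0 : 0 ≤ C)
    (hC : TraceInverseBound ℳ m k C)
    (hA : OscillationBound 𝒮 ℳ CA) (v : HybridSpace ℳ m k) (T : ℳ.cells) :
    𝒮.tref T * cellNormSq (T : Set (Rd d)) (𝒮.meanDefect T (cellVal v T)) ≤
      d ^ 2 * C * CA ^ 2 * (𝒮.rlow * cellNormSq (T : Set (Rd d)) (cellVal v T)) := by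
  have hh := ℳ.diam_pos hd T
  have ha := 𝒮.aref_nonneg T
  have hr := 𝒮.rlow_pos
  have h1 := hC.firstOrder hΩ v T (fun i => memLp_meanMat_sub (𝒮 := 𝒮) hΩ T i) (fun i => hA T i)
  rw [mul_pow, Real.sq_sqrt (by positivity)] at h1
  have h2 := 𝒮.tref_mul_aref_le hd T
  set q := cellNormSq (T : Set (Rd d)) (cellVal v T) with hq
  have hq0 : 0 ≤ q := cellNormSq_nonneg _ _
  refine le_of_mul_le_mul_left ?_ (pow_pos hh 2)
  calc ℳ.diam T ^ 2 * (𝒮.tref T * cellNormSq (T : Set (Rd d)) (𝒮.meanDefect T (cellVal v T)))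
      = 𝒮.tref T * (ℳ.diam T ^ 2 * cellNormSq (T : Set (Rd d))
          (𝒮.meanDefect T (cellVal v T))) := by ring
    _ ≤ 𝒮.tref T * (d ^ 2 * C * (CA ^ 2 * (𝒮.rlow * 𝒮.aref T * ℳ.diam T)) * q) :=
        mul_le_mul_of_nonneg_left h1 (𝒮.tref_pos T).le
    _ = (𝒮.tref T * 𝒮.aref T) * (d ^ 2 * C * CA ^ 2 * 𝒮.rlow * ℳ.diam T * q) := by ring
    _ ≤ ℳ.diam T * (d ^ 2 * C * CA ^ 2 * 𝒮.rlow * ℳ.diam T * q) :=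
        mul_le_mul_of_nonneg_right h2 (by positivity)
    _ = _ := by ring

/-- The local quantity which controls the test function on `T`: the graph part of the norm of `v`,
and its weighted `L²` part with the factor `K`. -/
def localEnergy (𝒮 : System d m Ω) (K : ℝ) (v : HybridSpace ℳ m k) (T : ℳ.cells) : ℝ :=
  𝒮.tref T * cellNormSq (T : Set (Rd d)) (𝒮.dirDeriv (cellVal v T)) +
    K * (𝒮.rlow * cellNormSq (T : Set (Rd d)) (cellVal v T))

theorem nsq_testField_le (hd : 0 < d) (hΩ : IsPolytopalDomain Ω) (hC0 : 0 ≤ C)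
    (hC : TraceInverseBound ℳ m k C)
    (hA : OscillationBound 𝒮 ℳ CA) (v : HybridSpace ℳ m k) (T : ℳ.cells) :
    cellNormSq (T : Set (Rd d)) (cellVal (testField 𝒮 v) T) ≤
      2 * 𝒮.tref T * localEnergy 𝒮 (d ^ 2 * C * CA ^ 2) v T := by
  have h1 : cellNormSq (T : Set (Rd d)) (cellVal (testField 𝒮 v) T) =
      𝒮.tref T ^ 2 * nsq (volume.restrict (T : Set (Rd d)))
        (fun x => 𝒮.dirDeriv (cellVal v T) x + 𝒮.meanDefect T (cellVal v T) x) := by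
    rw [cellVal_testField]
    have := nsq_smul (μ := volume.restrict (T : Set (Rd d))) (𝒮.tref T : ℂ)
      (fun x => 𝒮.dirDeriv (cellVal v T) x + 𝒮.meanDefect T (cellVal v T) x)
    rwa [Complex.norm_real, Real.norm_eq_abs, sq_abs] at this
  have h2 := nsq_add_le (𝒮.memLp_dirDeriv hΩ v T) (memLp_meanDefect (𝒮 := 𝒮) hΩ v T)
  have h3 := nsq_meanDefect_le hd hΩ hC0 hC hA v T
  have ht := 𝒮.tref_pos T
  rw [h1]
  unfold localEnergy
  unfold cellNormSq at h3 ⊢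
  unfold nsq at h2 ⊢
  nlinarith [mul_le_mul_of_nonneg_left h2 (sq_nonneg (𝒮.tref T)),
    mul_le_mul_of_nonneg_left h3 ht.le]

end InfSup

section InfSup

variable {d m k : ℕ} {Ω : Set (Rd d)} {ℳ : PolytopalMesh d Ω} {𝒮 : System d m Ω}
  {S : Stabilization ℳ m} {CS CA C : ℝ}

theorem localEnergy_nonneg (𝒮 : System d m Ω) {K : ℝ} (hK : 0 ≤ K) (v : HybridSpace ℳ m k)
    (T : ℳ.cells) : 0 ≤ localEnergy 𝒮 K v T :=
  add_nonneg (mul_nonneg (𝒮.tref_pos T).le (cellNormSq_nonneg _ _))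
    (mul_nonneg hK (mul_nonneg 𝒮.rlow_pos.le (cellNormSq_nonneg _ _)))

theorem rlow_mul_testField_le (hd : 0 < d) (hΩ : IsPolytopalDomain Ω) (hC0 : 0 ≤ C)
    (hC : TraceInverseBound ℳ m k C) (hA : OscillationBound 𝒮 ℳ CA) (v : HybridSpace ℳ m k)
    (T : ℳ.cells) :
    𝒮.rlow * cellNormSq (T : Set (Rd d)) (cellVal (testField 𝒮 v) T) ≤
      2 * localEnergy 𝒮 (d ^ 2 * C * CA ^ 2) v T := by
  have h1 := nsq_testField_le hd hΩ hC0 hC hA v T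
  have h2 := 𝒮.tref_mul_rlow_le T
  have h3 := localEnergy_nonneg 𝒮 (K := d ^ 2 * C * CA ^ 2) (by positivity) v T
  calc _ ≤ 𝒮.rlow * (2 * 𝒮.tref T * localEnergy 𝒮 (d ^ 2 * C * CA ^ 2) v T) :=
        mul_le_mul_of_nonneg_left h1 𝒮.rlow_pos.le
    _ = (𝒮.tref T * 𝒮.rlow) * (2 * localEnergy 𝒮 (d ^ 2 * C * CA ^ 2) v T) := by ring
    _ ≤ 1 * (2 * localEnergy 𝒮 (d ^ 2 * C * CA ^ 2) v T) :=
        mul_le_mul_of_nonneg_right h2 (by positivity)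
    _ = _ := one_mul _

theorem aref_mul_testField_le (hd : 0 < d) (hΩ : IsPolytopalDomain Ω) (hC0 : 0 ≤ C)
    (hC : TraceInverseBound ℳ m k C) (hA : OscillationBound 𝒮 ℳ CA) (v : HybridSpace ℳ m k)
    (T : ℳ.cells) :
    𝒮.aref T * cellNormSq (T : Set (Rd d)) (cellVal (testField 𝒮 v) T) ≤
      ℳ.diam T * (2 * localEnergy 𝒮 (d ^ 2 * C * CA ^ 2) v T) := by
  have h1 := nsq_testField_le hd hΩ hC0 hC hA v T
  have h2 := 𝒮.tref_mul_aref_le hd T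
  have h3 := localEnergy_nonneg 𝒮 (K := d ^ 2 * C * CA ^ 2) (by positivity) v T
  calc _ ≤ 𝒮.aref T * (2 * 𝒮.tref T * localEnergy 𝒮 (d ^ 2 * C * CA ^ 2) v T) :=
        mul_le_mul_of_nonneg_left h1 (𝒮.aref_nonneg T)
    _ = (𝒮.tref T * 𝒮.aref T) * (2 * localEnergy 𝒮 (d ^ 2 * C * CA ^ 2) v T) := by ring
    _ ≤ _ := mul_le_mul_of_nonneg_right h2 (by positivity)

theorem aref_mul_face_testField_le (hd : 0 < d) (hΩ : IsPolytopalDomain Ω) (hC0 : 0 ≤ C)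
    (hC : TraceInverseBound ℳ m k C) (hA : OscillationBound 𝒮 ℳ CA) (v : HybridSpace ℳ m k)
    (T : ℳ.cells) :
    ∑ F ∈ ℳ.cellFaces T, 𝒮.aref T * faceNormSq (F : Set (Rd d)) (cellVal (testField 𝒮 v) T) ≤
      2 * C * localEnergy 𝒮 (d ^ 2 * C * CA ^ 2) v T := by
  have h1 := aref_mul_testField_le hd hΩ hC0 hC hA v T
  have h2 := (hC T _ ((testField 𝒮 v).1 T).2).1
  rw [← Finset.mul_sum]
  refine le_of_mul_le_mul_left ?_ (ℳ.diam_pos hd T)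
  calc _ = 𝒮.aref T * (ℳ.diam T * ∑ F ∈ ℳ.cellFaces T,
        faceNormSq (F : Set (Rd d)) (cellVal (testField 𝒮 v) T)) := by ring
    _ ≤ 𝒮.aref T * (C * cellNormSq (T : Set (Rd d)) (cellVal (testField 𝒮 v) T)) :=
        mul_le_mul_of_nonneg_left h2 (𝒮.aref_nonneg T)
    _ = C * (𝒮.aref T * cellNormSq (T : Set (Rd d)) (cellVal (testField 𝒮 v) T)) := by ring
    _ ≤ C * (ℳ.diam T * (2 * localEnergy 𝒮 (d ^ 2 * C * CA ^ 2) v T)) :=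
        mul_le_mul_of_nonneg_left h1 hC0
    _ = _ := by ring

theorem tref_mul_dirDeriv_testField_le (hd : 0 < d) (hΩ : IsPolytopalDomain Ω) (hC0 : 0 ≤ C)
    (hC : TraceInverseBound ℳ m k C) (hA : OscillationBound 𝒮 ℳ CA) (v : HybridSpace ℳ m k)
    (T : ℳ.cells) :
    𝒮.tref T * cellNormSq (T : Set (Rd d)) (𝒮.dirDeriv (cellVal (testField 𝒮 v) T)) ≤
      2 * d ^ 2 * C * localEnergy 𝒮 (d ^ 2 * C * CA ^ 2) v T := by
  have h1 := aref_mul_testField_le hd hΩ hC0 hC hA v T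
  have h2 := sq_diam_mul_dirDeriv_le (𝒮 := 𝒮) hC hΩ (testField 𝒮 v) T
  have h3 := 𝒮.tref_mul_aref_le hd T
  have h4 := localEnergy_nonneg 𝒮 (K := d ^ 2 * C * CA ^ 2) (by positivity) v T
  have hh := ℳ.diam_pos hd T
  refine le_of_mul_le_mul_left ?_ (pow_pos hh 2)
  calc _ = 𝒮.tref T * (ℳ.diam T ^ 2 * cellNormSq (T : Set (Rd d))
          (𝒮.dirDeriv (cellVal (testField 𝒮 v) T))) := by ring
    _ ≤ 𝒮.tref T * (d ^ 2 * C * 𝒮.aref T ^ 2 *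
          cellNormSq (T : Set (Rd d)) (cellVal (testField 𝒮 v) T)) :=
        mul_le_mul_of_nonneg_left h2 (𝒮.tref_pos T).le
    _ = d ^ 2 * C * (𝒮.tref T * 𝒮.aref T) *
          (𝒮.aref T * cellNormSq (T : Set (Rd d)) (cellVal (testField 𝒮 v) T)) := by ring
    _ ≤ d ^ 2 * C * ℳ.diam T * (ℳ.diam T * (2 * localEnergy 𝒮 (d ^ 2 * C * CA ^ 2) v T)) := by
        refine mul_le_mul (mul_le_mul_of_nonneg_left h3 (by positivity)) h1
          (mul_nonneg (𝒮.aref_nonneg T) (cellNormSq_nonneg _ _)) (by positivity)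
    _ = _ := by ring

theorem faceNormSq_jump_testField (v : HybridSpace ℳ m k) (T : ℳ.cells) (F : ℳ.faces) :
    faceNormSq (F : Set (Rd d)) (jump (testField 𝒮 v) T F) =
      faceNormSq (F : Set (Rd d)) (cellVal (testField 𝒮 v) T) := by
  rw [jump_testField]
  exact nsq_neg _

theorem re_Si_testField_le (hS : StabilizationAssumption 𝒮 S k CS) (v : HybridSpace ℳ m k)
    (T : ℳ.cells) {F : ℳ.faces} (hF : F ∈ ℳ.cellFaces T) :
    (faceInner (F : Set (Rd d)) (fun x => act (S.Si T F x) (jump (testField 𝒮 v) T F x))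
      (jump (testField 𝒮 v) T F)).re ≤
    |CS| * (𝒮.aref T * faceNormSq (F : Set (Rd d)) (cellVal (testField 𝒮 v) T)) := by
  have hp : (-cellVal (testField 𝒮 v) T) ∈ polySpace d m k :=
    neg_mem ((testField 𝒮 v).1 T).2
  have h1 := hS.Si_upper T F hF _ ⟨_, hp, rfl⟩
  have hae : ∀ᵐ x ∂((surf d).restrict (F : Set (Rd d))), jump (testField 𝒮 v) T F x =
      (F : Set (Rd d)).indicator (-cellVal (testField 𝒮 v) T) x := by
    filter_upwards [ae_restrict_mem (ℳ.face_measurableSet F)] with x hx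
    rw [indicator_of_mem hx, jump_testField]; rfl
  have h2 : faceInner (F : Set (Rd d)) (fun x => act (S.Si T F x) (jump (testField 𝒮 v) T F x))
      (jump (testField 𝒮 v) T F) = _ :=
    ip_congr (hae.mono fun x hx => congrArg (act (S.Si T F x)) hx) hae
  have h3 : faceNormSq (F : Set (Rd d)) (jump (testField 𝒮 v) T F) = _ := nsq_congr hae
  rw [faceNormSq_jump_testField] at h3
  rw [h2, h3]
  refine h1.trans ?_
  rw [mul_assoc]
  exact mul_le_mul_of_nonneg_right (le_abs_self _)
    (mul_nonneg (𝒮.aref_nonneg T) (faceNormSq_nonneg _ _))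

/-- The norm of the test function is controlled by the local energies. -/
theorem re_tForm_testField_le (hd : 0 < d) (hΩ : IsPolytopalDomain Ω)
    (hS : StabilizationAssumption 𝒮 S k CS) (hC0 : 0 ≤ C)
    (hC : TraceInverseBound ℳ m k C) (hA : OscillationBound 𝒮 ℳ CA) (v : HybridSpace ℳ m k) :
    (tForm 𝒮 S (testField 𝒮 v) (testField 𝒮 v)).re ≤
      (2 + 2 * C + 2 * |CS| * C + 2 * d ^ 2 * C) *
        ∑ T : ℳ.cells, localEnergy 𝒮 (d ^ 2 * C * CA ^ 2) v T := by
  have hb : bdrySeminormSq 𝒮 S (testField 𝒮 v) = 0 := by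
    refine Finset.sum_eq_zero fun F _ => ?_
    have : faceInner (F : Set (Rd d)) (fun x => act (𝒮.M x + S.Sb F x)
        (faceVal (testField 𝒮 v) F x)) (faceVal (testField 𝒮 v) F) = 0 := ip_zero_right _
    rw [this, Complex.zero_re]
  rw [re_tForm_self]
  unfold flatNormSq localNormSq jh
  rw [hb]
  simp only [Complex.re_sum, faceNormSq_jump_testField]
  rw [Finset.mul_sum, Finset.mul_sum, mul_zero, add_zero, ← Finset.sum_add_distrib,
    ← Finset.sum_add_distrib]
  refine Finset.sum_le_sum fun T _ => ?_
  have h1 := rlow_mul_testField_le hd hΩ hC0 hC hA v T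
  have h2 := aref_mul_face_testField_le hd hΩ hC0 hC hA v T
  have h3 := tref_mul_dirDeriv_testField_le hd hΩ hC0 hC hA v T
  have h4 := mul_le_mul_of_nonneg_left (hC T _ ((testField 𝒮 v).1 T).2).1 𝒮.rlow_pos.le
  have h5 := Finset.sum_le_sum fun F hF => re_Si_testField_le (𝒮 := 𝒮) hS v T (F := F) hF
  rw [← Finset.mul_sum] at h5
  have h6 := mul_le_mul_of_nonneg_left h2 (abs_nonneg CS)
  have h7 := mul_le_mul_of_nonneg_left h1 hC0
  unfold cellVal at h1 h2 h3 h4 h5 h6 h7 ⊢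
  nlinarith

end InfSup

section InfSup

variable {d m k : ℕ} {Ω : Set (Rd d)} {ℳ : PolytopalMesh d Ω} {𝒮 : System d m Ω}
  {S : Stabilization ℳ m} {CS CA C : ℝ}

/-- The square of the graph part of the norm `‖·‖_h`. -/
def graphNormSq (𝒮 : System d m Ω) (v : HybridSpace ℳ m k) : ℝ :=
  ∑ T : ℳ.cells, 𝒮.tref T * cellNormSq (T : Set (Rd d)) (𝒮.dirDeriv (cellVal v T))

theorem re_jh_le_flatNormSq (hΩ : IsPolytopalDomain Ω) (hS : StabilizationAssumption 𝒮 S k CS)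
    (v : HybridSpace ℳ m k) : (jh S v v).re ≤ flatNormSq 𝒮 S v := by
  have h1 := bdrySeminormSq_nonneg hΩ hS v
  have h2 : 0 ≤ 𝒮.rlow * ∑ T, localNormSq v T :=
    mul_nonneg 𝒮.rlow_pos.le (Finset.sum_nonneg fun T _ => localNormSq_nonneg v T)
  unfold flatNormSq
  linarith

theorem sum_jump_le_flatNormSq (hΩ : IsPolytopalDomain Ω)
    (hS : StabilizationAssumption 𝒮 S k CS) (v : HybridSpace ℳ m k) :
    ∑ T, 𝒮.rlow * (ℳ.diam T * ∑ F ∈ ℳ.cellFaces T, faceNormSq (F : Set (Rd d)) (jump v T F)) ≤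
      flatNormSq 𝒮 S v := by
  rw [← Finset.mul_sum]
  exact (mul_le_mul_of_nonneg_left (Finset.sum_le_sum fun T _ =>
    le_add_of_nonneg_left (cellNormSq_nonneg _ _)) 𝒮.rlow_pos.le).trans
    (rlow_mul_sum_localNormSq_le hΩ hS v)

theorem norm_jh_le (hΩ : IsPolytopalDomain Ω) (hS : StabilizationAssumption 𝒮 S k CS)
    (v w : HybridSpace ℳ m k) :
    ‖jh S v w‖ ≤ √(flatNormSq 𝒮 S v) * √(flatNormSq 𝒮 S w) := by
  have hs := isSesquilinear_jh (k := k) hΩ hS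
  refine (norm_form_le _ hs.add_left hs.smul_left (jh_conj hS)
    (re_jh_nonneg hΩ hS) v w).trans ?_
  exact mul_le_mul (Real.sqrt_le_sqrt (re_jh_le_flatNormSq hΩ hS v))
    (Real.sqrt_le_sqrt (re_jh_le_flatNormSq hΩ hS w)) (Real.sqrt_nonneg _) (Real.sqrt_nonneg _)

theorem norm_jump_term_le (hΩ : IsPolytopalDomain Ω) (hS : StabilizationAssumption 𝒮 S k CS)
    (v w : HybridSpace ℳ m k) :
    ‖(𝒮.rlow : ℂ) * ∑ T, (ℳ.diam T : ℂ) * ∑ F ∈ ℳ.cellFaces T,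
      faceInner (F : Set (Rd d)) (jump v T F) (jump w T F)‖ ≤
      √(flatNormSq 𝒮 S v) * √(flatNormSq 𝒮 S w) := by
  have hr := 𝒮.rlow_pos
  have h0 : ∀ (v : HybridSpace ℳ m k) (T : ℳ.cells), 0 ≤ 𝒮.rlow * (ℳ.diam T *
      ∑ F ∈ ℳ.cellFaces T, faceNormSq (F : Set (Rd d)) (jump v T F)) := fun v T =>
    mul_nonneg hr.le (diam_mul_sum_nonneg v T)
  have hloc : ∀ T, 𝒮.rlow * (ℳ.diam T * ‖∑ F ∈ ℳ.cellFaces T,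
      faceInner (F : Set (Rd d)) (jump v T F) (jump w T F)‖) ≤
      √(𝒮.rlow * (ℳ.diam T * ∑ F ∈ ℳ.cellFaces T, faceNormSq (F : Set (Rd d)) (jump v T F))) *
      √(𝒮.rlow * (ℳ.diam T * ∑ F ∈ ℳ.cellFaces T, faceNormSq (F : Set (Rd d)) (jump w T F))) := by
    intro T
    have h1 := (norm_sum_le _ _).trans (sum_le_sqrt_mul_sqrt (ℳ.cellFaces T)
      (fun F _ => faceNormSq_nonneg (F : Set (Rd d)) (jump v T F))
      (fun F _ => faceNormSq_nonneg (F : Set (Rd d)) (jump w T F))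
      (fun F _ => norm_ip_le (memLp_jump hΩ v T F) (memLp_jump hΩ w T F)))
    have hh : 0 ≤ 𝒮.rlow * ℳ.diam T := mul_nonneg hr.le Metric.diam_nonneg
    have h2 := mul_le_mul_of_nonneg_left h1 hh
    rw [← mul_assoc, ← mul_assoc, ← mul_assoc, Real.sqrt_mul hh, Real.sqrt_mul hh,
      mul_mul_mul_comm, Real.mul_self_sqrt hh]
    exact h2
  rw [norm_mul, Complex.norm_real, Real.norm_of_nonneg hr.le]
  calc _ ≤ 𝒮.rlow * ∑ T, ‖(ℳ.diam T : ℂ) * ∑ F ∈ ℳ.cellFaces T,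
          faceInner (F : Set (Rd d)) (jump v T F) (jump w T F)‖ :=
        mul_le_mul_of_nonneg_left (norm_sum_le _ _) hr.le
    _ = ∑ T, 𝒮.rlow * (ℳ.diam T * ‖∑ F ∈ ℳ.cellFaces T,
          faceInner (F : Set (Rd d)) (jump v T F) (jump w T F)‖) := by
        rw [Finset.mul_sum]
        refine Finset.sum_congr rfl fun T _ => ?_
        rw [norm_mul, Complex.norm_real, Real.norm_of_nonneg (show 0 ≤ ℳ.diam T from
          Metric.diam_nonneg)]
    _ ≤ _ := sum_le_sqrt_mul_sqrt _ (fun T _ => h0 v T) (fun T _ => h0 w T) fun T _ => hloc T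
    _ ≤ _ := mul_le_mul (Real.sqrt_le_sqrt (sum_jump_le_flatNormSq hΩ hS v))
        (Real.sqrt_le_sqrt (sum_jump_le_flatNormSq hΩ hS w)) (Real.sqrt_nonneg _)
        (Real.sqrt_nonneg _)

theorem norm_reaction_term_le (hΩ : IsPolytopalDomain Ω) (hS : StabilizationAssumption 𝒮 S k CS)
    (v w : HybridSpace ℳ m k) :
    ‖∑ T : ℳ.cells, cellInner (T : Set (Rd d)) (fun x => act (𝒮.K x) (cellVal v T x))
      (cellVal w T)‖ ≤ 𝒮.rho * (√(flatNormSq 𝒮 S v) * √(flatNormSq 𝒮 S w)) := by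
  have hr := 𝒮.rlow_pos
  have hrho : 0 ≤ 𝒮.rho :=
    div_nonneg (add_nonneg ENNReal.toReal_nonneg ENNReal.toReal_nonneg) hr.le
  have hK : linfty Ω 𝒮.K ≤ 𝒮.rho * 𝒮.rlow := by
    unfold System.rho System.rhigh
    rw [div_mul_cancel₀ _ hr.ne']
    exact le_add_of_nonneg_right ENNReal.toReal_nonneg
  have hloc : ∀ T : ℳ.cells, ‖cellInner (T : Set (Rd d)) (fun x => act (𝒮.K x) (cellVal v T x))
      (cellVal w T)‖ ≤ 𝒮.rho * (√(𝒮.rlow * cellNormSq (T : Set (Rd d)) (cellVal v T)) *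
        √(𝒮.rlow * cellNormSq (T : Set (Rd d)) (cellVal w T))) := by
    intro T
    have hv := memLp_cellVal hΩ v T
    have h1 : ‖cellInner (T : Set (Rd d)) (fun x => act (𝒮.K x) (cellVal v T x)) (cellVal w T)‖ ≤
      √(cellNormSq (T : Set (Rd d)) (fun x => act (𝒮.K x) (cellVal v T x))) *
        √(cellNormSq (T : Set (Rd d)) (cellVal w T)) :=
      norm_ip_le (memLp_act (𝒮.memLp_K hΩ T) hv) (memLp_cellVal hΩ w T)
    have h2 : cellNormSq (T : Set (Rd d)) (fun x => act (𝒮.K x) (cellVal v T x)) ≤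
        (𝒮.rho * 𝒮.rlow) ^ 2 * cellNormSq (T : Set (Rd d)) (cellVal v T) := by
      refine nsq_le_of_bound hv ?_
      filter_upwards [ae_mono (Measure.restrict_mono_set volume (ℳ.cell_subset hΩ.1 T))
        (ae_norm_le_toReal 𝒮.K_bounded)] with x hx
      exact (norm_act_le _ _).trans (mul_le_mul_of_nonneg_right (hx.trans hK) (norm_nonneg _))
    have h3 := Real.sqrt_le_sqrt h2
    rw [Real.sqrt_mul (sq_nonneg _), Real.sqrt_sq (by positivity)] at h3
    rw [Real.sqrt_mul hr.le, Real.sqrt_mul hr.le, mul_mul_mul_comm, Real.mul_self_sqrt hr.le]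
    refine h1.trans ((mul_le_mul_of_nonneg_right h3 (Real.sqrt_nonneg _)).trans_eq ?_)
    ring
  have h0 : ∀ (v : HybridSpace ℳ m k) (T : ℳ.cells),
      0 ≤ 𝒮.rlow * cellNormSq (T : Set (Rd d)) (cellVal v T) := fun v T =>
    mul_nonneg hr.le (cellNormSq_nonneg _ _)
  have hsum : ∀ v : HybridSpace ℳ m k,
      ∑ T : ℳ.cells, 𝒮.rlow * cellNormSq (T : Set (Rd d)) (cellVal v T) ≤ flatNormSq 𝒮 S v :=
    fun v => by rw [← Finset.mul_sum]; exact rlow_mul_sum_cellNormSq_le hΩ hS v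
  calc _ ≤ ∑ T : ℳ.cells, 𝒮.rho * (√(𝒮.rlow * cellNormSq (T : Set (Rd d)) (cellVal v T)) *
        √(𝒮.rlow * cellNormSq (T : Set (Rd d)) (cellVal w T))) :=
        (norm_sum_le _ _).trans (Finset.sum_le_sum fun T _ => hloc T)
    _ = 𝒮.rho * ∑ T : ℳ.cells, √(𝒮.rlow * cellNormSq (T : Set (Rd d)) (cellVal v T)) *
        √(𝒮.rlow * cellNormSq (T : Set (Rd d)) (cellVal w T)) := (Finset.mul_sum _ _ _).symm
    _ ≤ _ := by
        refine mul_le_mul_of_nonneg_left ((sum_le_sqrt_mul_sqrt _ (fun T _ => h0 v T)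
          (fun T _ => h0 w T) fun T _ => le_rfl).trans ?_) hrho
        exact mul_le_mul (Real.sqrt_le_sqrt (hsum v)) (Real.sqrt_le_sqrt (hsum w))
          (Real.sqrt_nonneg _) (Real.sqrt_nonneg _)

theorem norm_defect_term_le (hd : 0 < d) (hΩ : IsPolytopalDomain Ω)
    (hS : StabilizationAssumption 𝒮 S k CS) (hC0 : 0 ≤ C)
    (hC : TraceInverseBound ℳ m k C) (hA : OscillationBound 𝒮 ℳ CA) (v : HybridSpace ℳ m k) :
    ‖∑ T : ℳ.cells, (𝒮.tref T : ℂ) * cellInner (T : Set (Rd d)) (𝒮.dirDeriv (cellVal v T))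
      (𝒮.meanDefect T (cellVal v T))‖ ≤
      √(graphNormSq 𝒮 v) * √(d ^ 2 * C * CA ^ 2 * flatNormSq 𝒮 S v) := by
  have hloc : ∀ T : ℳ.cells, ‖(𝒮.tref T : ℂ) * cellInner (T : Set (Rd d))
      (𝒮.dirDeriv (cellVal v T)) (𝒮.meanDefect T (cellVal v T))‖ ≤
      √(𝒮.tref T * cellNormSq (T : Set (Rd d)) (𝒮.dirDeriv (cellVal v T))) *
      √(d ^ 2 * C * CA ^ 2 * (𝒮.rlow * cellNormSq (T : Set (Rd d)) (cellVal v T))) := by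
    intro T
    have ht := (𝒮.tref_pos T).le
    have h1 : ‖cellInner (T : Set (Rd d)) (𝒮.dirDeriv (cellVal v T))
        (𝒮.meanDefect T (cellVal v T))‖ ≤ _ :=
      norm_ip_le (𝒮.memLp_dirDeriv hΩ v T) (memLp_meanDefect hΩ v T)
    have h2 := nsq_meanDefect_le hd hΩ hC0 hC hA v T
    rw [norm_mul, Complex.norm_real, Real.norm_of_nonneg ht]
    refine (mul_le_mul_of_nonneg_left h1 ht).trans (le_trans (le_of_eq ?_)
      (mul_le_mul_of_nonneg_left (Real.sqrt_le_sqrt h2) (Real.sqrt_nonneg _)))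
    rw [Real.sqrt_mul ht, Real.sqrt_mul ht, mul_mul_mul_comm, Real.mul_self_sqrt ht]
    rfl
  refine ((norm_sum_le _ _).trans (sum_le_sqrt_mul_sqrt _ (fun T _ => ?_) (fun T _ => ?_)
    fun T _ => hloc T)).trans ?_
  · exact mul_nonneg (𝒮.tref_pos T).le (cellNormSq_nonneg _ _)
  · exact mul_nonneg (by positivity) (mul_nonneg 𝒮.rlow_pos.le (cellNormSq_nonneg _ _))
  · refine mul_le_mul_of_nonneg_left (Real.sqrt_le_sqrt ?_) (Real.sqrt_nonneg _)
    rw [← Finset.mul_sum, ← Finset.mul_sum]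
    exact mul_le_mul_of_nonneg_left (rlow_mul_sum_cellNormSq_le hΩ hS v) (by positivity)

/-- The control of `N_F` by the stabilization trades the jump for the flat norm, and a factor
`𝔞_T^{1/2}` for the trace of the test function. -/
theorem norm_face_term_le (hd : 0 < d) (hΩ : IsPolytopalDomain Ω)
    (hS : StabilizationAssumption 𝒮 S k CS) (hC0 : 0 ≤ C)
    (hC : TraceInverseBound ℳ m k C) (hA : OscillationBound 𝒮 ℳ CA) (v : HybridSpace ℳ m k) :
    ‖∑ T, ∑ F ∈ ℳ.cellFaces T, (ℳ.orient T F : ℂ) * faceInner (F : Set (Rd d))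
      (fun x => act (𝒮.NF F x) (jump v T F x)) (avg (testField 𝒮 v) T F)‖ ≤
      |CS| * (√(2 * C * ∑ T : ℳ.cells, localEnergy 𝒮 (d ^ 2 * C * CA ^ 2) v T) *
        √(flatNormSq 𝒮 S v)) := by
  set q : ℳ.cells → ℳ.faces → ℝ := fun T F =>
    𝒮.aref T * faceNormSq (F : Set (Rd d)) (cellVal (testField 𝒮 v) T) with hq
  set p : ℳ.cells → ℳ.faces → ℝ := fun T F => (faceInner (F : Set (Rd d))
    (fun x => act (S.Si T F x) (jump v T F x)) (jump v T F)).re with hp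
  have hq0 : ∀ T F, 0 ≤ q T F := fun T F => mul_nonneg (𝒮.aref_nonneg T) (faceNormSq_nonneg _ _)
  have hp0 : ∀ T, ∀ F ∈ ℳ.cellFaces T, 0 ≤ p T F := fun T F hF =>
    re_Si_nonneg hS hF (memLp_jump hΩ v T F)
  have hloc : ∀ T, ∀ F ∈ ℳ.cellFaces T, ‖(ℳ.orient T F : ℂ) * faceInner (F : Set (Rd d))
      (fun x => act (𝒮.NF F x) (jump v T F x)) (avg (testField 𝒮 v) T F)‖ ≤
      |CS| * (√(q T F) * √(p T F)) := by
    intro T F hF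
    have h1 := hS.Si_control T F hF _ _ (memLp_cellVal_face hΩ (testField 𝒮 v) T F)
      (memLp_jump hΩ v T F)
    have h2 : faceInner (F : Set (Rd d)) (fun x => act (𝒮.NF F x) (jump v T F x))
        (avg (testField 𝒮 v) T F) = starRingEnd ℂ (2⁻¹ : ℂ) * starRingEnd ℂ (faceInner
          (F : Set (Rd d)) (cellVal (testField 𝒮 v) T)
          (fun x => act (𝒮.NF F x) (jump v T F x))) := by
      rw [avg_testField]
      refine (ip_smul_right _ _ _).trans ?_
      congr 1
      exact (ip_conj _ _).symm
    have h3 : ‖(ℳ.orient T F : ℂ)‖ = 1 := by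
      rcases ℳ.orient_eq_or T F with h | h <;> simp [h]
    rw [norm_mul, h3, one_mul, h2, norm_mul, RCLike.norm_conj, RCLike.norm_conj]
    have h4 : ‖(2⁻¹ : ℂ)‖ ≤ 1 := by norm_num
    refine (mul_le_of_le_one_left (norm_nonneg _) h4).trans (h1.trans ?_)
    rw [hq, hp]
    simp only
    rw [Real.sqrt_mul (𝒮.aref_nonneg T)]
    calc _ = CS * (√(𝒮.aref T) * √(faceNormSq (F : Set (Rd d)) (cellVal (testField 𝒮 v) T)) *
          √(faceInner (F : Set (Rd d)) (fun x => act (S.Si T F x) (jump v T F x))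
            (jump v T F)).re) := by ring
      _ ≤ _ := mul_le_mul_of_nonneg_right (le_abs_self _) (by positivity)
  have hT : ∀ T, ∑ F ∈ ℳ.cellFaces T, √(q T F) * √(p T F) ≤
      √(∑ F ∈ ℳ.cellFaces T, q T F) * √(∑ F ∈ ℳ.cellFaces T, p T F) := fun T =>
    sum_le_sqrt_mul_sqrt _ (fun F _ => hq0 T F) (hp0 T) fun F _ => le_rfl
  have hsum := sum_le_sqrt_mul_sqrt Finset.univ
    (fun T _ => Finset.sum_nonneg fun F (_ : F ∈ ℳ.cellFaces T) => hq0 T F)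
    (fun T _ => Finset.sum_nonneg (hp0 T)) (fun T _ => hT T)
  have hQ : ∑ T, ∑ F ∈ ℳ.cellFaces T, q T F ≤
      2 * C * ∑ T : ℳ.cells, localEnergy 𝒮 (d ^ 2 * C * CA ^ 2) v T := by
    rw [Finset.mul_sum]
    exact Finset.sum_le_sum fun T _ => aref_mul_face_testField_le hd hΩ hC0 hC hA v T
  have hP : ∑ T, ∑ F ∈ ℳ.cellFaces T, p T F ≤ flatNormSq 𝒮 S v := by
    have h1 := re_jh_le_flatNormSq hΩ hS v
    unfold jh at h1
    simpa only [Complex.re_sum] using h1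
  calc _ ≤ ∑ T, ∑ F ∈ ℳ.cellFaces T, |CS| * (√(q T F) * √(p T F)) :=
        (norm_sum_le _ _).trans (Finset.sum_le_sum fun T _ => (norm_sum_le _ _).trans
          (Finset.sum_le_sum (hloc T)))
    _ = |CS| * ∑ T, ∑ F ∈ ℳ.cellFaces T, √(q T F) * √(p T F) := by simp only [Finset.mul_sum]
    _ ≤ _ := mul_le_mul_of_nonneg_left (hsum.trans (mul_le_mul (Real.sqrt_le_sqrt hQ)
        (Real.sqrt_le_sqrt hP) (Real.sqrt_nonneg _) (Real.sqrt_nonneg _))) (abs_nonneg _)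

/-- Testing with `testField` isolates the graph part of the norm. -/
theorem ah_testField (hΩ : IsPolytopalDomain Ω) (v : HybridSpace ℳ m k) :
    ah 𝒮 S v (testField 𝒮 v) = (graphNormSq 𝒮 v : ℂ)
      + ∑ T : ℳ.cells, (𝒮.tref T : ℂ) * cellInner (T : Set (Rd d)) (𝒮.dirDeriv (cellVal v T))
          (𝒮.meanDefect T (cellVal v T))
      + ∑ T : ℳ.cells, cellInner (T : Set (Rd d)) (fun x => act (𝒮.K x) (cellVal v T x))
          (cellVal (testField 𝒮 v) T)
      + (𝒮.rlow : ℂ) * ∑ T, (ℳ.diam T : ℂ) * ∑ F ∈ ℳ.cellFaces T,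
          faceInner (F : Set (Rd d)) (jump v T F) (jump (testField 𝒮 v) T F)
      + ∑ T, ∑ F ∈ ℳ.cellFaces T, (ℳ.orient T F : ℂ) * faceInner (F : Set (Rd d))
          (fun x => act (𝒮.NF F x) (jump v T F x)) (avg (testField 𝒮 v) T F)
      + jh S v (testField 𝒮 v) := by
  have hb : ∑ F ∈ ℳ.bdryFaces, faceInner (F : Set (Rd d))
      (fun x => act (𝒮.M x + S.Sb F x - 𝒮.NF F x) (faceVal v F x))
      (faceVal (testField 𝒮 v) F) = 0 :=
    Finset.sum_eq_zero fun F _ => ip_zero_right _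
  have hT : ∀ T : ℳ.cells, cellInner (T : Set (Rd d)) (𝒮.op (cellVal v T))
      (cellVal (testField 𝒮 v) T) =
      (𝒮.tref T : ℂ) * (cellNormSq (T : Set (Rd d)) (𝒮.dirDeriv (cellVal v T)) : ℂ) +
      (𝒮.tref T : ℂ) * cellInner (T : Set (Rd d)) (𝒮.dirDeriv (cellVal v T))
          (𝒮.meanDefect T (cellVal v T)) +
      cellInner (T : Set (Rd d)) (fun x => act (𝒮.K x) (cellVal v T x))
          (cellVal (testField 𝒮 v) T) := by
    intro T
    have hA := 𝒮.memLp_dirDeriv hΩ v T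
    have hE := memLp_meanDefect (𝒮 := 𝒮) hΩ v T
    have h1 : cellInner (T : Set (Rd d)) (𝒮.op (cellVal v T)) (cellVal (testField 𝒮 v) T) =
        cellInner (T : Set (Rd d)) (fun x => act (𝒮.K x) (cellVal v T x))
          (cellVal (testField 𝒮 v) T) +
        cellInner (T : Set (Rd d)) (𝒮.dirDeriv (cellVal v T)) (cellVal (testField 𝒮 v) T) :=
      ip_add_left (memLp_act (𝒮.memLp_K hΩ T) (memLp_cellVal hΩ v T)) hA
        (memLp_cellVal hΩ (testField 𝒮 v) T)
    have h2 : cellInner (T : Set (Rd d)) (𝒮.dirDeriv (cellVal v T))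
        (cellVal (testField 𝒮 v) T) = (𝒮.tref T : ℂ) *
        (cellInner (T : Set (Rd d)) (𝒮.dirDeriv (cellVal v T)) (𝒮.dirDeriv (cellVal v T)) +
        cellInner (T : Set (Rd d)) (𝒮.dirDeriv (cellVal v T))
          (𝒮.meanDefect T (cellVal v T))) := by
      rw [cellVal_testField]
      refine (ip_smul_right _ _ _).trans ?_
      rw [Complex.conj_ofReal]
      congr 1
      exact ip_add_right hA hA hE
    rw [h1, h2, show cellInner (T : Set (Rd d)) (𝒮.dirDeriv (cellVal v T))
      (𝒮.dirDeriv (cellVal v T)) = _ from ip_self _]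
    unfold cellNormSq nsq
    ring
  unfold ah
  rw [hb, mul_zero, add_zero, Finset.sum_congr rfl fun T _ => hT T, Finset.sum_add_distrib,
    Finset.sum_add_distrib]
  unfold graphNormSq
  push_cast
  rfl

/-- The inf-sup condition with an explicit constant. Here `X` stands for the dual norm of
`a_h(v, ·)`. Coercivity bounds the flat norm by `(X ‖v‖_h)^{1/2}`; testing with `testField` bounds
the graph part by `X` and the flat norm; the two estimates are combined by `sqrt_add_le_of_absorb`.
The constant `K₁` measures the oscillation of the `A^i`, and `K₂` the norm of the test function in
terms of the local energies. -/
theorem infSup_of_traceInverse (hd : 0 < d) (hΩ : IsPolytopalDomain Ω) (hm : 0 < m)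
    (hS : StabilizationAssumption 𝒮 S k CS) (hC0 : 0 ≤ C)
    (hC : TraceInverseBound ℳ m k C) (hA : OscillationBound 𝒮 ℳ CA) (v : HybridSpace ℳ m k)
    {X : ℝ} (hX : 0 ≤ X) (hXv : ∀ w, ‖ah 𝒮 S v w‖ ≤ X * tnorm 𝒮 S w) {K K₁ K₂ : ℝ}
    (hK₁ : K₁ = d ^ 2 * C * CA ^ 2) (hK₂ : K₂ = 2 + 2 * C + 2 * |CS| * C + 2 * d ^ 2 * C)
    (hK : K = (3 * √K₂ + |CS| * √(2 * C)) * √(1 + K₁) + √K₁) :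
    tnorm 𝒮 S v ≤ (2 + 2 * K + K ^ 2) * 𝒮.rho ^ 2 * X := by
  have hρ := 𝒮.one_le_rho hΩ hm
  have hF := flatNormSq_nonneg hΩ hS v
  have hD : 0 ≤ graphNormSq 𝒮 v := sum_tref_nonneg v
  have hK₁0 : 0 ≤ K₁ := by rw [hK₁]; positivity
  have hK₂0 : 0 ≤ K₂ := by rw [hK₂]; positivity
  have hK0 : 0 ≤ K := by rw [hK]; positivity
  have hN : tnorm 𝒮 S v = √(flatNormSq 𝒮 S v + graphNormSq 𝒮 v) := rfl
  set w := testField 𝒮 v with hw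
  set Δ := ∑ T : ℳ.cells, localEnergy 𝒮 K₁ v T with hΔ
  have hΔN : Δ ≤ (1 + K₁) * (flatNormSq 𝒮 S v + graphNormSq 𝒮 v) := by
    have h1 : Δ = graphNormSq 𝒮 v + K₁ * (𝒮.rlow * ∑ T : ℳ.cells,
        cellNormSq (T : Set (Rd d)) (cellVal v T)) := by
      rw [hΔ, Finset.mul_sum, Finset.mul_sum]
      exact Finset.sum_add_distrib
    have h2 := mul_le_mul_of_nonneg_left (rlow_mul_sum_cellNormSq_le hΩ hS v) hK₁0
    nlinarith
  have hW : tnorm 𝒮 S w ≤ √K₂ * (√(1 + K₁) * tnorm 𝒮 S v) := by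
    rw [tnorm_eq w, hN, ← Real.sqrt_mul (by positivity), ← Real.sqrt_mul hK₂0]
    refine Real.sqrt_le_sqrt (le_trans ?_ (mul_le_mul_of_nonneg_left hΔN hK₂0))
    rw [hK₂, hΔ, hK₁]
    exact re_tForm_testField_le hd hΩ hS hC0 hC hA v
  have hfW : √(flatNormSq 𝒮 S w) ≤ tnorm 𝒮 S w := by
    rw [tnorm_eq]
    exact Real.sqrt_le_sqrt (flatNormSq_le_tForm w)
  have hΔ' : √(2 * C * Δ) ≤ √(2 * C) * (√(1 + K₁) * tnorm 𝒮 S v) := by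
    rw [hN, ← Real.sqrt_mul (by positivity), ← Real.sqrt_mul (by positivity)]
    exact Real.sqrt_le_sqrt (mul_le_mul_of_nonneg_left hΔN (by positivity))
  have hDN : √(graphNormSq 𝒮 v) ≤ tnorm 𝒮 S v :=
    Real.sqrt_le_sqrt (le_add_of_nonneg_left hF)
  -- bounds for the terms of the identity `ah_testField`
  have t1 := hXv w
  have t2 := norm_defect_term_le hd hΩ hS hC0 hC hA v
  have t3 := norm_reaction_term_le (𝒮 := 𝒮) hΩ hS v w
  have t4 := norm_jump_term_le (𝒮 := 𝒮) hΩ hS v w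
  have t5 := norm_face_term_le hd hΩ hS hC0 hC hA v
  have t6 := norm_jh_le (𝒮 := 𝒮) hΩ hS v w
  rw [← hK₁] at t2 t5
  rw [Real.sqrt_mul hK₁0] at t2
  have hid := ah_testField (𝒮 := 𝒮) (S := S) hΩ v
  rw [← hw] at hid t5
  set R2 := ∑ T : ℳ.cells, (𝒮.tref T : ℂ) * cellInner (T : Set (Rd d))
    (𝒮.dirDeriv (cellVal v T)) (𝒮.meanDefect T (cellVal v T))
  set R3 := ∑ T : ℳ.cells, cellInner (T : Set (Rd d)) (fun x => act (𝒮.K x) (cellVal v T x))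
    (cellVal w T)
  set R4 := (𝒮.rlow : ℂ) * ∑ T, (ℳ.diam T : ℂ) * ∑ F ∈ ℳ.cellFaces T,
    faceInner (F : Set (Rd d)) (jump v T F) (jump w T F)
  set R5 := ∑ T, ∑ F ∈ ℳ.cellFaces T, (ℳ.orient T F : ℂ) * faceInner (F : Set (Rd d))
    (fun x => act (𝒮.NF F x) (jump v T F x)) (avg w T F)
  set R6 := jh S v w
  have hDle : graphNormSq 𝒮 v ≤ ‖ah 𝒮 S v w‖ + ‖R2‖ + ‖R3‖ + ‖R4‖ + ‖R5‖ + ‖R6‖ := by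
    have h1 : (graphNormSq 𝒮 v : ℂ) = ah 𝒮 S v w - R2 - R3 - R4 - R5 - R6 := by
      rw [hid]; ring
    have h2 : graphNormSq 𝒮 v = ‖(graphNormSq 𝒮 v : ℂ)‖ := by
      rw [Complex.norm_real, Real.norm_of_nonneg hD]
    rw [h2, h1]
    refine (norm_sub_le _ _).trans (add_le_add_left ?_ _)
    refine (norm_sub_le _ _).trans (add_le_add_left ?_ _)
    refine (norm_sub_le _ _).trans (add_le_add_left ?_ _)
    refine (norm_sub_le _ _).trans (add_le_add_left ?_ _)
    exact norm_sub_le _ _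
  set N := tnorm 𝒮 S v with hNdef
  set f := √(flatNormSq 𝒮 S v) with hf
  have hN0 : 0 ≤ N := Real.sqrt_nonneg _
  have hf0 : 0 ≤ f := Real.sqrt_nonneg _
  have hcoer : flatNormSq 𝒮 S v ≤ X * N :=
    (flatNormSq_le_re_ah hd hΩ hS v).trans ((Complex.re_le_norm _).trans (hXv v))
  rw [hN]
  -- it remains to bound the graph part by `K (X + ρ f) N`
  refine sqrt_add_le_of_absorb hF hD hX hK0 hρ (by rw [← hN]; exact hcoer) ?_
  rw [← hN, ← hf]
  set a := √K₂ * √(1 + K₁) with ha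
  have ha0 : 0 ≤ a := by positivity
  have hW' : tnorm 𝒮 S w ≤ a * N := by rw [ha, mul_assoc]; exact hW
  have u1 : ‖ah 𝒮 S v w‖ ≤ a * X * N :=
    t1.trans ((mul_le_mul_of_nonneg_left hW' hX).trans_eq (by ring))
  have hfw : f * √(flatNormSq 𝒮 S w) ≤ a * (f * N) :=
    (mul_le_mul_of_nonneg_left (hfW.trans hW') hf0).trans_eq (by ring)
  have hρ1 : ∀ y : ℝ, 0 ≤ y → y ≤ 𝒮.rho * y := fun y hy => le_mul_of_one_le_left hy hρ
  have hfN : 0 ≤ f * N := mul_nonneg hf0 hN0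
  have u2 : ‖R2‖ ≤ √K₁ * (𝒮.rho * (f * N)) := by
    refine t2.trans ((mul_le_mul_of_nonneg_right hDN (by positivity)).trans ?_)
    calc N * (√K₁ * f) = √K₁ * (f * N) := by ring
      _ ≤ _ := mul_le_mul_of_nonneg_left (hρ1 _ hfN) (Real.sqrt_nonneg _)
  have u3 : ‖R3‖ ≤ a * (𝒮.rho * (f * N)) :=
    t3.trans ((mul_le_mul_of_nonneg_left hfw (zero_le_one.trans hρ)).trans_eq (by ring))
  have u4 : ‖R4‖ ≤ a * (𝒮.rho * (f * N)) :=
    (t4.trans hfw).trans (mul_le_mul_of_nonneg_left (hρ1 _ hfN) ha0)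
  have u6 : ‖R6‖ ≤ a * (𝒮.rho * (f * N)) :=
    (t6.trans hfw).trans (mul_le_mul_of_nonneg_left (hρ1 _ hfN) ha0)
  have u5 : ‖R5‖ ≤ |CS| * √(2 * C) * √(1 + K₁) * (𝒮.rho * (f * N)) := by
    refine t5.trans ?_
    calc |CS| * (√(2 * C * Δ) * f) ≤ |CS| * (√(2 * C) * (√(1 + K₁) * N) * f) :=
          mul_le_mul_of_nonneg_left (mul_le_mul_of_nonneg_right hΔ' hf0) (abs_nonneg _)
      _ = |CS| * √(2 * C) * √(1 + K₁) * (f * N) := by ring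
      _ ≤ _ := mul_le_mul_of_nonneg_left (hρ1 _ hfN) (by positivity)
  have hKa : K = 3 * a + |CS| * √(2 * C) * √(1 + K₁) + √K₁ := by rw [hK, ha]; ring
  have haK : a ≤ K := by
    rw [hKa]
    have : 0 ≤ |CS| * √(2 * C) * √(1 + K₁) + √K₁ := by positivity
    linarith
  have u1' : ‖ah 𝒮 S v w‖ ≤ K * X * N :=
    u1.trans (mul_le_mul_of_nonneg_right (mul_le_mul_of_nonneg_right haK hX) hN0)
  calc graphNormSq 𝒮 v ≤ _ := hDle
    _ ≤ K * X * N + (√K₁ * (𝒮.rho * (f * N)) + 3 * (a * (𝒮.rho * (f * N))) +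
        |CS| * √(2 * C) * √(1 + K₁) * (𝒮.rho * (f * N))) := by linarith
    _ = K * X * N + (3 * a + |CS| * √(2 * C) * √(1 + K₁) + √K₁) * (𝒮.rho * (f * N)) := by ring
    _ = K * (X + 𝒮.rho * f) * N := by rw [← hKa]; ring

end InfSup

end Friedrichs

end

theorem mainTheorem2 (d : ℕ) (hd : 0 < d) (Ω : Set (Friedrichs.Rd d))
    (hΩ : Friedrichs.IsPolytopalDomain Ω) (k : ℕ) (ϱ CA CS : ℝ) (hϱ : 0 < ϱ) (hϱ1 : ϱ < 1) :
    ∃ C : ℝ, 0 < C ∧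
      ∀ (m : ℕ) (_ : 0 < m) (𝒮 : Friedrichs.System d m Ω) (ℳ : Friedrichs.PolytopalMesh d Ω)
        (S : Friedrichs.Stabilization ℳ m),
        ℳ.IsRegular ϱ → Friedrichs.StabilizationAssumption 𝒮 S k CS →
          (Friedrichs.OscillationBound 𝒮 ℳ CA → ∀ v : Friedrichs.HybridSpace ℳ m k,
            ∃ s : ℝ, IsLUB {r : ℝ | ∃ w : Friedrichs.HybridSpace ℳ m k, w ≠ 0 ∧
                r = ‖Friedrichs.ah 𝒮 S v w‖ / Friedrichs.tnorm 𝒮 S w} s ∧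
              Friedrichs.tnorm 𝒮 S v ≤ C * 𝒮.rho ^ 2 * s) ∧
          Friedrichs.DiscreteWellPosed 𝒮 S k := by
  obtain ⟨C, hC0, hC⟩ := Friedrichs.exists_trace_inverse_constant d k hd hϱ
  -- the constant of `infSup_of_traceInverse`, which depends on `d`, `k`, `ϱ`, `CA` and `CS` only
  obtain ⟨K, hK⟩ : ∃ K, K = (3 * √(2 + 2 * C + 2 * |CS| * C + 2 * d ^ 2 * C) +
    |CS| * √(2 * C)) * √(1 + d ^ 2 * C * CA ^ 2) + √(d ^ 2 * C * CA ^ 2) := ⟨_, rfl⟩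
  have hK0 : 0 ≤ K := by rw [hK]; positivity
  refine ⟨2 + 2 * K + K ^ 2, by positivity, fun m hm 𝒮 ℳ S hreg hS => ?_⟩
  have hTI : Friedrichs.TraceInverseBound ℳ m k C := hC m Ω ℳ hreg
  refine ⟨fun hA v => ?_, Friedrichs.discreteWellPosed hd hΩ hS hC0.le hTI⟩
  obtain ⟨s, hs, hs0, hsv⟩ := Friedrichs.exists_isLUB_ah hd hΩ hm hS v
  exact ⟨s, hs, Friedrichs.infSup_of_traceInverse hd hΩ hm hS hC0.le hTI hA v hs0 hsv rfl rfl hK⟩
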